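/- **Setting.** Let $r>1$, let $\Omega\subset\mathbb R^2$ be open, $G\in C^r_b(\Omega,\mathbb R)$ with $0$ a regular value, $\Omega^\pm=\{x\in\Omega:\pm G(x)>0\}$, $\Omega^0=\{x\in\Omega: G(x)=0\}$, $f^\pm\in C^r_b(\Omega^\pm\cup\Omega^0,\mathbb R^2)$, $g\in C^r_b(\mathbb R\times\Omega\times\mathbb R,\mathbb R^2)$. Here $C^r_b$ means that the derivatives up to order $\lfloor r\rfloor$ are bounded and uniformly continuous and, if $r\notin\mathbb N$, that those of order $\lfloor r\rfloor$ are Hölder continuous with exponent $r-\lfloor r\rfloor$. Consider $$\dot x=f^\pm(x)+\varepsilon g(t,x,\varepsilon),\qquad x\in\Omega^\pm .\tag{PS}$$ A solution on an interval is a continuous, piecewise $C^r$ function with values in $\Omega$ which satisfies the equation with sign $\pm$ while it is in $\Omega^\pm$; whenever it is on $\Omega^0$ at a time $t_0$, it lies in $\Omega^+$ or in $\Omega^-$ on some left (right) neighbourhood of $t_0$, and its left (right) derivative at $t_0$ is given by the corresponding field (no sliding). Denote by $x(t,\tau;P)$ the solution that equals $P$ at $t=\tau$. Assume: * **F0** $0\in\Omega^0$,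 $f^\pm(0)=0$, and the eigenvalues of $f^\pm_x(0)$ satisfy $\lambda_s^\pm<0<\lambda_u^\pm$; let $v_s^\pm,v_u^\pm$ be corresponding unit eigenvectors. * **F1** $\nabla G(0)^*v_u^-<0<\nabla G(0)^*v_u^+$ and $\nabla G(0)^*v_s^-<0<\nabla G(0)^*v_s^+$. * **F2** $v_s^+$ and $v_s^-$ lie in different components of the complement of the polyline $\{cv_u^+:c\ge0\}\cup\{cv_u^-:c\ge 0\}$. * **K** For $\varepsilon=0$ there is a unique solution $\gamma$ on $\mathbb R$ homoclinic to $0$ with $\gamma(t)\in\Omega^-$ for $t<0$, $\gamma(0)\in\Omega^0$, $\gamma(t)\in\Omega^+$ for $t>0$; moreover $\nabla G(\gamma(0))^*f^\pm(\gamma(0))>0$. * **G** $g(t,0,\varepsilon)=0$ for all $t,\varepsilon\in\mathbb R$. Let $\Gamma=\{\gamma(t):t\in\mathbb R\}\cup\{0\}$, let $E^{\rm in}$ be the open set enclosed by $\Gamma$ and $E^{\rm out}=\mathbb R^2\setminus(E^{\rm in}\cup\Gamma)$. Assume (Scenario 1) that for some $\rho>0$ one has $dv_u^+,\,dv_s^-\in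 E^{\rm out}$ for all $0<d<\rho$, and that $0$ and $\gamma(0)$ are joined by an arc of $\Omega^0$ that leaves $0$ into $E^{\rm in}$. For a point $Q$ of this arc, prolonged beyond $\gamma(0)$, let $\ell(Q)$ be the arc length along $\Omega^0$ from $0$ to $Q$, and let $\mathscr D(Q,P)=\ell(P)-\ell(Q)$. Set $$\sigma_+^{\rm fwd}=\tfrac{|\lambda_s^+|}{\lambda_u^++|\lambda_s^+|},\qquad \sigma_-^{\rm bwd}=\tfrac{\lambda_u^-}{\lambda_u^-+|\lambda_s^-|},\qquad \mu_0=\tfrac14\min\Big\{\tfrac1{\lambda_u^++|\lambda_s^+|},\ \tfrac1{\lambda_u^-+|\lambda_s^-|},\ \min\{\sigma_+^{\rm fwd},\sigma_-^{\rm bwd}\}^2\Big\}.$$ **Notation.** $P_s(\tau)$ (resp. $P_u(\tau)$) is the point $P\in\Omega^0$ with $\|P-\gamma(0)\|<\sqrt\varepsilon$ such that $x(t,\tau;P)$ is in $\Omega^+$ for all $t>\tau$ and tends to $0$ as $t\to+\infty$ (resp. is in $\Omega^-$ for all $t<\tau$ and tends to $0$ as $t\to-\infty$). $Q_s(d,\tau)$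 and $Q_u(d,\tau)$ are the points of $\Omega^0$ with $\mathscr D(Q_s(d,\tau),P_s(\tau))=d$ and $\mathscr D(Q_u(d,\tau),P_u(\tau))=d$. The times $\tau<\mathscr T_{1/2}(d,\tau)<\mathscr T_1(d,\tau)$ are those for which $x(t,\tau;Q_s(d,\tau))$ is in $\Omega^+$ for $\tau<t<\mathscr T_{1/2}$, in $\Omega^0\cap E^{\rm in}$ at $t=\mathscr T_{1/2}$, in $\Omega^-$ for $\mathscr T_{1/2}<t<\mathscr T_1$, and on $\Omega^0$ at $t=\mathscr T_1$. The times $\mathscr T_{-1}(d,\tau)<\mathscr T_{-1/2}(d,\tau)<\tau$ are those for which $x(t,\tau;Q_u(d,\tau))$ is in $\Omega^-$ for $\mathscr T_{-1/2}<t<\tau$, in $\Omega^0\cap E^{\rm in}$ at $t=\mathscr T_{-1/2}$, in $\Omega^+$ for $\mathscr T_{-1}<t<\mathscr T_{-1/2}$, and on $\Omega^0$ at $t=\mathscr T_{-1}$. **Theorem.** For every $0<\mu<\mu_0$ there are $\varepsilon_0>0$ and $\delta>0$ such that for all $0<\varepsilon\le\varepsilon_0$, $0<d\le\delta$ and $\tau\in\mathbb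 R$ the points $P_s(\tau),P_u(\tau),Q_s(d,\tau),Q_u(d,\tau)$ exist and are unique, the loops defining $\mathscr T_{\pm1/2}(d,\tau)$ and $\mathscr T_{\pm1}(d,\tau)$ exist, and $$\|x(t,\tau;Q_s(d,\tau))-x(t,\tau;P_s(\tau))\|\le d^{\sigma_+^{\rm fwd}-\mu}\quad\text{for }\tau\le t\le\mathscr T_{1/2}(d,\tau),$$ $$\|x(t,\tau;Q_s(d,\tau))-x(t,\mathscr T_1(d,\tau);P_u(\mathscr T_1(d,\tau)))\|\le d^{\sigma_+^{\rm fwd}-\mu}\quad\text{for }\mathscr T_{1/2}(d,\tau)\le t\le\mathscr T_1(d,\tau),$$ $$\|x(t,\tau;Q_u(d,\tau))-x(t,\tau;P_u(\tau))\|\le d^{\sigma_-^{\rm bwd}-\mu}\quad\text{for }\mathscr T_{-1/2}(d,\tau)\le t\le\tau,$$ $$\|x(t,\tau;Q_u(d,\tau))-x(t,\mathscr T_{-1}(d,\tau);P_s(\mathscr T_{-1}(d,\tau)))\|\le d^{\sigma_-^{\rm bwd}-\mu}\quad\text{for }\mathscr T_{-1}(d,\tau)\le t\le\mathscr T_{-1/2}(d,\tau).$$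 -/

import Mathlib

open Set Filter Topology

/-- The plane with its Euclidean norm. -/
abbrev Plane : Type := EuclideanSpace ℝ (Fin 2)

/-- `f` is of class `C^r_b` on `s`, where `r = r₀ + r₁`, `r₀ = ⌊r⌋` and `0 ≤ r₁ < 1`: the derivatives
of order `≤ r₀` exist and are bounded and uniformly continuous on `s`, and the derivative of order
`r₀` is `r₁`-Hölder continuous (for an integer `r` this last condition only repeats boundedness). -/
def IsCrb {E F : Type*} [NormedAddCommGroup E] [NormedSpace ℝ E] [NormedAddCommGroup F]
    [NormedSpace ℝ F] (r : ℝ) (f : E → F) (s : Set E) : Prop :=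
  ContDiffOn ℝ (⌊r⌋₊ : ℕ) f s ∧
  (∀ k : ℕ, k ≤ ⌊r⌋₊ →
    (∃ C : ℝ, ∀ x ∈ s, ‖iteratedFDerivWithin ℝ k f s x‖ ≤ C) ∧
    UniformContinuousOn (iteratedFDerivWithin ℝ k f s) s) ∧
  ∃ C : ℝ, ∀ x ∈ s, ∀ y ∈ s,
    ‖iteratedFDerivWithin ℝ ⌊r⌋₊ f s x - iteratedFDerivWithin ℝ ⌊r⌋₊ f s y‖
      ≤ C * ‖x - y‖ ^ Int.fract r

/-- The union of the bounded components of the complement of `Γ`; for a Jordan curve `Γ` this is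
the open set enclosed by `Γ`. -/
def enclosed (Γ : Set Plane) : Set Plane :=
  {p | p ∉ Γ ∧ Bornology.IsBounded (connectedComponentIn Γᶜ p)}

/-- The open set complementary to `Γ` and to the set enclosed by it. -/
def exterior (Γ : Set Plane) : Set Plane := (enclosed Γ ∪ Γ)ᶜ

/-- The data of the piecewise smooth system
`x' = f^±(x) + ε g(t, x, ε)` for `x ∈ Ω^±`, `Ω^± = {x ∈ Ω | ± G x > 0}`. -/
structure PSSystem where
  Ω : Set Plane
  G : Plane → ℝ
  fp : Plane → Plane
  fm : Plane → Plane
  g : ℝ → Plane → ℝ → Plane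

/-- The numbers `λ_s^±`, `λ_u^±` and the vectors `v_s^±`, `v_u^±`. -/
structure EigenData where
  lsp : ℝ
  lup : ℝ
  lsm : ℝ
  lum : ℝ
  vsp : Plane
  vup : Plane
  vsm : Plane
  vum : Plane

namespace EigenData

/-- `σ₊^fwd = |λ_s^+| / (λ_u^+ + |λ_s^+|)` -/
noncomputable def sigmaFwdPlus (e : EigenData) : ℝ := |e.lsp| / (e.lup + |e.lsp|)

/-- `σ₋^bwd = λ_u^- / (λ_u^- + |λ_s^-|)` -/
noncomputable def sigmaBwdMinus (e : EigenData) : ℝ := e.lum / (e.lum + |e.lsm|)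

/-- `Σ₊^fwd = 1 / (λ_u^+ + |λ_s^+|)` -/
noncomputable def SigmaFwdPlus (e : EigenData) : ℝ := 1 / (e.lup + |e.lsp|)

/-- `Σ₋^bwd = 1 / (λ_u^- + |λ_s^-|)` -/
noncomputable def SigmaBwdMinus (e : EigenData) : ℝ := 1 / (e.lum + |e.lsm|)

/-- `μ₀ = (1/4) min {Σ₊^fwd, Σ₋^bwd, (min {σ₊^fwd, σ₋^bwd})²}` -/
noncomputable def mu0 (e : EigenData) : ℝ :=
  1 / 4 * min (min e.SigmaFwdPlus e.SigmaBwdMinus) (min e.sigmaFwdPlus e.sigmaBwdMinus ^ 2)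

end EigenData

namespace PSSystem

/-- `Ω^+` -/
def Op (S : PSSystem) : Set Plane := {x ∈ S.Ω | 0 < S.G x}

/-- `Ω^-` -/
def Om (S : PSSystem) : Set Plane := {x ∈ S.Ω | S.G x < 0}

/-- `Ω^0` -/
def O0 (S : PSSystem) : Set Plane := {x ∈ S.Ω | S.G x = 0}

/-- Regularity: `Ω` is open, `G`, `f^±`, `g` are of class `C^r_b` on `Ω`, `Ω^± ∪ Ω^0`, `ℝ × Ω × ℝ`,
and `0` is a regular value of `G`. -/
structure IsRegular (S : PSSystem) (r : ℝ) : Prop where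
  isOpen : IsOpen S.Ω
  G_reg : IsCrb r S.G S.Ω
  fp_reg : IsCrb r S.fp (S.Op ∪ S.O0)
  fm_reg : IsCrb r S.fm (S.Om ∪ S.O0)
  g_reg : IsCrb r (fun p : ℝ × Plane × ℝ => S.g p.1 p.2.1 p.2.2) (univ ×ˢ S.Ω ×ˢ univ)
  regularValue : ∀ x ∈ S.O0, fderiv ℝ S.G x ≠ 0

/-- The perturbed field `F^+ = f^+ + ε g`. -/
def Fp (S : PSSystem) (ε t : ℝ) (x : Plane) : Plane := S.fp x + ε • S.g t x ε

/-- The perturbed field `F^- = f^- + ε g`. -/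
def Fm (S : PSSystem) (ε t : ℝ) (x : Plane) : Plane := S.fm x + ε • S.g t x ε

/-- `x` is a solution (without sliding) on the interval `I`: it is continuous, it satisfies the
`+` (`-`) equation while it is in `Ω^+` (`Ω^-`), and whenever it is on `Ω^0` at a time `t` it is, on
some left neighbourhood of `t` inside `I`, either in `Ω^+` or in `Ω^-`, its left derivative being
given by the corresponding field, and similarly on the right. Hence the times at which it
is on `Ω^0` are isolated in `I`, and it is piecewise smooth, with the smoothness given by the
fields. -/
structure IsSolution (S : PSSystem) (ε : ℝ) (I : Set ℝ) (x : ℝ → Plane) : Prop where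
  continuousOn : ContinuousOn x I
  mem : ∀ t ∈ I, x t ∈ S.Ω
  plus : ∀ t ∈ I, x t ∈ S.Op → HasDerivWithinAt x (S.Fp ε t (x t)) I t
  minus : ∀ t ∈ I, x t ∈ S.Om → HasDerivWithinAt x (S.Fm ε t (x t)) I t
  left : ∀ t ∈ I, x t ∈ S.O0 → (∃ s ∈ I, s < t) →
    ((∀ᶠ s in 𝓝[<] t, x s ∈ S.Op) ∧ HasDerivWithinAt x (S.Fp ε t (x t)) (Iic t) t) ∨
    ((∀ᶠ s in 𝓝[<] t, x s ∈ S.Om) ∧ HasDerivWithinAt x (S.Fm ε t (x t)) (Iic t) t)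
  right : ∀ t ∈ I, x t ∈ S.O0 → (∃ s ∈ I, t < s) →
    ((∀ᶠ s in 𝓝[>] t, x s ∈ S.Op) ∧ HasDerivWithinAt x (S.Fp ε t (x t)) (Ici t) t) ∨
    ((∀ᶠ s in 𝓝[>] t, x s ∈ S.Om) ∧ HasDerivWithinAt x (S.Fm ε t (x t)) (Ici t) t)

/-- `v` is a normalized eigenvector of `A` for the eigenvalue `l`. -/
def IsUnitEigenvector (A : Plane →L[ℝ] Plane) (l : ℝ) (v : Plane) : Prop :=
  ‖v‖ = 1 ∧ A v = l • v

/-- Hypothesis **F0**: the origin lies on `Ω^0`, it is an equilibrium of `f^+` and `f^-`, and both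
linearizations are saddles; `e` records the eigenvalues and normalized eigenvectors. -/
structure HypF0 (S : PSSystem) (e : EigenData) : Prop where
  zero_mem : (0 : Plane) ∈ S.O0
  fp_zero : S.fp 0 = 0
  fm_zero : S.fm 0 = 0
  eig_sp : IsUnitEigenvector (fderivWithin ℝ S.fp (S.Op ∪ S.O0) 0) e.lsp e.vsp
  eig_up : IsUnitEigenvector (fderivWithin ℝ S.fp (S.Op ∪ S.O0) 0) e.lup e.vup
  eig_sm : IsUnitEigenvector (fderivWithin ℝ S.fm (S.Om ∪ S.O0) 0) e.lsm e.vsm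
  eig_um : IsUnitEigenvector (fderivWithin ℝ S.fm (S.Om ∪ S.O0) 0) e.lum e.vum
  lsp_neg : e.lsp < 0
  lsm_neg : e.lsm < 0
  lup_pos : 0 < e.lup
  lum_pos : 0 < e.lum

/-- Hypothesis **F1**: orientation of the eigenvectors with respect to `∇G(0)`. -/
structure HypF1 (S : PSSystem) (e : EigenData) : Prop where
  um : fderiv ℝ S.G 0 e.vum < 0
  up : 0 < fderiv ℝ S.G 0 e.vup
  sm : fderiv ℝ S.G 0 e.vsm < 0
  sp : 0 < fderiv ℝ S.G 0 e.vsp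

end PSSystem

/-- The polyline made of the half-lines spanned by `v_u^+` and `v_u^-`. -/
def EigenData.unstablePolyline (e : EigenData) : Set Plane :=
  {p | ∃ c : ℝ, 0 ≤ c ∧ (p = c • e.vup ∨ p = c • e.vum)}

/-- Hypothesis **F2**: `v_s^+` and `v_s^-` lie on opposite sides of the polyline. -/
structure EigenData.HypF2 (e : EigenData) : Prop where
  sp : e.vsp ∉ e.unstablePolyline
  sm : e.vsm ∉ e.unstablePolyline
  opposite : connectedComponentIn e.unstablePolylineᶜ e.vsp ≠
    connectedComponentIn e.unstablePolylineᶜ e.vsm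

namespace PSSystem

/-- `γ` solves the unperturbed system on `ℝ`, is homoclinic to the origin, and lies in `Ω^-` for
`t < 0`, on `Ω^0` for `t = 0`, in `Ω^+` for `t > 0`. -/
structure IsHomoclinic (S : PSSystem) (γ : ℝ → Plane) : Prop where
  sol : S.IsSolution 0 univ γ
  tendsto_atBot : Tendsto γ atBot (𝓝 0)
  tendsto_atTop : Tendsto γ atTop (𝓝 0)
  neg : ∀ t < 0, γ t ∈ S.Om
  zero : γ 0 ∈ S.O0
  pos : ∀ t > 0, γ t ∈ S.Op

/-- Hypothesis **K**: `γ` is the unique homoclinic solution as above, and it crosses `Ω^0`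
transversely at `t = 0`. -/
structure HypK (S : PSSystem) (γ : ℝ → Plane) : Prop where
  homoclinic : S.IsHomoclinic γ
  unique : ∀ γ' : ℝ → Plane, S.IsHomoclinic γ' → γ' = γ
  cross_plus : 0 < fderiv ℝ S.G (γ 0) (S.fp (γ 0))
  cross_minus : 0 < fderiv ℝ S.G (γ 0) (S.fm (γ 0))

/-- Hypothesis **G**: the origin is an equilibrium of the perturbation. -/
def HypG (S : PSSystem) : Prop := ∀ t ε : ℝ, S.g t 0 ε = 0

end PSSystem

/-- The closed loop `Γ = {γ(t) | t ∈ ℝ} ∪ {0}`. -/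
def loopSet (γ : ℝ → Plane) : Set Plane := range γ ∪ {0}

/-- The scenario considered: near the origin the directions `v_u^+` and `v_s^-` point to the
exterior of the loop. -/
def EigenData.Scenario1 (e : EigenData) (γ : ℝ → Plane) : Prop :=
  ∃ ρ > 0, ∀ d : ℝ, 0 < d → d < ρ →
    d • e.vup ∈ exterior (loopSet γ) ∧ d • e.vsm ∈ exterior (loopSet γ)

namespace PSSystem

/-- `ℓ(Q) = s`: the point `Q` is reached at arc length `s > 0` by the path of `Ω^0` which starts at
the origin towards the inside of the loop. The path is given by its arc length
parametrization. -/
def HasLength (S : PSSystem) (γ : ℝ → Plane) (Q : Plane) (s : ℝ) : Prop :=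
  0 < s ∧ ∃ c : ℝ → Plane, c 0 = 0 ∧ c s = Q ∧ InjOn c (Icc 0 s) ∧
    (∀ u ∈ Icc 0 s, c u ∈ S.O0) ∧
    (∀ u ∈ Icc 0 s, ∃ v : Plane, ‖v‖ = 1 ∧ HasDerivWithinAt c v (Icc 0 s) u) ∧
    ∀ᶠ u in 𝓝[>] (0 : ℝ), c u ∈ enclosed (loopSet γ)

/-- The directed distance `𝒟(Q, P) = ℓ(P) - ℓ(Q)` equals `d`. -/
def HasDirectedDist (S : PSSystem) (γ : ℝ → Plane) (Q P : Plane) (d : ℝ) : Prop :=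
  ∃ a b : ℝ, S.HasLength γ Q a ∧ S.HasLength γ P b ∧ b - a = d

/-- The transversal `L^0(ρ)`. -/
def L0 (S : PSSystem) (γ : ℝ → Plane) (ρ : ℝ) : Set Plane := {Q ∈ S.O0 | ‖Q - γ 0‖ < ρ}

/-- `y` is the trajectory `t ↦ x(t, τ; P_s(τ))`, `t ≥ τ`, of the point `P_s(τ)` in which the branch
of the stable leaf (initial conditions at time `τ` of solutions converging to `0` in the future)
that leaves the origin inside `Ω^+` first meets `L^0(√ε)`. -/
structure IsStableLeafTrajectory (S : PSSystem) (γ : ℝ → Plane) (ε τ : ℝ) (y : ℝ → Plane) :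
    Prop where
  sol : S.IsSolution ε (Ici τ) y
  start : y τ ∈ S.L0 γ (Real.sqrt ε)
  pos : ∀ t > τ, y t ∈ S.Op
  tendsto : Tendsto y atTop (𝓝 0)

/-- `y` is the trajectory `t ↦ x(t, τ; P_u(τ))`, `t ≤ τ`, of the point `P_u(τ)` in which the branch
of the unstable leaf (initial conditions at time `τ` of solutions converging to `0` in the past)
that leaves the origin inside `Ω^-` first meets `L^0(√ε)`. -/
structure IsUnstableLeafTrajectory (S : PSSystem) (γ : ℝ → Plane) (ε τ : ℝ) (y : ℝ → Plane) :
    Prop where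
  sol : S.IsSolution ε (Iic τ) y
  start : y τ ∈ S.L0 γ (Real.sqrt ε)
  neg : ∀ t < τ, y t ∈ S.Om
  tendsto : Tendsto y atBot (𝓝 0)

/-- `P = P_s(τ)` -/
def IsPs (S : PSSystem) (γ : ℝ → Plane) (ε τ : ℝ) (P : Plane) : Prop :=
  ∃ y, S.IsStableLeafTrajectory γ ε τ y ∧ y τ = P

/-- `P = P_u(τ)` -/
def IsPu (S : PSSystem) (γ : ℝ → Plane) (ε τ : ℝ) (P : Plane) : Prop :=
  ∃ y, S.IsUnstableLeafTrajectory γ ε τ y ∧ y τ = P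

/-- `Q = Q_s(d, τ)`: the point of `Ω^0` with `𝒟(Q, P_s(τ)) = d`. -/
def IsQs (S : PSSystem) (γ : ℝ → Plane) (ε d τ : ℝ) (Q : Plane) : Prop :=
  ∃ P, S.IsPs γ ε τ P ∧ S.HasDirectedDist γ Q P d

/-- `Q = Q_u(d, τ)`: the point of `Ω^0` with `𝒟(Q, P_u(τ)) = d`. -/
def IsQu (S : PSSystem) (γ : ℝ → Plane) (ε d τ : ℝ) (Q : Plane) : Prop :=
  ∃ P, S.IsPu γ ε τ P ∧ S.HasDirectedDist γ Q P d

/-- The solution `x` starts at `Q ∈ Ω^0` at time `τ` and performs a loop forward in time: it is in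
`Ω^+` until it meets `Ω^0`, inside the homoclinic loop, at time `Th`, and then in `Ω^-` until it is
back to `Ω^0` at time `T1`. For `Q = Q_s(d, τ)` these are `𝒯_{1/2}(d, τ)` and `𝒯_1(d, τ)`. -/
structure IsForwardLoop (S : PSSystem) (γ : ℝ → Plane) (ε τ : ℝ) (Q : Plane) (Th T1 : ℝ)
    (x : ℝ → Plane) : Prop where
  lt_half : τ < Th
  lt_one : Th < T1
  sol : S.IsSolution ε (Icc τ T1) x
  start : x τ = Q
  first : ∀ t ∈ Ioo τ Th, x t ∈ S.Op
  half : x Th ∈ S.O0 ∩ enclosed (loopSet γ)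
  second : ∀ t ∈ Ioo Th T1, x t ∈ S.Om
  final : x T1 ∈ S.O0

/-- The solution `x` is at `Q ∈ Ω^0` at time `τ` and performs a loop backward in time: it is in
`Ω^-` until it meets `Ω^0`, inside the homoclinic loop, at time `Th`, and then in `Ω^+` until it is
back to `Ω^0` at time `T1`. For `Q = Q_u(d, τ)` these are `𝒯_{-1/2}(d, τ)` and `𝒯_{-1}(d, τ)`. -/
structure IsBackwardLoop (S : PSSystem) (γ : ℝ → Plane) (ε τ : ℝ) (Q : Plane) (Th T1 : ℝ)
    (x : ℝ → Plane) : Prop where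
  half_lt : Th < τ
  one_lt : T1 < Th
  sol : S.IsSolution ε (Icc T1 τ) x
  start : x τ = Q
  first : ∀ t ∈ Ioo Th τ, x t ∈ S.Om
  half : x Th ∈ S.O0 ∩ enclosed (loopSet γ)
  second : ∀ t ∈ Ioo T1 Th, x t ∈ S.Op
  final : x T1 ∈ S.O0

end PSSystem

/-! ### Differential inequalities on an interval -/

/-! Reversing time and exchanging `Ω⁺` and `Ω⁻` (`PSSystem.rev`) turns backward loops into forward
loops, and turns the `Ω⁻` half of a forward loop into a trajectory of the same kind as its `Ω⁺`
half. Hence one half system is studied: trajectories in `Ω⁺ ∪ Ω⁰` that start on `Ω⁰` near `γ 0`,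
descend along the stable direction of the saddle, and either converge to it or turn back to `Ω⁰`.
`SaddleModel` records what is used: the perturbed field extended to a bounded Lipschitz field, and
linear eigen-coordinates `U` (unstable) and `V` (stable), scaled so that `U + V` is the derivative
of `G` at `0`. Near the saddle, differences of trajectories satisfy `U' = b U` and `V' = -a V` up to
a relative error `η`, where `a = |λ_s^+|`, `b = λ_u^+` and `η` is as small as desired.

The exponent. Let `x` start at distance `d` from a trajectory `y` of the stable leaf, and let `N` be
the time spent near the saddle until `x` is back on `Ω⁰`. Up to `η`, the distance from `x` to `y` is
at most of order `d e^{bN}`. On arrival `U ≈ -V` for `x`, whereas `y` lies in the cone `|U| ≤ V /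
4`, so the distance is at least of order `V(y)`, that is `e^{-aN}`. Therefore `e^{-(a+b)N}` is at
most of order `d`, and both points have size at most of order `d^{a/(a+b)}`
(`GoodTime.forward_estimate`). In reversed time the second half loop is a trajectory that ends at
that small distance from the other saddle; it stays close to the leaf, with an exponent tending to
`1` with `η` (`GoodTime.backward_estimate`). The product of the two exponents tends to `σ`, and `μ >
0` absorbs the loss and the constants (`exists_exponents`, `exists_mul_rpow_le`).

The leaf. Two trajectories that start on `Ω⁰` at the same time and stay in the stable cone until
both have size `ω` start within a multiple of `ω` of each other (`GoodTime.shift`). This enters the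
backward estimate; with `ω → 0` it yields uniqueness of the leaf point, and, compared with `γ`, a
distance of order `ε < √ε`. Existence is a shooting argument: leaving the cone through `U < 0` and
through `U > 0` are disjoint open conditions on the starting point, so some point of an arc joining
the two behaviours does neither (`exists_not_exits`). That both occur for `ε = 0` is planar
topology: an orbit cannot cross the loop, the side `U > 0` of the cone is outside and the part `V >
0` of `Ω⁰` is inside (`LoopFrame.exits`).

Two ingredients remain. `C¹` regularity up to `Ω⁰` gives strict differentiability at boundary
points, hence a small `η` (`exists_strict_derivative`). And the length of an arc of `Ω⁰` determines
its end point, because only one branch of `Ω⁰` leaves the origin inwards (`ArcPath.eqOn`). -/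

theorem le_of_forall_hasDerivAt_nonneg {f : ℝ → ℝ} {s t : ℝ} (hst : s ≤ t)
    (hc : ContinuousOn f (Icc s t)) (hd : ∀ u ∈ Ioo s t, ∃ d, HasDerivAt f d u ∧ 0 ≤ d) :
    f s ≤ f t := by
  have h : MonotoneOn f (Icc s t) := by
    refine monotoneOn_of_deriv_nonneg (convex_Icc s t) hc ?_ ?_
    · intro u hu
      rw [interior_Icc] at hu
      obtain ⟨d, hd, -⟩ := hd u hu
      exact hd.differentiableAt.differentiableWithinAt
    · intro u hu
      rw [interior_Icc] at hu
      obtain ⟨d, hd, h0⟩ := hd u hu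
      rwa [hd.deriv]
  exact h (left_mem_Icc.2 hst) (right_mem_Icc.2 hst) hst

theorem mul_exp_le_of_forall_hasDerivAt {f : ℝ → ℝ} {s t : ℝ} (k : ℝ) (hst : s ≤ t)
    (hc : ContinuousOn f (Icc s t)) (hd : ∀ u ∈ Ioo s t, ∃ d, HasDerivAt f d u ∧ k * f u ≤ d) :
    f s * Real.exp (k * (t - s)) ≤ f t := by
  have h := le_of_forall_hasDerivAt_nonneg (f := fun u => f u * Real.exp (-(k * (u - s)))) hst
    (hc.mul (by fun_prop)) (by
      intro u hu
      obtain ⟨d, hd, hk⟩ := hd u hu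
      have h1 : HasDerivAt (fun u : ℝ => Real.exp (-(k * (u - s))))
          (Real.exp (-(k * (u - s))) * (-(k * 1))) u :=
        ((((hasDerivAt_id u).sub_const s).const_mul k).neg).exp
      refine ⟨_, hd.mul h1, ?_⟩
      have := Real.exp_pos (-(k * (u - s)))
      nlinarith)
  simp only [sub_self, mul_zero, neg_zero, Real.exp_zero, mul_one, Real.exp_neg] at h
  rw [← div_eq_mul_inv, le_div_iff₀ (Real.exp_pos _)] at h
  exact h

theorem le_mul_exp_of_forall_hasDerivAt {f : ℝ → ℝ} {s t : ℝ} (k : ℝ) (hst : s ≤ t)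
    (hc : ContinuousOn f (Icc s t)) (hd : ∀ u ∈ Ioo s t, ∃ d, HasDerivAt f d u ∧ d ≤ k * f u) :
    f t ≤ f s * Real.exp (k * (t - s)) := by
  have h := mul_exp_le_of_forall_hasDerivAt (f := fun u => -f u) k hst hc.neg (by
    intro u hu
    obtain ⟨d, hd, hk⟩ := hd u hu
    exact ⟨-d, hd.neg, by linarith⟩)
  linarith

theorem lt_of_forall_hasDerivAt_pos {f : ℝ → ℝ} {s t c : ℝ} (hst : s ≤ t)
    (hc : ContinuousOn f (Icc s t)) (hd : ∀ u ∈ Ioo s t, ∃ d, HasDerivAt f d u ∧ c ≤ d) :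
    f s + c * (t - s) ≤ f t := by
  have h := le_of_forall_hasDerivAt_nonneg (f := fun u => f u - c * u) hst
    (hc.sub (by fun_prop)) (by
      intro u hu
      obtain ⟨d, hd, hk⟩ := hd u hu
      exact ⟨d - c * 1, hd.sub ((hasDerivAt_id u).const_mul c), by linarith⟩)
  linarith

/-- Two-sided Grönwall estimate for curves in an inner product space. -/
theorem norm_le_exp_of_hasDerivAt {E : Type*} [NormedAddCommGroup E] [InnerProductSpace ℝ E]
    {f : ℝ → E} {s t L e : ℝ} (hL : 0 ≤ L) (he : 0 ≤ e) (hc : ContinuousOn f (Icc s t))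
    (hd : ∀ u ∈ Ioo s t, ∃ d, HasDerivAt f d u ∧ ‖d‖ ≤ L * ‖f u‖ + e) {u v : ℝ}
    (hu : u ∈ Icc s t) (hv : v ∈ Icc s t) :
    ‖f u‖ ≤ (‖f v‖ + e) * Real.exp ((L + 1) * |u - v|) := by
  -- The squared norm is differentiable even where `f` vanishes; the added `e²` makes the estimate
  -- homogeneous, since `2‖f‖(L‖f‖ + e) ≤ 2(L + 1)(‖f‖² + e²)`.
  set φ : ℝ → ℝ := fun u => ‖f u‖ ^ 2 + e ^ 2 with hφ
  have hcφ : ContinuousOn φ (Icc s t) := (hc.norm.pow 2).add continuousOn_const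
  have hdφ : ∀ w ∈ Ioo s t, ∃ d, HasDerivAt φ d w ∧ |d| ≤ (2 * (L + 1)) * φ w := by
    intro w hw
    obtain ⟨d, hd, hb⟩ := hd w hw
    refine ⟨_, (hd.norm_sq).add_const (e ^ 2), ?_⟩
    have h1 : |inner ℝ (f w) d| ≤ ‖f w‖ * ‖d‖ := abs_real_inner_le_norm _ _
    rw [abs_mul, abs_two]
    have h2 : ‖f w‖ * ‖d‖ ≤ ‖f w‖ * (L * ‖f w‖ + e) :=
      mul_le_mul_of_nonneg_left hb (norm_nonneg _)
    simp only [hφ]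
    nlinarith [sq_nonneg (‖f w‖ - e), mul_nonneg hL (sq_nonneg e)]
  have key : φ u ≤ φ v * Real.exp (2 * (L + 1) * |u - v|) := by
    rcases le_total v u with h | h
    · rw [abs_of_nonneg (by linarith)]
      refine le_mul_exp_of_forall_hasDerivAt _ h (hcφ.mono (Icc_subset_Icc hv.1 hu.2)) ?_
      intro w hw
      obtain ⟨d, h1, h2⟩ := hdφ w ⟨hv.1.trans_lt hw.1, hw.2.trans_le hu.2⟩
      exact ⟨d, h1, (le_abs_self d).trans h2⟩
    · rw [abs_of_nonpos (by linarith)]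
      have := mul_exp_le_of_forall_hasDerivAt (-(2 * (L + 1))) h
        (hcφ.mono (Icc_subset_Icc hu.1 hv.2)) (by
          intro w hw
          obtain ⟨d, h1, h2⟩ := hdφ w ⟨hu.1.trans_lt hw.1, hw.2.trans_le hv.2⟩
          exact ⟨d, h1, by linarith [neg_abs_le d]⟩)
      rw [neg_mul, Real.exp_neg, ← div_eq_mul_inv, div_le_iff₀ (Real.exp_pos _)] at this
      rwa [neg_sub]
  have h2 : ‖f u‖ ^ 2 ≤ ((‖f v‖ + e) * Real.exp ((L + 1) * |u - v|)) ^ 2 := by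
    rw [mul_pow, ← Real.exp_nat_mul]
    push_cast
    rw [← mul_assoc]
    have h3 : φ v ≤ (‖f v‖ + e) ^ 2 := by
      simp only [hφ]; nlinarith [norm_nonneg (f v)]
    have h4 : ‖f u‖ ^ 2 ≤ φ u := by simp only [hφ]; nlinarith
    exact h4.trans (key.trans (mul_le_mul_of_nonneg_right h3 (Real.exp_pos _).le))
  exact le_of_sq_le_sq h2 (by positivity)

/-! ### First exit -/

/-- A continuous curve that starts in an open set and is not always in it has a first exit time. -/
theorem exists_first_exit {E : Type*} [TopologicalSpace E] {x : ℝ → E} {O : Set E} {s t : ℝ}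
    (hO : IsOpen O) (hx : ContinuousOn x (Icc s t)) (hs : x s ∈ O) (hst : s ≤ t) (ht : x t ∉ O) :
    ∃ u, s < u ∧ u ≤ t ∧ x u ∉ O ∧ ∀ v ∈ Ico s u, x v ∈ O := by
  set A : Set ℝ := Icc s t ∩ x ⁻¹' Oᶜ with hA
  have hAc : IsClosed A := hx.preimage_isClosed_of_isClosed isClosed_Icc hO.isClosed_compl
  have hAne : A.Nonempty := ⟨t, ⟨hst, le_rfl⟩, ht⟩
  have hbd : BddBelow A := ⟨s, fun u hu => hu.1.1⟩
  have hmem := hAc.csInf_mem hAne hbd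
  refine ⟨sInf A, ?_, hmem.1.2, hmem.2, ?_⟩
  · rcases hmem.1.1.lt_or_eq with h | h
    · exact h
    · exact absurd hs (by rw [h]; exact hmem.2)
  · intro v hv
    by_contra hcon
    exact (csInf_le hbd ⟨⟨hv.1, hv.2.le.trans hmem.1.2⟩, hcon⟩).not_gt hv.2

/-- Backward version of `exists_first_exit`. -/
theorem exists_last_exit {E : Type*} [TopologicalSpace E] {x : ℝ → E} {O : Set E} {s t : ℝ}
    (hO : IsOpen O) (hx : ContinuousOn x (Icc s t)) (ht : x t ∈ O) (hst : s ≤ t) (hs : x s ∉ O) :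
    ∃ u, s ≤ u ∧ u < t ∧ x u ∉ O ∧ ∀ v ∈ Ioc u t, x v ∈ O := by
  obtain ⟨u, h1, h2, h3, h4⟩ := exists_first_exit (x := fun v => x (-v)) (s := -t) (t := -s) hO
    (hx.comp continuous_neg.continuousOn (fun v hv => ⟨by linarith [hv.2], by linarith [hv.1]⟩))
    (by simpa using ht) (by linarith) (by simpa using hs)
  refine ⟨-u, by linarith, by linarith, h3, fun v hv => ?_⟩
  have := h4 (-v) ⟨by linarith [hv.2], by linarith [hv.1]⟩
  simpa using this

/-! ### Global flows of bounded Lipschitz fields -/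

section Flow
variable {E : Type*} [NormedAddCommGroup E] [InnerProductSpace ℝ E]

theorem eq_of_hasDerivAt_of_lipschitz {F : ℝ → E → E} {L : NNReal} (hF : ∀ t, LipschitzWith L (F t))
    {x y : ℝ → E} {s t : ℝ} (hx : ContinuousOn x (Icc s t)) (hy : ContinuousOn y (Icc s t))
    (hx' : ∀ u ∈ Ioo s t, HasDerivAt x (F u (x u)) u)
    (hy' : ∀ u ∈ Ioo s t, HasDerivAt y (F u (y u)) u) {v : ℝ} (hv : v ∈ Icc s t)
    (h : x v = y v) : EqOn x y (Icc s t) := by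
  intro u hu
  have := norm_le_exp_of_hasDerivAt (f := fun u => x u - y u) L.2 le_rfl (hx.sub hy) (by
    intro u hu
    refine ⟨_, (hx' u hu).sub (hy' u hu), ?_⟩
    have := (hF u).dist_le_mul (x u) (y u)
    rw [dist_eq_norm, dist_eq_norm] at this
    simpa using this) hu hv
  simp only [h, sub_self, norm_zero, add_zero, zero_mul] at this
  exact sub_eq_zero.1 (norm_le_zero_iff.1 this)

/-- Since the field is bounded by `C`, a solution cannot leave the ball of radius `C (n + 1)` within
time `n + 1`; Picard–Lindelöf thus works on every such interval, and uniqueness glues the pieces. -/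
theorem exists_global_solution [CompleteSpace E] {F : ℝ → E → E} {L : NNReal} {C : ℝ}
    (hF : ∀ t, LipschitzWith L (F t)) (hc : ∀ x, Continuous (fun t => F t x))
    (hb : ∀ t x, ‖F t x‖ ≤ C) (t₀ : ℝ) (x₀ : E) :
    ∃ x : ℝ → E, x t₀ = x₀ ∧ ∀ t, HasDerivAt x (F t (x t)) t := by
  have hC : 0 ≤ C := (norm_nonneg _).trans (hb 0 x₀)
  have h1 : ∀ n : ℕ, ∃ x : ℝ → E, x t₀ = x₀ ∧
      ∀ t ∈ Icc (t₀ - (n + 1)) (t₀ + (n + 1)),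
        HasDerivWithinAt x (F t (x t)) (Icc (t₀ - (n + 1)) (t₀ + (n + 1))) t := by
    intro n
    have hP : IsPicardLindelof F (tmin := t₀ - (n + 1)) (tmax := t₀ + (n + 1))
        ⟨t₀, by constructor <;> linarith [n.cast_nonneg (α := ℝ)]⟩ x₀
        (⟨C, hC⟩ * (n + 1)) 0 ⟨C, hC⟩ L :=
      { lipschitzOnWith := fun t _ => (hF t).lipschitzOnWith
        continuousOn := fun x _ => (hc x).continuousOn
        norm_le := fun t _ x _ => hb t x
        mul_max_le := by
          simp only [add_sub_cancel_left, sub_sub_cancel, max_self, NNReal.coe_zero, sub_zero]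
          exact le_of_eq rfl }
    exact hP.exists_eq_forall_mem_Icc_hasDerivWithinAt₀
  choose X hX0 hX using h1
  have hXd : ∀ n : ℕ, ∀ t ∈ Ioo (t₀ - (n + 1)) (t₀ + (n + 1)), HasDerivAt (X n) (F t (X n t)) t :=
    fun n t ht => (hX n t (Ioo_subset_Icc_self ht)).hasDerivAt (Icc_mem_nhds ht.1 ht.2)
  have hXc : ∀ n, ContinuousOn (X n) (Icc (t₀ - (n + 1)) (t₀ + (n + 1))) :=
    fun n t ht => (hX n t ht).continuousWithinAt
  have hcons : ∀ m n : ℕ, m ≤ n → EqOn (X m) (X n) (Icc (t₀ - (m + 1)) (t₀ + (m + 1))) := by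
    intro m n hmn
    have hmn' : (m : ℝ) ≤ n := by exact_mod_cast hmn
    have hsub : Icc (t₀ - (m + 1)) (t₀ + (m + 1)) ⊆ Icc (t₀ - (n + 1)) (t₀ + (n + 1)) :=
      Icc_subset_Icc (by linarith) (by linarith)
    refine eq_of_hasDerivAt_of_lipschitz hF (hXc m) ((hXc n).mono hsub) (hXd m)
      (fun u hu => hXd n u ⟨by linarith [hu.1], by linarith [hu.2]⟩) (v := t₀)
      ⟨by linarith [m.cast_nonneg (α := ℝ)], by linarith [m.cast_nonneg (α := ℝ)]⟩ ?_
    rw [hX0, hX0]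
  let x : ℝ → E := fun t => X ⌈|t - t₀|⌉₊ t
  have hx : ∀ (n : ℕ) t, |t - t₀| < n + 1 → x t = X n t := by
    intro n t ht
    have h2 : |t - t₀| ≤ ⌈|t - t₀|⌉₊ := Nat.le_ceil _
    rcases le_total ⌈|t - t₀|⌉₊ n with h | h
    · refine hcons _ _ h ⟨?_, ?_⟩ <;> linarith [neg_abs_le (t - t₀), le_abs_self (t - t₀)]
    · refine (hcons _ _ h ⟨?_, ?_⟩).symm <;> linarith [neg_abs_le (t - t₀), le_abs_self (t - t₀)]
  refine ⟨x, ?_, fun t => ?_⟩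
  · rw [hx 0 t₀ (by simp), hX0]
  · set n := ⌈|t - t₀|⌉₊ with hn
    have h2 : |t - t₀| < n + 1 := (Nat.le_ceil _).trans_lt (by linarith)
    have h3 : ∀ᶠ u in 𝓝 t, x u = X n u := by
      have : ∀ᶠ u in 𝓝 t, |u - t₀| < n + 1 :=
        (by fun_prop : Continuous fun u => |u - t₀|).continuousAt.eventually_lt_const h2
      exact this.mono fun u hu => hx n u hu
    have h4 : t ∈ Ioo (t₀ - (n + 1)) (t₀ + (n + 1)) :=
      ⟨by linarith [neg_abs_le (t - t₀)], by linarith [le_abs_self (t - t₀)]⟩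
    rw [h3.self_of_nhds]
    exact (hXd n t h4).congr_of_eventuallyEq h3

end Flow

/-! ### Planar differential inequalities of saddle type -/

/-- `P` and `Q` satisfy, up to errors, `P' = b P` and `Q' = -a Q` on `[s, t]`. -/
structure SaddleIneq (a b η e s t : ℝ) (P Q : ℝ → ℝ) : Prop where
  contP : ContinuousOn P (Icc s t)
  contQ : ContinuousOn Q (Icc s t)
  deriv : ∀ u ∈ Ioo s t, ∃ p q, HasDerivAt P p u ∧ HasDerivAt Q q u ∧
    |p - b * P u| ≤ η * (|P u| + |Q u|) + e ∧ |q + a * Q u| ≤ η * (|P u| + |Q u|) + e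

namespace SaddleIneq
variable {a b η e s t : ℝ} {P Q : ℝ → ℝ}

theorem mono (h : SaddleIneq a b η e s t P Q) {s' t' : ℝ} (hs : s ≤ s') (ht : t' ≤ t) :
    SaddleIneq a b η e s' t' P Q :=
  ⟨h.contP.mono (Icc_subset_Icc hs ht), h.contQ.mono (Icc_subset_Icc hs ht),
    fun u hu => h.deriv u ⟨hs.trans_lt hu.1, hu.2.trans_le ht⟩⟩

/-- The quadratic form `P² - q Q²` increases. -/
theorem sq_sub_le (h : SaddleIneq a b η 0 s t P Q) (hη : 0 ≤ η) (ha : 100 * η ≤ a)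
    (hb : 100 * η ≤ b) (hst : s ≤ t) {q : ℝ} (hq : 1 / 16 ≤ q) (hq' : q ≤ 16) :
    P s ^ 2 - q * Q s ^ 2 ≤ P t ^ 2 - q * Q t ^ 2 := by
  refine le_of_forall_hasDerivAt_nonneg (f := fun u => P u ^ 2 - q * Q u ^ 2) hst
    ((h.contP.pow 2).sub (continuousOn_const.mul (h.contQ.pow 2))) ?_
  intro u hu
  obtain ⟨p, r, hp, hr, h1, h2⟩ := h.deriv u hu
  refine ⟨_, (hp.pow 2).sub ((hr.pow 2).const_mul q), ?_⟩
  rw [add_zero, abs_le] at h1 h2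
  set x := P u
  set y := Q u
  have e1 : x * (p - b * x) ≥ -(|x| * (η * (|x| + |y|))) := by
    have := abs_mul x (p - b * x)
    have h3 : |p - b * x| ≤ η * (|x| + |y|) := abs_le.2 h1
    nlinarith [neg_abs_le (x * (p - b * x)), abs_nonneg x]
  have e2 : y * (r + a * y) ≤ |y| * (η * (|x| + |y|)) := by
    have := abs_mul y (r + a * y)
    have h3 : |r + a * y| ≤ η * (|x| + |y|) := abs_le.2 h2
    nlinarith [le_abs_self (y * (r + a * y)), abs_nonneg y]
  -- The mixed terms are split by Young's inequality. The range of `q` is exactly what this needs: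
  -- `y² / 8 ≤ 2 q y²` uses `q ≥ 1/16`, and the splitting of `q |x| |y|` uses `q ≤ 16`.
  have e3 : η * (|x| * |y|) * 1 ≤ η * (2 * x ^ 2 + y ^ 2 / 8) := by
    rw [mul_one]
    refine mul_le_mul_of_nonneg_left ?_ hη
    rw [← sq_abs x, ← sq_abs y]
    nlinarith [sq_nonneg (4 * |x| - |y|)]
  have e4 : q * (η * (|x| * |y|)) ≤ η * (q * (2 * y ^ 2) + 2 * x ^ 2) := by
    have : q * (|x| * |y|) ≤ q * (2 * y ^ 2) + 2 * x ^ 2 := by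
      rw [← sq_abs x, ← sq_abs y]
      nlinarith [sq_nonneg (4 * |x| - q * |y|), sq_nonneg (|x|), sq_nonneg (|y|),
        mul_nonneg (sub_nonneg.2 hq') (sq_nonneg |y|), mul_nonneg (by linarith : (0:ℝ) ≤ q) (mul_nonneg (sub_nonneg.2 hq') (sq_nonneg |y|))]
    nlinarith
  have e5 : x ^ 2 * (100 * η) ≤ x ^ 2 * b := mul_le_mul_of_nonneg_left hb (sq_nonneg x)
  have e6 : q * y ^ 2 * (100 * η) ≤ q * y ^ 2 * a :=
    mul_le_mul_of_nonneg_left ha (by positivity)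
  have e7 : q * (y * (r + a * y)) ≤ q * (|y| * (η * (|x| + |y|))) :=
    mul_le_mul_of_nonneg_left e2 (by positivity)
  have e8 : η * y ^ 2 ≤ 16 * (q * (η * y ^ 2)) := by
    nlinarith [mul_nonneg hη (sq_nonneg y)]
  have ex : |x| * |x| = x ^ 2 := by rw [← sq, sq_abs]
  have ey : |y| * |y| = y ^ 2 := by rw [← sq, sq_abs]
  have e9 : 0 ≤ η * x ^ 2 := mul_nonneg hη (sq_nonneg x)
  have e10 : 0 ≤ q * (η * y ^ 2) := by positivity
  have e11 : |x| * (η * (|x| + |y|)) = η * x ^ 2 + η * (|x| * |y|) := by rw [← ex]; ring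
  have e12 : q * (|y| * (η * (|x| + |y|))) = q * (η * (|x| * |y|)) + q * (η * y ^ 2) := by
    rw [← ey]; ring
  push_cast
  simp only [pow_one]
  nlinarith


theorem mul_bounds (h : SaddleIneq a b η e s t P Q) {u : ℝ} (hu : u ∈ Ioo s t) :
    ∃ p q, HasDerivAt P p u ∧ HasDerivAt Q q u ∧
      |P u * p - b * P u ^ 2| ≤ |P u| * (η * (|P u| + |Q u|) + e) ∧
      |Q u * q + a * Q u ^ 2| ≤ |Q u| * (η * (|P u| + |Q u|) + e) := by
  obtain ⟨p, q, hp, hq, h1, h2⟩ := h.deriv u hu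
  refine ⟨p, q, hp, hq, ?_, ?_⟩
  · rw [show P u * p - b * P u ^ 2 = P u * (p - b * P u) by ring, abs_mul]
    exact mul_le_mul_of_nonneg_left h1 (abs_nonneg _)
  · rw [show Q u * q + a * Q u ^ 2 = Q u * (q + a * Q u) by ring, abs_mul]
    exact mul_le_mul_of_nonneg_left h2 (abs_nonneg _)

/-- With an inhomogeneous error, the quadratic form at the initial time is controlled by the error
and by its final value. -/
theorem sq_sub_sq_le_error {m : ℝ} (h : SaddleIneq a b η e s t P Q) (hη : 0 ≤ η) (hm : 0 < m)
    (hηm : 100 * η ≤ m) (ha : m ≤ a) (hb : m ≤ b) (hst : s ≤ t) :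
    P s ^ 2 - Q s ^ 2 ≤ 4 * e ^ 2 / m ^ 2 + max 0 (P t ^ 2 - Q t ^ 2) := by
  -- Young's inequality leaves the error `4 e² / m = m c`; subtracting `c` makes `P² - Q² - c` grow
  -- at rate at least `m`, so a positive initial value is at most the final one.
  set c := 4 * e ^ 2 / m ^ 2 with hc
  have hmc : m * c = 4 * e ^ 2 / m := by rw [hc]; field_simp
  have hc0 : 0 ≤ c := by positivity
  have key := mul_exp_le_of_forall_hasDerivAt (f := fun u => P u ^ 2 - Q u ^ 2 - c) m hst
    (((h.contP.pow 2).sub (h.contQ.pow 2)).sub continuousOn_const) (by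
      intro u hu
      obtain ⟨p, q, hp, hq, h1, h2⟩ := h.mul_bounds hu
      refine ⟨_, ((hp.pow 2).sub (hq.pow 2)).sub_const c, ?_⟩
      rw [abs_le] at h1 h2
      push_cast
      simp only [pow_one]
      set x := P u
      set y := Q u
      have ex : |x| * |x| = x ^ 2 := by rw [← sq, sq_abs]
      have ey : |y| * |y| = y ^ 2 := by rw [← sq, sq_abs]
      have hxy : 2 * (|x| * |y|) ≤ x ^ 2 + y ^ 2 := by
        rw [← ex, ← ey]; nlinarith [sq_nonneg (|x| - |y|)]
      have e1 : (|x| + |y|) * (2 * e) ≤ m / 2 * (x ^ 2 + y ^ 2) + 4 * e ^ 2 / m := by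
        have : 4 * e ^ 2 / m = (4 / m) * e ^ 2 := by ring
        have h3 : (|x| + |y|) ^ 2 ≤ 2 * (x ^ 2 + y ^ 2) := by nlinarith
        have h4 : m / 4 * (|x| + |y|) ^ 2 ≤ m / 4 * (2 * (x ^ 2 + y ^ 2)) :=
          mul_le_mul_of_nonneg_left h3 (by positivity)
        have h5 : 0 ≤ (m / 2 * (|x| + |y|) - 2 * e) ^ 2 / m := by positivity
        have h6 : (m / 2 * (|x| + |y|) - 2 * e) ^ 2 / m =
            m / 4 * (|x| + |y|) ^ 2 - (|x| + |y|) * (2 * e) + 4 * e ^ 2 / m := by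
          field_simp; ring
        linarith
      have e2 : m * x ^ 2 ≤ b * x ^ 2 := mul_le_mul_of_nonneg_right hb (sq_nonneg x)
      have e3 : m * y ^ 2 ≤ a * y ^ 2 := mul_le_mul_of_nonneg_right ha (sq_nonneg y)
      have e4 : η * (2 * (|x| * |y|)) ≤ η * (x ^ 2 + y ^ 2) := mul_le_mul_of_nonneg_left hxy hη
      have e5 : 100 * η * (x ^ 2 + y ^ 2) ≤ m * (x ^ 2 + y ^ 2) :=
        mul_le_mul_of_nonneg_right hηm (by positivity)
      have e6 : |x| * (η * (|x| + |y|) + e) + |y| * (η * (|x| + |y|) + e) =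
          η * (x ^ 2 + y ^ 2) + η * (2 * (|x| * |y|)) + (|x| + |y|) * e := by
        rw [← ex, ← ey]; ring
      have e7 : 0 ≤ m * y ^ 2 := by positivity
      rw [mul_sub, hmc]
      nlinarith)
  rcases le_or_gt (P s ^ 2 - Q s ^ 2 - c) 0 with h0 | h0
  · linarith [le_max_left 0 (P t ^ 2 - Q t ^ 2)]
  · have : 1 ≤ Real.exp (m * (t - s)) := Real.one_le_exp (mul_nonneg hm.le (by linarith))
    have h1 : P s ^ 2 - Q s ^ 2 - c ≤ (P s ^ 2 - Q s ^ 2 - c) * Real.exp (m * (t - s)) :=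
      le_mul_of_one_le_right h0.le this
    linarith [le_max_right 0 (P t ^ 2 - Q t ^ 2)]

/-- Expansion in the unstable cone. -/
theorem expand (h : SaddleIneq a b η 0 s t P Q) (hη : 0 ≤ η) (hst : s ≤ t)
    (hcone : ∀ u ∈ Ioo s t, |Q u| ≤ 2 * |P u|) :
    |P s| * Real.exp ((b - 3 * η) * (t - s)) ≤ |P t| := by
  have key := mul_exp_le_of_forall_hasDerivAt (f := fun u => P u ^ 2) (2 * (b - 3 * η)) hst
    (h.contP.pow 2) (by
      intro u hu
      obtain ⟨p, q, hp, hq, h1, h2⟩ := h.mul_bounds hu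
      refine ⟨_, hp.pow 2, ?_⟩
      rw [abs_le] at h1
      push_cast
      simp only [pow_one]
      have h3 : |P u| * (η * (|P u| + |Q u|) + 0) ≤ |P u| * (η * (3 * |P u|)) := by
        have := hcone u hu
        rw [add_zero]
        gcongr; linarith
      have ex : |P u| * |P u| = P u ^ 2 := by rw [← sq, sq_abs]
      nlinarith)
  refine le_of_sq_le_sq ?_ (abs_nonneg _)
  rw [mul_pow, sq_abs, sq_abs, ← Real.exp_nat_mul,
    show ((2 : ℕ) : ℝ) * ((b - 3 * η) * (t - s)) = 2 * (b - 3 * η) * (t - s) by push_cast; ring]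
  exact key

/-- Contraction in the stable cone. -/
theorem contract (h : SaddleIneq a b η 0 s t P Q) (hη : 0 ≤ η) (hst : s ≤ t)
    (hcone : ∀ u ∈ Ioo s t, |P u| ≤ 2 * |Q u|) :
    |Q t| ≤ |Q s| * Real.exp (-((a - 3 * η) * (t - s))) := by
  have key := le_mul_exp_of_forall_hasDerivAt (f := fun u => Q u ^ 2) (-(2 * (a - 3 * η))) hst
    (h.contQ.pow 2) (by
      intro u hu
      obtain ⟨p, q, hp, hq, h1, h2⟩ := h.mul_bounds hu
      refine ⟨_, hq.pow 2, ?_⟩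
      rw [abs_le] at h2
      push_cast
      simp only [pow_one]
      have h3 : |Q u| * (η * (|P u| + |Q u|) + 0) ≤ |Q u| * (η * (3 * |Q u|)) := by
        have := hcone u hu
        rw [add_zero]
        gcongr; linarith
      have ex : |Q u| * |Q u| = Q u ^ 2 := by rw [← sq, sq_abs]
      nlinarith)
  refine le_of_sq_le_sq ?_ (by positivity)
  rw [mul_pow, sq_abs, sq_abs, ← Real.exp_nat_mul,
    show ((2 : ℕ) : ℝ) * -((a - 3 * η) * (t - s)) = -(2 * (a - 3 * η)) * (t - s) by
      push_cast; ring]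
  exact key

/-- Lower bound for the decay in the stable cone. -/
theorem contract_ge (h : SaddleIneq a b η 0 s t P Q) (hη : 0 ≤ η) (hst : s ≤ t)
    (hcone : ∀ u ∈ Ioo s t, |P u| ≤ 2 * |Q u|) :
    |Q s| * Real.exp (-((a + 3 * η) * (t - s))) ≤ |Q t| := by
  have key := mul_exp_le_of_forall_hasDerivAt (f := fun u => Q u ^ 2) (-(2 * (a + 3 * η))) hst
    (h.contQ.pow 2) (by
      intro u hu
      obtain ⟨p, q, hp, hq, h1, h2⟩ := h.mul_bounds hu
      refine ⟨_, hq.pow 2, ?_⟩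
      rw [abs_le] at h2
      push_cast
      simp only [pow_one]
      have h3 : |Q u| * (η * (|P u| + |Q u|) + 0) ≤ |Q u| * (η * (3 * |Q u|)) := by
        have := hcone u hu
        rw [add_zero]
        gcongr; linarith
      have ex : |Q u| * |Q u| = Q u ^ 2 := by rw [← sq, sq_abs]
      nlinarith)
  refine le_of_sq_le_sq ?_ (abs_nonneg _)
  rw [mul_pow, sq_abs, sq_abs, ← Real.exp_nat_mul,
    show ((2 : ℕ) : ℝ) * -((a + 3 * η) * (t - s)) = -(2 * (a + 3 * η)) * (t - s) by
      push_cast; ring]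
  exact key

/-- Upper bound for the growth. -/
theorem growth (h : SaddleIneq a b η 0 s t P Q) (hη : 0 ≤ η) (ha : 0 ≤ a) (hb : 0 ≤ b)
    (hst : s ≤ t) :
    |P t| + |Q t| ≤ 2 * (|P s| + |Q s|) * Real.exp ((b + 2 * η) * (t - s)) := by
  have key := le_mul_exp_of_forall_hasDerivAt (f := fun u => P u ^ 2 + Q u ^ 2)
    (2 * (b + 2 * η)) hst ((h.contP.pow 2).add (h.contQ.pow 2)) (by
      intro u hu
      obtain ⟨p, q, hp, hq, h1, h2⟩ := h.mul_bounds hu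
      refine ⟨_, (hp.pow 2).add (hq.pow 2), ?_⟩
      rw [abs_le] at h1 h2
      push_cast
      simp only [pow_one]
      have ex : |P u| * |P u| = P u ^ 2 := by rw [← sq, sq_abs]
      have ey : |Q u| * |Q u| = Q u ^ 2 := by rw [← sq, sq_abs]
      have hxy : η * (2 * (|P u| * |Q u|)) ≤ η * (P u ^ 2 + Q u ^ 2) := by
        refine mul_le_mul_of_nonneg_left ?_ hη
        rw [← ex, ← ey]; nlinarith [sq_nonneg (|P u| - |Q u|)]
      have e6 : |P u| * (η * (|P u| + |Q u|) + 0) + |Q u| * (η * (|P u| + |Q u|) + 0) =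
          η * (P u ^ 2 + Q u ^ 2) + η * (2 * (|P u| * |Q u|)) := by
        rw [← ex, ← ey]; ring
      have : 0 ≤ a * Q u ^ 2 := by positivity
      have : 0 ≤ b * Q u ^ 2 := by positivity
      nlinarith)
  refine le_of_sq_le_sq ?_ (by positivity)
  rw [mul_pow, ← Real.exp_nat_mul]
  have e0 : ((2 : ℕ) : ℝ) * ((b + 2 * η) * (t - s)) = 2 * (b + 2 * η) * (t - s) := by
    push_cast; ring
  rw [e0]
  have e1 : (|P t| + |Q t|) ^ 2 ≤ 2 * (P t ^ 2 + Q t ^ 2) := by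
    rw [← sq_abs (P t), ← sq_abs (Q t)]; nlinarith [sq_nonneg (|P t| - |Q t|)]
  have e2 : 2 * (P s ^ 2 + Q s ^ 2) ≤ (2 * (|P s| + |Q s|)) ^ 2 := by
    rw [← sq_abs (P s), ← sq_abs (Q s)]
    nlinarith [mul_nonneg (abs_nonneg (P s)) (abs_nonneg (Q s)), sq_nonneg (|P s|),
      sq_nonneg (|Q s|)]
  have e3 := mul_le_mul_of_nonneg_right e2 (Real.exp_pos (2 * (b + 2 * η) * (t - s))).le
  linarith

/-- The unstable component is controlled by its final value, the stable one by its initial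
value. -/
theorem abs_add_abs_le (h : SaddleIneq a b η 0 s t P Q) (hη : 0 ≤ η) (ha : 100 * η ≤ a)
    (hb : 100 * η ≤ b) {u : ℝ} (hu : u ∈ Icc s t) :
    |P u| + |Q u| ≤ 2 * (|Q s| + |P t|) := by
  -- `P² - Q²` increases. If it is nonpositive at `u`, the whole past lies in the stable cone, where
  -- `Q` has decreased since `s`; otherwise the whole future lies in the unstable cone, where `P`
  -- increases up to `t`.
  rcases le_total (P u ^ 2 - 1 * Q u ^ 2) 0 with h0 | h0
  · have hh := h.mono le_rfl hu.2
    have h1 : ∀ v ∈ Icc s u, |P v| ≤ |Q v| := by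
      intro v hv
      have := (hh.mono hv.1 le_rfl).sq_sub_le hη ha hb hv.2 (q := 1) (by norm_num) (by norm_num)
      exact sq_le_sq.1 (by linarith)
    have h2 := hh.contract hη hu.1 (fun v hv => by
      linarith [h1 v (Ioo_subset_Icc_self hv), abs_nonneg (Q v)])
    have h3 : Real.exp (-((a - 3 * η) * (u - s))) ≤ 1 := by
      rw [Real.exp_le_one_iff]
      nlinarith [mul_nonneg (by linarith : 0 ≤ a - 3 * η) (sub_nonneg.2 hu.1)]
    have h4 : |Q u| ≤ |Q s| := h2.trans (mul_le_of_le_one_right (abs_nonneg _) h3)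
    linarith [h1 u ⟨hu.1, le_rfl⟩, abs_nonneg (P t)]
  · have hh := h.mono hu.1 le_rfl
    have h1 : ∀ v ∈ Icc u t, |Q v| ≤ |P v| := by
      intro v hv
      have := (hh.mono le_rfl hv.2).sq_sub_le hη ha hb hv.1 (q := 1) (by norm_num) (by norm_num)
      exact sq_le_sq.1 (by linarith)
    have h2 := hh.expand hη hu.2 (fun v hv => by
      linarith [h1 v (Ioo_subset_Icc_self hv), abs_nonneg (P v)])
    have h3 : 1 ≤ Real.exp ((b - 3 * η) * (t - u)) :=
      Real.one_le_exp (mul_nonneg (by linarith) (sub_nonneg.2 hu.2))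
    have h4 : |P u| ≤ |P t| := (le_mul_of_one_le_right (abs_nonneg _) h3).trans h2
    linarith [h1 u ⟨le_rfl, hu.2⟩, abs_nonneg (Q s)]

end SaddleIneq

/-- Pairing `f` with the fixed vector `f t - f s` reduces the mean value inequality to a scalar
function. -/
theorem norm_sub_le_of_hasDerivAt {E : Type*} [NormedAddCommGroup E] [InnerProductSpace ℝ E]
    {f : ℝ → E} {s t c : ℝ} (hst : s ≤ t) (hc : ContinuousOn f (Icc s t))
    (hd : ∀ u ∈ Ioo s t, ∃ d, HasDerivAt f d u ∧ ‖d‖ ≤ c) : ‖f t - f s‖ ≤ c * (t - s) := by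
  set w := f t - f s with hw
  have h := lt_of_forall_hasDerivAt_pos (f := fun u => -inner ℝ w (f u)) (c := -(‖w‖ * c)) hst
    (continuousOn_const.inner hc).neg (by
      intro u hu
      obtain ⟨d, hd, hb⟩ := hd u hu
      have h1 := ((hasDerivAt_const u w).inner ℝ hd).neg
      refine ⟨_, h1, ?_⟩
      rw [inner_zero_left, add_zero, neg_le_neg_iff]
      exact (real_inner_le_norm _ _).trans (mul_le_mul_of_nonneg_left hb (norm_nonneg _)))
  have h2 : inner ℝ w (f t) - inner ℝ w (f s) = ‖w‖ * ‖w‖ := by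
    rw [← inner_sub_right, ← hw, real_inner_self_eq_norm_mul_norm]
  rcases (norm_nonneg w).eq_or_lt with h0 | h0
  · rcases hst.eq_or_lt with h3 | h3
    · rw [← h0, ← h3]; simp
    · obtain ⟨d, -, hb⟩ := hd ((s + t) / 2) ⟨by linarith, by linarith⟩
      rw [← h0]
      exact mul_nonneg ((norm_nonneg _).trans hb) (by linarith)
  · have : ‖w‖ * ‖w‖ ≤ ‖w‖ * (c * (t - s)) := by linarith
    exact le_of_mul_le_mul_left this h0

/-! ### The half system on `Ω⁺ ∪ Ω⁰` and its saddle -/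

/-- The closed half domain `Ω⁺ ∪ Ω⁰`. -/
def PSSystem.Dp (S : PSSystem) : Set Plane := S.Op ∪ S.O0

/-- Quantitative description of the half system on `Ω⁺ ∪ Ω⁰`: `F` extends the perturbed field
from a neighbourhood `K` of the half loop to a bounded Lipschitz field, `U` and `V` are the unstable
and the stable coordinate at the saddle, `b` and `-a` the eigenvalues, and `η` measures the
nonlinearity in the ball of radius `r`. -/
structure SaddleModel (S : PSSystem) (γ : ℝ → Plane) where
  F : ℝ → ℝ → Plane → Plane
  K : Set Plane
  U : Plane →L[ℝ] ℝ
  V : Plane →L[ℝ] ℝ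
  a : ℝ
  b : ℝ
  η : ℝ
  r : ℝ
  r₀ : ℝ
  c₀ : ℝ
  C : ℝ
  ε₁ : ℝ
  L : NNReal
  a_pos : 0 < a
  b_pos : 0 < b
  η_pos : 0 < η
  r_pos : 0 < r
  r₀_pos : 0 < r₀
  c₀_pos : 0 < c₀
  one_le_C : 1 ≤ C
  ε₁_pos : 0 < ε₁
  η_le_a : 100 * η ≤ a
  η_le_b : 100 * η ≤ b
  η_le : 100 * η ≤ 1
  norm_le : ∀ x, ‖x‖ ≤ C * (|U x| + |V x|)
  U_le : ∀ x, |U x| ≤ C * ‖x‖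
  V_le : ∀ x, |V x| ≤ C * ‖x‖
  isOpen_K : IsOpen K
  K_sub : K ⊆ S.Ω
  isOpen_Ω : IsOpen S.Ω
  G_diff : ∀ x ∈ S.Ω, DifferentiableAt ℝ S.G x
  F_lip : ∀ ε ∈ Icc 0 ε₁, ∀ t, LipschitzWith L (F ε t)
  F_cont : ∀ ε ∈ Icc 0 ε₁, ∀ x, Continuous (fun t => F ε t x)
  F_bdd : ∀ ε ∈ Icc 0 ε₁, ∀ t x, ‖F ε t x‖ ≤ C
  F_eq : ∀ ε ∈ Icc 0 ε₁, ∀ t, ∀ x ∈ K, x ∈ S.Dp → F ε t x = S.Fp ε t x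
  F_shift : ∀ ε ∈ Icc 0 ε₁, ∀ t t', ∀ x ∈ K, x ∈ S.Dp →
    ‖F ε t x - F ε t' x‖ ≤ C * ε * |t - t'|
  F_var : ∀ ε ∈ Icc 0 ε₁, ∀ t, ∀ x ∈ K, x ∈ S.Dp → ‖F ε t x - F 0 t x‖ ≤ C * ε
  F_zero : ∀ ε ∈ Icc 0 ε₁, ∀ t, F ε t 0 = 0
  zero_mem : (0 : Plane) ∈ S.O0
  ball_sub : Metric.ball 0 r ⊆ K
  saddle_U : ∀ ε ∈ Icc 0 ε₁, ∀ t, ∀ x ∈ Metric.ball (0 : Plane) r, ∀ y ∈ Metric.ball (0 : Plane) r,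
    x ∈ S.Dp → y ∈ S.Dp →
    |U (F ε t x - F ε t y) - b * U (x - y)| ≤ η * (|U (x - y)| + |V (x - y)|)
  saddle_V : ∀ ε ∈ Icc 0 ε₁, ∀ t, ∀ x ∈ Metric.ball (0 : Plane) r, ∀ y ∈ Metric.ball (0 : Plane) r,
    x ∈ S.Dp → y ∈ S.Dp →
    |V (F ε t x - F ε t y) + a * V (x - y)| ≤ η * (|U (x - y)| + |V (x - y)|)
  G_deriv_zero : HasFDerivAt S.G (U + V) 0
  G_near : ∀ x ∈ Metric.ball (0 : Plane) r, |S.G x - (U x + V x)| ≤ η * (|U x| + |V x|)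
  G_flow : ∀ ε ∈ Icc 0 ε₁, ∀ t, ∀ x ∈ Metric.ball (0 : Plane) r, x ∈ S.Dp →
    |fderiv ℝ S.G x (F ε t x) - (b * U x - a * V x)| ≤ η * (|U x| + |V x|)
  ball₀_sub : Metric.ball (γ 0) r₀ ⊆ K
  cross : ∀ ε ∈ Icc 0 ε₁, ∀ t, ∀ x ∈ Metric.ball (γ 0) r₀, c₀ ≤ fderiv ℝ S.G x (F ε t x)
  G_lip : ∀ x ∈ Metric.ball (γ 0) r₀, ∀ y ∈ Metric.ball (γ 0) r₀, |S.G x - S.G y| ≤ C * ‖x - y‖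
  γ_zero : γ 0 ∈ S.O0
  γ_pos : ∀ t > 0, γ t ∈ S.Op
  γ_tendsto : Tendsto γ atTop (𝓝 0)
  γ_K : ∀ t, 0 ≤ t → γ t ∈ K
  γ_cont : Continuous γ
  γ_deriv : ∀ t > 0, HasDerivAt γ (F 0 t (γ t)) t

namespace SaddleModel
variable {S : PSSystem} {γ : ℝ → Plane} (M : SaddleModel S γ)

/-- A global solution of the extended field. -/
def Sol (ε : ℝ) (x : ℝ → Plane) : Prop := ∀ t, HasDerivAt x (M.F ε t (x t)) t

/-- A solution of the extended field on `[τ, ∞)`. -/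
structure Traj (ε τ : ℝ) (x : ℝ → Plane) : Prop where
  cont : ContinuousOn x (Ici τ)
  deriv : ∀ t > τ, HasDerivAt x (M.F ε t (x t)) t

/-- The cone around the stable direction. -/
def Z : Set Plane := {x | x ∈ S.Dp ∧ x ∈ Metric.ball (0 : Plane) M.r ∧ 0 < M.V x ∧
  |M.U x| ≤ 2 * M.V x}

variable {M}

theorem C_pos : 0 < M.C := zero_lt_one.trans_le M.one_le_C

theorem zero_mem_Icc : (0 : ℝ) ∈ Icc 0 M.ε₁ := ⟨le_rfl, M.ε₁_pos.le⟩

theorem Sol.continuous {ε : ℝ} {x : ℝ → Plane} (h : M.Sol ε x) : Continuous x :=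
  continuous_iff_continuousAt.2 fun t => (h t).continuousAt

theorem Sol.traj {ε : ℝ} {x : ℝ → Plane} (h : M.Sol ε x) (τ : ℝ) : M.Traj ε τ x :=
  ⟨h.continuous.continuousOn, fun t _ => h t⟩

theorem Traj.mono {ε τ τ' : ℝ} {x : ℝ → Plane} (h : M.Traj ε τ x) (hτ : τ ≤ τ') :
    M.Traj ε τ' x :=
  ⟨h.cont.mono (Ici_subset_Ici.2 hτ), fun t ht => h.deriv t (hτ.trans_lt ht)⟩

theorem Traj.contIcc {ε τ s t : ℝ} {x : ℝ → Plane} (h : M.Traj ε τ x) (hs : τ ≤ s) :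
    ContinuousOn x (Icc s t) := h.cont.mono fun _ hu => hs.trans hu.1

theorem exists_sol {ε : ℝ} (hε : ε ∈ Icc 0 M.ε₁) (t₀ : ℝ) (x₀ : Plane) :
    ∃ x, M.Sol ε x ∧ x t₀ = x₀ := by
  obtain ⟨x, h1, h2⟩ := exists_global_solution (M.F_lip ε hε) (M.F_cont ε hε) (M.F_bdd ε hε) t₀ x₀
  exact ⟨x, h2, h1⟩

theorem Op_isOpen (M : SaddleModel S γ) : IsOpen S.Op := by
  have : ContinuousOn S.G S.Ω := fun x hx => (M.G_diff x hx).continuousAt.continuousWithinAt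
  exact this.isOpen_inter_preimage M.isOpen_Ω isOpen_Ioi

theorem Traj.norm_sub_le {ε τ s t : ℝ} {x : ℝ → Plane} (hx : M.Traj ε τ x)
    (hε : ε ∈ Icc 0 M.ε₁) (hs : τ ≤ s) (hst : s ≤ t) : ‖x t - x s‖ ≤ M.C * (t - s) :=
  norm_sub_le_of_hasDerivAt hst (hx.contIcc hs)
    fun u hu => ⟨_, hx.deriv u (hs.trans_lt hu.1), M.F_bdd ε hε _ _⟩

/-- Grönwall estimate between a trajectory and an approximate trajectory. -/
theorem norm_sub_le_exp {ε e s t : ℝ} {x y y' : ℝ → Plane} (hε : ε ∈ Icc 0 M.ε₁) (he : 0 ≤ e)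
    (hx : ContinuousOn x (Icc s t)) (hx' : ∀ u ∈ Ioo s t, HasDerivAt x (M.F ε u (x u)) u)
    (hy : ContinuousOn y (Icc s t)) (hy' : ∀ u ∈ Ioo s t, HasDerivAt y (y' u) u)
    (hye : ∀ u ∈ Ioo s t, ‖M.F ε u (y u) - y' u‖ ≤ e) {u v : ℝ} (hu : u ∈ Icc s t)
    (hv : v ∈ Icc s t) :
    ‖x u - y u‖ ≤ (‖x v - y v‖ + e) * Real.exp ((M.L + 1) * |u - v|) := by
  refine norm_le_exp_of_hasDerivAt (f := fun u => x u - y u) M.L.2 he (hx.sub hy) ?_ hu hv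
  intro w hw
  refine ⟨_, (hx' w hw).sub (hy' w hw), ?_⟩
  have h1 := (M.F_lip ε hε w).dist_le_mul (x w) (y w)
  rw [dist_eq_norm, dist_eq_norm] at h1
  calc ‖M.F ε w (x w) - y' w‖
      = ‖(M.F ε w (x w) - M.F ε w (y w)) + (M.F ε w (y w) - y' w)‖ := by congr 1; abel
    _ ≤ _ := (norm_add_le _ _).trans (add_le_add h1 (hye w hw))

theorem Sol.norm_sub_le {ε : ℝ} {x y : ℝ → Plane} (hx : M.Sol ε x) (hy : M.Sol ε y)
    (hε : ε ∈ Icc 0 M.ε₁) (u v : ℝ) :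
    ‖x u - y u‖ ≤ ‖x v - y v‖ * Real.exp ((M.L + 1) * |u - v|) := by
  have := norm_sub_le_exp (s := min u v) (t := max u v) hε le_rfl hx.continuous.continuousOn
    (fun u _ => hx u) hy.continuous.continuousOn (fun u _ => hy u) (by simp)
    (u := u) (v := v) ⟨min_le_left _ _, le_max_left _ _⟩ ⟨min_le_right _ _, le_max_right _ _⟩
  simpa using this

/-! ### Near the saddle -/

/-- The second curve need only be an approximate solution: this allows comparison with `γ`, which
solves the unperturbed equation, and with time shifts of solutions of the nonautonomous equation. -/
theorem saddleIneq {ε e s t : ℝ} {x y y' : ℝ → Plane} (hε : ε ∈ Icc 0 M.ε₁)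
    (hx : ContinuousOn x (Icc s t)) (hx' : ∀ u ∈ Ioo s t, HasDerivAt x (M.F ε u (x u)) u)
    (hy : ContinuousOn y (Icc s t)) (hy' : ∀ u ∈ Ioo s t, HasDerivAt y (y' u) u)
    (hye : ∀ u ∈ Ioo s t, ‖M.F ε u (y u) - y' u‖ ≤ e)
    (hxD : ∀ u ∈ Ioo s t, x u ∈ S.Dp ∧ x u ∈ Metric.ball (0 : Plane) M.r)
    (hyD : ∀ u ∈ Ioo s t, y u ∈ S.Dp ∧ y u ∈ Metric.ball (0 : Plane) M.r) :
    SaddleIneq M.a M.b M.η (M.C * e) s t (fun u => M.U (x u - y u)) (fun u => M.V (x u - y u)) := by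
  refine ⟨M.U.continuous.comp_continuousOn (hx.sub hy), M.V.continuous.comp_continuousOn (hx.sub hy),
    fun u hu => ⟨_, _, M.U.hasFDerivAt.comp_hasDerivAt u ((hx' u hu).sub (hy' u hu)),
      M.V.hasFDerivAt.comp_hasDerivAt u ((hx' u hu).sub (hy' u hu)), ?_, ?_⟩⟩
  · have h1 := M.saddle_U ε hε u _ (hxD u hu).2 _ (hyD u hu).2 (hxD u hu).1 (hyD u hu).1
    have h2 := (M.U_le (M.F ε u (y u) - y' u)).trans
      (mul_le_mul_of_nonneg_left (hye u hu) C_pos.le)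
    have h3 : M.U (M.F ε u (x u) - y' u) - M.b * M.U (x u - y u) =
      (M.U (M.F ε u (x u) - M.F ε u (y u)) - M.b * M.U (x u - y u)) +
        M.U (M.F ε u (y u) - y' u) := by simp only [map_sub]; ring
    rw [h3]
    exact (abs_add_le _ _).trans (add_le_add h1 h2)
  · have h1 := M.saddle_V ε hε u _ (hxD u hu).2 _ (hyD u hu).2 (hxD u hu).1 (hyD u hu).1
    have h2 := (M.V_le (M.F ε u (y u) - y' u)).trans
      (mul_le_mul_of_nonneg_left (hye u hu) C_pos.le)
    have h3 : M.V (M.F ε u (x u) - y' u) + M.a * M.V (x u - y u) =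
      (M.V (M.F ε u (x u) - M.F ε u (y u)) + M.a * M.V (x u - y u)) +
        M.V (M.F ε u (y u) - y' u) := by simp only [map_sub]; ring
    rw [h3]
    exact (abs_add_le _ _).trans (add_le_add h1 h2)

theorem zero_mem_Dp (M : SaddleModel S γ) : (0 : Plane) ∈ S.Dp := Or.inr M.zero_mem

theorem saddleIneq_zero {ε s t : ℝ} {x : ℝ → Plane} (hε : ε ∈ Icc 0 M.ε₁)
    (hx : ContinuousOn x (Icc s t)) (hx' : ∀ u ∈ Ioo s t, HasDerivAt x (M.F ε u (x u)) u)
    (hxD : ∀ u ∈ Ioo s t, x u ∈ S.Dp ∧ x u ∈ Metric.ball (0 : Plane) M.r) :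
    SaddleIneq M.a M.b M.η 0 s t (fun u => M.U (x u)) (fun u => M.V (x u)) := by
  have := saddleIneq (y := fun _ => 0) (y' := fun _ => 0) (e := 0) hε hx hx' continuousOn_const
    (fun u _ => hasDerivAt_const u _) (fun u _ => by rw [M.F_zero ε hε]; simp) hxD
    (fun u _ => ⟨M.zero_mem_Dp, Metric.mem_ball_self M.r_pos⟩)
  simpa using this

theorem saddleIneq_pair {ε s t : ℝ} {x y : ℝ → Plane} (hε : ε ∈ Icc 0 M.ε₁)
    (hx : ContinuousOn x (Icc s t)) (hx' : ∀ u ∈ Ioo s t, HasDerivAt x (M.F ε u (x u)) u)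
    (hy : ContinuousOn y (Icc s t)) (hy' : ∀ u ∈ Ioo s t, HasDerivAt y (M.F ε u (y u)) u)
    (hxD : ∀ u ∈ Ioo s t, x u ∈ S.Dp ∧ x u ∈ Metric.ball (0 : Plane) M.r)
    (hyD : ∀ u ∈ Ioo s t, y u ∈ S.Dp ∧ y u ∈ Metric.ball (0 : Plane) M.r) :
    SaddleIneq M.a M.b M.η 0 s t (fun u => M.U (x u - y u)) (fun u => M.V (x u - y u)) := by
  have := saddleIneq (e := 0) hε hx hx' hy hy' (by simp) hxD hyD
  simpa using this

theorem norm_le_of_mem_Z {x : Plane} (hx : x ∈ M.Z) : ‖x‖ ≤ 3 * M.C * M.V x := by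
  have h := M.norm_le x
  have h1 := hx.2.2.2
  have h2 := hx.2.2.1
  rw [abs_of_pos h2] at h
  nlinarith [C_pos (M := M)]

/-- Both rates are needed: the upper bound measures how small the orbit becomes, the lower one
bounds from below the time it takes to become small. -/
theorem V_contract {ε s t : ℝ} {x : ℝ → Plane} (hε : ε ∈ Icc 0 M.ε₁)
    (hx : ContinuousOn x (Icc s t)) (hx' : ∀ u ∈ Ioo s t, HasDerivAt x (M.F ε u (x u)) u)
    (hZ : ∀ u ∈ Icc s t, x u ∈ M.Z) (hst : s ≤ t) :
    M.V (x t) ≤ M.V (x s) * Real.exp (-((M.a - 3 * M.η) * (t - s))) ∧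
    M.V (x s) * Real.exp (-((M.a + 3 * M.η) * (t - s))) ≤ M.V (x t) := by
  have h := saddleIneq_zero hε hx hx' fun u hu =>
    ⟨(hZ u (Ioo_subset_Icc_self hu)).1, (hZ u (Ioo_subset_Icc_self hu)).2.1⟩
  have hcone : ∀ u ∈ Ioo s t, |M.U (x u)| ≤ 2 * |M.V (x u)| := fun u hu => by
    have := hZ u (Ioo_subset_Icc_self hu)
    rw [abs_of_pos this.2.2.1]; exact this.2.2.2
  have h1 := h.contract M.η_pos.le hst hcone
  have h2 := h.contract_ge M.η_pos.le hst hcone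
  rw [abs_of_pos (hZ s ⟨le_rfl, hst⟩).2.2.1, abs_of_pos (hZ t ⟨hst, le_rfl⟩).2.2.1] at h1 h2
  exact ⟨h1, h2⟩

theorem G_nonneg_of_mem_Dp {x : Plane} (hx : x ∈ S.Dp) : 0 ≤ S.G x := by
  rcases hx with h | h
  · exact h.2.le
  · exact h.2.ge

theorem ball_sub_Ω : Metric.ball (0 : Plane) M.r ⊆ S.Ω := M.ball_sub.trans M.K_sub

/-- In the cone `|U| < 3/4 V` the function `G` is positive. -/
theorem mem_Op_of_cone {x : Plane} (hx : x ∈ Metric.ball (0 : Plane) M.r) (hV : 0 < M.V x)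
    (hU : -(3 / 4 * M.V x) ≤ M.U x) : x ∈ S.Op := by
  refine ⟨ball_sub_Ω hx, ?_⟩
  have h := abs_le.1 (M.G_near x hx)
  have h1 := M.η_le
  rw [abs_of_pos hV] at h
  rcases le_total 0 (M.U x) with h0 | h0
  · rw [abs_of_nonneg h0] at h
    nlinarith
  · rw [abs_of_nonpos h0] at h
    nlinarith

/-- In this double cone `G ≈ U + V` has the sign of `V`, so membership in `Ω⁺` selects the half with
`V > 0`. -/
theorem V_pos_of_Dp_cone {x : Plane} (hx : x ∈ Metric.ball (0 : Plane) M.r) (hxD : x ∈ S.Op)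
    (hU : |M.U x| ≤ 3 / 4 * |M.V x|) : 0 < M.V x := by
  by_contra hV
  push Not at hV
  have h := abs_le.1 (M.G_near x hx)
  have h1 := M.η_le
  have h2 := hxD.2
  have h3 := le_abs_self (M.U x)
  have h4 := M.η_pos
  rw [abs_of_nonpos hV] at h hU
  nlinarith [abs_nonneg (M.U x)]

/-- A trajectory in `Ω⁺` close to the saddle and converging to it is close to the stable
direction. -/
theorem cone_of_tendsto {ε τ : ℝ} {x : ℝ → Plane} (hε : ε ∈ Icc 0 M.ε₁) (hx : M.Traj ε τ x)
    (hxb : ∀ t ≥ τ, x t ∈ Metric.ball (0 : Plane) M.r) (hxO : ∀ t ≥ τ, x t ∈ S.Op)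
    (h0 : Tendsto x atTop (𝓝 0)) :
    ∀ t ≥ τ, 0 < M.V (x t) ∧ |M.U (x t)| ≤ 1 / 4 * M.V (x t) := by
  intro t ht
  have hU0 : Tendsto (fun t => M.U (x t)) atTop (𝓝 0) := by
    have := (M.U.continuous.tendsto 0).comp h0
    rwa [map_zero] at this
  have hV0 : Tendsto (fun t => M.V (x t)) atTop (𝓝 0) := by
    have := (M.V.continuous.tendsto 0).comp h0
    rwa [map_zero] at this
  have hW0 : Tendsto (fun t => M.U (x t) ^ 2 - 1 / 16 * M.V (x t) ^ 2) atTop (𝓝 0) := by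
    have := (hU0.pow 2).sub ((hV0.pow 2).const_mul (1 / 16))
    simpa using this
  -- The form `U² - V² / 16` increases along the orbit and tends to `0`, hence it is nonpositive
  -- throughout.
  have hmono : ∀ u ≥ t, M.U (x t) ^ 2 - 1 / 16 * M.V (x t) ^ 2 ≤
      M.U (x u) ^ 2 - 1 / 16 * M.V (x u) ^ 2 := by
    intro u hu
    have := saddleIneq_zero (s := t) (t := u) hε (hx.contIcc ht)
      (fun v hv => hx.deriv v (lt_of_le_of_lt ht hv.1))
      (fun v hv => ⟨Or.inl (hxO v (ht.le.trans hv.1.le)), hxb v (ht.le.trans hv.1.le)⟩)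
    exact this.sq_sub_le M.η_pos.le M.η_le_a M.η_le_b hu (by norm_num) (by norm_num)
  have hW : M.U (x t) ^ 2 - 1 / 16 * M.V (x t) ^ 2 ≤ 0 :=
    ge_of_tendsto hW0 ((eventually_ge_atTop t).mono hmono)
  have h1 : |M.U (x t)| ≤ |1 / 4 * M.V (x t)| := by
    refine sq_le_sq.1 ?_
    nlinarith
  rw [abs_mul, abs_of_pos (by norm_num : (0 : ℝ) < 1 / 4)] at h1
  have h2 := V_pos_of_Dp_cone (hxb t ht) (hxO t ht) (by linarith [abs_nonneg (M.V (x t))])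
  rw [abs_of_pos h2] at h1
  exact ⟨h2, h1⟩

/-- For `ε = 0` the bound `F_shift` says that the extended field is autonomous on the relevant set,
so translates of `γ` are trajectories. -/
theorem γ_traj (M : SaddleModel S γ) (τ : ℝ) : M.Traj 0 τ (fun t => γ (t - τ)) := by
  refine ⟨(M.γ_cont.comp (by fun_prop)).continuousOn, fun t ht => ?_⟩
  have h1 := (M.γ_deriv (t - τ) (by linarith)).comp_sub_const t τ
  have h2 := M.F_shift 0 zero_mem_Icc (t - τ) t (γ (t - τ)) (M.γ_K _ (by linarith))
    (Or.inl (M.γ_pos _ (by linarith)))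
  rw [mul_zero, zero_mul, norm_le_zero_iff, sub_eq_zero] at h2
  rwa [h2] at h1

theorem γ_mem_Dp (M : SaddleModel S γ) {t : ℝ} (ht : 0 ≤ t) : γ t ∈ S.Dp := by
  rcases ht.eq_or_lt with h | h
  · rw [← h]; exact Or.inr M.γ_zero
  · exact Or.inl (M.γ_pos t h)

theorem exists_γ_cone (M : SaddleModel S γ) {ρ : ℝ} (hρ : 0 < ρ) :
    ∃ T > 0, ∀ t ≥ T, γ t ∈ Metric.ball (0 : Plane) M.r ∧ ‖γ t‖ < ρ ∧ 0 < M.V (γ t) ∧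
      |M.U (γ t)| ≤ 1 / 4 * M.V (γ t) := by
  obtain ⟨T, hT⟩ := eventually_atTop.1 ((M.γ_tendsto.eventually (Metric.ball_mem_nhds 0 M.r_pos)).and
    (M.γ_tendsto.eventually (Metric.ball_mem_nhds 0 hρ)))
  refine ⟨max T 1, by positivity, fun t ht => ⟨(hT t ((le_max_left _ _).trans ht)).1, ?_, ?_⟩⟩
  · simpa using (hT t ((le_max_left _ _).trans ht)).2
  · have htr : M.Traj 0 (max T 1) γ := by
      have := (M.γ_traj 0).mono (le_trans zero_le_one (le_max_right T 1))
      simpa using this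
    exact cone_of_tendsto zero_mem_Icc htr
      (fun u hu => (hT u ((le_max_left _ _).trans hu)).1)
      (fun u hu => M.γ_pos u (lt_of_lt_of_le zero_lt_one ((le_max_right _ _).trans hu)))
      M.γ_tendsto t ht

theorem mem_Z_of_cone {x : Plane} (hx : x ∈ Metric.ball (0 : Plane) M.r) (hV : 0 < M.V x)
    (hU : |M.U x| ≤ 3 / 4 * M.V x) : x ∈ M.Z :=
  ⟨Or.inl (mem_Op_of_cone hx hV (by linarith [neg_abs_le (M.U x)])), hx, hV, by linarith⟩

/-! ### Tracking the homoclinic orbit -/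

theorem norm_sub_γ_le {ε τ T : ℝ} {x : ℝ → Plane} (hε : ε ∈ Icc 0 M.ε₁)
    (hx : M.Traj ε τ x) {s t : ℝ} (hs : s ∈ Icc 0 T) (ht : t ∈ Icc 0 T) :
    ‖x (τ + t) - γ t‖ ≤ (‖x (τ + s) - γ s‖ + M.C * ε) * Real.exp ((M.L + 1) * T) := by
  have hγ := M.γ_traj τ
  have h := norm_sub_le_exp (s := τ) (t := τ + T) (x := x) (y := fun t => γ (t - τ)) hε
    (mul_nonneg C_pos.le hε.1) (hx.contIcc le_rfl) (fun u hu => hx.deriv u hu.1)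
    (hγ.contIcc le_rfl) (fun u hu => hγ.deriv u hu.1)
    (fun u hu => M.F_var ε hε u _ (M.γ_K _ (by linarith [hu.1]))
      (M.γ_mem_Dp (by linarith [hu.1]))) (u := τ + t) (v := τ + s)
    ⟨by linarith [ht.1], by linarith [ht.2]⟩ ⟨by linarith [hs.1], by linarith [hs.2]⟩
  simp only [add_sub_cancel_left, add_sub_add_left_eq_sub] at h
  refine h.trans ?_
  have : |t - s| ≤ T := abs_le.2 ⟨by linarith [hs.2, ht.1], by linarith [hs.1, ht.2]⟩
  have h0 : 0 ≤ M.C * ε := mul_nonneg C_pos.le hε.1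
  gcongr

/-- `G` increases along trajectories near `γ 0`. -/
theorem G_increase {ε τ s t : ℝ} {x : ℝ → Plane} (hε : ε ∈ Icc 0 M.ε₁) (hx : M.Traj ε τ x)
    (hs : τ ≤ s) (hst : s ≤ t) (hb : ∀ u ∈ Icc s t, x u ∈ Metric.ball (γ 0) M.r₀) :
    S.G (x s) + M.c₀ * (t - s) ≤ S.G (x t) := by
  have hΩ : ∀ u ∈ Icc s t, x u ∈ S.Ω := fun u hu => M.K_sub (M.ball₀_sub (hb u hu))
  refine lt_of_forall_hasDerivAt_pos (f := fun u => S.G (x u)) hst ?_ ?_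
  · intro u hu
    exact (M.G_diff _ (hΩ u hu)).continuousAt.comp_continuousWithinAt (hx.contIcc hs u hu)
  · intro u hu
    have hu' := Ioo_subset_Icc_self hu
    exact ⟨_, (M.G_diff _ (hΩ u hu')).hasFDerivAt.comp_hasDerivAt u
      (hx.deriv u (hs.trans_lt hu.1)), M.cross ε hε u _ (hb u hu')⟩

theorem exists_near_zero (M : SaddleModel S γ) :
    ∃ t₁ > 0, ∀ t ∈ Icc 0 t₁, γ t ∈ Metric.ball (γ 0) (M.r₀ / 2) := by
  have h := M.γ_cont.continuousAt (x := 0) (Metric.ball_mem_nhds (γ 0) (half_pos M.r₀_pos))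
  obtain ⟨δ, hδ, h⟩ := Metric.mem_nhds_iff.1 h
  refine ⟨δ / 2, by linarith, fun t ht => h ?_⟩
  rw [Metric.mem_ball, Real.dist_eq, sub_zero, abs_of_nonneg ht.1]
  linarith [ht.2]

/-- Closeness to `γ` comes from Grönwall. Membership in `Ω⁺` has two sources: near `γ 0`, where `γ`
itself is close to `Ω⁰`, transversality makes `G` increase from `0`; later, a neighbourhood of the
compact arc `γ([t₁, T])` lies in `Ω⁺`. -/
theorem track_forward (M : SaddleModel S γ) {T : ℝ} (hT : 0 < T) :
    ∃ ρ > 0, ∃ B ≥ 1, ∀ ε ∈ Icc 0 M.ε₁, ε ≤ ρ → ∀ x τ, M.Traj ε τ x → x τ ∈ S.O0 →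
      ‖x τ - γ 0‖ ≤ ρ → (∀ t ∈ Ioc 0 T, x (τ + t) ∈ S.Op) ∧ ∀ t ∈ Icc 0 T, x (τ + t) ∈ M.K ∧
        ‖x (τ + t) - γ t‖ ≤ B * (‖x τ - γ 0‖ + ε) := by
  obtain ⟨t₁, ht₁, hγ₁⟩ := M.exists_near_zero
  have hcomp : IsCompact (γ '' Icc t₁ T) := isCompact_Icc.image M.γ_cont
  have hsub : γ '' Icc t₁ T ⊆ S.Op ∩ M.K := by
    rintro _ ⟨t, ht, rfl⟩
    exact ⟨M.γ_pos t (ht₁.trans_le ht.1), M.γ_K t (ht₁.le.trans ht.1)⟩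
  obtain ⟨ρ₁, hρ₁, hth⟩ := hcomp.exists_thickening_subset_open (M.Op_isOpen.inter M.isOpen_K) hsub
  set B := M.C * Real.exp ((M.L + 1) * T) with hB
  have hexp : 1 ≤ Real.exp ((M.L + 1) * T) := Real.one_le_exp (by positivity)
  have hB1 : 1 ≤ B := by
    rw [hB]; nlinarith [M.one_le_C]
  have hBpos : 0 < B := by linarith
  refine ⟨min ρ₁ (M.r₀ / 2) / (4 * B), by have := M.r₀_pos; positivity, B, hB1, ?_⟩
  intro ε hε hερ x τ hx hx0 hxρ
  have hρ' : B * (‖x τ - γ 0‖ + ε) ≤ min ρ₁ (M.r₀ / 2) / 2 := by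
    have h1 := (le_div_iff₀ (by positivity)).1 hερ
    have h2 := (le_div_iff₀ (by positivity)).1 hxρ
    nlinarith
  have hmin : 0 < min ρ₁ (M.r₀ / 2) := by have := M.r₀_pos; positivity
  have htrack : ∀ t ∈ Icc 0 T, ‖x (τ + t) - γ t‖ ≤ B * (‖x τ - γ 0‖ + ε) := by
    intro t ht
    have h := norm_sub_γ_le hε hx (s := 0) ⟨le_rfl, hT.le⟩ ht
    rw [add_zero] at h
    refine h.trans ?_
    rw [show B * (‖x τ - γ 0‖ + ε) = M.C * (‖x τ - γ 0‖ + ε) * Real.exp ((M.L + 1) * T) by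
      rw [hB]; ring]
    refine mul_le_mul_of_nonneg_right ?_ (Real.exp_pos _).le
    nlinarith [M.one_le_C, norm_nonneg (x τ - γ 0)]
  have hnear : ∀ t ∈ Icc 0 T, t ≤ t₁ → x (τ + t) ∈ Metric.ball (γ 0) M.r₀ := by
    intro t ht ht1
    have h1 := hγ₁ t ⟨ht.1, ht1⟩
    rw [Metric.mem_ball, dist_eq_norm] at h1 ⊢
    have h2 := htrack t ht
    have h3 : ‖x (τ + t) - γ 0‖ ≤ ‖x (τ + t) - γ t‖ + ‖γ t - γ 0‖ := by
      rw [show x (τ + t) - γ 0 = (x (τ + t) - γ t) + (γ t - γ 0) by abel]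
      exact norm_add_le _ _
    have h4 := min_le_right ρ₁ (M.r₀ / 2)
    have := M.r₀_pos
    linarith
  have hfar : ∀ t ∈ Icc 0 T, t₁ ≤ t → x (τ + t) ∈ S.Op ∩ M.K := by
    intro t ht ht1
    refine hth (Metric.mem_thickening_iff.2 ⟨γ t, ⟨t, ⟨ht1, ht.2⟩, rfl⟩, ?_⟩)
    rw [dist_eq_norm]
    have h2 := htrack t ht
    have h4 := min_le_left ρ₁ (M.r₀ / 2)
    linarith
  refine ⟨fun t ht => ?_, fun t ht => ⟨?_, htrack t ht⟩⟩
  · rcases le_total t t₁ with h | h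
    · have hb : ∀ u ∈ Icc τ (τ + t), x u ∈ Metric.ball (γ 0) M.r₀ := fun u hu => by
        have := hnear (u - τ) ⟨by linarith [hu.1], by linarith [hu.2, ht.2]⟩ (by linarith [hu.2])
        rwa [add_sub_cancel] at this
      have h1 := G_increase hε hx le_rfl (by linarith [ht.1]) hb
      refine ⟨M.K_sub (M.ball₀_sub (hb _ ⟨by linarith [ht.1], le_rfl⟩)), ?_⟩
      have h2 : S.G (x τ) = 0 := hx0.2
      have h3 := mul_pos M.c₀_pos ht.1
      rw [h2, add_sub_cancel_left] at h1
      linarith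
    · exact (hfar t ⟨ht.1.le, ht.2⟩ h).1
  · rcases le_total t t₁ with h | h
    · exact M.ball₀_sub (hnear t ht h)
    · exact (hfar t ht h).2

/-- Grönwall brings the orbit at time `t - T` within `A d` of `γ 0`, where `|G| ≤ C A d`. As `G`
increases there at rate at least `c₀`, it vanishes at some time within `C A d / c₀` of `t - T`. -/
theorem track_back (M : SaddleModel S γ) {T : ℝ} (hT : 0 < T) :
    ∃ ρ > 0, ∃ B ≥ 1, ∀ ε ∈ Icc 0 M.ε₁, ε ≤ ρ → ∀ x t, M.Sol ε x → ‖x t - γ T‖ ≤ ρ →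
      ∃ τ, |τ - (t - T)| ≤ B * (‖x t - γ T‖ + ε) ∧ x τ ∈ S.O0 ∧
        ‖x τ - γ 0‖ ≤ B * (‖x t - γ T‖ + ε) := by
  set A := M.C * Real.exp ((M.L + 1) * T) with hA
  have hexp : 1 ≤ Real.exp ((M.L + 1) * T) := Real.one_le_exp (by positivity)
  have hC := M.one_le_C
  have hCp := C_pos (M := M)
  have hc₀ := M.c₀_pos
  have hA1 : 1 ≤ A := by rw [hA]; nlinarith
  have hr₀ := M.r₀_pos
  set H := M.C / M.c₀ with hH
  have hHp : 0 < H := by positivity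
  set B := A * (1 + M.C * H) + A * H with hB
  have hCH : 0 < M.C * H := by positivity
  have hAH : 0 < A * H := by positivity
  have hB1 : 1 ≤ B := by rw [hB]; nlinarith
  refine ⟨M.r₀ / (4 * B), by positivity, B, hB1, ?_⟩
  intro ε hε hερ x t hx hxρ
  have hsum : B * (‖x t - γ T‖ + ε) ≤ M.r₀ / 2 := by
    have h1 := (le_div_iff₀ (by positivity)).1 hερ
    have h2 := (le_div_iff₀ (by positivity)).1 hxρ
    nlinarith
  set d := ‖x t - γ T‖ + ε with hd
  have hd0 : 0 ≤ d := add_nonneg (norm_nonneg _) hε.1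
  have hz : ‖x (t - T) - γ 0‖ ≤ A * d := by
    have h := norm_sub_γ_le hε (hx.traj (t - T)) (s := T) (t := 0) ⟨hT.le, le_rfl⟩
      ⟨le_rfl, hT.le⟩
    rw [add_zero, sub_add_cancel] at h
    refine h.trans ?_
    rw [show A * d = M.C * d * Real.exp ((M.L + 1) * T) by rw [hA]; ring]
    refine mul_le_mul_of_nonneg_right ?_ (Real.exp_pos _).le
    nlinarith [norm_nonneg (x t - γ T)]
  set h := H * (A * d) with hh
  have hh0 : 0 ≤ h := by positivity
  have hb : ∀ u ∈ Icc (t - T - h) (t - T + h), ‖x u - γ 0‖ ≤ A * d + M.C * h := by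
    intro u hu
    have h1 : ‖x u - x (t - T)‖ ≤ M.C * h := by
      rcases le_total u (t - T) with h2 | h2
      · rw [norm_sub_rev]
        refine ((hx.traj u).norm_sub_le hε le_rfl h2).trans ?_
        exact mul_le_mul_of_nonneg_left (by linarith [hu.1]) hCp.le
      · refine ((hx.traj (t - T)).norm_sub_le hε le_rfl h2).trans ?_
        exact mul_le_mul_of_nonneg_left (by linarith [hu.2]) hCp.le
    calc ‖x u - γ 0‖ = ‖(x u - x (t - T)) + (x (t - T) - γ 0)‖ := by congr 1; abel
      _ ≤ _ := (norm_add_le _ _).trans (by linarith)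
  have hbd : A * d + M.C * h ≤ B * d := by
    rw [hB, hh]
    have : 0 ≤ A * H * d := by positivity
    nlinarith
  have hhB : h ≤ B * d := by
    rw [hB, hh]
    have : 0 ≤ A * (1 + M.C * H) * d := by positivity
    nlinarith
  have hball : ∀ u ∈ Icc (t - T - h) (t - T + h), x u ∈ Metric.ball (γ 0) M.r₀ := by
    intro u hu
    rw [Metric.mem_ball, dist_eq_norm]
    linarith [hb u hu]
  have hGz : |S.G (x (t - T))| ≤ M.C * (A * d) := by
    have h1 := M.G_lip _ (hball (t - T) ⟨by linarith, by linarith⟩) _ (Metric.mem_ball_self hr₀)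
    have h2 : S.G (γ 0) = 0 := M.γ_zero.2
    rw [h2, sub_zero] at h1
    exact h1.trans (mul_le_mul_of_nonneg_left hz hCp.le)
  have hch : M.c₀ * h = M.C * (A * d) := by rw [hh, hH]; field_simp
  have hup : 0 ≤ S.G (x (t - T + h)) := by
    have := G_increase hε (hx.traj (t - T)) le_rfl (t := t - T + h) (by linarith)
      (fun u hu => hball u ⟨by linarith [hu.1], hu.2⟩)
    rw [add_sub_cancel_left, hch] at this
    linarith [neg_abs_le (S.G (x (t - T)))]
  have hlow : S.G (x (t - T - h)) ≤ 0 := by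
    have := G_increase hε (hx.traj (t - T - h)) le_rfl (t := t - T) (by linarith)
      (fun u hu => hball u ⟨hu.1, by linarith [hu.2]⟩)
    rw [sub_sub_cancel, hch] at this
    linarith [le_abs_self (S.G (x (t - T)))]
  have hcont : ContinuousOn (fun u => S.G (x u)) (Icc (t - T - h) (t - T + h)) := fun u hu =>
    ((M.G_diff _ (M.K_sub (M.ball₀_sub (hball u hu)))).continuousAt.comp
      hx.continuous.continuousAt).continuousWithinAt
  obtain ⟨τ, hτ, hG⟩ := intermediate_value_Icc (by linarith) hcont ⟨hlow, hup⟩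
  refine ⟨τ, ?_, ⟨M.K_sub (M.ball₀_sub (hball τ hτ)), hG⟩, (hb τ hτ).trans hbd⟩
  exact (abs_le.2 ⟨by linarith [hτ.1], by linarith [hτ.2]⟩).trans hhB

end SaddleModel

/-! ### Orbits in the stable cone: backward continuation and exit -/

theorem nonneg_left_of_Ioo {f : ℝ → ℝ} {u t : ℝ} (hut : u < t) (hf : ContinuousWithinAt f (Ioi u) u)
    (h : ∀ v ∈ Ioo u t, 0 ≤ f v) : 0 ≤ f u :=
  ge_of_tendsto hf (mem_of_superset (Ioo_mem_nhdsGT hut) h)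

theorem nonneg_right_of_Ioo {f : ℝ → ℝ} {u t : ℝ} (hut : u < t)
    (hf : ContinuousWithinAt f (Iio t) t) (h : ∀ v ∈ Ioo u t, 0 ≤ f v) : 0 ≤ f t :=
  ge_of_tendsto hf (mem_of_superset (Ioo_mem_nhdsLT hut) h)

/-- With `g = G ∘ x` this covers the end point on `Ω⁰`: a negative derivative at a zero of `g` shows
that the orbit comes from `Ω⁺`. -/
theorem eventually_pos_left {g : ℝ → ℝ} {d t : ℝ} (hg : HasDerivAt g d t) (h0 : 0 ≤ g t)
    (hd : g t = 0 → d < 0) : ∀ᶠ s in 𝓝[<] t, 0 < g s := by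
  rcases h0.eq_or_lt with h | h
  · have h1 := hasDerivAt_iff_tendsto_slope.1 hg
    have h2 : Tendsto (slope g t) (𝓝[<] t) (𝓝 d) :=
      h1.mono_left (nhdsWithin_mono t fun s (hs : s < t) => hs.ne)
    filter_upwards [h2.eventually_lt_const (hd h.symm), self_mem_nhdsWithin] with s hs hst
    rw [slope_def_field, ← h, sub_zero] at hs
    have hst' : s - t < 0 := sub_neg.2 hst
    by_contra hcon
    exact absurd hs (not_lt.2 (div_nonneg_of_nonpos (not_lt.1 hcon) hst'.le))
  · exact (hg.continuousAt.eventually_const_lt h).filter_mono nhdsWithin_le_nhds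

namespace SaddleModel
variable {S : PSSystem} {γ : ℝ → Plane} {M : SaddleModel S γ}

theorem mem_Dp_iff {x : Plane} (hx : x ∈ S.Ω) : x ∈ S.Dp ↔ 0 ≤ S.G x := by
  constructor
  · exact G_nonneg_of_mem_Dp
  · intro h
    rcases h.eq_or_lt with h | h
    · exact Or.inr ⟨hx, h.symm⟩
    · exact Or.inl ⟨hx, h⟩

theorem hasDerivAt_G {x : ℝ → Plane} {v : Plane} {t : ℝ} (M : SaddleModel S γ) (hx : HasDerivAt x v t)
    (hΩ : x t ∈ S.Ω) : HasDerivAt (fun u => S.G (x u)) (fderiv ℝ S.G (x t) v) t :=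
  (M.G_diff _ hΩ).hasFDerivAt.comp_hasDerivAt t hx

/-- To first order the derivative of `G` along the flow is `b U - a V` while `b G` is `b U + b V`;
the difference `-(a + b) V` is negative in the cone and dominates the errors. -/
theorem G_deriv_lt {ε t : ℝ} {x : Plane} (hε : ε ∈ Icc 0 M.ε₁) (hx : x ∈ M.Z) :
    fderiv ℝ S.G x (M.F ε t x) < M.b * S.G x := by
  obtain ⟨hD, hb, hV, hU⟩ := hx
  have h1 := (abs_le.1 (M.G_flow ε hε t x hb hD)).2
  have h2 := (abs_le.1 (M.G_near x hb)).1
  rw [abs_of_pos hV] at h1 h2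
  have h3 : M.η * (|M.U x| + M.V x) ≤ M.η * (3 * M.V x) :=
    mul_le_mul_of_nonneg_left (by linarith) M.η_pos.le
  have h4 : M.b * M.U x ≤ M.b * (S.G x - M.V x + M.η * (3 * M.V x)) :=
    mul_le_mul_of_nonneg_left (by linarith) M.b_pos.le
  have h5 : 100 * M.η * M.V x ≤ M.a * M.V x := mul_le_mul_of_nonneg_right M.η_le_a hV.le
  have h6 : 100 * M.η * (M.b * M.V x) ≤ 1 * (M.b * M.V x) :=
    mul_le_mul_of_nonneg_right M.η_le (mul_pos M.b_pos hV).le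
  have h7 := mul_pos M.b_pos hV
  have h8 := mul_pos M.a_pos hV
  nlinarith

/-- `G e^{-b u}` decreases strictly in the cone. Consequently `G ≥ 0` at the end forces `G > 0`
before: an orbit in the cone can meet `Ω⁰` only at its last time. -/
theorem G_decrease {ε s t : ℝ} {x : ℝ → Plane} (hε : ε ∈ Icc 0 M.ε₁) (hst : s < t)
    (hx : ContinuousOn x (Icc s t)) (hx' : ∀ u ∈ Ioo s t, HasDerivAt x (M.F ε u (x u)) u)
    (hZ : ∀ u ∈ Icc s t, x u ∈ M.Z) :
    S.G (x t) < S.G (x s) * Real.exp (M.b * (t - s)) := by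
  have hΩ : ∀ u ∈ Icc s t, x u ∈ S.Ω := fun u hu => ball_sub_Ω (hZ u hu).2.1
  have hd : ∀ u ∈ Ioo s t, HasDerivAt (fun u => S.G (x u) * Real.exp (-(M.b * (u - s))))
      ((fderiv ℝ S.G (x u) (M.F ε u (x u)) - M.b * S.G (x u)) * Real.exp (-(M.b * (u - s)))) u := by
    intro u hu
    have h1 : HasDerivAt (fun u : ℝ => Real.exp (-(M.b * (u - s))))
        (Real.exp (-(M.b * (u - s))) * (-(M.b * 1))) u :=
      ((((hasDerivAt_id u).sub_const s).const_mul M.b).neg).exp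
    have h2 := (M.hasDerivAt_G (hx' u hu) (hΩ u (Ioo_subset_Icc_self hu))).mul h1
    exact h2.congr_deriv (by ring)
  have h : StrictAntiOn (fun u => S.G (x u) * Real.exp (-(M.b * (u - s)))) (Icc s t) := by
    refine strictAntiOn_of_deriv_neg (convex_Icc s t) ?_ ?_
    · refine ContinuousOn.mul (fun u hu => ?_) (by fun_prop)
      exact (M.G_diff _ (hΩ u hu)).continuousAt.comp_continuousWithinAt (hx u hu)
    · intro u hu
      rw [interior_Icc] at hu
      rw [(hd u hu).deriv]
      exact mul_neg_of_neg_of_pos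
        (sub_neg.2 (G_deriv_lt hε (hZ u (Ioo_subset_Icc_self hu)))) (Real.exp_pos _)
  have := h ⟨le_rfl, hst.le⟩ ⟨hst.le, le_rfl⟩ hst
  simp only [sub_self, mul_zero, neg_zero, Real.exp_zero, mul_one, Real.exp_neg] at this
  rwa [← div_eq_mul_inv, div_lt_iff₀ (Real.exp_pos _)] at this

theorem norm_le_of_cone {x : Plane} {k : ℝ} (hV : 0 ≤ M.V x) (hU : |M.U x| ≤ k * M.V x) :
    ‖x‖ ≤ (k + 1) * M.C * M.V x := by
  have h := M.norm_le x
  rw [abs_of_nonneg hV] at h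
  nlinarith [C_pos (M := M)]

/-- The part of the half domain in which orbits are followed backward. -/
def backRegion (M : SaddleModel S γ) (s₀ : ℝ) : Set Plane :=
  {x | x ∈ Metric.ball (0 : Plane) M.r ∧ x ∈ S.Op ∧ 0 < M.V x ∧ M.V x < s₀ ∧ |M.U x| < 3 * M.V x}

theorem isOpen_backRegion (M : SaddleModel S γ) (s₀ : ℝ) : IsOpen (M.backRegion s₀) := by
  refine Metric.isOpen_ball.inter (M.Op_isOpen.inter ?_)
  refine (isOpen_lt continuous_const M.V.continuous).inter
    ((isOpen_lt M.V.continuous continuous_const).inter ?_)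
  exact isOpen_lt M.U.continuous.abs (continuous_const.mul M.V.continuous)

/-- A bootstrap. Since `U² - 4 V²` increases with time and is nonpositive at `t`, the bound `|U| ≤ 2
V` holds at all earlier times, strictly inside the region `|U| < 3 V`. The coordinate `V` cannot
vanish, because the orbit would then be the equilibrium. Going backward, the region can thus be left
only through `V = s₀`. -/
theorem mem_Z_of_backRegion {ε s₀ u t : ℝ} {x : ℝ → Plane} (hε : ε ∈ Icc 0 M.ε₁) (hx : M.Sol ε x)
    (ht : x t ∈ M.Z) (hs₀ : 4 * M.C * s₀ < M.r)
    (hO : ∀ v ∈ Ioo u t, x v ∈ M.backRegion s₀) : ∀ v ∈ Ico u t, x v ∈ M.Z ∧ M.V (x v) ≤ s₀ := by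
  have hcV : Continuous fun v => M.V (x v) := M.V.continuous.comp hx.continuous
  have hcU : Continuous fun v => M.U (x v) := M.U.continuous.comp hx.continuous
  intro v hv
  have hI := saddleIneq_zero (s := v) (t := t) hε hx.continuous.continuousOn (fun w _ => hx w)
    (fun w hw => ⟨Or.inl (hO w ⟨hv.1.trans_lt hw.1, hw.2⟩).2.1,
      (hO w ⟨hv.1.trans_lt hw.1, hw.2⟩).1⟩)
  have hle : ∀ w ∈ Ioo v t, 0 ≤ M.V (x w) ∧ 0 ≤ s₀ - M.V (x w) := fun w hw => by
    have := hO w ⟨hv.1.trans_lt hw.1, hw.2⟩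
    exact ⟨this.2.2.1.le, by linarith [this.2.2.2.1]⟩
  have hV0 : 0 ≤ M.V (x v) :=
    nonneg_left_of_Ioo hv.2 hcV.continuousWithinAt fun w hw => (hle w hw).1
  have hVs : 0 ≤ s₀ - M.V (x v) :=
    nonneg_left_of_Ioo (f := fun w => s₀ - M.V (x w)) hv.2
      (continuous_const.sub hcV).continuousWithinAt fun w hw => (hle w hw).2
  have hU : |M.U (x v)| ≤ 2 * M.V (x v) := by
    have h1 := hI.sq_sub_le M.η_pos.le M.η_le_a M.η_le_b hv.2.le (q := 4) (by norm_num)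
      (by norm_num)
    have h2 : M.U (x t) ^ 2 ≤ (2 * M.V (x t)) ^ 2 := by
      rw [← sq_abs (M.U (x t))]
      exact pow_le_pow_left₀ (abs_nonneg _) ht.2.2.2 2
    have h3 : |M.U (x v)| ≤ |2 * M.V (x v)| := sq_le_sq.1 (by nlinarith)
    rwa [abs_of_nonneg (by linarith : 0 ≤ 2 * M.V (x v))] at h3
  have hnorm := norm_le_of_cone hV0 hU
  have hball : x v ∈ Metric.ball (0 : Plane) M.r := by
    rw [mem_ball_zero_iff]
    have : M.C * M.V (x v) ≤ M.C * s₀ := mul_le_mul_of_nonneg_left (by linarith) C_pos.le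
    have : 0 ≤ M.C * M.V (x v) := mul_nonneg C_pos.le hV0
    nlinarith
  have hVpos : 0 < M.V (x v) := by
    refine hV0.lt_of_ne fun h0 => ?_
    have h0' : x v = 0 := by
      rw [← h0, mul_zero] at hnorm
      exact norm_le_zero_iff.1 hnorm
    obtain ⟨y, hy, -⟩ := exists_sol hε v (0 : Plane)
    have hzero : M.Sol ε (fun _ => 0) := fun w => by
      rw [M.F_zero ε hε]; exact hasDerivAt_const w _
    have h5 := hx.norm_sub_le hzero hε t v
    rw [h0'] at h5
    simp only [sub_zero, norm_zero, zero_mul, norm_le_zero_iff] at h5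
    have := ht.2.2.1
    rw [h5, map_zero] at this
    exact this.false
  refine ⟨⟨(mem_Dp_iff (ball_sub_Ω hball)).2 ?_, hball, hVpos, hU⟩, by linarith⟩
  refine nonneg_left_of_Ioo (f := fun w => S.G (x w)) hv.2 ?_
    fun w hw => (hO w ⟨hv.1.trans_lt hw.1, hw.2⟩).2.1.2.le
  exact ((M.G_diff _ (ball_sub_Ω hball)).continuousAt.comp
    hx.continuous.continuousAt).continuousWithinAt

/-- Backward in time, orbits in the cone reach the level `V = s₀`. -/
theorem back_to_level {ε s₀ t : ℝ} {x : ℝ → Plane} (hε : ε ∈ Icc 0 M.ε₁) (hx : M.Sol ε x)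
    (ht : x t ∈ M.Z) (hts : M.V (x t) < s₀) (hs₀ : 4 * M.C * s₀ < M.r) :
    ∃ u < t, M.V (x u) = s₀ ∧ (∀ v ∈ Icc u t, x v ∈ M.Z) ∧ ∀ v ∈ Ico u t, x v ∈ S.Op := by
  have hcV : Continuous fun v => M.V (x v) := M.V.continuous.comp hx.continuous
  have hcU : Continuous fun v => M.U (x v) := M.U.continuous.comp hx.continuous
  have hΩ : x t ∈ S.Ω := ball_sub_Ω ht.2.1
  have hev : ∀ᶠ v in 𝓝[<] t, x v ∈ M.backRegion s₀ := by
    have h1 : ∀ᶠ v in 𝓝 t, x v ∈ Metric.ball (0 : Plane) M.r :=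
      hx.continuous.continuousAt.eventually (Metric.isOpen_ball.mem_nhds ht.2.1)
    have h1' : ∀ᶠ v in 𝓝 t, x v ∈ S.Ω := hx.continuous.continuousAt.eventually
      (M.isOpen_Ω.mem_nhds hΩ)
    have h2 : ∀ᶠ v in 𝓝 t, 0 < M.V (x v) := hcV.continuousAt.eventually_const_lt ht.2.2.1
    have h3 : ∀ᶠ v in 𝓝 t, M.V (x v) < s₀ := hcV.continuousAt.eventually_lt_const hts
    have h4 : ∀ᶠ v in 𝓝 t, |M.U (x v)| < 3 * M.V (x v) :=
      hcU.abs.continuousAt.eventually_lt (hcV.const_mul 3).continuousAt (by linarith [ht.2.2.1, ht.2.2.2])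
    -- The end point may lie on `Ω⁰`; there the derivative of `G` is below `b G = 0`, so `G > 0`
    -- just before `t`.
    have h5 := eventually_pos_left (M.hasDerivAt_G (hx t) hΩ) (G_nonneg_of_mem_Dp ht.1)
      (fun h0 => by
        have := G_deriv_lt (t := t) hε ht
        rwa [h0, mul_zero] at this)
    filter_upwards [nhdsWithin_le_nhds h1, nhdsWithin_le_nhds h1', nhdsWithin_le_nhds h2,
      nhdsWithin_le_nhds h3, nhdsWithin_le_nhds h4, h5] with v a1 a1' a2 a3 a4 a5
    exact ⟨a1, ⟨a1', a5⟩, a2, a3, a4⟩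
  obtain ⟨t₃, ht₃, hI⟩ := (mem_nhdsLT_iff_exists_Ioo_subset).1 hev
  have ht₃ : t₃ < t := ht₃
  set t₄ := (t₃ + t) / 2 with ht₄
  have hI4 : ∀ v ∈ Ico t₄ t, x v ∈ M.backRegion s₀ := fun v hv => hI ⟨by linarith [hv.1], hv.2⟩
  have hrate : 0 < M.a - 3 * M.η := by linarith [M.η_le_a, M.η_pos]
  -- A time long enough for `V`, growing backward at rate `a - 3η`, to exceed `s₀`: `e^y > y` with
  -- `y = (a - 3η) N = s₀ / V(x t)`.
  set N := (s₀ / M.V (x t)) / (M.a - 3 * M.η) with hN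
  have hs₀p : 0 < s₀ := ht.2.2.1.trans hts
  have hN0 : 0 < N := div_pos (div_pos hs₀p ht.2.2.1) hrate
  have hexit : x (t₄ - N) ∉ M.backRegion s₀ ∨ ∃ w ∈ Icc (t₄ - N) t₄, x w ∉ M.backRegion s₀ := by
    by_contra hcon
    push Not at hcon
    have hall : ∀ v ∈ Ioo (t₄ - N) t, x v ∈ M.backRegion s₀ := fun v hv => by
      rcases le_total v t₄ with h | h
      · exact hcon.2 v ⟨hv.1.le, h⟩
      · exact hI4 v ⟨h, hv.2⟩
    have hlt : t₄ - N < t := by linarith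
    have hZ := mem_Z_of_backRegion hε hx ht hs₀ hall
    have hZ' : ∀ v ∈ Icc (t₄ - N) t, x v ∈ M.Z := fun v hv => by
      rcases hv.2.eq_or_lt with h | h
      · rwa [h]
      · exact (hZ v ⟨hv.1, h⟩).1
    have h1 := (V_contract hε hx.continuous.continuousOn (fun w _ => hx w) hZ' hlt.le).1
    have h2 := (hZ (t₄ - N) ⟨le_rfl, hlt⟩).2
    have h3 : s₀ / M.V (x t) < Real.exp ((M.a - 3 * M.η) * (t - (t₄ - N))) := by
      have h4 : (M.a - 3 * M.η) * N ≤ (M.a - 3 * M.η) * (t - (t₄ - N)) :=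
        mul_le_mul_of_nonneg_left (by linarith) hrate.le
      have h5 : (M.a - 3 * M.η) * N = s₀ / M.V (x t) := by rw [hN]; field_simp
      have := Real.add_one_le_exp ((M.a - 3 * M.η) * (t - (t₄ - N)))
      linarith
    rw [Real.exp_neg, ← div_eq_mul_inv, le_div_iff₀ (Real.exp_pos _)] at h1
    rw [div_lt_iff₀ ht.2.2.1] at h3
    linarith
  obtain ⟨w, hw, hwO⟩ : ∃ w ∈ Icc (t₄ - N) t₄, x w ∉ M.backRegion s₀ := by
    rcases hexit with h | h
    · exact ⟨_, ⟨le_rfl, by linarith⟩, h⟩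
    · exact h
  obtain ⟨u, -, hu2, hu3, hu4⟩ := exists_last_exit (M.isOpen_backRegion s₀)
    hx.continuous.continuousOn (hI4 t₄ ⟨le_rfl, by linarith⟩) hw.2 hwO
  have hut : u < t := by linarith
  have hall : ∀ v ∈ Ioo u t, x v ∈ M.backRegion s₀ := fun v hv => by
    rcases le_total v t₄ with h | h
    · exact hu4 v ⟨hv.1, h⟩
    · exact hI4 v ⟨h, hv.2⟩
  have hZ := mem_Z_of_backRegion hε hx ht hs₀ hall
  have hZ' : ∀ v ∈ Icc u t, x v ∈ M.Z := fun v hv => by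
    rcases hv.2.eq_or_lt with h | h
    · rwa [h]
    · exact (hZ v ⟨hv.1, h⟩).1
  have hOp : ∀ v ∈ Ico u t, x v ∈ S.Op := fun v hv => by
    refine ⟨ball_sub_Ω (hZ v hv).1.2.1, ?_⟩
    have h1 := G_decrease hε hv.2 hx.continuous.continuousOn (fun w _ => hx w)
      (fun w hw => hZ' w ⟨hv.1.trans hw.1, hw.2⟩)
    have h2 := G_nonneg_of_mem_Dp ht.1
    exact pos_of_mul_pos_left (h2.trans_lt h1) (Real.exp_pos _).le
  refine ⟨u, hut, ?_, hZ', hOp⟩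
  have hu := hZ u ⟨le_rfl, hut⟩
  refine le_antisymm hu.2 (not_lt.1 fun hlt => hu3 ⟨hu.1.2.1, hOp u ⟨le_rfl, hut⟩, hu.1.2.2.1,
    hlt, by linarith [hu.1.2.2.1, hu.1.2.2.2]⟩)

/-- An orbit that has left the cone around the stable direction on the side `U < 0` reaches
`Ω⁰`. -/
theorem exit_right {ε τ t : ℝ} {x : ℝ → Plane} (hε : ε ∈ Icc 0 M.ε₁) (hx : M.Traj ε τ x)
    (hτ : τ ≤ t) (hV : 0 < M.V (x t)) (hVr : 4 * M.C * M.V (x t) < M.r)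
    (hU : M.U (x t) < -(1 / 2 * M.V (x t))) (hU' : -(3 / 4 * M.V (x t)) ≤ M.U (x t)) :
    ∃ u > t, x u ∈ S.O0 ∧ (∀ v ∈ Icc t u, x v ∈ M.Z ∧ M.U (x v) < 0) ∧
      ∀ v ∈ Ico t u, x v ∈ S.Op := by
  have hcV : ContinuousOn (fun v => M.V (x v)) (Ici τ) := M.V.continuous.comp_continuousOn hx.cont
  have hcU : ContinuousOn (fun v => M.U (x v)) (Ici τ) := M.U.continuous.comp_continuousOn hx.cont
  set O : Set Plane := {y | y ∈ Metric.ball (0 : Plane) M.r ∧ y ∈ S.Op ∧ 0 < M.V y ∧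
    |M.U y| < 2 * M.V y} with hOdef
  have hOo : IsOpen O := by
    refine Metric.isOpen_ball.inter (M.Op_isOpen.inter ?_)
    exact (isOpen_lt continuous_const M.V.continuous).inter
      (isOpen_lt M.U.continuous.abs (continuous_const.mul M.V.continuous))
  have habs : |M.U (x t)| ≤ 3 / 4 * M.V (x t) := abs_le.2 ⟨by linarith, by linarith⟩
  have hball_of : ∀ y : Plane, 0 ≤ M.V y → M.V y ≤ M.V (x t) → |M.U y| ≤ 2 * M.V y →
      y ∈ Metric.ball (0 : Plane) M.r := by
    intro y h0 h1 h2
    rw [mem_ball_zero_iff]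
    have h3 := norm_le_of_cone h0 h2
    have : M.C * M.V y ≤ M.C * M.V (x t) := mul_le_mul_of_nonneg_left h1 C_pos.le
    have : 0 ≤ M.C * M.V y := mul_nonneg C_pos.le h0
    nlinarith
  have hbt := hball_of (x t) hV.le le_rfl (by linarith)
  have htO : x t ∈ O := ⟨hbt, mem_Op_of_cone hbt hV hU', hV, by linarith⟩
  have hOZ : O ⊆ M.Z := fun y hy => ⟨Or.inl hy.2.1, hy.1, hy.2.2.1, hy.2.2.2.le⟩
  -- properties as long as the orbit is in `O`
  have key : ∀ u ≥ t, (∀ v ∈ Ico t u, x v ∈ O) → x u ∈ M.Z ∧ M.U (x u) < -(1 / 2 * M.V (x u)) ∧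
      M.V (x u) ≤ M.V (x t) ∧
      |M.U (x t)| * Real.exp ((M.b - 3 * M.η) * (u - t)) ≤ |M.U (x u)| := by
    intro u hu hO
    rcases hu.eq_or_lt with h | htu
    · rw [← h]; exact ⟨hOZ htO, hU, le_rfl, by simp⟩
    have hI : ∀ w ∈ Icc t u, SaddleIneq M.a M.b M.η 0 t w (fun v => M.U (x v))
        (fun v => M.V (x v)) := fun w hw =>
      saddleIneq_zero hε (hx.contIcc hτ) (fun v hv => hx.deriv v (hτ.trans_lt hv.1))
        (fun v hv => ⟨Or.inl (hO v ⟨hv.1.le, hv.2.trans_le hw.2⟩).2.1,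
          (hO v ⟨hv.1.le, hv.2.trans_le hw.2⟩).1⟩)
    have hne : ∀ w ∈ Icc t u, |1 / 2 * M.V (x w)| < |M.U (x w)| := by
      intro w hw
      have h1 := (hI w hw).sq_sub_le M.η_pos.le M.η_le_a M.η_le_b hw.1 (q := 1 / 4) (by norm_num)
        (by norm_num)
      have h2 : (1 / 2 * M.V (x t)) ^ 2 < M.U (x t) ^ 2 := by
        rw [sq_lt_sq, abs_of_pos (by linarith), abs_of_neg (by linarith)]; linarith
      exact sq_lt_sq.1 (by nlinarith)
    have hneg : ∀ w ∈ Icc t u, M.U (x w) < 0 := by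
      intro w hw
      by_contra hcon
      have := intermediate_value_Icc hw.1 (hcU.mono fun v hv => hτ.trans hv.1)
        ⟨by linarith, not_lt.1 hcon⟩
      obtain ⟨v, hv, h0⟩ := this
      have := hne v ⟨hv.1, hv.2.trans hw.2⟩
      simp only at h0
      rw [h0, abs_zero] at this
      exact absurd this (not_lt.2 (abs_nonneg _))
    have hcw : ContinuousWithinAt x (Iio u) u :=
      ((hx.cont u (hτ.trans hu)).continuousAt
        (Ici_mem_nhds (hτ.trans_lt htu))).continuousWithinAt
    have hVabs : |M.V (x u)| ≤ |M.V (x t)| ∧ 0 < |M.V (x u)| := by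
      have hcone : ∀ v ∈ Ioo t u, |M.U (x v)| ≤ 2 * |M.V (x v)| := fun v hv => by
        have := hO v ⟨hv.1.le, hv.2⟩
        rw [abs_of_pos this.2.2.1]; exact this.2.2.2.le
      have h1 := (hI u ⟨hu, le_rfl⟩).contract M.η_pos.le hu hcone
      have h2 := (hI u ⟨hu, le_rfl⟩).contract_ge M.η_pos.le hu hcone
      refine ⟨h1.trans (mul_le_of_le_one_right (abs_nonneg _) ?_), lt_of_lt_of_le ?_ h2⟩
      · rw [Real.exp_le_one_iff]
        have : 0 ≤ M.a - 3 * M.η := by linarith [M.η_le_a, M.η_pos]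
        nlinarith [mul_nonneg this (sub_nonneg.2 hu)]
      · exact mul_pos (abs_pos.2 hV.ne') (Real.exp_pos _)
    have hV0 : 0 ≤ M.V (x u) := nonneg_right_of_Ioo (f := fun v => M.V (x v)) htu
      (M.V.continuous.continuousAt.comp_continuousWithinAt hcw)
      fun v hv => (hO v ⟨hv.1.le, hv.2⟩).2.2.1.le
    rw [abs_of_nonneg hV0, abs_of_pos hV] at hVabs
    have hU2 : 0 ≤ 2 * M.V (x u) - |M.U (x u)| :=
      nonneg_right_of_Ioo (f := fun v => 2 * M.V (x v) - |M.U (x v)|) htu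
        (by
          have h1 := M.V.continuous.continuousAt.comp_continuousWithinAt hcw
          have h2 := M.U.continuous.continuousAt.comp_continuousWithinAt hcw
          exact (h1.const_mul 2).sub h2.abs)
        fun v hv => by linarith [(hO v ⟨hv.1.le, hv.2⟩).2.2.2]
    have hb := hball_of (x u) hV0 hVabs.1 (by linarith)
    have hD : x u ∈ S.Dp := (mem_Dp_iff (ball_sub_Ω hb)).2
      (nonneg_right_of_Ioo (f := fun v => S.G (x v)) htu
        ((M.G_diff _ (ball_sub_Ω hb)).continuousAt.comp_continuousWithinAt hcw)
        fun v hv => (hO v ⟨hv.1.le, hv.2⟩).2.1.2.le)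
    refine ⟨⟨hD, hb, hVabs.2, by linarith⟩, ?_, hVabs.1, ?_⟩
    · have h1 := hne u ⟨hu, le_rfl⟩
      rw [abs_of_neg (hneg u ⟨hu, le_rfl⟩), abs_of_pos (by linarith)] at h1
      linarith
    · refine (hI u ⟨hu, le_rfl⟩).expand M.η_pos.le hu fun v hv => ?_
      have h1 := hne v (Ioo_subset_Icc_self hv)
      rw [abs_mul, abs_of_pos (by norm_num : (0 : ℝ) < 1 / 2)] at h1
      linarith
  have hrate : 0 < M.b - 3 * M.η := by linarith [M.η_le_b, M.η_pos]
  -- After this time `|U|` would have grown by a factor `e³ ≥ 4`, from more than `V(x t) / 2` to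
  -- more than `2 V(x t)`, although the region imposes `|U| < 2 V ≤ 2 V(x t)`.
  set N := 3 / (M.b - 3 * M.η) with hN
  have hNp : 0 < N := by positivity
  obtain ⟨w, hw, hwO⟩ : ∃ w ∈ Icc t (t + N), x w ∉ O := by
    by_contra hcon
    push Not at hcon
    obtain ⟨k1, k2, k3, k4⟩ := key (t + N) (by linarith)
      (fun v hv => hcon v (Ico_subset_Icc_self hv))
    rw [add_sub_cancel_left, show (M.b - 3 * M.η) * N = 3 by rw [hN]; field_simp] at k4
    have h1 := Real.add_one_le_exp (3 : ℝ)
    have h2 : 1 / 2 * M.V (x t) < |M.U (x t)| := by rw [abs_of_neg (by linarith)]; linarith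
    have h3 := (hcon (t + N) ⟨by linarith, le_rfl⟩).2.2.2
    nlinarith
  obtain ⟨u, hu1, -, hu3, hu4⟩ := exists_first_exit hOo (hx.contIcc hτ) htO hw.1 hwO
  obtain ⟨k1, k2, k3, -⟩ := key u hu1.le hu4
  refine ⟨u, hu1, ?_, fun v hv => ?_, fun v hv => (hu4 v hv).2.1⟩
  -- The orbit cannot leave through `|U| = 2 V`: with `U < 0` and `G > 0`, the estimate `G ≈ U + V`
  -- keeps `|U|` well below `2 V`. So the exit point is on `Ω⁰`.
  · rcases k1.1 with h | h
    · exfalso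
      refine hu3 ⟨k1.2.1, h, k1.2.2.1, ?_⟩
      have h1 := (abs_le.1 (M.G_near _ k1.2.1)).2
      have h2 := M.η_le
      have h3 := h.2
      have h4 := k1.2.2.1
      rw [abs_of_pos h4, abs_of_neg (by linarith)] at h1
      rw [abs_of_neg (by linarith)]
      nlinarith
    · exact h
  · obtain ⟨j1, j2, -, -⟩ := key v hv.1 fun w hw => hu4 w ⟨hw.1, hw.2.trans_le hv.2⟩
    exact ⟨j1, by linarith [j1.2.2.1]⟩

end SaddleModel

/-! ### Comparison of trajectories that stay in the stable cone -/

namespace SaddleModel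
variable {S : PSSystem} {γ : ℝ → Plane} {M : SaddleModel S γ}

/-- A time after which the half orbit is in a small cone around the stable direction. -/
structure GoodTime (M : SaddleModel S γ) (T : ℝ) : Prop where
  pos : 0 < T
  cone : ∀ t ≥ T, γ t ∈ Metric.ball (0 : Plane) M.r ∧ 0 < M.V (γ t) ∧
    |M.U (γ t)| ≤ 1 / 4 * M.V (γ t)
  small : 16 * M.C * M.V (γ T) < M.r

theorem exists_goodTime (M : SaddleModel S γ) {ρ : ℝ} (hρ : 0 < ρ) :
    ∃ T, M.GoodTime T ∧ M.V (γ T) < ρ := by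
  have hC := C_pos (M := M)
  have hr := M.r_pos
  obtain ⟨T, hT, h⟩ := M.exists_γ_cone (ρ := min ρ (M.r / (16 * M.C)) / M.C) (by positivity)
  have hV : M.V (γ T) < min ρ (M.r / (16 * M.C)) := by
    have h1 := (h T le_rfl).2.1
    rw [lt_div_iff₀ hC] at h1
    have h2 := (le_abs_self _).trans (M.V_le (γ T))
    linarith
  refine ⟨T, ⟨hT, fun t ht => ⟨(h t ht).1, (h t ht).2.2⟩, ?_⟩, hV.trans_le (min_le_left _ _)⟩
  have h1 := hV.trans_le (min_le_right _ _)
  rw [lt_div_iff₀ (by positivity)] at h1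
  linarith

variable {T : ℝ}

theorem GoodTime.mem_Z (hT : M.GoodTime T) {t : ℝ} (ht : T ≤ t) : γ t ∈ M.Z :=
  mem_Z_of_cone (hT.cone t ht).1 (hT.cone t ht).2.1
    (by linarith [(hT.cone t ht).2.1, (hT.cone t ht).2.2])

theorem GoodTime.V_strictAnti (hT : M.GoodTime T) {s t : ℝ} (hs : T ≤ s) (hst : s < t) :
    M.V (γ t) < M.V (γ s) := by
  have h := V_contract zero_mem_Icc (s := s) (t := t) M.γ_cont.continuousOn
    (fun u hu => M.γ_deriv u (hT.pos.trans (hs.trans_lt hu.1)))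
    (fun u hu => hT.mem_Z (hs.trans hu.1)) hst.le
  refine h.1.trans_lt (mul_lt_of_lt_one_right (hT.cone s hs).2.1 ?_)
  rw [Real.exp_lt_one_iff]
  have : 0 < M.a - 3 * M.η := by linarith [M.η_le_a, M.η_pos]
  linarith [mul_pos this (sub_pos.2 hst)]

/-- Points close to `γ([T, T + 1])` are in the cone. -/
theorem GoodTime.near (hT : M.GoodTime T) : ∃ ν > 0, ∀ t ∈ Icc T (T + 1), ∀ z : Plane,
    ‖z - γ t‖ ≤ ν → z ∈ Metric.ball (0 : Plane) M.r ∧ 0 < M.V z ∧ |M.U z| ≤ 1 / 2 * M.V z ∧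
      M.V z < 2 * M.V (γ T) ∧ M.V (γ (T + 1)) ≤ 2 * M.V z := by
  have hC := C_pos (M := M)
  set v := M.V (γ (T + 1)) with hv
  have hv0 : 0 < v := (hT.cone (T + 1) (by linarith)).2.1
  refine ⟨min (v / (8 * M.C)) (M.r / 2), by have := M.r_pos; positivity, fun t ht z hz => ?_⟩
  obtain ⟨h1, h2, h3⟩ := hT.cone t ht.1
  have hvt : v ≤ M.V (γ t) := by
    rcases ht.2.eq_or_lt with h | h
    · rw [h]
    · exact (hT.V_strictAnti ht.1 h).le
  have htT : M.V (γ t) ≤ M.V (γ T) := by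
    rcases ht.1.eq_or_lt with h | h
    · rw [h]
    · exact (hT.V_strictAnti le_rfl h).le
  have hd : M.C * ‖z - γ t‖ ≤ v / 8 := by
    have := mul_le_mul_of_nonneg_left (hz.trans (min_le_left _ _)) hC.le
    refine this.trans (le_of_eq ?_)
    field_simp
  have hV := abs_le.1 ((M.V_le (z - γ t)).trans hd)
  have hU := (M.U_le (z - γ t)).trans hd
  rw [map_sub] at hV hU
  have hUz : |M.U z| ≤ |M.U z - M.U (γ t)| + |M.U (γ t)| := by
    have := abs_add_le (M.U z - M.U (γ t)) (M.U (γ t))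
    rwa [sub_add_cancel] at this
  refine ⟨?_, by linarith, by linarith, by linarith, by linarith⟩
  rw [mem_ball_zero_iff]
  have h4 := norm_le_of_mem_Z (hT.mem_Z ht.1)
  have h5 : ‖z‖ ≤ ‖z - γ t‖ + ‖γ t‖ := by
    have := norm_add_le (z - γ t) (γ t)
    rwa [sub_add_cancel] at this
  have h6 := hz.trans (min_le_right _ _)
  have h7 := hT.small
  have h8 : M.C * M.V (γ t) ≤ M.C * M.V (γ T) := mul_le_mul_of_nonneg_left htT hC.le
  nlinarith

/-- Trajectories from points of `Ω⁰` near `γ 0` follow `γ` on `[0, T + 1]` into the cone. -/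
theorem GoodTime.track (hT : M.GoodTime T) : ∃ ρ > 0, ∃ B ≥ 1, ∀ ε ∈ Icc 0 M.ε₁, ε ≤ ρ → ∀ x τ,
    M.Traj ε τ x → x τ ∈ S.O0 → ‖x τ - γ 0‖ ≤ ρ →
      (∀ t ∈ Ioc τ (τ + T + 1), x t ∈ S.Op) ∧ (∀ t ∈ Icc τ (τ + T + 1), x t ∈ M.K ∧
        ‖x t - γ (t - τ)‖ ≤ B * (‖x τ - γ 0‖ + ε)) ∧
      ∀ t ∈ Icc (τ + T) (τ + T + 1), x t ∈ Metric.ball (0 : Plane) M.r ∧ 0 < M.V (x t) ∧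
        |M.U (x t)| ≤ 1 / 2 * M.V (x t) ∧ M.V (x t) < 2 * M.V (γ T) ∧
        M.V (γ (T + 1)) ≤ 2 * M.V (x t) := by
  obtain ⟨ν, hν, hnear⟩ := hT.near
  obtain ⟨ρ, hρ, B, hB, h⟩ := M.track_forward (T := T + 1) (by linarith [hT.pos])
  have hBp : 0 < B := by linarith
  refine ⟨min ρ (ν / (2 * B)), by positivity, B, hB, fun ε hε hερ x τ hx hx0 hxρ => ?_⟩
  obtain ⟨h1, h2⟩ := h ε hε (hερ.trans (min_le_left _ _)) x τ hx hx0 (hxρ.trans (min_le_left _ _))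
  have hsmall : B * (‖x τ - γ 0‖ + ε) ≤ ν := by
    have a1 := (le_div_iff₀ (by positivity)).1 (hερ.trans (min_le_right _ _))
    have a2 := (le_div_iff₀ (by positivity)).1 (hxρ.trans (min_le_right _ _))
    nlinarith
  have h2' : ∀ t ∈ Icc τ (τ + T + 1), x t ∈ M.K ∧
      ‖x t - γ (t - τ)‖ ≤ B * (‖x τ - γ 0‖ + ε) := fun t ht => by
    have := h2 (t - τ) ⟨by linarith [ht.1], by linarith [ht.2]⟩
    rwa [add_sub_cancel] at this
  refine ⟨fun t ht => ?_, h2', fun t ht => ?_⟩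
  · have := h1 (t - τ) ⟨by linarith [ht.1], by linarith [ht.2]⟩
    rwa [add_sub_cancel] at this
  · exact hnear (t - τ) ⟨by linarith [ht.1], by linarith [ht.2]⟩ _
      ((h2' t ⟨by linarith [ht.1, hT.pos], ht.2⟩).2.trans hsmall)

theorem mem_Z_of_half {x : Plane} (hx : x ∈ Metric.ball (0 : Plane) M.r) (hV : 0 < M.V x)
    (hU : |M.U x| ≤ 1 / 2 * M.V x) : x ∈ M.Z :=
  mem_Z_of_cone hx hV (by linarith)

set_option maxHeartbeats 1000000 in
-- The trajectory with the larger `V` at time `τ + T` is delayed by `θ` so that the `V` coordinates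
-- agree there. The form `U² - V²` of the difference is then the square of its `U` component, and it
-- is controlled by the error and by the final size `ω`. Grönwall carries this back to time `τ`.
-- Finally `θ` is itself controlled, because both curves start on `Ω⁰` and `G` grows at rate at
-- least `c₀` along the shifted one.
theorem GoodTime.shift_aux (hT : M.GoodTime T) : ∃ ρ > 0, ∃ B ≥ 1, ∀ ε ∈ Icc 0 M.ε₁,
    ∀ ε' ∈ Icc 0 M.ε₁, ε ≤ ρ → ε' ≤ ρ → ∀ E ≥ 0,
    (∀ t, ∀ z ∈ M.K, z ∈ S.Dp → ‖M.F ε t z - M.F ε' t z‖ ≤ E) → ∀ x y τ t₁ ω,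
    M.Traj ε τ x → M.Traj ε' τ y → x τ ∈ S.O0 → y τ ∈ S.O0 → ‖x τ - γ 0‖ ≤ ρ → ‖y τ - γ 0‖ ≤ ρ →
    τ + T + 2 ≤ t₁ → (∀ t ∈ Icc (τ + T) t₁, x t ∈ M.Z) → (∀ t ∈ Icc (τ + T) t₁, y t ∈ M.Z) →
    (∀ t ∈ Icc (t₁ - 1) t₁, ‖x t‖ ≤ ω ∧ ‖y t‖ ≤ ω) → M.V (x (τ + T)) ≤ M.V (y (τ + T)) →
    ‖x τ - y τ‖ ≤ B * (E + ω) := by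
  obtain ⟨ρ₁, hρ₁, B₁, hB₁, htrack⟩ := hT.track
  have hC := C_pos (M := M)
  have hC1 := M.one_le_C
  have hr₀ := M.r₀_pos
  have hc₀ := M.c₀_pos
  have hTp := hT.pos
  have hs₀ : 0 < M.V (γ T) := (hT.cone T le_rfl).2.1
  set s₀ := M.V (γ T) with hs₀def
  have hrate : 0 < M.a - 3 * M.η := by linarith [M.η_le_a, M.η_pos]
  -- The largest admissible shift: at most `1`, so that `t₁ - θ` stays in the final interval where
  -- the curves are small, and short enough for `y` to remain in the ball where `G` increases.
  set θ₀ := min 1 (M.r₀ / (2 * M.C)) with hθ₀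
  have hθ₀p : 0 < θ₀ := by positivity
  have hθ₀1 : θ₀ ≤ 1 := min_le_left _ _
  set q := Real.exp (-((M.a - 3 * M.η) * θ₀)) with hq
  have hq1 : q < 1 := by rw [hq, Real.exp_lt_one_iff]; linarith [mul_pos hrate hθ₀p]
  have hq0 : 0 < q := Real.exp_pos _
  set m := min M.a M.b with hm
  have hmp : 0 < m := lt_min M.a_pos M.b_pos
  have hηm : 100 * M.η ≤ m := le_min M.η_le_a M.η_le_b
  set X := Real.exp ((M.L + 1) * T) with hX
  have hX1 : 1 ≤ X := Real.one_le_exp (by positivity)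
  set B₂ := M.C * (2 * M.C / m + 2 * M.C) with hB₂
  have hB₂p : 0 < B₂ := by positivity
  set B₃ := (B₂ + 1) * X with hB₃
  have hB₃1 : 1 ≤ B₃ := by rw [hB₃]; nlinarith
  set B := B₃ + (M.c₀ / 2 + M.C) * (2 * M.C * B₃ / M.c₀) with hB
  have hBB : B₃ ≤ B := by
    rw [hB]
    have : 0 ≤ (M.c₀ / 2 + M.C) * (2 * M.C * B₃ / M.c₀) := by positivity
    linarith
  -- The bound containing `1 - q` puts both values of `V` so close to `s₀` that contraction during
  -- `θ₀` compensates their gap; the bound containing `c₀` makes the error `C ε' θ` absorbable at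
  -- the end.
  set ρ := min (min ρ₁ (M.r₀ / 4)) (min (s₀ * (1 - q) / (4 * M.C * B₁))
    (M.c₀ / (2 * M.C ^ 2 * B₃))) with hρ
  have h1q : 0 < 1 - q := by linarith
  have hρp : 0 < ρ := by positivity
  have hρ1 : ρ ≤ ρ₁ := (min_le_left _ _).trans (min_le_left _ _)
  have hρ2 : ρ ≤ M.r₀ / 4 := (min_le_left _ _).trans (min_le_right _ _)
  have hρ3 : ρ ≤ s₀ * (1 - q) / (4 * M.C * B₁) := (min_le_right _ _).trans (min_le_left _ _)
  have hρ4 : ρ ≤ M.c₀ / (2 * M.C ^ 2 * B₃) := (min_le_right _ _).trans (min_le_right _ _)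
  have hma : m ≤ M.a := min_le_left _ _
  have hmb : m ≤ M.b := min_le_right _ _
  have hθr : θ₀ ≤ M.r₀ / (2 * M.C) := min_le_right _ _
  clear_value ρ B B₃ B₂ X m q θ₀
  refine ⟨ρ, hρp, B, by linarith, ?_⟩
  intro ε hε ε' hε' hερ hε'ρ E hE hF x y τ t₁ ω hx hy hx0 hy0 hxρ hyρ ht₁ hxZ hyZ hω hVxy
  rw [le_div_iff₀ (by positivity)] at hρ3 hρ4
  obtain ⟨hxOp, hxK, -⟩ := htrack ε hε (hερ.trans hρ1) x τ hx hx0 (hxρ.trans hρ1)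
  obtain ⟨hyOp, hyK, -⟩ := htrack ε' hε' (hε'ρ.trans hρ1) y τ hy hy0 (hyρ.trans hρ1)
  have hτT : τ + T ∈ Icc τ (τ + T + 1) := ⟨by linarith, by linarith⟩
  have hclose : ∀ {ε₂ : ℝ} {w : ℝ → Plane}, ε₂ ≤ ρ → ‖w τ - γ 0‖ ≤ ρ →
      ‖w (τ + T) - γ (τ + T - τ)‖ ≤ B₁ * (‖w τ - γ 0‖ + ε₂) →
      |M.V (w (τ + T)) - s₀| ≤ s₀ * (1 - q) / 2 := by
    intro ε₂ w h1 h2 h3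
    rw [add_sub_cancel_left] at h3
    have h4 := M.V_le (w (τ + T) - γ T)
    rw [map_sub] at h4
    refine h4.trans ((mul_le_mul_of_nonneg_left h3 hC.le).trans ?_)
    have h5 : M.C * (B₁ * (‖w τ - γ 0‖ + ε₂)) ≤ M.C * (B₁ * (ρ + ρ)) := by gcongr
    linarith
  have hVx := abs_le.1 (hclose hερ hxρ (hxK _ hτT).2)
  have hVy := abs_le.1 (hclose hε'ρ hyρ (hyK _ hτT).2)
  -- the time shift
  have hcVy : ContinuousOn (fun t => M.V (y t)) (Icc (τ + T) (τ + T + θ₀)) :=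
    M.V.continuous.comp_continuousOn (hy.contIcc (by linarith))
  have hend : M.V (y (τ + T + θ₀)) ≤ M.V (x (τ + T)) := by
    have h1 := (V_contract hε' (hy.contIcc (s := τ + T) (t := τ + T + θ₀) (by linarith))
      (fun u hu => hy.deriv u (by linarith [hu.1]))
      (fun u hu => hyZ u ⟨hu.1, by linarith [hu.2]⟩) (by linarith)).1
    rw [add_sub_cancel_left, ← hq] at h1
    refine h1.trans ?_
    have h2 : M.V (y (τ + T)) * q ≤ (s₀ + s₀ * (1 - q) / 2) * q :=
      mul_le_mul_of_nonneg_right (by linarith) hq0.le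
    have h3 : 0 ≤ s₀ * (1 - q) ^ 2 := by positivity
    linarith
  obtain ⟨t₂, ht₂, hVt₂⟩ := intermediate_value_Icc' (by linarith) hcVy ⟨hend, hVxy⟩
  simp only at hVt₂
  set θ := t₂ - (τ + T) with hθ
  have hθ0 : 0 ≤ θ := by linarith [ht₂.1]
  have hθ1 : θ ≤ θ₀ := by linarith [ht₂.2]
  have hε'0 := hε'.1
  -- The defect of the shifted curve: `E` for the change of parameter, `C ε' θ` for the time
  -- dependence, which only the perturbation carries.
  set e := E + M.C * ε' * θ with he
  have he0 : 0 ≤ e := by positivity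
  have hyDK : ∀ u ∈ Ioc τ t₁, y u ∈ M.K ∧ y u ∈ S.Dp := by
    intro u hu
    rcases le_total u (τ + T) with h | h
    · exact ⟨(hyK u ⟨hu.1.le, by linarith⟩).1, Or.inl (hyOp u ⟨hu.1, by linarith⟩)⟩
    · exact ⟨M.ball_sub (hyZ u ⟨h, hu.2⟩).2.1, (hyZ u ⟨h, hu.2⟩).1⟩
  have hyd : ∀ u > τ, HasDerivAt (fun u => y (u + θ)) (M.F ε' (u + θ) (y (u + θ))) u := fun u hu =>
    (hy.deriv (u + θ) (by linarith)).comp_add_const u θ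
  have hyc : ∀ s t, τ ≤ s → ContinuousOn (fun u => y (u + θ)) (Icc s t) := fun s t hs =>
    hy.cont.comp (by fun_prop) fun u hu => by
      rw [mem_Ici]; linarith [hu.1]
  have hye : ∀ u, τ < u + θ → u + θ ≤ t₁ →
      ‖M.F ε u (y (u + θ)) - M.F ε' (u + θ) (y (u + θ))‖ ≤ e := by
    intro u hu hu'
    obtain ⟨hK, hD⟩ := hyDK (u + θ) ⟨hu, hu'⟩
    have h1 := hF u _ hK hD
    have h2 := M.F_shift ε' hε' u (u + θ) _ hK hD
    rw [show u - (u + θ) = -θ by ring, abs_neg, abs_of_nonneg hθ0] at h2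
    calc _ = ‖(M.F ε u (y (u + θ)) - M.F ε' u (y (u + θ))) +
          (M.F ε' u (y (u + θ)) - M.F ε' (u + θ) (y (u + θ)))‖ := by congr 1; abel
      _ ≤ e := (norm_add_le _ _).trans (add_le_add h1 h2)
  -- near the saddle
  have hI := saddleIneq (s := τ + T) (t := t₁ - θ) (x := x) (y := fun u => y (u + θ)) hε
    (hx.contIcc (by linarith)) (fun u hu => hx.deriv u (by linarith [hu.1]))
    (hyc _ _ (by linarith)) (fun u hu => hyd u (by linarith [hu.1]))
    (fun u hu => hye u (by linarith [hu.1]) (by linarith [hu.2]))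
    (fun u hu => by
      have := hxZ u ⟨hu.1.le, by linarith [hu.2]⟩
      exact ⟨this.1, this.2.1⟩)
    (fun u hu => by
      have := hyZ (u + θ) ⟨by linarith [hu.1], by linarith [hu.2]⟩
      exact ⟨this.1, this.2.1⟩)
  have hω0 : 0 ≤ ω := (norm_nonneg _).trans (hω t₁ ⟨by linarith, le_rfl⟩).1
  have hP : |M.U (x (τ + T) - y (τ + T + θ))| ≤ 2 * M.C / m * e + 2 * M.C * ω := by
    have h1 := hI.sq_sub_sq_le_error M.η_pos.le hmp hηm hma hmb
      (by linarith)
    have h2 : M.V (x (τ + T) - y (τ + T + θ)) = 0 := by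
      rw [map_sub, ← hVt₂, hθ, add_sub_cancel, sub_self]
    have h3 : |M.U (x (t₁ - θ) - y (t₁ - θ + θ))| ≤ 2 * M.C * ω := by
      refine (M.U_le _).trans ?_
      have h4 : ‖x (t₁ - θ) - y (t₁ - θ + θ)‖ ≤ ω + ω := by
        refine (norm_sub_le _ _).trans (add_le_add (hω _ ⟨by linarith, by linarith⟩).1 ?_)
        rw [sub_add_cancel]
        exact (hω t₁ ⟨by linarith, le_rfl⟩).2
      have := mul_le_mul_of_nonneg_left h4 hC.le
      linarith
    have h5 : max 0 (M.U (x (t₁ - θ) - y (t₁ - θ + θ)) ^ 2 -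
        M.V (x (t₁ - θ) - y (t₁ - θ + θ)) ^ 2) ≤ (2 * M.C * ω) ^ 2 := by
      refine max_le (sq_nonneg _) ?_
      have : M.U (x (t₁ - θ) - y (t₁ - θ + θ)) ^ 2 ≤ (2 * M.C * ω) ^ 2 := by
        rw [← sq_abs]; exact pow_le_pow_left₀ (abs_nonneg _) h3 2
      linarith [sq_nonneg (M.V (x (t₁ - θ) - y (t₁ - θ + θ)))]
    rw [h2] at h1
    refine abs_le_of_sq_le_sq ?_ (by positivity)
    have h6 : 4 * (M.C * e) ^ 2 / m ^ 2 = (2 * M.C / m * e) ^ 2 := by field_simp; ring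
    have h7 : 0 ≤ (2 * M.C / m * e) * (2 * M.C * ω) := by positivity
    rw [h6] at h1
    linarith [add_sq (2 * M.C / m * e) (2 * M.C * ω)]
  have hdist : ‖x (τ + T) - y (τ + T + θ)‖ ≤ B₂ * (e + ω) := by
    have h2 : M.V (x (τ + T) - y (τ + T + θ)) = 0 := by
      rw [map_sub, ← hVt₂, hθ, add_sub_cancel, sub_self]
    have h1 := M.norm_le (x (τ + T) - y (τ + T + θ))
    rw [h2, abs_zero, add_zero] at h1
    refine h1.trans ((mul_le_mul_of_nonneg_left hP hC.le).trans ?_)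
    rw [hB₂]
    have : 0 ≤ M.C * (2 * M.C * e + 2 * M.C / m * ω) := by positivity
    linarith
  have hback : ‖x τ - y (τ + θ)‖ ≤ B₃ * (e + ω) := by
    have h1 := norm_sub_le_exp (s := τ) (t := τ + T) (x := x) (y := fun u => y (u + θ)) hε he0
      (hx.contIcc le_rfl) (fun u hu => hx.deriv u hu.1) (hyc _ _ le_rfl)
      (fun u hu => hyd u hu.1)
      (fun u hu => hye u (by linarith [hu.1]) (by linarith [hu.2]))
      (u := τ) (v := τ + T) ⟨le_rfl, by linarith⟩ ⟨by linarith, le_rfl⟩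
    rw [show |τ - (τ + T)| = T by rw [sub_add_cancel_left, abs_neg, abs_of_pos hTp]] at h1
    rw [← hX] at h1
    have h2 : (‖x (τ + T) - y (τ + T + θ)‖ + e) * X ≤ (B₂ * (e + ω) + e) * X :=
      mul_le_mul_of_nonneg_right (by linarith) (by linarith)
    have h3 : 0 ≤ X * ω := mul_nonneg (by linarith) hω0
    rw [hB₃]
    linarith
  -- the shift is small
  have hyball : ∀ u ∈ Icc τ (τ + θ), y u ∈ Metric.ball (γ 0) M.r₀ := by
    intro u hu
    rw [Metric.mem_ball, dist_eq_norm]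
    have h1 := hy.norm_sub_le hε' le_rfl hu.1
    have h2 : M.C * (u - τ) ≤ M.C * (M.r₀ / (2 * M.C)) :=
      mul_le_mul_of_nonneg_left ((by linarith [hu.2] : u - τ ≤ θ₀).trans hθr) hC.le
    rw [show M.C * (M.r₀ / (2 * M.C)) = M.r₀ / 2 by field_simp] at h2
    have h3 : ‖y u - γ 0‖ ≤ ‖y u - y τ‖ + ‖y τ - γ 0‖ := by
      rw [show y u - γ 0 = (y u - y τ) + (y τ - γ 0) by abel]; exact norm_add_le _ _
    linarith
  have hGy := G_increase hε' hy le_rfl (by linarith) hyball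
  rw [add_sub_cancel_left] at hGy
  have hG0x : S.G (x τ) = 0 := hx0.2
  have hG0y : S.G (y τ) = 0 := hy0.2
  have hxball : x τ ∈ Metric.ball (γ 0) M.r₀ := by
    rw [Metric.mem_ball, dist_eq_norm]; linarith
  have hGl := M.G_lip _ hxball _ (hyball (τ + θ) ⟨by linarith, le_rfl⟩)
  rw [hG0x, zero_sub, abs_neg] at hGl
  -- Circular at first sight, since `e` contains `θ`; the term `C B₃ C ε' θ` is at most `c₀ θ / 2`
  -- and moves to the left side.
  have hθle : M.c₀ * θ ≤ M.C * (B₃ * (e + ω)) := by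
    have := le_abs_self (S.G (y (τ + θ)))
    have := mul_le_mul_of_nonneg_left hback hC.le
    linarith
  have hCε : M.C * (B₃ * (M.C * ε' * θ)) ≤ M.c₀ / 2 * θ := by
    have h1 : ε' * (2 * M.C ^ 2 * B₃) ≤ M.c₀ :=
      (mul_le_mul_of_nonneg_right hε'ρ (by positivity)).trans hρ4
    have := mul_le_mul_of_nonneg_right h1 hθ0
    linarith
  have hθfin : θ ≤ 2 * M.C * B₃ / M.c₀ * (E + ω) := by
    rw [div_mul_eq_mul_div, le_div_iff₀ hc₀]
    rw [he] at hθle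
    linarith
  have hlast : ‖y (τ + θ) - y τ‖ ≤ M.C * θ := by
    have := hy.norm_sub_le hε' le_rfl (by linarith : τ ≤ τ + θ)
    rwa [add_sub_cancel_left] at this
  have hB₃ε : B₃ * (M.C * ε' * θ) ≤ M.c₀ / 2 * θ := by
    have h0 : 0 ≤ B₃ * (M.C * ε' * θ) := by positivity
    exact (le_mul_of_one_le_left h0 hC1).trans hCε
  calc ‖x τ - y τ‖ = ‖(x τ - y (τ + θ)) + (y (τ + θ) - y τ)‖ := by congr 1; abel
    _ ≤ B₃ * (e + ω) + M.C * θ := (norm_add_le _ _).trans (add_le_add hback hlast)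
    _ ≤ B₃ * (E + ω) + (M.c₀ / 2 + M.C) * θ := by rw [he]; linarith
    _ ≤ B₃ * (E + ω) + (M.c₀ / 2 + M.C) * (2 * M.C * B₃ / M.c₀ * (E + ω)) := by gcongr
    _ = B * (E + ω) := by rw [hB]; ring

/-- Two trajectories from points of `Ω⁰` near `γ 0` that both stay in the cone and come close to the
saddle start close to each other. -/
theorem GoodTime.shift (hT : M.GoodTime T) : ∃ ρ > 0, ∃ B ≥ 1, ∀ ε ∈ Icc 0 M.ε₁,
    ∀ ε' ∈ Icc 0 M.ε₁, ε ≤ ρ → ε' ≤ ρ → ∀ E ≥ 0,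
    (∀ t, ∀ z ∈ M.K, z ∈ S.Dp → ‖M.F ε t z - M.F ε' t z‖ ≤ E) → ∀ x y τ t₁ ω,
    M.Traj ε τ x → M.Traj ε' τ y → x τ ∈ S.O0 → y τ ∈ S.O0 → ‖x τ - γ 0‖ ≤ ρ → ‖y τ - γ 0‖ ≤ ρ →
    τ + T + 2 ≤ t₁ → (∀ t ∈ Icc (τ + T) t₁, x t ∈ M.Z) → (∀ t ∈ Icc (τ + T) t₁, y t ∈ M.Z) →
    (∀ t ∈ Icc (t₁ - 1) t₁, ‖x t‖ ≤ ω ∧ ‖y t‖ ≤ ω) →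
    ‖x τ - y τ‖ ≤ B * (E + ω) := by
  obtain ⟨ρ, hρ, B, hB, h⟩ := hT.shift_aux
  refine ⟨ρ, hρ, B, hB, ?_⟩
  intro ε hε ε' hε' hερ hε'ρ E hE hF x y τ t₁ ω hx hy hx0 hy0 hxρ hyρ ht₁ hxZ hyZ hω
  rcases le_total (M.V (x (τ + T))) (M.V (y (τ + T))) with hle | hle
  · exact h ε hε ε' hε' hερ hε'ρ E hE hF x y τ t₁ ω hx hy hx0 hy0 hxρ hyρ ht₁ hxZ hyZ hω hle
  · rw [norm_sub_rev]
    exact h ε' hε' ε hε hε'ρ hερ E hE (fun t z hz hD => by rw [norm_sub_rev]; exact hF t z hz hD)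
      y x τ t₁ ω hy hx hy0 hx0 hyρ hxρ ht₁ hyZ hxZ (fun t ht => (hω t ht).symm) hle

/-- Orbits through points of the cone close to the saddle come from `Ω⁰` near `γ 0`. -/
theorem GoodTime.back (hT : M.GoodTime T) {ρ' : ℝ} (hρ' : 0 < ρ') : ∃ ρ > 0, ∃ δ > 0,
    ∀ ε ∈ Icc 0 M.ε₁, ε ≤ ρ → ∀ x t, M.Sol ε x → x t ∈ M.Z → M.V (x t) ≤ δ →
    ∃ τ, τ + T + 2 ≤ t ∧ x τ ∈ S.O0 ∧ ‖x τ - γ 0‖ ≤ ρ' ∧ (∀ u ∈ Ioo τ t, x u ∈ S.Op) ∧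
      (∀ u ∈ Icc τ t, x u ∈ M.K) ∧ ∀ u ∈ Icc (τ + T) t, x u ∈ M.Z := by
  obtain ⟨ρ₁, hρ₁, B₁, hB₁, htrack⟩ := hT.track
  obtain ⟨ρ₂, hρ₂, B₂, hB₂, hback⟩ := M.track_back hT.pos
  have hC := C_pos (M := M)
  have hC1 := M.one_le_C
  have hTp := hT.pos
  have hs₀ : 0 < M.V (γ T) := (hT.cone T le_rfl).2.1
  set s₀ := M.V (γ T) with hs₀def
  set m := min M.a M.b with hm
  have hmp : 0 < m := lt_min M.a_pos M.b_pos
  have hηm : 100 * M.η ≤ m := le_min M.η_le_a M.η_le_b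
  have hrate : 0 < M.a + 3 * M.η := by linarith [M.a_pos, M.η_pos]
  -- the required closeness to `γ T`
  set σ := min (min ρ₁ ρ₂) (min ρ' (1 / 2)) / (2 * B₂) with hσ
  have hσp : 0 < σ := by positivity
  have hB₂p : 0 < B₂ := by linarith
  set ν := σ / (2 * M.C * (M.C * (3 * M.C + 1))) with hν
  have hνp : 0 < ν := by positivity
  obtain ⟨N₀, hN₀⟩ := eventually_atTop.1 (M.γ_tendsto.eventually (Metric.ball_mem_nhds 0 hνp))
  set N₁ := max 3 N₀ with hN₁
  -- The exponential bound forces the orbit to spend at least time `N₁` in the cone: `N₁ ≥ N₀` makes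
  -- the translate of `γ` small as well, and `N₁ ≥ 3` gives `τ + T + 2 ≤ t`, because `τ` differs
  -- from `t' - T` by at most `1 / 2`.
  set δ := min (min ν (s₀ / 2)) (s₀ * Real.exp (-((M.a + 3 * M.η) * N₁))) with hδ
  set ρ := min (min ρ₁ ρ₂) (min σ (σ / (2 * M.C * (2 * M.C ^ 2 / m)))) with hρ
  have hδp : 0 < δ := by have := Real.exp_pos (-((M.a + 3 * M.η) * N₁)); positivity
  have hρp : 0 < ρ := by positivity
  have hδ1 : δ ≤ ν := (min_le_left _ _).trans (min_le_left _ _)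
  have hδ2 : δ ≤ s₀ / 2 := (min_le_left _ _).trans (min_le_right _ _)
  have hδ3 : δ ≤ s₀ * Real.exp (-((M.a + 3 * M.η) * N₁)) := min_le_right _ _
  have hρa : ρ ≤ ρ₁ := (min_le_left _ _).trans (min_le_left _ _)
  have hρb : ρ ≤ ρ₂ := (min_le_left _ _).trans (min_le_right _ _)
  have hρc : ρ ≤ σ := (min_le_right _ _).trans (min_le_left _ _)
  have hρd : ρ ≤ σ / (2 * M.C * (2 * M.C ^ 2 / m)) := (min_le_right _ _).trans (min_le_right _ _)
  have hma : m ≤ M.a := min_le_left _ _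
  have hmb : m ≤ M.b := min_le_right _ _
  have hN₁3 : 3 ≤ N₁ := le_max_left _ _
  have hN₁0 : N₀ ≤ N₁ := le_max_right _ _
  clear_value ρ δ N₁ ν σ m
  refine ⟨ρ, hρp, δ, hδp, ?_⟩
  intro ε hε hερ x t hx hxZ hVδ
  have hsm := hT.small
  have hCs : 0 < M.C * s₀ := by positivity
  -- The level is `V(γ T)`, so that at time `t'` the difference from the translate of `γ` has zero
  -- `V` component.
  obtain ⟨t', ht', hVt', hZ', hOp'⟩ := back_to_level hε hx hxZ (by linarith : M.V (x t) < s₀)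
    (by linarith)
  set N := t - t' with hN
  have hNN : N₁ ≤ N := by
    have h1 := (V_contract hε hx.continuous.continuousOn (fun u _ => hx u) hZ' ht'.le).2
    rw [hVt'] at h1
    have h2 := le_of_mul_le_mul_left ((h1.trans hVδ).trans hδ3) hs₀
    rw [Real.exp_le_exp, neg_le_neg_iff] at h2
    exact le_of_mul_le_mul_left h2 hrate
  have hN3 : 3 ≤ N := hN₁3.trans hNN
  -- comparison with `γ`
  have hγ := M.γ_traj (t' - T)
  have hI := saddleIneq (s := t') (t := t) (x := x) (y := fun u => γ (u - (t' - T))) hε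
    hx.continuous.continuousOn (fun u _ => hx u)
    (hγ.contIcc (by linarith)) (fun u hu => hγ.deriv u (by linarith [hu.1]))
    (fun u hu => M.F_var ε hε u _ (M.γ_K _ (by linarith [hu.1])) (M.γ_mem_Dp (by linarith [hu.1])))
    (fun u hu => ⟨(hZ' u (Ioo_subset_Icc_self hu)).1, (hZ' u (Ioo_subset_Icc_self hu)).2.1⟩)
    (fun u hu => by
      have := hT.mem_Z (t := u - (t' - T)) (by linarith [hu.1])
      exact ⟨this.1, this.2.1⟩)
  have hV0 : M.V (x t' - γ (t' - (t' - T))) = 0 := by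
    rw [sub_sub_cancel, map_sub, hVt', hs₀def, sub_self]
  have hend : ‖x t - γ (t - (t' - T))‖ ≤ (3 * M.C + 1) * ν := by
    refine (norm_sub_le _ _).trans ?_
    have h1 := norm_le_of_mem_Z hxZ
    have h2 := hN₀ (t - (t' - T)) (by linarith)
    rw [dist_zero_right] at h2
    have h3 : M.C * M.V (x t) ≤ M.C * ν := mul_le_mul_of_nonneg_left (hVδ.trans hδ1) hC.le
    linarith
  have hP : |M.U (x t' - γ (t' - (t' - T)))| ≤ 2 * M.C ^ 2 / m * ε +
      M.C * ((3 * M.C + 1) * ν) := by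
    have h1 := hI.sq_sub_sq_le_error M.η_pos.le hmp hηm hma hmb
      ht'.le
    rw [hV0] at h1
    have h3 : |M.U (x t - γ (t - (t' - T)))| ≤ M.C * ((3 * M.C + 1) * ν) :=
      (M.U_le _).trans (mul_le_mul_of_nonneg_left hend hC.le)
    have h5 : max 0 (M.U (x t - γ (t - (t' - T))) ^ 2 - M.V (x t - γ (t - (t' - T))) ^ 2) ≤
        (M.C * ((3 * M.C + 1) * ν)) ^ 2 := by
      refine max_le (sq_nonneg _) ?_
      have : M.U (x t - γ (t - (t' - T))) ^ 2 ≤ (M.C * ((3 * M.C + 1) * ν)) ^ 2 := by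
        rw [← sq_abs]; exact pow_le_pow_left₀ (abs_nonneg _) h3 2
      linarith [sq_nonneg (M.V (x t - γ (t - (t' - T))))]
    have hε0 := hε.1
    refine abs_le_of_sq_le_sq ?_ (by positivity)
    have h6 : 4 * (M.C * (M.C * ε)) ^ 2 / m ^ 2 = (2 * M.C ^ 2 / m * ε) ^ 2 := by field_simp; ring
    have h7 : 0 ≤ (2 * M.C ^ 2 / m * ε) * (M.C * ((3 * M.C + 1) * ν)) := by positivity
    rw [h6] at h1
    linarith [add_sq (2 * M.C ^ 2 / m * ε) (M.C * ((3 * M.C + 1) * ν))]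
  have hdist : ‖x t' - γ T‖ ≤ σ := by
    have h1 := M.norm_le (x t' - γ (t' - (t' - T)))
    rw [hV0, abs_zero, add_zero] at h1
    rw [sub_sub_cancel] at h1 hP
    have h2 : M.C * (2 * M.C ^ 2 / m * ε) ≤ σ / 2 := by
      have : ε ≤ σ / (2 * M.C * (2 * M.C ^ 2 / m)) :=
        hερ.trans hρd
      rw [le_div_iff₀ (by positivity)] at this
      linarith
    have h3 : M.C * (M.C * ((3 * M.C + 1) * ν)) = σ / 2 := by rw [hν]; field_simp
    have h4 := mul_le_mul_of_nonneg_left hP hC.le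
    linarith
  have hεσ : ε ≤ σ := hερ.trans hρc
  have hBσ : B₂ * (‖x t' - γ T‖ + ε) ≤ min (min ρ₁ ρ₂) (min ρ' (1 / 2)) := by
    have h1 : B₂ * (‖x t' - γ T‖ + ε) ≤ B₂ * (σ + σ) :=
      mul_le_mul_of_nonneg_left (by linarith) hB₂p.le
    have h2 : B₂ * (σ + σ) = min (min ρ₁ ρ₂) (min ρ' (1 / 2)) := by rw [hσ]; field_simp; ring
    linarith
  have hσρ₂ : σ ≤ ρ₂ := by
    have h2 : σ * (2 * B₂) = min (min ρ₁ ρ₂) (min ρ' (1 / 2)) := by rw [hσ]; field_simp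
    have h3 : min (min ρ₁ ρ₂) (min ρ' (1 / 2)) ≤ ρ₂ := (min_le_left _ _).trans (min_le_right _ _)
    have h4 : σ * 1 ≤ σ * (2 * B₂) := mul_le_mul_of_nonneg_left (by linarith) hσp.le
    linarith
  obtain ⟨τ, hτ1, hτ2, hτ3⟩ := hback ε hε (hερ.trans hρb)
    x t' hx (hdist.trans hσρ₂)
  have hτ4 := abs_le.1 (hτ1.trans (hBσ.trans ((min_le_right _ _).trans (min_le_right _ _))))
  obtain ⟨f1, f2, f3⟩ := htrack ε hε (hερ.trans hρa) x τ
    (hx.traj τ) hτ2 (hτ3.trans (hBσ.trans ((min_le_left _ _).trans (min_le_left _ _))))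
  refine ⟨τ, by linarith [hτ4.2], hτ2, hτ3.trans (hBσ.trans ((min_le_right _ _).trans
    (min_le_left _ _))), fun u hu => ?_, fun u hu => ?_, fun u hu => ?_⟩
  · rcases lt_or_ge u t' with h | h
    · exact f1 u ⟨hu.1, by linarith [hτ4.1]⟩
    · exact hOp' u ⟨h, hu.2⟩
  · rcases lt_or_ge u t' with h | h
    · exact (f2 u ⟨hu.1, by linarith [hτ4.1]⟩).1
    · exact M.ball_sub (hZ' u ⟨h, hu.2⟩).2.1
  · rcases lt_or_ge u t' with h | h
    · obtain ⟨g1, g2, g3, -⟩ := f3 u ⟨hu.1, by linarith [hτ4.1]⟩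
      exact mem_Z_of_half g1 g2 g3
    · exact hZ' u ⟨h, hu.2⟩

end SaddleModel

/-! ### The stable leaf of the half system -/

/-- `z` is a solution in `Ω⁺` on the open interval `(p, q)`. -/
structure PSSystem.PlusOn (S : PSSystem) (ε p q : ℝ) (z : ℝ → Plane) : Prop where
  cont : ContinuousOn z (Icc p q)
  mem : ∀ t ∈ Ioo p q, z t ∈ S.Op
  deriv : ∀ t ∈ Ioo p q, HasDerivAt z (S.Fp ε t (z t)) t

/-- `y` is a solution in `Ω⁺` on `(τ, ∞)` which starts on `Ω⁰` and converges to the origin. -/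
structure PSSystem.IsLeaf (S : PSSystem) (ε τ : ℝ) (y : ℝ → Plane) : Prop where
  cont : ContinuousOn y (Ici τ)
  start : y τ ∈ S.O0
  mem : ∀ t > τ, y t ∈ S.Op
  deriv : ∀ t > τ, HasDerivAt y (S.Fp ε t (y t)) t
  tendsto : Tendsto y atTop (𝓝 0)

theorem PSSystem.Op_disjoint_O0 {S : PSSystem} {x : Plane} (h : x ∈ S.Op) (h' : x ∈ S.O0) :
    False := by
  have h1 := h.2
  have h2 := h'.2
  linarith

theorem PSSystem.IsLeaf.plusOn {S : PSSystem} {ε τ p q : ℝ} {y : ℝ → Plane}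
    (h : S.IsLeaf ε τ y) (hp : τ ≤ p) : S.PlusOn ε p q y :=
  ⟨h.cont.mono fun _ hu => hp.trans hu.1, fun t ht => h.mem t (hp.trans_lt ht.1),
    fun t ht => h.deriv t (hp.trans_lt ht.1)⟩

theorem PSSystem.PlusOn.mono {S : PSSystem} {ε p q p' q' : ℝ} {z : ℝ → Plane}
    (h : S.PlusOn ε p q z) (hp : p ≤ p') (hq : q' ≤ q) : S.PlusOn ε p' q' z :=
  ⟨h.cont.mono (Icc_subset_Icc hp hq), fun t ht => h.mem t ⟨hp.trans_lt ht.1, ht.2.trans_le hq⟩,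
    fun t ht => h.deriv t ⟨hp.trans_lt ht.1, ht.2.trans_le hq⟩⟩

namespace SaddleModel
variable {S : PSSystem} {γ : ℝ → Plane} {M : SaddleModel S γ}

theorem plusOn_eq_of_mem_K {ε p q : ℝ} {x z : ℝ → Plane} (hε : ε ∈ Icc 0 M.ε₁) (hx : M.Sol ε x)
    (hz : S.PlusOn ε p q z) (hK : ∀ t ∈ Ioo p q, z t ∈ M.K) {v : ℝ} (hv : v ∈ Icc p q)
    (h : z v = x v) : EqOn z x (Icc p q) := by
  refine eq_of_hasDerivAt_of_lipschitz (M.F_lip ε hε) hz.cont hx.continuous.continuousOn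
    (fun u hu => ?_) (fun u _ => hx u) hv h
  rw [M.F_eq ε hε u _ (hK u hu) (Or.inl (hz.mem u hu))]
  exact hz.deriv u hu

/-- A solution of the original equation need not stay in `K`, where the extended field agrees with
the true one. Up to its first exit it coincides with `x`, which lies in `K`, so there is no exit. -/
theorem plusOn_eq_forward {ε p q : ℝ} {x z : ℝ → Plane} (hε : ε ∈ Icc 0 M.ε₁) (hx : M.Sol ε x)
    (hpq : p ≤ q) (hxK : ∀ t ∈ Icc p q, x t ∈ M.K) (hz : S.PlusOn ε p q z) (h : z p = x p) :
    EqOn z x (Icc p q) := by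
  by_cases hall : ∀ t ∈ Icc p q, z t ∈ M.K
  · exact plusOn_eq_of_mem_K hε hx hz (fun t ht => hall t (Ioo_subset_Icc_self ht))
      ⟨le_rfl, hpq⟩ h
  · push Not at hall
    obtain ⟨t, ht, htK⟩ := hall
    obtain ⟨u, h1, h2, h3, h4⟩ := exists_first_exit M.isOpen_K
      (hz.cont.mono (Icc_subset_Icc_right ht.2)) (by rw [h]; exact hxK p ⟨le_rfl, hpq⟩) ht.1 htK
    have := plusOn_eq_of_mem_K hε hx (hz.mono le_rfl (h2.trans ht.2))
      (fun v hv => h4 v ⟨hv.1.le, hv.2⟩) ⟨le_rfl, h1.le⟩ h ⟨h1.le, le_rfl⟩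
    exact absurd (this ▸ hxK u ⟨h1.le, h2.trans ht.2⟩) h3

theorem plusOn_eq_backward {ε p q : ℝ} {x z : ℝ → Plane} (hε : ε ∈ Icc 0 M.ε₁) (hx : M.Sol ε x)
    (hpq : p ≤ q) (hxK : ∀ t ∈ Icc p q, x t ∈ M.K) (hz : S.PlusOn ε p q z) (h : z q = x q) :
    EqOn z x (Icc p q) := by
  by_cases hall : ∀ t ∈ Icc p q, z t ∈ M.K
  · exact plusOn_eq_of_mem_K hε hx hz (fun t ht => hall t (Ioo_subset_Icc_self ht))
      ⟨hpq, le_rfl⟩ h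
  · push Not at hall
    obtain ⟨t, ht, htK⟩ := hall
    obtain ⟨u, h1, h2, h3, h4⟩ := exists_last_exit M.isOpen_K
      (hz.cont.mono (Icc_subset_Icc_left ht.1)) (by rw [h]; exact hxK q ⟨hpq, le_rfl⟩) ht.2 htK
    have := plusOn_eq_of_mem_K hε hx (hz.mono (ht.1.trans h1) le_rfl)
      (fun v hv => h4 v ⟨hv.1, hv.2.le⟩) ⟨h2.le, le_rfl⟩ h ⟨le_rfl, h2.le⟩
    exact absurd (this ▸ hxK u ⟨ht.1.trans h1, h2.le⟩) h3

variable {T : ℝ}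

/-- The solutions of the stable leaf follow the homoclinic orbit. -/
theorem GoodTime.leaf (hT : M.GoodTime T) {ρ' : ℝ} (hρ' : 0 < ρ') : ∃ ρ > 0, ∀ ε ∈ Icc 0 M.ε₁,
    ε ≤ ρ → ∀ τ y, S.IsLeaf ε τ y → M.Traj ε τ y ∧ ‖y τ - γ 0‖ ≤ ρ' ∧ (∀ t ≥ τ, y t ∈ M.K) ∧
      ∀ t ≥ τ + T, y t ∈ M.Z ∧ |M.U (y t)| ≤ 1 / 4 * M.V (y t) := by
  obtain ⟨ρ, hρ, δ, hδ, hback⟩ := hT.back hρ'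
  refine ⟨ρ, hρ, fun ε hε hερ τ y hy => ?_⟩
  have hV0 : Tendsto (fun t => M.V (y t)) atTop (𝓝 0) := by
    have := (M.V.continuous.tendsto 0).comp hy.tendsto
    rwa [map_zero] at this
  obtain ⟨t₀, ht₀⟩ := eventually_atTop.1 (((hy.tendsto.eventually
    (Metric.ball_mem_nhds 0 M.r_pos)).and (hV0.eventually_le_const hδ)).and
    (eventually_gt_atTop τ))
  have htr : M.Traj ε t₀ y := by
    refine ⟨hy.cont.mono (Ici_subset_Ici.2 (ht₀ t₀ le_rfl).2.le), fun t ht => ?_⟩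
    have h1 := ht₀ t ht.le
    rw [M.F_eq ε hε t _ (M.ball_sub h1.1.1) (Or.inl (hy.mem t h1.2))]
    exact hy.deriv t h1.2
  have hcone₀ := cone_of_tendsto hε htr (fun t ht => (ht₀ t ht).1.1)
    (fun t ht => hy.mem t (ht₀ t ht).2) hy.tendsto
  have hZ₀ : ∀ t ≥ t₀, y t ∈ M.Z := fun t ht =>
    mem_Z_of_cone (ht₀ t ht).1.1 (hcone₀ t ht).1
      (by linarith [(hcone₀ t ht).1, (hcone₀ t ht).2])
  obtain ⟨x, hx, hxt⟩ := exists_sol hε t₀ (y t₀)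
  obtain ⟨τ', hτ', hO, hnear, hOp, hK, hZ⟩ := hback ε hε hερ x t₀ hx (by rw [hxt]; exact hZ₀ t₀ le_rfl)
    (by rw [hxt]; exact (ht₀ t₀ le_rfl).1.2)
  have hτt := (ht₀ t₀ le_rfl).2
  have hTp := hT.pos
  have heq : EqOn y x (Icc (max τ τ') t₀) :=
    plusOn_eq_backward hε hx (max_le hτt.le (by linarith))
      (fun t ht => hK t ⟨(le_max_right _ _).trans ht.1, ht.2⟩) (hy.plusOn (le_max_left _ _)) hxt.symm
  -- Both `τ` and `τ'` are the first time, going backward, at which the common curve meets `Ω⁰`.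
  have hττ : τ = τ' := by
    rcases lt_trichotomy τ τ' with h | h | h
    · have := heq (x := τ') ⟨by rw [max_eq_right h.le], by linarith⟩
      exact (PSSystem.Op_disjoint_O0 (hy.mem τ' h) (by rw [this]; exact hO)).elim
    · exact h
    · have := heq (x := τ) ⟨by rw [max_eq_left h.le], hτt.le⟩
      exact (PSSystem.Op_disjoint_O0 (hOp τ ⟨h, hτt⟩) (by rw [← this]; exact hy.start)).elim
  subst hττ
  rw [max_self] at heq
  have hyK : ∀ t ≥ τ, y t ∈ M.K := fun t ht => by
    rcases le_total t t₀ with h | h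
    · rw [heq ⟨ht, h⟩]; exact hK t ⟨ht, h⟩
    · exact M.ball_sub (ht₀ t h).1.1
  have htraj : M.Traj ε τ y := by
    refine ⟨hy.cont, fun t ht => ?_⟩
    rw [M.F_eq ε hε t _ (hyK t ht.le) (Or.inl (hy.mem t ht))]
    exact hy.deriv t ht
  have hball : ∀ t ≥ τ + T, y t ∈ Metric.ball (0 : Plane) M.r := fun t ht => by
    rcases le_total t t₀ with h | h
    · rw [heq ⟨by linarith, h⟩]; exact (hZ t ⟨ht, h⟩).2.1
    · exact (ht₀ t h).1.1
  have hcone := cone_of_tendsto hε (htraj.mono (by linarith : τ ≤ τ + T)) hball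
    (fun t ht => hy.mem t (by linarith)) hy.tendsto
  refine ⟨htraj, ?_, hyK, fun t ht => ⟨mem_Z_of_cone (hball t ht) (hcone t ht).1
    (by linarith [(hcone t ht).1, (hcone t ht).2]), (hcone t ht).2⟩⟩
  rw [heq ⟨le_rfl, hτt.le⟩]
  exact hnear

/-- Two leaf trajectories stay in the cone forever, so `shift` applies with `E = 0` and every `ω >
0`. -/
theorem GoodTime.leaf_unique (hT : M.GoodTime T) : ∃ ρ > 0, ∀ ε ∈ Icc 0 M.ε₁, ε ≤ ρ →
    ∀ τ y y', S.IsLeaf ε τ y → S.IsLeaf ε τ y' → y τ = y' τ := by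
  obtain ⟨ρ₁, hρ₁, B, hB, hshift⟩ := hT.shift
  obtain ⟨ρ₂, hρ₂, hleaf⟩ := hT.leaf hρ₁
  refine ⟨min ρ₁ ρ₂, lt_min hρ₁ hρ₂, fun ε hε hερ τ y y' hy hy' => ?_⟩
  obtain ⟨a1, a2, -, a4⟩ := hleaf ε hε (hερ.trans (min_le_right _ _)) τ y hy
  obtain ⟨b1, b2, -, b4⟩ := hleaf ε hε (hερ.trans (min_le_right _ _)) τ y' hy'
  have key : ∀ ω > 0, ‖y τ - y' τ‖ ≤ B * ω := by
    intro ω hω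
    obtain ⟨t, ht⟩ := eventually_atTop.1 ((hy.tendsto.eventually (Metric.ball_mem_nhds 0 hω)).and
      (hy'.tendsto.eventually (Metric.ball_mem_nhds 0 hω)))
    have h := hshift ε hε ε hε (hερ.trans (min_le_left _ _)) (hερ.trans (min_le_left _ _)) 0 le_rfl
      (fun t z _ _ => by simp) y y' τ (max (t + 1) (τ + T + 2)) ω a1 b1 hy.start hy'.start a2 b2
      (le_max_right _ _) (fun u hu => (a4 u hu.1).1) (fun u hu => (b4 u hu.1).1) (fun u hu => by
        have := ht u (by linarith [le_max_left (t + 1) (τ + T + 2), hu.1])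
        rw [dist_zero_right, dist_zero_right] at this
        exact ⟨this.1.le, this.2.le⟩)
    simpa using h
  have : ‖y τ - y' τ‖ ≤ 0 := by
    refine le_of_forall_pos_le_add fun e he => ?_
    have := key (e / B) (by positivity)
    rwa [mul_div_cancel₀ _ (by linarith : B ≠ 0), ← zero_add e] at this
  exact sub_eq_zero.1 (norm_le_zero_iff.1 this)

/-- Here `shift` compares the leaf with the translate of `γ`, a trajectory for parameter `0`; the
fields differ by `E = C ε`, and `ω` tends to `0`. -/
theorem GoodTime.leaf_close (hT : M.GoodTime T) : ∃ ρ > 0, ∃ B ≥ 1, ∀ ε ∈ Icc 0 M.ε₁, ε ≤ ρ →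
    ∀ τ y, S.IsLeaf ε τ y → ‖y τ - γ 0‖ ≤ B * ε := by
  obtain ⟨ρ₁, hρ₁, B, hB, hshift⟩ := hT.shift
  obtain ⟨ρ₂, hρ₂, hleaf⟩ := hT.leaf hρ₁
  have hC1 := M.one_le_C
  refine ⟨min ρ₁ ρ₂, lt_min hρ₁ hρ₂, B * M.C, by nlinarith, fun ε hε hερ τ y hy => ?_⟩
  obtain ⟨a1, a2, -, a4⟩ := hleaf ε hε (hερ.trans (min_le_right _ _)) τ y hy
  have key : ∀ ω > 0, ‖y τ - γ 0‖ ≤ B * (M.C * ε + ω) := by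
    intro ω hω
    have hγ0 : Tendsto (fun t => γ (t - τ)) atTop (𝓝 0) :=
      M.γ_tendsto.comp (tendsto_atTop_add_const_right _ (-τ) tendsto_id)
    obtain ⟨t, ht⟩ := eventually_atTop.1 ((hy.tendsto.eventually (Metric.ball_mem_nhds 0 hω)).and
      (hγ0.eventually (Metric.ball_mem_nhds 0 hω)))
    have h := hshift ε hε 0 zero_mem_Icc (hερ.trans (min_le_left _ _)) hρ₁.le (M.C * ε)
      (mul_nonneg C_pos.le hε.1)
      (fun t z hz hD => M.F_var ε hε t z hz hD) y (fun t => γ (t - τ)) τ (max (t + 1) (τ + T + 2)) ω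
      a1 (M.γ_traj τ) hy.start (by simpa using M.γ_zero) a2 (by simpa using hρ₁.le)
      (le_max_right _ _) (fun u hu => (a4 u hu.1).1)
      (fun u hu => hT.mem_Z (by linarith [hu.1])) (fun u hu => by
        have := ht u (by linarith [le_max_left (t + 1) (τ + T + 2), hu.1])
        rw [dist_zero_right, dist_zero_right] at this
        exact ⟨this.1.le, this.2.le⟩)
    simpa using h
  refine le_of_forall_pos_le_add fun e he => ?_
  have := key (e / B) (by positivity)
  rwa [mul_add, mul_div_cancel₀ _ (by linarith : B ≠ 0), ← mul_assoc] at this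

/-! ### Shooting -/

/-- The cone in which the exit from the neighbourhood of the stable direction is observed. -/
def W (M : SaddleModel S γ) : Set Plane :=
  {x | x ∈ Metric.ball (0 : Plane) M.r ∧ 0 < M.V x ∧ |M.U x| < 3 / 4 * M.V x}

theorem isOpen_W (M : SaddleModel S γ) : IsOpen M.W := by
  refine Metric.isOpen_ball.inter ((isOpen_lt continuous_const M.V.continuous).inter ?_)
  exact isOpen_lt M.U.continuous.abs (continuous_const.mul M.V.continuous)

theorem W_subset_Op : M.W ⊆ S.Op := fun x hx =>
  mem_Op_of_cone hx.1 hx.2.1 (by linarith [neg_abs_le (M.U x), hx.2.2])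

theorem W_subset_Z : M.W ⊆ M.Z := fun _ hx => mem_Z_of_cone hx.1 hx.2.1 hx.2.2.le

/-- The curve `x` leaves the cone around the stable direction through the side
`sgn * U > V / 2`. -/
def Exits (M : SaddleModel S γ) (sgn T τ : ℝ) (x : ℝ → Plane) : Prop :=
  ∃ t ≥ τ + T, 1 / 2 * M.V (x t) < sgn * M.U (x t) ∧ ∀ u ∈ Icc (τ + T) t, x u ∈ M.W

/-- An exit is witnessed by a compact piece of orbit in the open cone `W` and a strict inequality at
its end, hence it is an open condition. -/
theorem exits_of_close {sgn τ t : ℝ} {x : ℝ → Plane} (hx : Continuous x) (ht : τ + T ≤ t)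
    (h1 : 1 / 2 * M.V (x t) < sgn * M.U (x t)) (h2 : ∀ u ∈ Icc (τ + T) t, x u ∈ M.W) :
    ∃ δ > 0, ∀ τ' x', (∀ u ∈ Icc T (t - τ), ‖x' (τ' + u) - x (τ + u)‖ < δ) →
      M.Exits sgn T τ' x' := by
  have hcomp : IsCompact (x '' Icc (τ + T) t) := isCompact_Icc.image hx
  obtain ⟨δ₁, hδ₁, hth⟩ := hcomp.exists_thickening_subset_open M.isOpen_W
    (by rintro _ ⟨u, hu, rfl⟩; exact h2 u hu)
  have hopen : IsOpen {z : Plane | 1 / 2 * M.V z < sgn * M.U z} :=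
    isOpen_lt (continuous_const.mul M.V.continuous) (continuous_const.mul M.U.continuous)
  obtain ⟨δ₂, hδ₂, hball⟩ := Metric.isOpen_iff.1 hopen (x t) h1
  refine ⟨min δ₁ δ₂, lt_min hδ₁ hδ₂, fun τ' x' hx' => ⟨τ' + (t - τ), by linarith, ?_, ?_⟩⟩
  · refine hball ?_
    rw [Metric.mem_ball, dist_eq_norm]
    have := hx' (t - τ) ⟨by linarith, le_rfl⟩
    rw [add_sub_cancel] at this
    exact this.trans_le (min_le_right _ _)
  · intro u hu
    refine hth (Metric.mem_thickening_iff.2 ⟨x (τ + (u - τ')),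
      ⟨_, ⟨by linarith [hu.1], by linarith [hu.2]⟩, rfl⟩, ?_⟩)
    have := hx' (u - τ') ⟨by linarith [hu.1], by linarith [hu.2]⟩
    rw [add_sub_cancel] at this
    rw [dist_eq_norm]
    exact this.trans_le (min_le_left _ _)

theorem Traj.saddleIneq {ε τ s t : ℝ} {x : ℝ → Plane} (hε : ε ∈ Icc 0 M.ε₁) (hx : M.Traj ε τ x)
    (hs : τ ≤ s) (hZ : ∀ u ∈ Ioo s t, x u ∈ M.Z) :
    SaddleIneq M.a M.b M.η 0 s t (fun u => M.U (x u)) (fun u => M.V (x u)) :=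
  saddleIneq_zero hε (hx.contIcc hs) (fun u hu => hx.deriv u (hs.trans_lt hu.1))
    fun u hu => ⟨(hZ u hu).1, (hZ u hu).2.1⟩

/-- Between two exits on opposite sides `U` would vanish. But `U² - V² / 4` increases and is
positive from the first exit on. -/
theorem not_exits_both {ε τ : ℝ} {x : ℝ → Plane} (hε : ε ∈ Icc 0 M.ε₁) (hx : M.Sol ε x)
    (h : M.Exits 1 T τ x) (h' : M.Exits (-1) T τ x) : False := by
  have key : ∀ s t sgn : ℝ, sgn = 1 ∨ sgn = -1 → s ≤ t → 1 / 2 * M.V (x s) < sgn * M.U (x s) →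
      1 / 2 * M.V (x t) < -sgn * M.U (x t) → (∀ u ∈ Icc s t, x u ∈ M.W) → False := by
    intro s t sgn hsgn hst hs ht hW
    have hU : ContinuousOn (fun u => sgn * M.U (x u)) (Icc s t) :=
      (continuous_const.mul (M.U.continuous.comp hx.continuous)).continuousOn
    have hVs := (hW s ⟨le_rfl, hst⟩).2.1
    have hVt := (hW t ⟨hst, le_rfl⟩).2.1
    have h0I : (0 : ℝ) ∈ Icc (sgn * M.U (x t)) (sgn * M.U (x s)) := ⟨by linarith, by linarith⟩
    obtain ⟨u, hu, h0⟩ := intermediate_value_Icc' hst hU h0I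
    have h0' : M.U (x u) = 0 := by
      rcases hsgn with rfl | rfl <;> simpa using h0
    have hI := (hx.traj s).saddleIneq (t := u) hε le_rfl fun v hv =>
      W_subset_Z (hW v ⟨hv.1.le, hv.2.le.trans hu.2⟩)
    have h1 := hI.sq_sub_le M.η_pos.le M.η_le_a M.η_le_b hu.1 (q := 1 / 4) (by norm_num)
      (by norm_num)
    rw [h0'] at h1
    have h2 : (1 / 2 * M.V (x s)) ^ 2 < (sgn * M.U (x s)) ^ 2 :=
      pow_lt_pow_left₀ hs (by linarith) two_ne_zero
    have h3 : sgn ^ 2 = 1 := by rcases hsgn with rfl | rfl <;> norm_num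
    rw [mul_pow, mul_pow, h3, one_mul] at h2
    linarith [sq_nonneg (M.V (x u))]
  obtain ⟨t, ht, h1, h2⟩ := h
  obtain ⟨t', ht', h1', h2'⟩ := h'
  rcases le_total t t' with hle | hle
  · exact key t t' 1 (Or.inl rfl) hle h1 h1' fun u hu => h2' u ⟨ht.trans hu.1, hu.2⟩
  · exact key t' t (-1) (Or.inr rfl) hle h1' (by simpa using h1) fun u hu => h2 u ⟨ht'.trans hu.1, hu.2⟩

/-- Without an exit `|U| ≤ V / 2` as long as the orbit is in `W`, which is strictly inside `|U| < 3V
/ 4`; `V` stays positive and decreases, so the orbit never leaves `W` and converges to `0`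
exponentially. -/
theorem GoodTime.stay (hT : M.GoodTime T) {ε τ : ℝ} {x : ℝ → Plane} (hε : ε ∈ Icc 0 M.ε₁)
    (hx : M.Sol ε x) (h0 : x (τ + T) ∈ M.W) (hV : M.V (x (τ + T)) < 2 * M.V (γ T))
    (hR : ¬ M.Exits (-1) T τ x) (hL : ¬ M.Exits 1 T τ x) :
    (∀ t ≥ τ + T, x t ∈ M.W) ∧ Tendsto x atTop (𝓝 0) := by
  have hhalf : ∀ t ≥ τ + T, (∀ u ∈ Icc (τ + T) t, x u ∈ M.W) →
      |M.U (x t)| ≤ 1 / 2 * M.V (x t) := by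
    intro t ht hW
    by_contra hcon
    push Not at hcon
    rcases le_total 0 (M.U (x t)) with h | h
    · rw [abs_of_nonneg h] at hcon
      exact hL ⟨t, ht, by linarith, hW⟩
    · rw [abs_of_nonpos h] at hcon
      exact hR ⟨t, ht, by linarith, hW⟩
  have hW : ∀ t ≥ τ + T, x t ∈ M.W := by
    by_contra hcon
    push Not at hcon
    obtain ⟨t, ht, htW⟩ := hcon
    obtain ⟨u, h1, h2, h3, h4⟩ := exists_first_exit M.isOpen_W hx.continuous.continuousOn h0 ht htW
    have hI := (hx.traj (τ + T)).saddleIneq (t := u) hε le_rfl fun v hv =>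
      W_subset_Z (h4 v ⟨hv.1.le, hv.2⟩)
    have hcone : ∀ v ∈ Ioo (τ + T) u, |M.U (x v)| ≤ 2 * |M.V (x v)| := fun v hv => by
      have := (h4 v ⟨hv.1.le, hv.2⟩).2
      rw [abs_of_pos this.1]; linarith
    have c1 := hI.contract M.η_pos.le h1.le hcone
    have c2 := hI.contract_ge M.η_pos.le h1.le hcone
    have hVp := h0.2.1
    have hcV : Continuous fun v => M.V (x v) := M.V.continuous.comp hx.continuous
    have hcU : Continuous fun v => M.U (x v) := M.U.continuous.comp hx.continuous
    have hVu0 : 0 ≤ M.V (x u) := nonneg_right_of_Ioo (f := fun v => M.V (x v)) h1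
      hcV.continuousWithinAt fun v hv => (h4 v ⟨hv.1.le, hv.2⟩).2.1.le
    have hUu : 0 ≤ 1 / 2 * M.V (x u) - |M.U (x u)| :=
      nonneg_right_of_Ioo (f := fun v => 1 / 2 * M.V (x v) - |M.U (x v)|) h1
        ((hcV.const_mul _).sub hcU.abs).continuousWithinAt fun v hv => by
          have := hhalf v hv.1.le fun w hw => h4 w ⟨hw.1, hw.2.trans_lt hv.2⟩
          linarith
    rw [abs_of_nonneg hVu0, abs_of_pos hVp] at c1 c2
    have hVu : 0 < M.V (x u) := (mul_pos hVp (Real.exp_pos _)).trans_le c2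
    have hVle : M.V (x u) ≤ M.V (x (τ + T)) := c1.trans (mul_le_of_le_one_right hVp.le (by
      rw [Real.exp_le_one_iff]
      have : 0 ≤ M.a - 3 * M.η := by linarith [M.η_le_a, M.η_pos]
      linarith [mul_nonneg this (sub_nonneg.2 h1.le)]))
    refine h3 ⟨?_, hVu, by linarith⟩
    rw [mem_ball_zero_iff]
    have h5 := norm_le_of_cone hVu0 (by linarith : |M.U (x u)| ≤ 1 / 2 * M.V (x u))
    have h6 := hT.small
    have h7 : M.C * M.V (x u) ≤ M.C * (2 * M.V (γ T)) :=
      mul_le_mul_of_nonneg_left (by linarith) C_pos.le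
    have h8 : 0 ≤ M.C * M.V (γ T) := mul_nonneg C_pos.le (by linarith)
    linarith
  refine ⟨hW, ?_⟩
  have hrate : 0 < M.a - 3 * M.η := by linarith [M.η_le_a, M.η_pos]
  have hbd : ∀ t ≥ τ + T, ‖x t‖ ≤ 3 * M.C * (M.V (x (τ + T)) *
      Real.exp (-((M.a - 3 * M.η) * (t - (τ + T))))) := by
    intro t ht
    have h1 := (V_contract hε hx.continuous.continuousOn (fun u _ => hx u)
      (fun u hu => W_subset_Z (hW u hu.1)) ht).1
    exact (norm_le_of_mem_Z (W_subset_Z (hW t ht))).trans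
      (mul_le_mul_of_nonneg_left h1 (by linarith [C_pos (M := M)]))
  have hlim : Tendsto (fun t => 3 * M.C * (M.V (x (τ + T)) *
      Real.exp (-((M.a - 3 * M.η) * (t - (τ + T)))))) atTop (𝓝 0) := by
    have h1 : Tendsto (fun t : ℝ => (M.a - 3 * M.η) * (t - (τ + T))) atTop atTop :=
      (tendsto_atTop_add_const_right _ (-(τ + T)) tendsto_id).const_mul_atTop hrate
    have h2 := (Real.tendsto_exp_neg_atTop_nhds_zero.comp h1).const_mul (M.V (x (τ + T)))
    have h3 := h2.const_mul (3 * M.C)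
    simpa using h3
  exact squeeze_zero_norm' ((eventually_ge_atTop (τ + T)).mono hbd) hlim

/-- A trajectory from `Ω⁰` near `γ 0` which does not leave the cone around the stable direction
belongs to the stable leaf. -/
theorem GoodTime.isLeaf_of_not_exits (hT : M.GoodTime T) : ∃ ρ > 0, ∀ ε ∈ Icc 0 M.ε₁, ε ≤ ρ →
    ∀ τ x, M.Sol ε x → x τ ∈ S.O0 → ‖x τ - γ 0‖ ≤ ρ → ¬ M.Exits (-1) T τ x →
    ¬ M.Exits 1 T τ x → S.IsLeaf ε τ x := by
  obtain ⟨ρ, hρ, B, -, htrack⟩ := hT.track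
  refine ⟨ρ, hρ, fun ε hε hερ τ x hx hx0 hxρ hR hL => ?_⟩
  obtain ⟨h1, h2, h3⟩ := htrack ε hε hερ x τ (hx.traj τ) hx0 hxρ
  obtain ⟨g1, g2, g3, g4, -⟩ := h3 (τ + T) ⟨le_rfl, by linarith⟩
  obtain ⟨h4, h5⟩ := hT.stay hε hx ⟨g1, g2, by linarith⟩ g4 hR hL
  have hOp : ∀ t > τ, x t ∈ S.Op := fun t ht => by
    rcases le_total t (τ + T) with h | h
    · exact h1 t ⟨ht, by linarith⟩
    · exact W_subset_Op (h4 t h)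
  refine ⟨hx.continuous.continuousOn, hx0, hOp, fun t ht => ?_, h5⟩
  have hK : x t ∈ M.K := by
    rcases le_total t (τ + T) with h | h
    · exact (h2 t ⟨ht.le, by linarith⟩).1
    · exact M.ball_sub (h4 t h).1
  rw [← M.F_eq ε hε t _ hK (Or.inl (hOp t ht))]
  exact hx t

/-- A trajectory that leaves the cone on the side `U < 0` arrives at `Ω⁰`. -/
theorem GoodTime.arrive (hT : M.GoodTime T) : ∃ ρ > 0, ∀ ε ∈ Icc 0 M.ε₁, ε ≤ ρ →
    ∀ τ x, M.Sol ε x → x τ ∈ S.O0 → ‖x τ - γ 0‖ ≤ ρ → M.Exits (-1) T τ x →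
    ∃ t ≥ τ + T, x t ∈ S.O0 ∧ M.U (x t) < 0 ∧ (∀ u ∈ Ioo τ t, x u ∈ S.Op) ∧
      (∀ u ∈ Icc τ t, x u ∈ M.K) ∧ ∀ u ∈ Icc (τ + T) t, x u ∈ M.Z := by
  obtain ⟨ρ, hρ, B, -, htrack⟩ := hT.track
  refine ⟨ρ, hρ, fun ε hε hερ τ x hx hx0 hxρ ⟨t, ht, hU, hW⟩ => ?_⟩
  obtain ⟨h1, h2, h3⟩ := htrack ε hε hερ x τ (hx.traj τ) hx0 hxρ
  obtain ⟨-, -, -, g4, -⟩ := h3 (τ + T) ⟨le_rfl, by linarith⟩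
  have hWt := hW t ⟨ht, le_rfl⟩
  have hVle : M.V (x t) ≤ M.V (x (τ + T)) := by
    have c1 := (V_contract hε hx.continuous.continuousOn (fun u _ => hx u)
      (fun u hu => W_subset_Z (hW u hu)) ht).1
    refine c1.trans (mul_le_of_le_one_right (hW _ ⟨le_rfl, ht⟩).2.1.le ?_)
    rw [Real.exp_le_one_iff]
    have : 0 ≤ M.a - 3 * M.η := by linarith [M.η_le_a, M.η_pos]
    linarith [mul_nonneg this (sub_nonneg.2 ht)]
  have h7 : M.C * M.V (x t) ≤ M.C * (2 * M.V (γ T)) :=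
    mul_le_mul_of_nonneg_left (by linarith) C_pos.le
  have h8 := hT.small
  have h9 : 0 < M.C * M.V (x t) := mul_pos C_pos hWt.2.1
  obtain ⟨u, hu1, hu2, hu3, hu4⟩ := exit_right hε (hx.traj t) le_rfl hWt.2.1 (by linarith)
    (by linarith) (by linarith [neg_abs_le (M.U (x t)), hWt.2.2])
  have hTp := hT.pos
  refine ⟨u, by linarith, hu2, (hu3 u ⟨hu1.le, le_rfl⟩).2, fun v hv => ?_, fun v hv => ?_,
    fun v hv => ?_⟩
  · rcases le_total v (τ + T) with h | h
    · exact h1 v ⟨hv.1, by linarith⟩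
    · rcases le_total v t with h' | h'
      · exact W_subset_Op (hW v ⟨h, h'⟩)
      · exact hu4 v ⟨h', hv.2⟩
  · rcases le_total v (τ + T) with h | h
    · exact (h2 v ⟨hv.1, by linarith⟩).1
    · rcases le_total v t with h' | h'
      · exact M.ball_sub (hW v ⟨h, h'⟩).1
      · exact M.ball_sub (hu3 v ⟨h', hv.2⟩).1.2.1
  · rcases le_total v t with h' | h'
    · exact W_subset_Z (hW v ⟨hv.1, h'⟩)
    · exact (hu3 v ⟨h', hv.2⟩).1

/-- Between an initial point leaving to the left and one leaving to the right there is one that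
stays in the cone. -/
theorem exists_not_exits {ε τ h₁ h₂ : ℝ} {P : ℝ → Plane} {X : ℝ → ℝ → Plane}
    (hε : ε ∈ Icc 0 M.ε₁) (hP : ContinuousOn P (Icc h₁ h₂)) (h12 : h₁ ≤ h₂)
    (hX : ∀ h, M.Sol ε (X h)) (hXP : ∀ h, X h τ = P h) (hT0 : 0 ≤ T)
    (hR : M.Exits (-1) T τ (X h₁)) (hL : M.Exits 1 T τ (X h₂)) :
    ∃ h ∈ Icc h₁ h₂, ¬ M.Exits (-1) T τ (X h) ∧ ¬ M.Exits 1 T τ (X h) := by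
  have hopen : ∀ sgn : ℝ, ∀ h ∈ Icc h₁ h₂, M.Exits sgn T τ (X h) →
      ∃ δ > 0, ∀ h' ∈ Icc h₁ h₂, |h' - h| < δ → M.Exits sgn T τ (X h') := by
    rintro sgn h hh ⟨t, ht, h1, h2⟩
    obtain ⟨δ, hδ, hcl⟩ := exits_of_close (hX h).continuous ht h1 h2
    set E := Real.exp ((M.L + 1) * (t - τ)) with hE
    have hEp : 0 < E := Real.exp_pos _
    obtain ⟨δ', hδ', hPc⟩ := Metric.continuousOn_iff.1 hP h hh (δ / E) (by positivity)
    refine ⟨δ', hδ', fun h' hh' hd => hcl τ _ fun u hu => ?_⟩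
    have h3 := (hX h').norm_sub_le (hX h) hε (τ + u) τ
    rw [hXP, hXP, add_sub_cancel_left, abs_of_nonneg (by linarith [hu.1])] at h3
    have h4 : ‖P h' - P h‖ < δ / E := by
      have := hPc h' hh' (by rwa [Real.dist_eq])
      rwa [dist_eq_norm] at this
    have h5 : Real.exp ((M.L + 1) * u) ≤ E :=
      Real.exp_le_exp.2 (mul_le_mul_of_nonneg_left hu.2 (by positivity))
    calc _ ≤ _ := h3
      _ ≤ ‖P h' - P h‖ * E := mul_le_mul_of_nonneg_left h5 (norm_nonneg _)
      _ < δ / E * E := mul_lt_mul_of_pos_right h4 hEp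
      _ = δ := div_mul_cancel₀ _ hEp.ne'
  by_contra hcon
  push Not at hcon
  -- The two exit sets are open, disjoint and nonempty; if they covered the interval, the supremum
  -- of the first could belong to neither.
  set A := {h ∈ Icc h₁ h₂ | M.Exits (-1) T τ (X h)} with hA
  have hAne : A.Nonempty := ⟨h₁, ⟨le_rfl, h12⟩, hR⟩
  have hAbd : BddAbove A := ⟨h₂, fun h hh => hh.1.2⟩
  have hmem : sSup A ∈ Icc h₁ h₂ :=
    ⟨le_csSup hAbd ⟨⟨le_rfl, h12⟩, hR⟩, csSup_le hAne fun h hh => hh.1.2⟩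
  by_cases hS : M.Exits (-1) T τ (X (sSup A))
  · obtain ⟨δ, hδ, hδ'⟩ := hopen (-1) _ hmem hS
    have hlt : sSup A < h₂ := hmem.2.lt_of_ne fun h => not_exits_both hε (hX _) hL (h ▸ hS)
    set h' := min (sSup A + δ / 2) h₂ with hh'
    have h1 : sSup A < h' := lt_min (by linarith) hlt
    have h2 : h' ∈ Icc h₁ h₂ := ⟨hmem.1.trans h1.le, min_le_right _ _⟩
    have h3 : |h' - sSup A| < δ := by
      rw [abs_of_pos (by linarith)]
      linarith [min_le_left (sSup A + δ / 2) h₂]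
    exact (le_csSup hAbd ⟨h2, hδ' h' h2 h3⟩).not_gt h1
  · have hS' := hcon _ hmem hS
    obtain ⟨δ, hδ, hδ'⟩ := hopen 1 _ hmem hS'
    obtain ⟨h, hh, hlt⟩ := exists_lt_of_lt_csSup hAne (by linarith : sSup A - δ < sSup A)
    have hle := le_csSup hAbd hh
    exact not_exits_both hε (hX h) (hδ' h hh.1 (abs_lt.2 ⟨by linarith, by linarith⟩)) hh.2

/-- Exits of the unperturbed system persist. -/
theorem GoodTime.exits_persist (hT : M.GoodTime T) : ∃ ρ > 0, ∀ sgn : ℝ, ∀ x₀, M.Sol 0 x₀ →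
    x₀ 0 ∈ S.O0 → ‖x₀ 0 - γ 0‖ ≤ ρ → M.Exits sgn T 0 x₀ →
    ∃ ε₂ > 0, ∀ ε ∈ Icc 0 M.ε₁, ε ≤ ε₂ → ∀ τ x, M.Sol ε x → x τ = x₀ 0 → M.Exits sgn T τ x := by
  obtain ⟨ρ, hρ, B, -, htrack⟩ := hT.track
  refine ⟨ρ, hρ, fun sgn x₀ hx₀ h0 hnear ⟨t, ht, hU, hW⟩ => ?_⟩
  obtain ⟨h1, h2, h3⟩ := htrack 0 zero_mem_Icc hρ.le x₀ 0 (hx₀.traj 0) h0 hnear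
  obtain ⟨δ, hδ, hcl⟩ := exits_of_close hx₀.continuous ht hU hW
  have hTp := hT.pos
  rw [zero_add] at ht hW
  have hDK : ∀ u ∈ Ioo 0 t, x₀ u ∈ M.K ∧ x₀ u ∈ S.Dp := by
    intro u hu
    rcases le_total u T with h | h
    · exact ⟨(h2 u ⟨hu.1.le, by linarith⟩).1, Or.inl (h1 u ⟨hu.1, by linarith⟩)⟩
    · exact ⟨M.ball_sub (hW u ⟨h, hu.2.le⟩).1, Or.inl (W_subset_Op (hW u ⟨h, hu.2.le⟩))⟩
  set E := M.C * Real.exp ((M.L + 1) * t) with hE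
  have hEp : 0 < E := mul_pos C_pos (Real.exp_pos _)
  refine ⟨δ / (2 * E), by positivity, fun ε hε hεδ τ x hx hxτ => hcl τ x fun u hu => ?_⟩
  have hut : u ≤ t := by linarith [hu.2]
  have hy : ∀ v, HasDerivAt (fun w => x₀ (w - τ)) (M.F 0 (v - τ) (x₀ (v - τ))) v := fun v =>
    (hx₀ (v - τ)).comp_sub_const v τ
  have h4 := norm_sub_le_exp (s := τ) (t := τ + t) (x := x) (y := fun w => x₀ (w - τ)) hε
    (mul_nonneg C_pos.le hε.1 : 0 ≤ M.C * ε) hx.continuous.continuousOn (fun v _ => hx v)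
    (hx₀.continuous.comp (by fun_prop)).continuousOn (fun v _ => hy v)
    (fun v hv => by
      obtain ⟨hK, hD⟩ := hDK (v - τ) ⟨by linarith [hv.1], by linarith [hv.2]⟩
      have e1 := M.F_var ε hε v _ hK hD
      have e2 := M.F_shift 0 zero_mem_Icc v (v - τ) _ hK hD
      rw [mul_zero, zero_mul, norm_le_zero_iff, sub_eq_zero] at e2
      rwa [e2] at e1)
    (u := τ + u) (v := τ) ⟨by linarith [hu.1], by linarith⟩ ⟨le_rfl, by linarith⟩
  rw [sub_self, hxτ, sub_self, norm_zero, zero_add, add_sub_cancel_left,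
    abs_of_nonneg (by linarith [hu.1])] at h4
  rw [zero_add]
  have h5 : Real.exp ((M.L + 1) * u) ≤ Real.exp ((M.L + 1) * t) :=
    Real.exp_le_exp.2 (mul_le_mul_of_nonneg_left hut (by positivity))
  have h6 : M.C * ε * Real.exp ((M.L + 1) * u) ≤ E * ε := by
    rw [hE, mul_right_comm]
    exact mul_le_mul_of_nonneg_right (mul_le_mul_of_nonneg_left h5 C_pos.le) hε.1 |>.trans'
      (by rw [mul_right_comm])
  rw [le_div_iff₀ (by positivity)] at hεδ
  linarith

end SaddleModel

/-! ### Quantitative estimates near the leaf -/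

namespace SaddleModel
variable {S : PSSystem} {γ : ℝ → Plane} {M : SaddleModel S γ} {T : ℝ}

theorem Traj.norm_sub_le_exp {ε τ h : ℝ} {x y : ℝ → Plane} (hε : ε ∈ Icc 0 M.ε₁)
    (hx : M.Traj ε τ x) (hy : M.Traj ε τ y) {u : ℝ} (hu : u ∈ Icc τ (τ + h)) :
    ‖x u - y u‖ ≤ Real.exp ((M.L + 1) * h) * ‖x τ - y τ‖ := by
  have h1 := SaddleModel.norm_sub_le_exp (s := τ) (t := τ + h) (x := x) (y := y) hε le_rfl
    (hx.contIcc le_rfl) (fun v hv => hx.deriv v hv.1) (hy.contIcc le_rfl)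
    (fun v hv => hy.deriv v hv.1) (by simp) hu ⟨le_rfl, hu.1.trans hu.2⟩
  rw [add_zero, mul_comm, abs_of_nonneg (sub_nonneg.2 hu.1)] at h1
  refine h1.trans (mul_le_mul_of_nonneg_right (Real.exp_le_exp.2 ?_) (norm_nonneg _))
  exact mul_le_mul_of_nonneg_left (by linarith [hu.2]) (by positivity)

theorem U_lt_of_mem_O0 {x : Plane} (hx : x ∈ M.Z) (h0 : x ∈ S.O0) :
    M.U x ≤ -(97 / 100 * M.V x) := by
  have h1 := (abs_le.1 (M.G_near x hx.2.1)).1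
  rw [h0.2, abs_of_pos hx.2.2.1] at h1
  have h2 : M.η * (|M.U x| + M.V x) ≤ 1 / 100 * (3 * M.V x) :=
    mul_le_mul (by linarith [M.η_le]) (by linarith [hx.2.2.2])
      (by linarith [abs_nonneg (M.U x), hx.2.2.1]) (by norm_num)
  linarith

/-- No exponential in the length of the interval appears: hyperbolicity bounds the stable component
by its initial value and the unstable one by its final value. -/
theorem norm_sub_le_of_Z {ε τ s t : ℝ} {x y : ℝ → Plane} (hε : ε ∈ Icc 0 M.ε₁)
    (hx : M.Traj ε τ x) (hy : M.Traj ε τ y) (hs : τ ≤ s) (hxZ : ∀ u ∈ Icc s t, x u ∈ M.Z)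
    (hyZ : ∀ u ∈ Icc s t, y u ∈ M.Z) {u : ℝ} (hu : u ∈ Icc s t) :
    ‖x u - y u‖ ≤ 2 * M.C * (M.C * ‖x s - y s‖ + |M.U (x t - y t)|) := by
  have hI := saddleIneq_pair (s := s) (t := t) hε (hx.contIcc hs)
    (fun v hv => hx.deriv v (hs.trans_lt hv.1)) (hy.contIcc hs)
    (fun v hv => hy.deriv v (hs.trans_lt hv.1))
    (fun v hv => ⟨(hxZ v (Ioo_subset_Icc_self hv)).1, (hxZ v (Ioo_subset_Icc_self hv)).2.1⟩)
    (fun v hv => ⟨(hyZ v (Ioo_subset_Icc_self hv)).1, (hyZ v (Ioo_subset_Icc_self hv)).2.1⟩)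
  have h1 := hI.abs_add_abs_le M.η_pos.le M.η_le_a M.η_le_b hu
  have h2 := M.V_le (x s - y s)
  calc _ ≤ _ := M.norm_le (x u - y u)
    _ ≤ M.C * (2 * (M.C * ‖x s - y s‖ + |M.U (x t - y t)|)) :=
      mul_le_mul_of_nonneg_left (by linarith) C_pos.le
    _ = _ := by ring

/-- The exponent of the forward estimate. -/
noncomputable def expFwd (M : SaddleModel S γ) : ℝ := (M.a - 3 * M.η) / (M.a + M.b + 5 * M.η)

/-- The exponent of the backward estimate. -/
noncomputable def expBwd (M : SaddleModel S γ) : ℝ := (M.a - 3 * M.η) / (M.a + 3 * M.η)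

theorem rate_pos (M : SaddleModel S γ) : 0 < M.a - 3 * M.η := by
  linarith [M.η_le_a, M.η_pos]

theorem expFwd_mem (M : SaddleModel S γ) : 0 < M.expFwd ∧ M.expFwd ≤ 1 := by
  have h1 := M.rate_pos
  have h2 := M.η_pos
  have h3 := M.b_pos
  have h4 : 0 < M.a + M.b + 5 * M.η := by linarith
  exact ⟨div_pos h1 h4, (div_le_one h4).2 (by linarith)⟩

theorem expBwd_mem (M : SaddleModel S γ) : 0 < M.expBwd ∧ M.expBwd ≤ 1 := by
  have h1 := M.rate_pos
  have h2 := M.η_pos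
  have h4 : 0 < M.a + 3 * M.η := by linarith
  exact ⟨div_pos h1 h4, (div_le_one h4).2 (by linarith)⟩

theorem exp_neg_mul_eq_rpow {p q N : ℝ} (hq : 0 < q) :
    Real.exp (-(p * N)) = Real.exp (-(q * N)) ^ (p / q) := by
  rw [← Real.exp_mul]
  congr 1
  field_simp

/-- Until its arrival at `Ω⁰`, a trajectory which starts at a distance at most `d` from the stable
leaf stays close to the leaf. -/
theorem GoodTime.forward_estimate (hT : M.GoodTime T) : ∃ ρ > 0, ∃ B > 0, ∀ ε ∈ Icc 0 M.ε₁, ε ≤ ρ →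
    ∀ τ t x y d, M.Traj ε τ x → x τ ∈ S.O0 → ‖x τ - γ 0‖ ≤ ρ → τ + T ≤ t →
    (∀ u ∈ Icc (τ + T) t, x u ∈ M.Z) → x t ∈ S.O0 → M.Traj ε τ y → y τ ∈ S.O0 →
    ‖y τ - γ 0‖ ≤ ρ → (∀ u ≥ τ + T, y u ∈ M.Z ∧ |M.U (y u)| ≤ 1 / 4 * M.V (y u)) →
    ‖x τ - y τ‖ ≤ d → 0 < d → d ≤ 1 →
    ‖x t‖ ≤ B * d ^ M.expFwd ∧ ∀ u ∈ Icc τ t, ‖x u - y u‖ ≤ B * d ^ M.expFwd := by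
  obtain ⟨ρ, hρ, _, _, htrack⟩ := hT.track
  have hC := C_pos (M := M)
  set X := Real.exp ((M.L + 1) * T) with hX
  have hX1 : 1 ≤ X := Real.one_le_exp (mul_nonneg (by positivity) hT.pos.le)
  set v₀ := M.V (γ (T + 1)) / 2 with hv₀
  have hv₀p : 0 < v₀ := half_pos (hT.cone (T + 1) (by linarith)).2.1
  set s₀ := 2 * M.V (γ T) with hs₀
  have hs₀p : 0 < s₀ := mul_pos two_pos (hT.cone T le_rfl).2.1
  set H := 4 * M.C * X / (7 / 10 * v₀) with hH
  have hHp : 0 < H := by positivity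
  set p := M.expFwd with hp
  obtain ⟨hp0, hp1⟩ := M.expFwd_mem
  set A := s₀ * H ^ p with hA
  have hAp : 0 < A := mul_pos hs₀p (Real.rpow_pos_of_pos hHp p)
  refine ⟨ρ, hρ, 3 * M.C * A + (X + 2 * M.C * (M.C * X + 3 * A)), by positivity, ?_⟩
  intro ε hε hερ τ t x y d hx hx0 hxρ hTt hxZ hxt hy hy0 hyρ hyZ hd hd0 hd1
  clear_value s₀ v₀
  have hTp := hT.pos
  have hdp : 0 < d ^ p := Real.rpow_pos_of_pos hd0 p
  have hddp : d ≤ d ^ p := by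
    have := Real.rpow_le_rpow_of_exponent_ge hd0 hd1 hp1
    rwa [Real.rpow_one] at this
  have hs : ∀ u ∈ Icc τ (τ + T), ‖x u - y u‖ ≤ X * d := fun u hu =>
    (hx.norm_sub_le_exp hε hy hu).trans (mul_le_mul_of_nonneg_left hd (by positivity))
  obtain ⟨-, -, hx3⟩ := htrack ε hε hερ x τ hx hx0 hxρ
  obtain ⟨-, -, hy3⟩ := htrack ε hε hερ y τ hy hy0 hyρ
  obtain ⟨-, -, -, hxs, -⟩ := hx3 (τ + T) ⟨le_rfl, by linarith⟩
  obtain ⟨-, -, -, hys, hys'⟩ := hy3 (τ + T) ⟨le_rfl, by linarith⟩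
  have hyZ' : ∀ u ∈ Icc (τ + T) t, y u ∈ M.Z := fun u hu => (hyZ u hu.1).1
  set N := t - (τ + T) with hN
  have hN0 : 0 ≤ N := sub_nonneg.2 hTt
  have hτ : τ ≤ τ + T := by linarith
  obtain ⟨cx, -⟩ := V_contract hε (hx.contIcc hτ) (fun u hu => hx.deriv u (hτ.trans_lt hu.1)) hxZ hTt
  obtain ⟨cy, cy'⟩ := V_contract hε (hy.contIcc hτ) (fun u hu => hy.deriv u (hτ.trans_lt hu.1)) hyZ' hTt
  rw [← hN] at cx cy cy'
  have hI := saddleIneq_pair (s := τ + T) (t := t) hε (hx.contIcc hτ)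
    (fun v hv => hx.deriv v (hτ.trans_lt hv.1)) (hy.contIcc hτ)
    (fun v hv => hy.deriv v (hτ.trans_lt hv.1))
    (fun v hv => ⟨(hxZ v (Ioo_subset_Icc_self hv)).1, (hxZ v (Ioo_subset_Icc_self hv)).2.1⟩)
    (fun v hv => ⟨(hyZ' v (Ioo_subset_Icc_self hv)).1, (hyZ' v (Ioo_subset_Icc_self hv)).2.1⟩)
  have hgr := hI.growth M.η_pos.le M.a_pos.le M.b_pos.le hTt
  simp only [← hN] at hgr
  have hdT := hs (τ + T) ⟨hτ, le_rfl⟩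
  have hUs := (M.U_le (x (τ + T) - y (τ + T))).trans (mul_le_mul_of_nonneg_left hdT hC.le)
  have hVs := (M.V_le (x (τ + T) - y (τ + T))).trans (mul_le_mul_of_nonneg_left hdT hC.le)
  have hgr' : |M.U (x t - y t)| + |M.V (x t - y t)| ≤
      4 * M.C * X * d * Real.exp ((M.b + 2 * M.η) * N) :=
    hgr.trans (mul_le_mul_of_nonneg_right (by linarith) (Real.exp_pos _).le)
  have hxU := U_lt_of_mem_O0 (hxZ t ⟨hTt, le_rfl⟩) hxt
  have hyU := (hyZ t hTt).2
  have hxV := (hxZ t ⟨hTt, le_rfl⟩).2.2.1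
  have hyV := (hyZ' t ⟨hTt, le_rfl⟩).2.2.1
  -- On arrival `U(x) ≤ -0.97 V(x)`, whereas `U(y) ≥ -V(y) / 4`: whichever of `V(x)`, `V(y)` is
  -- larger, the gap in `U` or in `V` is comparable with `V(y)`.
  have hlow : 7 / 10 * M.V (y t) ≤ |M.U (x t - y t)| + |M.V (x t - y t)| := by
    rw [map_sub, map_sub]
    have h1 := neg_le_abs (M.U (x t) - M.U (y t))
    have h2 := neg_le_abs (M.V (x t) - M.V (y t))
    have h3 := le_abs_self (M.V (x t) - M.V (y t))
    have h4 := (abs_le.1 hyU).1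
    rcases le_total (M.V (x t)) (M.V (y t)) with h | h <;> linarith
  have hv : v₀ * Real.exp (-((M.a + 3 * M.η) * N)) ≤ M.V (y t) :=
    (mul_le_mul_of_nonneg_right (by linarith) (Real.exp_pos _).le).trans cy'
  -- The separation is at least of order `e^{-(a+3η)N}` and at most of order `d e^{(b+2η)N}`;
  -- dividing gives the rate `a + b + 5η`, the denominator of `expFwd`.
  have hkey : Real.exp (-((M.a + M.b + 5 * M.η) * N)) ≤ H * d := by
    have e1 : Real.exp (-((M.a + M.b + 5 * M.η) * N)) * Real.exp ((M.b + 2 * M.η) * N) =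
        Real.exp (-((M.a + 3 * M.η) * N)) := by rw [← Real.exp_add]; congr 1; ring
    have h1 : 7 / 10 * v₀ * Real.exp (-((M.a + M.b + 5 * M.η) * N)) *
        Real.exp ((M.b + 2 * M.η) * N) ≤ 4 * M.C * X * d * Real.exp ((M.b + 2 * M.η) * N) := by
      rw [mul_assoc, e1]; linarith
    have h2 := le_of_mul_le_mul_right h1 (Real.exp_pos _)
    rw [hH, div_mul_eq_mul_div, le_div_iff₀ (by positivity)]
    linarith
  have hrate : s₀ * Real.exp (-((M.a - 3 * M.η) * N)) ≤ A * d ^ p := by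
    have hq : 0 < M.a + M.b + 5 * M.η := by linarith [M.a_pos, M.b_pos, M.η_pos]
    rw [exp_neg_mul_eq_rpow hq, hA, mul_assoc, ← Real.mul_rpow hHp.le hd0.le]
    exact mul_le_mul_of_nonneg_left (Real.rpow_le_rpow (Real.exp_pos _).le hkey hp0.le) hs₀p.le
  have hxA : M.V (x t) ≤ A * d ^ p :=
    (cx.trans (mul_le_mul_of_nonneg_right hxs.le (Real.exp_pos _).le)).trans hrate
  have hyA : M.V (y t) ≤ A * d ^ p :=
    (cy.trans (mul_le_mul_of_nonneg_right hys.le (Real.exp_pos _).le)).trans hrate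
  have hB1 : 0 ≤ 3 * M.C * A * d ^ p := by positivity
  have hB2 : 0 ≤ X * d ^ p := by positivity
  have hB3 : 0 ≤ 2 * M.C * (M.C * X + 3 * A) * d ^ p := by positivity
  refine ⟨?_, fun u hu => ?_⟩
  · have h1 := (norm_le_of_mem_Z (hxZ t ⟨hTt, le_rfl⟩)).trans
      (mul_le_mul_of_nonneg_left hxA (by positivity))
    linarith
  · rcases le_total u (τ + T) with h | h
    · have h1 := hs u ⟨hu.1, h⟩
      have h2 : X * d ≤ X * d ^ p := mul_le_mul_of_nonneg_left hddp (by positivity)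
      linarith
    · have h1 := norm_sub_le_of_Z hε hx hy hτ hxZ hyZ' (u := u) ⟨h, hu.2⟩
      have h2 : M.C * ‖x (τ + T) - y (τ + T)‖ ≤ M.C * (X * d ^ p) :=
        mul_le_mul_of_nonneg_left (hdT.trans (mul_le_mul_of_nonneg_left hddp (by positivity))) hC.le
      have h3 : |M.U (x t - y t)| ≤ 3 * (A * d ^ p) := by
        rw [map_sub]
        have h4 := abs_sub (M.U (x t)) (M.U (y t))
        have h5 := (hxZ t ⟨hTt, le_rfl⟩).2.2.2
        linarith
      have h6 : 2 * M.C * (M.C * ‖x (τ + T) - y (τ + T)‖ + |M.U (x t - y t)|) ≤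
          2 * M.C * (M.C * (X * d ^ p) + 3 * (A * d ^ p)) :=
        mul_le_mul_of_nonneg_left (add_le_add h2 h3) (by positivity)
      linarith

/-- A trajectory in the cone which ends close to the saddle is close to the stable leaf. -/
theorem GoodTime.backward_estimate (hT : M.GoodTime T) : ∃ ρ > 0, ∃ B > 0, ∃ δ > 0,
    ∀ ε ∈ Icc 0 M.ε₁, ε ≤ ρ →
    ∀ τ t x y, M.Traj ε τ x → x τ ∈ S.O0 → ‖x τ - γ 0‖ ≤ ρ → τ + T ≤ t →
    (∀ u ∈ Icc (τ + T) t, x u ∈ M.Z) → M.Traj ε τ y → y τ ∈ S.O0 →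
    ‖y τ - γ 0‖ ≤ ρ → (∀ u ≥ τ + T, y u ∈ M.Z ∧ |M.U (y u)| ≤ 1 / 4 * M.V (y u)) →
    ‖x t‖ ≤ δ → ∀ u ∈ Icc τ t, ‖x u - y u‖ ≤ B * ‖x t‖ ^ M.expBwd := by
  obtain ⟨ρ₁, hρ₁, _, _, htrack⟩ := hT.track
  obtain ⟨ρ₂, hρ₂, B₂, hB₂, hshift⟩ := hT.shift
  have hC := C_pos (M := M)
  set X := Real.exp ((M.L + 1) * T) with hX
  have hX1 : 1 ≤ X := Real.one_le_exp (mul_nonneg (by positivity) hT.pos.le)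
  set v₀ := M.V (γ (T + 1)) / 2 with hv₀
  have hv₀p : 0 < v₀ := half_pos (hT.cone (T + 1) (by linarith)).2.1
  set s₀ := 2 * M.V (γ T) with hs₀
  have hs₀p : 0 < s₀ := mul_pos two_pos (hT.cone T le_rfl).2.1
  set c := Real.exp (M.a + 3 * M.η) with hc
  have hc1 : 1 ≤ c := Real.one_le_exp (by linarith [M.a_pos, M.η_pos])
  set p := M.expBwd with hp
  obtain ⟨hp0, hp1⟩ := M.expBwd_mem
  set H := M.C / v₀ with hH
  have hHp : 0 < H := by positivity
  set A := 3 * M.C * c * (M.C + s₀ * H ^ p) with hA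
  have hHpp := Real.rpow_pos_of_pos hHp p
  have hAp : 0 < A := by positivity
  refine ⟨min ρ₁ ρ₂, lt_min hρ₁ hρ₂, X * (B₂ * A) + 2 * M.C * (M.C * (X * (B₂ * A)) + 2 * M.C * A),
    by positivity, min 1 (v₀ / (2 * M.C * c ^ 2)), by positivity, ?_⟩
  intro ε hε hερ τ t x y hx hx0 hxρ hTt hxZ hy hy0 hyρ hyZ hxt u hu
  clear_value s₀ v₀
  have hTp := hT.pos
  have hτ : τ ≤ τ + T := by linarith
  have hxV := (hxZ t ⟨hTt, le_rfl⟩).2.2.1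
  have hxn : 0 < ‖x t‖ := by
    rw [norm_pos_iff]; intro h; rw [h, map_zero] at hxV; exact hxV.false
  set d := ‖x t‖ with hd
  have hd1 : d ≤ 1 := hxt.trans (min_le_left _ _)
  have hddp : d ≤ d ^ p := by
    have := Real.rpow_le_rpow_of_exponent_ge hxn hd1 hp1
    rwa [Real.rpow_one] at this
  have hdp : 0 < d ^ p := Real.rpow_pos_of_pos hxn p
  obtain ⟨-, -, hx3⟩ := htrack ε hε (hερ.trans (min_le_left _ _)) x τ hx hx0
    (hxρ.trans (min_le_left _ _))
  obtain ⟨-, -, hy3⟩ := htrack ε hε (hερ.trans (min_le_left _ _)) y τ hy hy0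
    (hyρ.trans (min_le_left _ _))
  obtain ⟨-, -, -, -, hxs⟩ := hx3 (τ + T) ⟨le_rfl, by linarith⟩
  obtain ⟨-, -, -, hys, -⟩ := hy3 (τ + T) ⟨le_rfl, by linarith⟩
  have hyZ' : ∀ s ≥ τ + T, y s ∈ M.Z := fun s hs => (hyZ s hs).1
  have hxd : M.V (x t) ≤ M.C * d := (le_abs_self _).trans (M.V_le (x t))
  obtain ⟨-, cx⟩ := V_contract hε (hx.contIcc hτ) (fun u hu => hx.deriv u (hτ.trans_lt hu.1)) hxZ hTt
  set N := t - (τ + T) with hN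
  have hkey : Real.exp (-((M.a + 3 * M.η) * N)) ≤ H * d := by
    have h1 : v₀ * Real.exp (-((M.a + 3 * M.η) * N)) ≤ M.C * d :=
      ((mul_le_mul_of_nonneg_right (by linarith) (Real.exp_pos _).le).trans cx).trans hxd
    rw [hH, div_mul_eq_mul_div, le_div_iff₀ hv₀p]
    linarith
  have hq : 0 < M.a + 3 * M.η := by linarith [M.a_pos, M.η_pos]
  -- The comparison by `shift` requires `τ + T + 2 ≤ t`; the smallness of `‖x t‖`, through the
  -- factor `c²` in the threshold, ensures it.
  have hN2 : 2 < N := by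
    by_contra hcon
    push Not at hcon
    have h1 : c ^ 2 = Real.exp ((M.a + 3 * M.η) * 2) := by
      rw [hc, ← Real.exp_nat_mul]; congr 1; push_cast; ring
    have h2 : Real.exp (-((M.a + 3 * M.η) * 2)) ≤ Real.exp (-((M.a + 3 * M.η) * N)) := by
      rw [Real.exp_le_exp]
      linarith [mul_le_mul_of_nonneg_left hcon hq.le]
    rw [Real.exp_neg, ← h1] at h2
    have h3 := hxt.trans (min_le_right _ _)
    have h4 : H * d ≤ H * (v₀ / (2 * M.C * c ^ 2)) := mul_le_mul_of_nonneg_left h3 hHp.le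
    have h5 : H * (v₀ / (2 * M.C * c ^ 2)) = (c ^ 2)⁻¹ / 2 := by
      rw [hH]; field_simp
    have h6 : 0 < (c ^ 2)⁻¹ := by positivity
    linarith
  have hrate : s₀ * Real.exp (-((M.a - 3 * M.η) * N)) ≤ s₀ * H ^ p * d ^ p := by
    rw [exp_neg_mul_eq_rpow hq, mul_assoc, ← Real.mul_rpow hHp.le hxn.le]
    exact mul_le_mul_of_nonneg_left (Real.rpow_le_rpow (Real.exp_pos _).le hkey hp0.le) hs₀p.le
  -- For `x` the bound follows from its end point at the cost of a factor `c`. For `y`, contraction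
  -- over the time `N` gives `e^{-(a-3η)N}`, at most a constant times `d` to the power `(a - 3η) /
  -- (a + 3η)`, which is the exponent `expBwd`.
  have hω : ∀ s ∈ Icc (t - 1) t, ‖x s‖ ≤ A * d ^ p ∧ ‖y s‖ ≤ A * d ^ p := by
    intro s hs
    have hTs : τ + T ≤ s := by linarith [hs.1]
    have hsp : 0 ≤ s₀ * H ^ p := by positivity
    constructor
    · obtain ⟨-, c1⟩ := V_contract (s := s) (t := t) hε (hx.contIcc (hτ.trans hTs))
        (fun u hu => hx.deriv u ((hτ.trans hTs).trans_lt hu.1))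
        (fun u hu => hxZ u ⟨hTs.trans hu.1, hu.2⟩) hs.2
      have hV := (hxZ s ⟨hTs, hs.2⟩).2.2.1
      have h2 : c⁻¹ ≤ Real.exp (-((M.a + 3 * M.η) * (t - s))) := by
        rw [hc, ← Real.exp_neg, Real.exp_le_exp]
        linarith [mul_le_mul_of_nonneg_left (by linarith [hs.1] : t - s ≤ 1) hq.le]
      have h3 : M.V (x s) * c⁻¹ ≤ M.C * d :=
        ((mul_le_mul_of_nonneg_left h2 hV.le).trans c1).trans hxd
      rw [mul_inv_le_iff₀ (by positivity)] at h3
      refine (norm_le_of_mem_Z (hxZ s ⟨hTs, hs.2⟩)).trans ?_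
      have h4 : 3 * M.C * M.V (x s) ≤ 3 * M.C * (M.C * d * c) :=
        mul_le_mul_of_nonneg_left h3 (by positivity)
      have h5 : 3 * M.C * (M.C * d * c) ≤ 3 * M.C * (M.C * d ^ p * c) := by gcongr
      have h6 : 0 ≤ 3 * M.C * c * (s₀ * H ^ p) * d ^ p := by positivity
      rw [hA]
      linarith
    · obtain ⟨c1, -⟩ := V_contract (s := τ + T) (t := s) hε (hy.contIcc hτ)
        (fun u hu => hy.deriv u (hτ.trans_lt hu.1)) (fun u hu => hyZ' u hu.1) hTs
      have hV := (hyZ' s hTs).2.2.1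
      have h2 : Real.exp (-((M.a - 3 * M.η) * (s - (τ + T)))) ≤
          c * Real.exp (-((M.a - 3 * M.η) * N)) := by
        rw [hc, ← Real.exp_add, Real.exp_le_exp]
        have h7 := mul_le_mul_of_nonneg_left (by linarith [hs.1] : N - 1 ≤ s - (τ + T))
          M.rate_pos.le
        linarith [M.η_pos]
      have h3 : M.V (y s) ≤ s₀ * (c * Real.exp (-((M.a - 3 * M.η) * N))) :=
        c1.trans (mul_le_mul hys.le h2 (Real.exp_pos _).le hs₀p.le)
      have h4 : M.V (y s) ≤ c * (s₀ * H ^ p * d ^ p) := by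
        have := mul_le_mul_of_nonneg_left hrate (by positivity : 0 ≤ c)
        linarith
      refine (norm_le_of_mem_Z (hyZ' s hTs)).trans ?_
      have h5 : 3 * M.C * M.V (y s) ≤ 3 * M.C * (c * (s₀ * H ^ p * d ^ p)) :=
        mul_le_mul_of_nonneg_left h4 (by positivity)
      have h6 : 0 ≤ 3 * M.C * c * M.C * d ^ p := by positivity
      rw [hA]
      linarith
  have hs := hshift ε hε ε hε (hερ.trans (min_le_right _ _)) (hερ.trans (min_le_right _ _)) 0 le_rfl
    (fun _ _ _ _ => by simp) x y τ t (A * d ^ p) hx hy hx0 hy0 (hxρ.trans (min_le_right _ _))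
    (hyρ.trans (min_le_right _ _)) (by linarith) hxZ (fun s hs => hyZ' s hs.1) hω
  rw [zero_add] at hs
  have hsX : ∀ s ∈ Icc τ (τ + T), ‖x s - y s‖ ≤ X * (B₂ * (A * d ^ p)) := fun s h =>
    (hx.norm_sub_le_exp hε hy h).trans (mul_le_mul_of_nonneg_left hs (by positivity))
  have hB1 : 0 ≤ X * (B₂ * A) * d ^ p := by positivity
  have hB2 : 0 ≤ 2 * M.C * (M.C * (X * (B₂ * A)) + 2 * M.C * A) * d ^ p := by positivity
  rcases le_total u (τ + T) with h | h
  · have h1 := hsX u ⟨hu.1, h⟩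
    linarith
  · have h1 := norm_sub_le_of_Z hε hx hy hτ hxZ (fun s hs => hyZ' s hs.1) (u := u) ⟨h, hu.2⟩
    have h2 := hsX (τ + T) ⟨hτ, le_rfl⟩
    have h3 : |M.U (x t - y t)| ≤ M.C * (2 * (A * d ^ p)) := by
      refine (M.U_le _).trans (mul_le_mul_of_nonneg_left ?_ hC.le)
      have h4 := hω t ⟨by linarith, le_rfl⟩
      exact (norm_sub_le _ _).trans (by linarith [h4.1, h4.2])
    have h5 : 2 * M.C * (M.C * ‖x (τ + T) - y (τ + T)‖ + |M.U (x t - y t)|) ≤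
        2 * M.C * (M.C * (X * (B₂ * (A * d ^ p))) + M.C * (2 * (A * d ^ p))) :=
      mul_le_mul_of_nonneg_left (add_le_add (mul_le_mul_of_nonneg_left h2 hC.le) h3) (by positivity)
    linarith

end SaddleModel

/-! ### Inside and outside of the loop near the saddle -/

theorem subset_enclosed {Γ A : Set Plane} (hA : IsPreconnected A) (hAΓ : A ⊆ Γᶜ) {p : Plane}
    (hp : p ∈ A) (hpE : p ∈ enclosed Γ) : A ⊆ enclosed Γ := fun q hq =>
  ⟨hAΓ hq, by
    rw [← connectedComponentIn_eq (hA.subset_connectedComponentIn hp hAΓ hq)]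
    exact hpE.2⟩

namespace SaddleModel
variable {S : PSSystem} {γ : ℝ → Plane}

/-- The position of the loop near the saddle. -/
structure LoopFrame (M : SaddleModel S γ) where
  v : Plane
  κ : ℝ
  ρ : ℝ
  T₁ : ℝ
  U_v : 0 < M.U v
  V_v : M.V v = 0
  κ_pos : 0 < κ
  ρ_pos : 0 < ρ
  good : M.GoodTime T₁
  ext : ∀ d : ℝ, 0 < d → d < ρ → d • v ∉ enclosed (loopSet γ)
  near : ∀ x ∈ loopSet γ, ‖x‖ < ρ →
    x = 0 ∨ (∃ t ≥ T₁, x = γ t) ∨ M.U x + M.V x ≤ -(κ * ‖x‖)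
  γ_neg : ∀ t < 0, γ t ∈ S.Om
  enclosed_near : ∀ δ > 0, ∃ R ∈ S.O0, R ∈ enclosed (loopSet γ) ∧ ‖R‖ < δ

variable {M : SaddleModel S γ}

namespace LoopFrame

theorem not_mem_loopSet (f : M.LoopFrame) {x : Plane} (hx : ‖x‖ < f.ρ) (h0 : x ≠ 0)
    (hc : 0 < M.V x → 1 / 4 * M.V x < |M.U x|) (hs : -(f.κ * ‖x‖) < M.U x + M.V x) :
    x ∉ loopSet γ := by
  intro h
  rcases f.near x h hx with h1 | ⟨t, ht, rfl⟩ | h1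
  · exact h0 h1
  · have h2 := f.good.cone t ht
    exact (hc h2.2.1).not_ge h2.2.2
  · linarith

/-- The sector `V ≥ 0`, `U > V / 4` is convex and misses the loop: the stable end of `γ` lies in
`|U| ≤ V / 4`, the part of the loop in `Ω⁻` has `U + V < 0`. It also contains the exterior points `d
• v`. -/
theorem not_enclosed_of_left (f : M.LoopFrame) {x : Plane} (hx : ‖x‖ < f.ρ) (hV : 0 ≤ M.V x)
    (hU : 1 / 4 * M.V x < M.U x) : x ∉ enclosed (loopSet γ) := by
  set A : Set Plane := Metric.ball 0 f.ρ ∩ {z | 0 ≤ M.V z} ∩ {z | 0 < (M.U - (1 / 4 : ℝ) • M.V) z}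
    with hA
  have hconv : Convex ℝ A := ((convex_ball 0 f.ρ).inter
    (convex_halfSpace_ge M.V.toLinearMap.isLinear 0)).inter
    (convex_halfSpace_gt (M.U - (1 / 4 : ℝ) • M.V).toLinearMap.isLinear 0)
  have hsub : A ⊆ (loopSet γ)ᶜ := by
    rintro z ⟨⟨hz, hzV⟩, hzU⟩
    simp only [mem_ofPred_eq, _root_.sub_apply, _root_.smul_apply,
      smul_eq_mul] at hzV hzU
    rw [mem_ball_zero_iff] at hz
    have hU0 : 0 < M.U z := by linarith
    refine f.not_mem_loopSet hz ?_ (fun _ => ?_) ?_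
    · rintro rfl; simp at hU0
    · rw [abs_of_pos hU0]; linarith
    · linarith [mul_nonneg f.κ_pos.le (norm_nonneg z)]
  set d := f.ρ / (2 * (1 + ‖f.v‖)) with hd
  have hρ := f.ρ_pos
  have hn := norm_nonneg f.v
  have hd0 : 0 < d := by positivity
  have hdn : d * (1 + ‖f.v‖) = f.ρ / 2 := by rw [hd]; field_simp
  have hdρ : d < f.ρ := by linarith [mul_nonneg hd0.le hn]
  have hdA : d • f.v ∈ A := by
    refine ⟨⟨?_, ?_⟩, ?_⟩
    · rw [mem_ball_zero_iff, norm_smul, Real.norm_eq_abs, abs_of_pos hd0]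
      linarith
    · simp [f.V_v]
    · simp only [mem_ofPred_eq, _root_.sub_apply, _root_.smul_apply,
        smul_eq_mul, map_smul, f.V_v, mul_zero, sub_zero]
      exact mul_pos hd0 f.U_v
  have hxA : x ∈ A := by
    refine ⟨⟨by rwa [mem_ball_zero_iff], hV⟩, ?_⟩
    simp only [mem_ofPred_eq, _root_.sub_apply, _root_.smul_apply,
      smul_eq_mul]
    linarith
  intro hxE
  exact f.ext d hd0 hdρ (subset_enclosed hconv.isPreconnected hsub hxA hxE hdA)

/-- Near the saddle, the inside part of `Ω⁰` is the one on which `V` is positive. -/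
theorem mem_enclosed_iff (f : M.LoopFrame) : ∃ δ > 0, ∀ R ∈ S.O0, ‖R‖ < δ →
    (R ∈ enclosed (loopSet γ) ↔ 0 < M.V R) := by
  have hC := C_pos (M := M)
  have hρ := f.ρ_pos
  have hκ := f.κ_pos
  -- The aperture of the sectors around `U + V = 0` that contain `Ω⁰`. It is narrower than the gap
  -- `κ` separating this line from the part of the loop in `Ω⁻`.
  set e := min (f.κ / (2 * M.C)) (1 / 10) with he
  have he0 : 0 < e := by positivity
  have heκ : ∀ x : Plane, x ≠ 0 → e * (M.C * ‖x‖) < f.κ * ‖x‖ := by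
    intro x hx
    have hx0 : 0 < ‖x‖ := norm_pos_iff.2 hx
    have h1 : e ≤ f.κ / (2 * M.C) := min_le_left _ _
    rw [le_div_iff₀ (by positivity)] at h1
    have h2 : e * (2 * M.C) * ‖x‖ ≤ f.κ * ‖x‖ := mul_le_mul_of_nonneg_right h1 hx0.le
    have h3 : 0 < e * M.C * ‖x‖ := by positivity
    linarith
  have he1 : e ≤ 1 / 10 := min_le_right _ _
  clear_value e
  have hG := M.G_deriv_zero.isLittleO.def (c := e / (3 * M.C)) (by positivity)
  rw [M.zero_mem.2] at hG
  obtain ⟨δ₁, hδ₁, hG⟩ := Metric.eventually_nhds_iff_ball.1 hG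
  set δ := min (min δ₁ f.ρ) M.r with hδ
  have hδ0 : 0 < δ := lt_min (lt_min hδ₁ hρ) M.r_pos
  have hO : ∀ R ∈ S.O0, ‖R‖ < δ → R ≠ 0 →
      (0 < M.V R ∧ M.U R < -(1 / 2 * M.V R) ∧ -(e * M.V R) ≤ M.U R + M.V R) ∨
      (M.V R < 0 ∧ 0 < M.U R ∧ -(e * M.U R) ≤ M.U R + M.V R) := by
    intro R hR hRδ hR0
    have h1 := hG R (by
      rw [mem_ball_zero_iff]; exact hRδ.trans_le ((min_le_left _ _).trans (min_le_left _ _)))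
    rw [hR.2, sub_zero, sub_zero, zero_sub, norm_neg, Real.norm_eq_abs,
      _root_.add_apply] at h1
    have h2 : e / (3 * M.C) * ‖R‖ ≤ e / 3 * (|M.U R| + |M.V R|) := by
      have := mul_le_mul_of_nonneg_left (M.norm_le R) (by positivity : 0 ≤ e / (3 * M.C))
      refine this.trans (le_of_eq ?_)
      field_simp
    have h3 := abs_le.1 (h1.trans h2)
    have hpos : 0 < |M.U R| + |M.V R| := by
      have h5 := (norm_pos_iff.2 hR0).trans_le (M.norm_le R)
      exact pos_of_mul_pos_right h5 hC.le
    have h4 : e * (|M.U R| + |M.V R|) ≤ 1 / 10 * (|M.U R| + |M.V R|) :=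
      mul_le_mul_of_nonneg_right he1 hpos.le
    rcases lt_trichotomy (M.V R) 0 with hV | hV | hV
    · right
      have hU : 0 < M.U R := by
        by_contra hcon
        push Not at hcon
        rw [abs_of_neg hV, abs_of_nonpos hcon] at h3 h4
        linarith [h3.1]
      refine ⟨hV, hU, ?_⟩
      rw [abs_of_neg hV, abs_of_pos hU] at h3 h4
      have h6 : e * (-M.V R) ≤ e * (2 * M.U R) :=
        mul_le_mul_of_nonneg_left (by linarith [h3.1]) he0.le
      linarith [h3.1]
    · exfalso
      rw [hV, abs_zero, add_zero, add_zero] at h3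
      rw [hV, abs_zero, add_zero] at h4 hpos
      have : |M.U R| ≤ e / 3 * |M.U R| := abs_le.2 h3
      linarith
    · left
      have hU : M.U R < -(1 / 2 * M.V R) := by
        rcases le_total 0 (M.U R) with h | h
        · rw [abs_of_pos hV, abs_of_nonneg h] at h3 h4
          linarith [h3.2]
        · rw [abs_of_pos hV, abs_of_nonpos h] at h3 h4
          linarith [h3.2]
      refine ⟨hV, hU, ?_⟩
      have hU0 : M.U R < 0 := by linarith
      rw [abs_of_pos hV, abs_of_neg hU0] at h3 h4
      have h6 : e * (-M.U R) ≤ e * (2 * M.V R) :=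
        mul_le_mul_of_nonneg_left (by linarith [h3.1]) he0.le
      linarith [h3.1]
  have hδρ : δ ≤ f.ρ := (min_le_left _ _).trans (min_le_right _ _)
  have hneg : ∀ R ∈ S.O0, ‖R‖ < δ → R ∈ enclosed (loopSet γ) → 0 < M.V R := by
    intro R hR hRδ hRE
    have hR0 : R ≠ 0 := by
      rintro rfl
      exact hRE.1 (Or.inr rfl)
    rcases hO R hR hRδ hR0 with h | ⟨hV, hU, hS⟩
    · exact h.1
    exfalso
    -- A convex sector missing the loop that contains `R` and the exterior points `d • v`; so the
    -- branch of `Ω⁰` with `V < 0` is not enclosed.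
    set A : Set Plane := Metric.ball 0 f.ρ ∩ {z | M.V z ≤ 0} ∩ {z | 0 < M.U z} ∩
      {z | 0 ≤ (M.U + M.V + e • M.U) z} with hA
    have hconv : Convex ℝ A := (((convex_ball 0 f.ρ).inter
      (convex_halfSpace_le M.V.toLinearMap.isLinear 0)).inter
      (convex_halfSpace_gt M.U.toLinearMap.isLinear 0)).inter
      (convex_halfSpace_ge (M.U + M.V + e • M.U).toLinearMap.isLinear 0)
    have hsub : A ⊆ (loopSet γ)ᶜ := by
      rintro z ⟨⟨⟨hz, hzV⟩, hzU⟩, hzS⟩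
      simp only [mem_ofPred_eq, _root_.add_apply, _root_.smul_apply,
        smul_eq_mul] at hzV hzU hzS
      rw [mem_ball_zero_iff] at hz
      have hz0 : z ≠ 0 := by rintro rfl; simp at hzU
      refine f.not_mem_loopSet hz hz0 (fun h => absurd h (not_lt.2 hzV)) ?_
      have h1 := heκ z hz0
      have h2 : e * M.U z ≤ e * (M.C * ‖z‖) :=
        mul_le_mul_of_nonneg_left ((le_abs_self _).trans (M.U_le z)) he0.le
      linarith
    set d := f.ρ / (2 * (1 + ‖f.v‖)) with hd
    have hn := norm_nonneg f.v
    have hd0 : 0 < d := by positivity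
    have hdn : d * (1 + ‖f.v‖) = f.ρ / 2 := by rw [hd]; field_simp
    have hdA : d • f.v ∈ A := by
      have h1 := mul_pos hd0 f.U_v
      refine ⟨⟨⟨?_, ?_⟩, ?_⟩, ?_⟩
      · rw [mem_ball_zero_iff, norm_smul, Real.norm_eq_abs, abs_of_pos hd0]
        linarith
      · simp [f.V_v]
      · simpa using h1
      · simp only [mem_ofPred_eq, _root_.add_apply, _root_.smul_apply,
          smul_eq_mul, map_smul, f.V_v, mul_zero, add_zero]
        linarith [mul_pos he0 h1]
    have hRA : R ∈ A := by
      refine ⟨⟨⟨by rw [mem_ball_zero_iff]; exact hRδ.trans_le hδρ, hV.le⟩, hU⟩, ?_⟩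
      simp only [mem_ofPred_eq, _root_.add_apply, _root_.smul_apply,
        smul_eq_mul]
      linarith
    exact f.ext d hd0 (by linarith [mul_nonneg hd0.le hn])
      (subset_enclosed hconv.isPreconnected hsub hRA hRE hdA)
  refine ⟨δ, hδ0, fun R hR hRδ => ⟨hneg R hR hRδ, fun hV => ?_⟩⟩
  obtain ⟨R', hR', hRE', hRδ'⟩ := f.enclosed_near δ hδ0
  have hV' := hneg R' hR' hRδ' hRE'
  -- A convex sector missing the loop that contains the whole branch with `V > 0`. It contains an
  -- enclosed point `R'`, which lies on this branch by the first part.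
  set A : Set Plane := Metric.ball 0 f.ρ ∩ {z | 0 < M.V z} ∩ {z | (M.U + (1 / 2 : ℝ) • M.V) z < 0} ∩
    {z | 0 ≤ (M.U + M.V + e • M.V) z} with hA
  have hconv : Convex ℝ A := (((convex_ball 0 f.ρ).inter
    (convex_halfSpace_gt M.V.toLinearMap.isLinear 0)).inter
    (convex_halfSpace_lt (M.U + (1 / 2 : ℝ) • M.V).toLinearMap.isLinear 0)).inter
    (convex_halfSpace_ge (M.U + M.V + e • M.V).toLinearMap.isLinear 0)
  have hsub : A ⊆ (loopSet γ)ᶜ := by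
    rintro z ⟨⟨⟨hz, hzV⟩, hzU⟩, hzS⟩
    simp only [mem_ofPred_eq, _root_.add_apply, _root_.smul_apply,
      smul_eq_mul] at hzV hzU hzS
    rw [mem_ball_zero_iff] at hz
    have hz0 : z ≠ 0 := by rintro rfl; simp at hzV
    refine f.not_mem_loopSet hz hz0 (fun h => ?_) ?_
    · linarith [neg_le_abs (M.U z)]
    have h1 := heκ z hz0
    have h2 : e * M.V z ≤ e * (M.C * ‖z‖) :=
      mul_le_mul_of_nonneg_left ((le_abs_self _).trans (M.V_le z)) he0.le
    linarith
  have hmem : ∀ Q ∈ S.O0, ‖Q‖ < δ → 0 < M.V Q → Q ∈ A := by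
    intro Q hQ hQδ hQV
    have hQ0 : Q ≠ 0 := by rintro rfl; simp at hQV
    rcases hO Q hQ hQδ hQ0 with ⟨-, h2, h3⟩ | h
    · refine ⟨⟨⟨by rw [mem_ball_zero_iff]; exact hQδ.trans_le hδρ, hQV⟩, ?_⟩, ?_⟩ <;>
      · simp only [mem_ofPred_eq, _root_.add_apply, _root_.smul_apply,
          smul_eq_mul]
        linarith
    · linarith [h.1]
  exact subset_enclosed hconv.isPreconnected hsub (hmem R' hR' hRδ' hV') hRE' (hmem R hR hRδ hV)

end LoopFrame
end SaddleModel

/-! ### Orbits of the unperturbed system from the two sides of the loop -/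

/-- A parametrization of `Ω⁰` near `γ 0`, inside the loop for negative values of the parameter. -/
structure CrossArc (S : PSSystem) (γ : ℝ → Plane) where
  P : ℝ → Plane
  k : ℝ
  k_pos : 0 < k
  P_zero : P 0 = γ 0
  lip : ∀ h ∈ Ioo (-k) k, ∀ h' ∈ Ioo (-k) k, ‖P h - P h'‖ ≤ |h - h'|
  mem : ∀ h ∈ Ioo (-k) k, P h ∈ S.O0
  inj : InjOn P (Ioo (-k) k)
  ne_zero : ∀ h ∈ Ioo (-k) k, P h ≠ 0
  surj : ∀ k' > 0, ∃ ρ > 0, ∀ x ∈ S.O0, ‖x - γ 0‖ < ρ → ∃ h ∈ Ioo (-k) k, |h| < k' ∧ P h = x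
  enclosed : ∀ h ∈ Ioo (-k) k, h < 0 → P h ∈ enclosed (loopSet γ)

theorem CrossArc.zero_mem {S : PSSystem} {γ : ℝ → Plane} (A : CrossArc S γ) :
    (0 : ℝ) ∈ Ioo (-A.k) A.k := ⟨by linarith [A.k_pos], A.k_pos⟩

theorem CrossArc.norm_sub_le {S : PSSystem} {γ : ℝ → Plane} (A : CrossArc S γ) {h : ℝ}
    (hh : h ∈ Ioo (-A.k) A.k) : ‖A.P h - γ 0‖ ≤ |h| := by
  have := A.lip h hh 0 A.zero_mem
  rwa [A.P_zero, sub_zero] at this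

theorem CrossArc.continuousOn {S : PSSystem} {γ : ℝ → Plane} (A : CrossArc S γ) :
    ContinuousOn A.P (Ioo (-A.k) A.k) := by
  have : LipschitzOnWith 1 A.P (Ioo (-A.k) A.k) := LipschitzOnWith.of_dist_le_mul fun h hh h' hh' => by
    rw [dist_eq_norm, NNReal.coe_one, one_mul, Real.dist_eq]
    exact A.lip h hh h' hh'
  exact this.continuousOn

namespace SaddleModel
variable {S : PSSystem} {γ : ℝ → Plane} {M : SaddleModel S γ}

theorem V_le_of_Z {ε s t : ℝ} {x : ℝ → Plane} (hε : ε ∈ Icc 0 M.ε₁) (hx : M.Sol ε x)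
    (hZ : ∀ u ∈ Icc s t, x u ∈ M.Z) (hst : s ≤ t) : M.V (x t) ≤ M.V (x s) := by
  have c1 := (V_contract hε hx.continuous.continuousOn (fun u _ => hx u) hZ hst).1
  refine c1.trans (mul_le_of_le_one_right (hZ _ ⟨le_rfl, hst⟩).2.2.1.le ?_)
  rw [Real.exp_le_one_iff]
  linarith [mul_nonneg M.rate_pos.le (sub_nonneg.2 hst)]

theorem eq_γ_of_eq {x : ℝ → Plane} (hx : M.Sol 0 x) {p q s v : ℝ} (hp : s ≤ p) (hv : v ∈ Icc p q)
    (h : x v = γ (v - s)) : EqOn x (fun u => γ (u - s)) (Icc p q) := by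
  have hγ := M.γ_traj s
  exact eq_of_hasDerivAt_of_lipschitz (M.F_lip 0 zero_mem_Icc) hx.continuous.continuousOn
    (hγ.contIcc hp) (fun u _ => hx u) (fun u hu => hγ.deriv u (hp.trans_lt hu.1)) hv h

theorem γ_zero_ne_zero (M : SaddleModel S γ) : γ 0 ≠ 0 := by
  intro h
  have h1 := M.cross 0 zero_mem_Icc 0 (γ 0) (Metric.mem_ball_self M.r₀_pos)
  rw [h, M.F_zero 0 zero_mem_Icc, map_zero] at h1
  exact h1.not_gt M.c₀_pos

theorem γ_zero_isLeaf (M : SaddleModel S γ) : S.IsLeaf 0 0 γ := by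
  refine ⟨M.γ_cont.continuousOn, M.γ_zero, M.γ_pos, fun t ht => ?_, M.γ_tendsto⟩
  rw [← M.F_eq 0 zero_mem_Icc t _ (M.γ_K t ht.le) (Or.inl (M.γ_pos t ht))]
  exact M.γ_deriv t ht

namespace LoopFrame

theorem O0_inter_loopSet (f : M.LoopFrame) {x : Plane} (hx : x ∈ S.O0) (hΓ : x ∈ loopSet γ) :
    x = 0 ∨ x = γ 0 := by
  rcases hΓ with ⟨s, rfl⟩ | h
  · rcases lt_trichotomy s 0 with h | h | h
    · have h1 := (f.γ_neg s h).2
      have h2 := hx.2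
      linarith
    · rw [h]; exact Or.inr rfl
    · exact (PSSystem.Op_disjoint_O0 (M.γ_pos s h) hx).elim
  · exact Or.inl h

/-- By uniqueness an orbit that meets the loop at `γ s`, `s > 0`, is a translate of `γ` on the past.
Going back, either the starting time is reached while still on the loop, or `γ 0 ∈ Ω⁰` is met at a
time when the orbit should be in `Ω⁺`. -/
theorem orbit_not_mem (f : M.LoopFrame) {x : ℝ → Plane} {τ u : ℝ} (hx : M.Sol 0 x)
    (hu : τ ≤ u) (hOp : ∀ v ∈ Ioc τ u, x v ∈ S.Op) (hΓ : x τ ∉ loopSet γ) :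
    x u ∉ loopSet γ := by
  intro h
  rcases hu.eq_or_lt with h1 | h1
  · rw [← h1] at h; exact hΓ h
  have hO := hOp u ⟨h1, le_rfl⟩
  rcases h with ⟨s, hs⟩ | h
  · rw [← hs] at hO
    have hs0 : 0 < s := by
      rcases lt_trichotomy s 0 with h | h | h
      · have h2 := (f.γ_neg s h).2
        have h3 := hO.2
        linarith
      · rw [h] at hO; exact (PSSystem.Op_disjoint_O0 hO M.γ_zero).elim
      · exact h
    rcases lt_or_ge (u - τ) s with hlt | hge
    · have := eq_γ_of_eq hx (p := τ) (q := u) (s := u - s) (v := u) (by linarith) ⟨hu, le_rfl⟩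
        (by rw [sub_sub_cancel, hs]) (⟨le_rfl, hu⟩ : τ ∈ Icc τ u)
      exact hΓ (Or.inl ⟨τ - (u - s), this.symm⟩)
    · have := eq_γ_of_eq hx (p := u - s) (q := u) (s := u - s) (v := u) le_rfl
        ⟨by linarith, le_rfl⟩ (by rw [sub_sub_cancel, hs])
        (⟨le_rfl, by linarith⟩ : u - s ∈ Icc (u - s) u)
      simp only [sub_self] at this
      rcases hge.eq_or_lt with h2 | h2
      · rw [h2, sub_sub_cancel] at this
        exact hΓ (Or.inl ⟨0, this.symm⟩)
      · have h3 := hOp (u - s) ⟨by linarith, by linarith⟩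
        rw [this] at h3
        exact PSSystem.Op_disjoint_O0 h3 M.γ_zero
  · rw [h] at hO
    exact PSSystem.Op_disjoint_O0 hO M.zero_mem

/-- The orbit is a connected set that misses the loop, so it lies in a single component of the
complement. -/
theorem orbit_enclosed (f : M.LoopFrame) {x : ℝ → Plane} {τ t : ℝ} (hx : M.Sol 0 x)
    (ht : τ ≤ t) (hOp : ∀ v ∈ Ioo τ t, x v ∈ S.Op) (hΓ : x τ ∉ loopSet γ)
    (hΓ' : x t ∉ loopSet γ) : x τ ∈ enclosed (loopSet γ) ↔ x t ∈ enclosed (loopSet γ) := by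
  have hsub : x '' Icc τ t ⊆ (loopSet γ)ᶜ := by
    rintro _ ⟨u, hu, rfl⟩
    rcases hu.2.eq_or_lt with h | h
    · rw [h]; exact hΓ'
    · exact f.orbit_not_mem hx hu.1 (fun v hv => hOp v ⟨hv.1, hv.2.trans_lt h⟩) hΓ
  have hconn : IsPreconnected (x '' Icc τ t) :=
    isPreconnected_Icc.image x hx.continuous.continuousOn
  have h1 : x τ ∈ x '' Icc τ t := ⟨τ, ⟨le_rfl, ht⟩, rfl⟩
  have h2 : x t ∈ x '' Icc τ t := ⟨t, ⟨ht, le_rfl⟩, rfl⟩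
  exact ⟨fun h => subset_enclosed hconn hsub h1 h h2, fun h => subset_enclosed hconn hsub h2 h h1⟩

theorem V_injOn (f : M.LoopFrame) {T : ℝ} (hT : M.GoodTime T) {s : ℝ} (hs : f.T₁ ≤ s)
    (h : M.V (γ s) = M.V (γ T)) : s = T := by
  have key : ∀ T', M.GoodTime T' → T' ≤ s → T' ≤ T → s = T := fun T' hT' h1 h2 => by
    rcases lt_trichotomy s T with h3 | h3 | h3
    · exact absurd h (hT'.V_strictAnti h1 h3).ne'
    · exact h3
    · exact absurd h (hT'.V_strictAnti h2 h3).ne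
  rcases le_total f.T₁ T with h1 | h1
  · exact key _ f.good hs h1
  · exact key _ hT (h1.trans hs) le_rfl

/-- The points on the unstable side of `γ T` are not enclosed. -/
theorem not_enclosed_add_smul (f : M.LoopFrame) {T : ℝ} (hT : M.GoodTime T)
    (hTρ : M.V (γ T) < f.ρ / (12 * M.C)) (hTv : M.V (γ T) < f.ρ * M.U f.v / (4 * (1 + ‖f.v‖))) {ν : ℝ}
    (hν : 0 < ν) (hν' : ν ≤ M.V (γ T) / M.U f.v) :
    γ T + ν • f.v ∉ loopSet γ ∧ γ T + ν • f.v ∉ enclosed (loopSet γ) := by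
  have hC := C_pos (M := M)
  have hUv := f.U_v
  have hn := norm_nonneg f.v
  obtain ⟨h1, h2, h3⟩ := hT.cone T le_rfl
  set s₁ := M.V (γ T) / M.U f.v with hs₁
  have hs₁U : s₁ * M.U f.v = M.V (γ T) := div_mul_cancel₀ _ hUv.ne'
  have hs₁p : 0 < s₁ := div_pos h2 hUv
  have hnorm : ∀ s ∈ Icc ν s₁, ‖γ T + s • f.v‖ < f.ρ := by
    intro s hs
    have h4 := norm_le_of_mem_Z (hT.mem_Z le_rfl)
    rw [lt_div_iff₀ (by positivity)] at hTρ hTv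
    have h5 : s₁ * ‖f.v‖ < f.ρ / 4 := by
      have h6 : s₁ * M.U f.v * (4 * (1 + ‖f.v‖)) < f.ρ * M.U f.v := by rw [hs₁U]; exact hTv
      have h7 : (s₁ * (4 * (1 + ‖f.v‖))) * M.U f.v < f.ρ * M.U f.v := by linarith
      have h8 := lt_of_mul_lt_mul_right h7 hUv.le
      linarith
    have h9 : s * ‖f.v‖ ≤ s₁ * ‖f.v‖ := mul_le_mul_of_nonneg_right hs.2 hn
    calc _ ≤ _ := norm_add_le _ _
      _ = ‖γ T‖ + s * ‖f.v‖ := by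
        rw [norm_smul, Real.norm_eq_abs, abs_of_pos (hν.trans_le hs.1)]
      _ < f.ρ := by linarith [f.ρ_pos]
  have hV : ∀ s : ℝ, M.V (γ T + s • f.v) = M.V (γ T) := fun s => by simp [f.V_v]
  have hU : ∀ s : ℝ, M.U (γ T + s • f.v) = M.U (γ T) + s * M.U f.v := fun s => by simp
  -- On this segment `V` is constant and equal to `V(γ T)`. Since `V` is injective along the stable
  -- end of `γ`, the loop could be met only at `γ T` itself; the other part of the loop is excluded
  -- by `U + V > 0`.
  have havoid : ∀ s ∈ Icc ν s₁, γ T + s • f.v ∉ loopSet γ := by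
    intro s hs hΓ
    have hs0 : 0 < s := hν.trans_le hs.1
    have h5 := (abs_le.1 h3).1
    have h6 := mul_pos hs0 hUv
    rcases f.near _ hΓ (hnorm s hs) with h | ⟨t, ht, h⟩ | h
    · have := hV s
      rw [h, map_zero] at this
      linarith
    · have h7 := f.V_injOn hT ht (by rw [← h, hV])
      rw [h7] at h
      have := hU s
      rw [h] at this
      linarith
    · rw [hV, hU] at h
      linarith [mul_nonneg f.κ_pos.le (norm_nonneg (γ T + s • f.v))]
  refine ⟨havoid ν ⟨le_rfl, hν'⟩, fun hE => ?_⟩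
  have hconn : IsPreconnected ((fun s : ℝ => γ T + s • f.v) '' Icc ν s₁) :=
    isPreconnected_Icc.image _ (by fun_prop)
  have h4 := subset_enclosed hconn (by rintro _ ⟨s, hs, rfl⟩; exact havoid s hs)
    ⟨ν, ⟨le_rfl, hν'⟩, rfl⟩ hE ⟨s₁, ⟨hν', le_rfl⟩, rfl⟩
  refine f.not_enclosed_of_left (hnorm s₁ ⟨hν', le_rfl⟩) (by rw [hV]; exact h2.le) ?_ h4
  rw [hV, hU, hs₁U]
  linarith [(abs_le.1 h3).1]

/-- Orbits of the unperturbed system from `Ω⁰` near `γ 0` leave the cone around the stable direction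
on the side prescribed by the position of the initial point. -/
theorem exits (f : M.LoopFrame) (A : CrossArc S γ) : ∃ T, M.GoodTime T ∧ ∃ k' > 0, k' ≤ A.k ∧
    ∀ h, |h| < k' → ∀ x, M.Sol 0 x → x 0 = A.P h →
      (h < 0 → M.Exits (-1) T 0 x) ∧ (0 < h → M.Exits 1 T 0 x) := by
  have hC := C_pos (M := M)
  have hρ := f.ρ_pos
  have hUv := f.U_v
  have hn := norm_nonneg f.v
  obtain ⟨δ, hδ, hEiff⟩ := f.mem_enclosed_iff
  obtain ⟨T, hT, hTV⟩ := M.exists_goodTime (ρ := min (min f.ρ δ / (12 * M.C))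
    (f.ρ * M.U f.v / (4 * (1 + ‖f.v‖)))) (by positivity)
  have hTp := hT.pos
  have hV0 := (hT.cone T le_rfl).2.1
  have hTV1 : M.V (γ T) < min f.ρ δ / (12 * M.C) := hTV.trans_le (min_le_left _ _)
  have hTρ : M.V (γ T) < f.ρ / (12 * M.C) := hTV1.trans_le
    (div_le_div_of_nonneg_right (min_le_left _ _) (by positivity))
  have hTv := hTV.trans_le (min_le_right _ _)
  rw [lt_div_iff₀ (by positivity)] at hTV1
  obtain ⟨ρ₁, hρ₁, B₁, _, htrack⟩ := hT.track
  obtain ⟨ρ₂, hρ₂, hnot⟩ := hT.isLeaf_of_not_exits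
  obtain ⟨ρ₃, hρ₃, harr⟩ := hT.arrive
  obtain ⟨ρ₄, hρ₄, huniq⟩ := hT.leaf_unique
  obtain ⟨ρ₅, hρ₅, B₅, hB₅, hback⟩ := M.track_back hTp
  set k' := min (min ρ₁ ρ₂) (min ρ₃ A.k) with hk'
  have hk'0 : 0 < k' := lt_min (lt_min hρ₁ hρ₂) (lt_min hρ₃ A.k_pos)
  have hk1 : k' ≤ ρ₁ := (min_le_left _ _).trans (min_le_left _ _)
  have hk2 : k' ≤ ρ₂ := (min_le_left _ _).trans (min_le_right _ _)
  have hk3 : k' ≤ ρ₃ := (min_le_right _ _).trans (min_le_left _ _)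
  have hk4 : k' ≤ A.k := (min_le_right _ _).trans (min_le_right _ _)
  have h00 := zero_mem_Icc (M := M)
  have hmem : ∀ h, |h| < k' → h ∈ Ioo (-A.k) A.k := fun h hh => abs_lt.1 (hh.trans_le hk4)
  have hΓ : ∀ h, |h| < k' → h ≠ 0 → A.P h ∉ loopSet γ := by
    intro h hh h0 hΓ
    rcases f.O0_inter_loopSet (A.mem h (hmem h hh)) hΓ with h1 | h1
    · exact A.ne_zero h (hmem h hh) h1
    · rw [← A.P_zero] at h1
      exact h0 (A.inj (hmem h hh) A.zero_mem h1)
  -- A starting point that exits on neither side would be on the leaf for `ε = 0`, which by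
  -- uniqueness consists of `γ 0` only.
  have hstay : ∀ h, |h| < k' → h ≠ 0 → ∀ x, M.Sol 0 x → x 0 = A.P h → ¬ M.Exits (-1) T 0 x →
      M.Exits 1 T 0 x := by
    intro h hh h0 x hx hx0 hR
    by_contra hL
    have h1 := hnot 0 h00 hρ₂.le 0 x hx (by rw [hx0]; exact A.mem h (hmem h hh))
      (by rw [hx0]; exact (A.norm_sub_le (hmem h hh)).trans (hh.le.trans hk2)) hR hL
    have h2 := huniq 0 h00 hρ₄.le 0 x γ h1 M.γ_zero_isLeaf
    rw [hx0, ← A.P_zero] at h2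
    exact h0 (A.inj (hmem h hh) A.zero_mem h2)
  have hsmall : ∀ x : ℝ → Plane, M.Sol 0 x → ∀ t ≥ T, (∀ u ∈ Icc T t, x u ∈ M.Z) →
      M.V (x T) < 2 * M.V (γ T) → ‖x t‖ < f.ρ ∧ ‖x t‖ < δ := by
    intro x hx t ht hZ hVT
    have h1 := V_le_of_Z h00 hx hZ ht
    have h2 := norm_le_of_mem_Z (hZ t ⟨ht, le_rfl⟩)
    have h3 : M.C * M.V (x t) ≤ M.C * (2 * M.V (γ T)) :=
      mul_le_mul_of_nonneg_left (by linarith) hC.le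
    have h4 := min_le_left f.ρ δ
    have h5 := min_le_right f.ρ δ
    have h6 := mul_pos hC hV0
    constructor <;> linarith
  -- `CrossArc` says nothing about positive parameters. A point next to `γ T` on its unstable side
  -- is not enclosed; traced back, it gives a point `P h₁` that is not enclosed, so `h₁ > 0`. The
  -- arc over `(0, k')` misses the loop and is connected, hence is not enclosed at all.
  have hpos : ∀ h, |h| < k' → 0 < h → A.P h ∉ enclosed (loopSet γ) := by
    obtain ⟨ρ₆, hρ₆, hsurj⟩ := A.surj k' hk'0
    set ν := min (M.V (γ T) / M.U f.v)
      (min ρ₅ (min (min k' ρ₆ / (2 * B₅)) (min 1 T / B₅)) / (1 + ‖f.v‖)) with hν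
    have hB : 0 < B₅ := by linarith
    have hν0 : 0 < ν := by positivity
    obtain ⟨hz1, hz2⟩ := f.not_enclosed_add_smul hT hTρ hTv hν0 (min_le_left _ _)
    obtain ⟨x, hx, hxT⟩ := exists_sol h00 T (γ T + ν • f.v)
    have hd : ‖x T - γ T‖ ≤ min ρ₅ (min (min k' ρ₆ / (2 * B₅)) (min 1 T / B₅)) := by
      rw [hxT, add_sub_cancel_left, norm_smul, Real.norm_eq_abs, abs_of_pos hν0]
      have h1 : ν ≤ _ := min_le_right _ _
      rw [le_div_iff₀ (by positivity)] at h1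
      linarith
    obtain ⟨τ, h1, h2, h3⟩ := hback 0 h00 hρ₅.le x T hx (hd.trans (min_le_left _ _))
    rw [add_zero] at h1 h3
    have hd2 := (hd.trans (min_le_right _ _)).trans (min_le_left _ _)
    have hd3 := (hd.trans (min_le_right _ _)).trans (min_le_right _ _)
    rw [le_div_iff₀ (by positivity)] at hd2 hd3
    rw [sub_self, sub_zero] at h1
    have hτ1 : |τ| ≤ min 1 T := by linarith
    have hτ2 := abs_le.1 (hτ1.trans (min_le_left _ _))
    have hτ3 := abs_le.1 (hτ1.trans (min_le_right _ _))
    have hmin := lt_min hk'0 hρ₆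
    have hnear : ‖x τ - γ 0‖ < min k' ρ₆ := by linarith
    obtain ⟨hOp, -, -⟩ := htrack 0 h00 hρ₁.le x τ (hx.traj τ) h2
      (hnear.le.trans ((min_le_left _ _).trans hk1))
    obtain ⟨h₁, hh₁, hh₁', hPh⟩ := hsurj (x τ) h2 (hnear.trans_le (min_le_right _ _))
    have hτΓ : x τ ∉ loopSet γ := by
      intro hcon
      rcases f.O0_inter_loopSet h2 hcon with h | h
      · exact A.ne_zero h₁ hh₁ (hPh.trans h)
      · have := eq_γ_of_eq hx (p := τ) (q := T) (s := τ) (v := τ) le_rfl ⟨le_rfl, hτ3.2⟩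
          (by rw [sub_self, h]) (⟨hτ3.2, le_rfl⟩ : T ∈ Icc τ T)
        rw [hxT] at this
        exact hz1 (Or.inl ⟨T - τ, this.symm⟩)
    have hiff := f.orbit_enclosed hx hτ3.2 (fun v hv => hOp v ⟨hv.1, by linarith [hv.2]⟩) hτΓ
      (by rw [hxT]; exact hz1)
    rw [hxT, ← hPh] at hiff
    have hnE : A.P h₁ ∉ enclosed (loopSet γ) := fun h => hz2 (hiff.1 h)
    have hh₁pos : 0 < h₁ := by
      rcases lt_trichotomy h₁ 0 with h | h | h
      · exact (hnE (A.enclosed h₁ hh₁ h)).elim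
      · rw [← hPh, h, A.P_zero] at hτΓ
        exact (hτΓ (Or.inl ⟨0, rfl⟩)).elim
      · exact h
    intro h hh hh0 hE
    have habs : ∀ u ∈ Ioo 0 k', |u| < k' := fun u hu => by rw [abs_of_pos hu.1]; exact hu.2
    have hconn : IsPreconnected (A.P '' Ioo 0 k') := isPreconnected_Ioo.image _
      (A.continuousOn.mono fun u hu => hmem u (habs u hu))
    refine hnE (subset_enclosed hconn ?_ ⟨h, ⟨hh0, (abs_lt.1 hh).2⟩, rfl⟩ hE
      ⟨h₁, ⟨hh₁pos, (abs_lt.1 hh₁').2⟩, rfl⟩)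
    rintro _ ⟨u, hu, rfl⟩
    exact hΓ u (habs u hu) hu.1.ne'
  refine ⟨T, hT, k', hk'0, hk4, fun h hh x hx hx0 => ?_⟩
  have hx0O : x 0 ∈ S.O0 := by rw [hx0]; exact A.mem h (hmem h hh)
  have hxn : ‖x 0 - γ 0‖ ≤ k' := by rw [hx0]; exact (A.norm_sub_le (hmem h hh)).trans hh.le
  obtain ⟨hOp, -, hcone⟩ := htrack 0 h00 hρ₁.le x 0 (hx.traj 0) hx0O (hxn.trans hk1)
  rw [zero_add] at hOp hcone
  have hVT := (hcone T ⟨le_rfl, by linarith⟩).2.2.2.1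
  -- An enclosed orbit cannot reach the side `U > V / 4`, which is not enclosed; an orbit that is
  -- not enclosed cannot arrive at the part of `Ω⁰` with `V > 0`, which is enclosed.
  refine ⟨fun hneg => ?_, fun hpos' => ?_⟩
  · by_contra hR
    obtain ⟨t, ht, hU, hW⟩ := hstay h hh hneg.ne x hx hx0 hR
    rw [zero_add] at ht hW
    have hOp' : ∀ v ∈ Ioc 0 t, x v ∈ S.Op := fun v hv => by
      rcases le_total v T with h | h
      · exact hOp v ⟨hv.1, by linarith⟩
      · exact W_subset_Op (hW v ⟨h, hv.2⟩)
    have hΓ0 : x 0 ∉ loopSet γ := by rw [hx0]; exact hΓ h hh hneg.ne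
    have hΓt := f.orbit_not_mem hx (hTp.le.trans ht) hOp' hΓ0
    have hE := (f.orbit_enclosed hx (hTp.le.trans ht) (fun v hv => hOp' v ⟨hv.1, hv.2.le⟩) hΓ0
      hΓt).1 (by rw [hx0]; exact A.enclosed h (hmem h hh) hneg)
    have hVt := (hW t ⟨ht, le_rfl⟩).2.1
    exact f.not_enclosed_of_left (hsmall x hx t ht (fun u hu => W_subset_Z (hW u hu)) hVT).1
      hVt.le (by linarith) hE
  · refine hstay h hh hpos'.ne' x hx hx0 fun hR => ?_
    obtain ⟨t, ht, htO, -, hO, -, hZ⟩ := harr 0 h00 hρ₃.le 0 x hx hx0O (hxn.trans hk3) hR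
    rw [zero_add] at ht hZ
    have hE := (hEiff (x t) htO (hsmall x hx t ht hZ hVT).2).2 (hZ t ⟨ht, le_rfl⟩).2.2.1
    have hΓ0 : x 0 ∉ loopSet γ := by rw [hx0]; exact hΓ h hh hpos'.ne'
    have := (f.orbit_enclosed hx (hTp.le.trans ht) hO hΓ0 hE.1).2 hE
    rw [hx0] at this
    exact hpos h hh hpos' this

end LoopFrame
end SaddleModel

/-! ### Half loops of the perturbed system -/

namespace PSSystem

/-- A solution in `Ω⁺` on `(p, q)` with end points on `Ω⁰`. -/
structure PlusArc (S : PSSystem) (ε p q : ℝ) (x : ℝ → Plane) : Prop where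
  lt : p < q
  plusOn : S.PlusOn ε p q x
  left : x p ∈ S.O0
  right : x q ∈ S.O0

/-- A solution in `Ω⁺` on `(p, q)` with end points on `Ω⁰` which extends across `Ω⁰` to a
differentiable function. -/
structure FullArc (S : PSSystem) (ε p q : ℝ) (x : ℝ → Plane) : Prop where
  lt : p < q
  mem : ∀ t ∈ Ioo p q, x t ∈ S.Op
  deriv : ∀ t ∈ Icc p q, HasDerivAt x (S.Fp ε t (x t)) t
  left : x p ∈ S.O0
  right : x q ∈ S.O0

theorem FullArc.plusArc {S : PSSystem} {ε p q : ℝ} {x : ℝ → Plane} (h : S.FullArc ε p q x) :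
    S.PlusArc ε p q x :=
  ⟨h.lt, ⟨fun t ht => (h.deriv t ht).continuousAt.continuousWithinAt, h.mem,
    fun t ht => h.deriv t (Ioo_subset_Icc_self ht)⟩, h.left, h.right⟩

end PSSystem

namespace SaddleModel
variable {S : PSSystem} {γ : ℝ → Plane} {M : SaddleModel S γ}

theorem fullArc_of_sol {ε p q : ℝ} {x : ℝ → Plane} (hε : ε ∈ Icc 0 M.ε₁) (hx : M.Sol ε x)
    (hpq : p < q) (hO : ∀ t ∈ Ioo p q, x t ∈ S.Op) (hp : x p ∈ S.O0) (hq : x q ∈ S.O0)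
    (hK : ∀ t ∈ Icc p q, x t ∈ M.K) : S.FullArc ε p q x := by
  refine ⟨hpq, hO, fun t ht => ?_, hp, hq⟩
  have hD : x t ∈ S.Dp := by
    rcases ht.1.eq_or_lt with h | h
    · rw [← h]; exact Or.inr hp
    · rcases ht.2.eq_or_lt with h' | h'
      · rw [h']; exact Or.inr hq
      · exact Or.inl (hO t ⟨h, h'⟩)
  rw [← M.F_eq ε hε t _ (hK t ht) hD]
  exact hx t

/-- The arrival time is determined too: if the times differed, the earlier one would be a time at
which the other arc is both in `Ω⁺` and on `Ω⁰`. -/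
theorem plusArc_eq_forward {ε p q q' : ℝ} {x z : ℝ → Plane} (hε : ε ∈ Icc 0 M.ε₁)
    (hx : M.Sol ε x) (hxa : S.FullArc ε p q x) (hK : ∀ t ∈ Icc p q, x t ∈ M.K)
    (hz : S.PlusArc ε p q' z) (h : z p = x p) : q' = q ∧ EqOn z x (Icc p q) := by
  have heq := plusOn_eq_forward (q := min q q') hε hx (le_min hxa.lt.le hz.lt.le)
    (fun t ht => hK t ⟨ht.1, ht.2.trans (min_le_left _ _)⟩)
    (hz.plusOn.mono le_rfl (min_le_right _ _)) h
  have hqq : q' = q := by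
    rcases lt_trichotomy q' q with h1 | h1 | h1
    · have := heq (⟨hz.lt.le, by rw [min_eq_right h1.le]⟩ : q' ∈ Icc p (min q q'))
      exact (PSSystem.Op_disjoint_O0 (hxa.mem q' ⟨hz.lt, h1⟩) (this ▸ hz.right)).elim
    · exact h1
    · have := heq (⟨hxa.lt.le, by rw [min_eq_left h1.le]⟩ : q ∈ Icc p (min q q'))
      exact (PSSystem.Op_disjoint_O0 (hz.plusOn.mem q ⟨hxa.lt, h1⟩) (this ▸ hxa.right)).elim
  refine ⟨hqq, ?_⟩
  rwa [hqq, min_self] at heq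

theorem plusArc_eq_backward {ε p p' q : ℝ} {x z : ℝ → Plane} (hε : ε ∈ Icc 0 M.ε₁)
    (hx : M.Sol ε x) (hxa : S.FullArc ε p q x) (hK : ∀ t ∈ Icc p q, x t ∈ M.K)
    (hz : S.PlusArc ε p' q z) (h : z q = x q) : p' = p ∧ EqOn z x (Icc p q) := by
  have heq := plusOn_eq_backward (p := max p p') hε hx (max_le hxa.lt.le hz.lt.le)
    (fun t ht => hK t ⟨(le_max_left _ _).trans ht.1, ht.2⟩)
    (hz.plusOn.mono (le_max_right _ _) le_rfl) h
  have hpp : p' = p := by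
    rcases lt_trichotomy p' p with h1 | h1 | h1
    · have := heq (⟨by rw [max_eq_left h1.le], hxa.lt.le⟩ : p ∈ Icc (max p p') q)
      exact (PSSystem.Op_disjoint_O0 (hz.plusOn.mem p ⟨h1, hxa.lt⟩) (this ▸ hxa.left)).elim
    · exact h1
    · have := heq (⟨by rw [max_eq_right h1.le], hz.lt.le⟩ : p' ∈ Icc (max p p') q)
      exact (PSSystem.Op_disjoint_O0 (hxa.mem p' ⟨h1, hz.lt⟩) (this ▸ hz.left)).elim
  refine ⟨hpp, ?_⟩
  rwa [hpp, max_self] at heq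

theorem mem_Z_of_O0 {x : Plane} (hx : x ∈ Metric.ball (0 : Plane) M.r) (h0 : x ∈ S.O0)
    (hV : 0 < M.V x) : x ∈ M.Z := by
  refine ⟨Or.inr h0, hx, hV, ?_⟩
  have h1 := abs_le.1 (M.G_near x hx)
  rw [h0.2, abs_of_pos hV] at h1
  have h2 : M.η * (|M.U x| + M.V x) ≤ 1 / 100 * (|M.U x| + M.V x) :=
    mul_le_mul_of_nonneg_right (by linarith [M.η_le]) (by linarith [abs_nonneg (M.U x)])
  rcases le_total 0 (M.U x) with h | h
  · rw [abs_of_nonneg h] at h1 h2 ⊢; linarith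
  · rw [abs_of_nonpos h] at h1 h2 ⊢; linarith

namespace LoopFrame

/-- The stable leaf for small `ε`: existence, uniqueness, and behaviour of the neighbouring
solutions. -/
theorem half (f : M.LoopFrame) (A : CrossArc S γ) : ∃ ε₂ > 0, ∃ δ > 0, ∃ B > 0, ∃ k₁ > 0,
    2 * k₁ ≤ A.k ∧ δ ≤ k₁ ∧ ∀ ε, 0 < ε → ε ≤ ε₂ → ∀ τ,
    (∃ h y, |h| < k₁ ∧ S.IsLeaf ε τ y ∧ y τ = A.P h) ∧
    (∀ y, S.IsLeaf ε τ y → ‖y τ - γ 0‖ ≤ B * ε) ∧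
    (∀ y y', S.IsLeaf ε τ y → S.IsLeaf ε τ y' → y τ = y' τ) ∧
    (∀ y h d, S.IsLeaf ε τ y → y τ = A.P h → |h| < k₁ → 0 < d → d ≤ δ →
      (∃ t x, S.FullArc ε τ t x ∧ x τ = A.P (h - d)) ∧
      ∀ t x, S.PlusArc ε τ t x → x τ = A.P (h - d) → x t ∈ enclosed (loopSet γ) ∧
        ‖x t‖ ≤ B * d ^ M.expFwd ∧ ∀ u ∈ Icc τ t, ‖x u - y u‖ ≤ B * d ^ M.expFwd) ∧
    ∀ R ∈ S.O0, R ∈ enclosed (loopSet γ) → ‖R‖ ≤ δ →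
      (∃ τ' x, S.FullArc ε τ' τ x ∧ x τ = R) ∧
      ∀ τ' x y, S.PlusArc ε τ' τ x → x τ = R → S.IsLeaf ε τ' y →
        ∀ u ∈ Icc τ' τ, ‖x u - y u‖ ≤ B * ‖R‖ ^ M.expBwd := by
  obtain ⟨T, hT, k', hk', hk'A, hex⟩ := f.exits A
  have hC := C_pos (M := M)
  have hTp := hT.pos
  obtain ⟨δ₀, hδ₀, hEiff⟩ := f.mem_enclosed_iff
  obtain ⟨ρ₁, hρ₁, hnot⟩ := hT.isLeaf_of_not_exits
  obtain ⟨ρ₂, hρ₂, harr⟩ := hT.arrive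
  obtain ⟨ρ₃, hρ₃, huniq⟩ := hT.leaf_unique
  obtain ⟨ρ₄, hρ₄, B₄, hB₄, hclose⟩ := hT.leaf_close
  obtain ⟨ρ₅, hρ₅, hpers⟩ := hT.exits_persist
  obtain ⟨ρ₆, hρ₆, B₆, hB₆, hfwd⟩ := hT.forward_estimate
  obtain ⟨ρ₇, hρ₇, B₇, hB₇, δ₇, hδ₇, hbwd⟩ := hT.backward_estimate
  obtain ⟨ρ₈, hρ₈, hleaf⟩ := hT.leaf (lt_min hρ₆ hρ₇)
  obtain ⟨ρ₉, hρ₉, δ₉, hδ₉, hback⟩ := hT.back hρ₇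
  set k₀ := min k' (min (min ρ₁ ρ₂) (min ρ₅ ρ₆)) with hk₀
  have hk₀p : 0 < k₀ := by positivity
  have hk₀k' : k₀ ≤ k' := min_le_left _ _
  have hk₀1 : k₀ ≤ ρ₁ := ((min_le_right _ _).trans (min_le_left _ _)).trans (min_le_left _ _)
  have hk₀2 : k₀ ≤ ρ₂ := ((min_le_right _ _).trans (min_le_left _ _)).trans (min_le_right _ _)
  have hk₀5 : k₀ ≤ ρ₅ := ((min_le_right _ _).trans (min_le_right _ _)).trans (min_le_left _ _)
  have hk₀6 : k₀ ≤ ρ₆ := ((min_le_right _ _).trans (min_le_right _ _)).trans (min_le_right _ _)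
  clear_value k₀
  have hmem : ∀ h, |h| < k₀ → h ∈ Ioo (-A.k) A.k := fun h hh =>
    abs_lt.1 (hh.trans_le (hk₀k'.trans hk'A))
  have hPn : ∀ h, |h| < k₀ → ‖A.P h - γ 0‖ ≤ k₀ := fun h hh =>
    (A.norm_sub_le (hmem h hh)).trans hh.le
  have hhalf : |k₀ / 2| < k₀ := by rw [abs_of_pos (by linarith)]; linarith
  have hhalf' : |-(k₀ / 2)| < k₀ := by rw [abs_neg]; exact hhalf
  -- Persistence is needed only at two fixed starting points, `±k₀ / 2`; the resulting bound on `ε`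
  -- does not depend on `τ`.
  have hexit : ∀ (sgn h : ℝ), |h| < k₀ → (∀ x, M.Sol 0 x → x 0 = A.P h → M.Exits sgn T 0 x) →
      ∃ ε₂ > 0, ∀ ε ∈ Icc 0 M.ε₁, ε ≤ ε₂ → ∀ τ x, M.Sol ε x → x τ = A.P h →
        M.Exits sgn T τ x := by
    intro sgn h hh hE
    obtain ⟨x, hx, hx0⟩ := exists_sol zero_mem_Icc (M := M) 0 (A.P h)
    have := hpers sgn x hx (by rw [hx0]; exact A.mem h (hmem h hh))
      (by rw [hx0]; exact (hPn h hh).trans hk₀5) (hE x hx hx0)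
    rwa [hx0] at this
  obtain ⟨e₁, he₁, hR⟩ := hexit (-1) (-(k₀ / 2)) hhalf' fun x hx hx0 =>
    (hex _ (hhalf'.trans_le hk₀k') x hx hx0).1 (by linarith)
  obtain ⟨e₂, he₂, hL⟩ := hexit 1 (k₀ / 2) hhalf fun x hx hx0 =>
    (hex _ (hhalf.trans_le hk₀k') x hx hx0).2 (by linarith)
  obtain ⟨ρs, hρs, hsurj⟩ := A.surj (k₀ / 4) (by linarith)
  set ε₂ := min (min M.ε₁ (min e₁ e₂)) (min (min (min ρ₁ ρ₂) (min ρ₃ ρ₄)) (min (min ρ₆ ρ₇)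
    (min (min ρ₈ ρ₉) (ρs / (2 * B₄))))) with hε₂
  have hB₄p : 0 < B₄ := by linarith
  have hε₂p : 0 < ε₂ := by have := M.ε₁_pos; positivity
  have hall : ∀ ε ≤ ε₂, (ε ≤ M.ε₁ ∧ ε ≤ e₁ ∧ ε ≤ e₂) ∧ (ε ≤ ρ₁ ∧ ε ≤ ρ₂) ∧ (ε ≤ ρ₃ ∧ ε ≤ ρ₄) ∧
      (ε ≤ ρ₆ ∧ ε ≤ ρ₇) ∧ (ε ≤ ρ₈ ∧ ε ≤ ρ₉) ∧ ε ≤ ρs / (2 * B₄) := by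
    intro ε h
    simp only [hε₂, le_min_iff] at h
    tauto
  clear_value ε₂
  obtain ⟨hp0, hp1⟩ := M.expFwd_mem
  set B := max B₄ (max B₆ B₇) with hB
  have hBB4 : B₄ ≤ B := le_max_left _ _
  have hBB6 : B₆ ≤ B := (le_max_left _ _).trans (le_max_right _ _)
  have hBB7 : B₇ ≤ B := (le_max_right _ _).trans (le_max_right _ _)
  have hBp : 0 < B := hB₄p.trans_le hBB4
  clear_value B
  obtain ⟨δ₁, hδ₁, hδ₁'⟩ : ∃ δ₁ > 0, ∀ d, 0 < d → d ≤ δ₁ → B * d ^ M.expFwd < δ₀ := by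
    refine ⟨(δ₀ / (2 * B)) ^ (M.expFwd)⁻¹, by positivity, fun d hd hd' => ?_⟩
    have h1 := Real.rpow_le_rpow hd.le hd' hp0.le
    rw [← Real.rpow_mul (by positivity), inv_mul_cancel₀ hp0.ne', Real.rpow_one,
      le_div_iff₀ (by positivity)] at h1
    linarith
  set δ := min (min (k₀ / 4) (min δ₁ 1)) (min (min δ₀ M.r / 2) (min δ₇ (δ₉ / M.C))) with hδ
  have hδp : 0 < δ := by have := M.r_pos; positivity
  have hδall : δ ≤ k₀ / 4 ∧ δ ≤ δ₁ ∧ δ ≤ 1 ∧ δ ≤ min δ₀ M.r / 2 ∧ δ ≤ δ₇ ∧ δ ≤ δ₉ / M.C := by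
    have : δ ≤ δ := le_rfl
    conv at this => rhs; rw [hδ]
    simp only [le_min_iff] at this
    tauto
  clear_value δ
  obtain ⟨d1, d2, d3, d4, d5, d6⟩ := hδall
  refine ⟨ε₂, hε₂p, δ, hδp, B, hBp, k₀ / 4, by linarith, by linarith, d1, ?_⟩
  intro ε hε0 hεle τ
  obtain ⟨⟨i1, i2, i3⟩, ⟨i4, i5⟩, ⟨i6, i7⟩, ⟨i8, i9⟩, ⟨i10, i11⟩, i12⟩ := hall ε hεle
  have hε : ε ∈ Icc 0 M.ε₁ := ⟨hε0.le, i1⟩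
  have hX : ∀ h : ℝ, ∃ x, M.Sol ε x ∧ x τ = A.P h := fun h => exists_sol hε τ _
  choose X hXs hXτ using hX
  have hcl : ∀ y, S.IsLeaf ε τ y → ‖y τ - γ 0‖ ≤ B₄ * ε := hclose ε hε i7 τ
  have huq : ∀ y y', S.IsLeaf ε τ y → S.IsLeaf ε τ y' → y τ = y' τ := huniq ε hε i6 τ
  have hnl : ∀ h, |h| < k₀ → ¬ M.Exits (-1) T τ (X h) → ¬ M.Exits 1 T τ (X h) →
      S.IsLeaf ε τ (X h) := fun h hh =>
    hnot ε hε i4 τ (X h) (hXs h) (by rw [hXτ]; exact A.mem h (hmem h hh))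
      (by rw [hXτ]; exact (hPn h hh).trans hk₀1)
  have habs : ∀ h ∈ Icc (-(k₀ / 2)) (k₀ / 2), |h| < k₀ := fun h hh =>
    abs_lt.2 ⟨by linarith [hh.1], by linarith [hh.2]⟩
  have hR' := hR ε hε i2 τ (X (-(k₀ / 2))) (hXs _) (hXτ _)
  have hL' := hL ε hε i3 τ (X (k₀ / 2)) (hXs _) (hXτ _)
  -- Shooting between `-k₀ / 2` and any point exiting to the side `U > 0` produces a leaf point in
  -- between.
  have hbet : ∀ h₂ ≤ k₀ / 2, -(k₀ / 2) ≤ h₂ → M.Exits 1 T τ (X h₂) →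
      ∃ h ∈ Icc (-(k₀ / 2)) h₂, S.IsLeaf ε τ (X h) := by
    intro h₂ hh₂ hh₂' hE
    obtain ⟨h, hh, h1, h2⟩ := exists_not_exits hε (P := A.P)
      (A.continuousOn.mono fun h hh => hmem h (habs h ⟨hh.1, hh.2.trans hh₂⟩)) hh₂' hXs hXτ hTp.le
      hR' hE
    exact ⟨h, hh, hnl h (habs h ⟨hh.1, hh.2.trans hh₂⟩) h1 h2⟩
  refine ⟨?_, fun y hy => (hcl y hy).trans (mul_le_mul_of_nonneg_right hBB4 hε0.le), huq, ?_, ?_⟩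
  · obtain ⟨h, hh, hy⟩ := hbet (k₀ / 2) le_rfl (by linarith) hL'
    rw [le_div_iff₀ (by positivity)] at i12
    obtain ⟨h', -, hh', hP⟩ := hsurj _ hy.start ((hcl _ hy).trans_lt (by linarith))
    exact ⟨h', _, hh', hy, hP.symm⟩
  · intro y h d hy hyh hh hd0 hd
    obtain ⟨hh1, hh2⟩ := abs_lt.1 hh
    have hhd : h - d ∈ Icc (-(k₀ / 2)) (k₀ / 2) := ⟨by linarith, by linarith⟩
    have hhd' := habs _ hhd
    have hnotleaf : ∀ h' ∈ Icc (-(k₀ / 2)) (h - d), ¬ S.IsLeaf ε τ (X h') := by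
      intro h' hh' hl
      have h1 := huq _ _ hl hy
      rw [hXτ, hyh] at h1
      have := A.inj (hmem h' (habs h' ⟨hh'.1, hh'.2.trans hhd.2⟩)) (hmem h (by
        exact hh.trans (by linarith))) h1
      linarith [hh'.2]
    -- Left of the leaf point every orbit exits through `U < 0`: staying, or exiting on the other
    -- side, would produce a second leaf point with parameter at most `h - d`.
    have hER : M.Exits (-1) T τ (X (h - d)) := by
      by_contra hcon
      by_cases hE1 : M.Exits 1 T τ (X (h - d))
      · obtain ⟨h', hh', hl⟩ := hbet (h - d) hhd.2 hhd.1 hE1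
        exact hnotleaf h' hh' hl
      · exact hnotleaf (h - d) ⟨hhd.1, le_rfl⟩ (hnl _ hhd' hcon hE1)
    have hO : X (h - d) τ ∈ S.O0 := by rw [hXτ]; exact A.mem _ (hmem _ hhd')
    have hn : ‖X (h - d) τ - γ 0‖ ≤ k₀ := by rw [hXτ]; exact hPn _ hhd'
    obtain ⟨t, ht, htO, -, hOp, hK, hZ⟩ := harr ε hε i5 τ _ (hXs _) hO (hn.trans hk₀2) hER
    have hfull := fullArc_of_sol hε (hXs (h - d)) (by linarith) hOp hO htO hK
    refine ⟨⟨t, _, hfull, hXτ _⟩, fun t' x hx hxτ => ?_⟩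
    obtain ⟨rfl, heq⟩ := plusArc_eq_forward hε (hXs (h - d)) hfull hK hx (hxτ.trans (hXτ _).symm)
    obtain ⟨b1, b2, -, b4⟩ := hleaf ε hε i10 τ y hy
    have hdist : ‖X (h - d) τ - y τ‖ ≤ d := by
      rw [hXτ, hyh]
      refine (A.lip _ (hmem _ hhd') _ (hmem _ (hh.trans (by linarith)))).trans ?_
      rw [sub_sub_cancel_left, abs_neg, abs_of_pos hd0]
    obtain ⟨c1, c2⟩ := hfwd ε hε i8 τ t' (X (h - d)) y d ((hXs _).traj τ) hO (hn.trans hk₀6) ht hZ htO b1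
      hy.start (b2.trans (min_le_left _ _)) b4 hdist hd0 (hd.trans d3)
    have hdp : 0 ≤ d ^ M.expFwd := (Real.rpow_pos_of_pos hd0 _).le
    have hle : B₆ * d ^ M.expFwd ≤ B * d ^ M.expFwd := mul_le_mul_of_nonneg_right hBB6 hdp
    rw [heq ⟨by linarith, le_rfl⟩]
    refine ⟨?_, c1.trans hle, fun u hu => by rw [heq hu]; exact (c2 u hu).trans hle⟩
    exact (hEiff _ htO ((c1.trans hle).trans_lt (hδ₁' d hd0 (hd.trans d2)))).2
      (hZ t' ⟨ht, le_rfl⟩).2.2.1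
  · intro R hR hRE hRδ
    have hRm := hRδ.trans d4
    have hm1 := min_le_left δ₀ M.r
    have hm2 := min_le_right δ₀ M.r
    have hm3 := lt_min hδ₀ M.r_pos
    have hV := (hEiff R hR (by linarith)).1 hRE
    have hZR : R ∈ M.Z := mem_Z_of_O0 (by rw [mem_ball_zero_iff]; linarith) hR hV
    obtain ⟨x, hx, hxτ⟩ := exists_sol hε τ R
    have hVR : M.V R ≤ δ₉ := by
      have h1 := hRδ.trans d6
      rw [le_div_iff₀ hC] at h1
      linarith [(le_abs_self _).trans (M.V_le R)]
    obtain ⟨τ', e1, e2, e3, e4, e5, e6⟩ := hback ε hε i11 x τ hx (by rw [hxτ]; exact hZR)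
      (by rw [hxτ]; exact hVR)
    have hfull := fullArc_of_sol hε hx (by linarith : τ' < τ) e4 e2 (by rw [hxτ]; exact hR) e5
    refine ⟨⟨τ', x, hfull, hxτ⟩, fun τ'' z y hz hzτ hy u hu => ?_⟩
    obtain ⟨rfl, heq⟩ := plusArc_eq_backward hε hx hfull e5 hz (hzτ.trans hxτ.symm)
    obtain ⟨b1, b2, -, b4⟩ := hleaf ε hε i10 _ y hy
    have := hbwd ε hε i9 τ'' τ x y (hx.traj _) e2 e3 (by linarith) e6 b1 hy.start
      (b2.trans (min_le_right _ _)) b4 (by rw [hxτ]; exact hRδ.trans d5) u hu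
    rw [heq hu]
    rw [hxτ] at this
    exact this.trans (mul_le_mul_of_nonneg_right hBB7 (Real.rpow_nonneg (norm_nonneg _) _))

end LoopFrame
end SaddleModel

/-! ### Functions of class `C¹` up to the boundary of a half domain -/

section HalfDomain
variable {E F : Type*} [NormedAddCommGroup E] [NormedSpace ℝ E] [NormedAddCommGroup F]
  [NormedSpace ℝ F] {G : E → ℝ} {G' : E →L[ℝ] ℝ} {D : Set E} {p : E} {f : E → F}

theorem exists_apply_eq_one (hG0 : G' ≠ 0) : ∃ n, G' n = 1 ∧ 0 < ‖n‖ := by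
  obtain ⟨v, hv⟩ : ∃ v, G' v ≠ 0 := by
    by_contra h
    push Not at h
    exact hG0 (ContinuousLinearMap.ext h)
  have h1 : G' ((G' v)⁻¹ • v) = 1 := by rw [map_smul, smul_eq_mul, inv_mul_cancel₀ hv]
  refine ⟨_, h1, norm_pos_iff.2 fun h => ?_⟩
  rw [h, map_zero] at h1
  exact zero_ne_one h1

/-- On a half domain bounded by a regular hypersurface, a function which is `C^1` up to the boundary
is strictly differentiable at the boundary points. -/
theorem exists_strict_derivative (hG : HasStrictFDerivAt G G' p) (hG0 : G' ≠ 0)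
    (hD : ∀ᶠ x in 𝓝 p, 0 ≤ G x → x ∈ D) (hD' : ∀ x ∈ D, 0 ≤ G x) (hp : p ∈ D)
    (hf : ContDiffWithinAt ℝ 1 f D p) : ∃ A : E →L[ℝ] F, HasFDerivWithinAt f A D p ∧
      ∀ e > 0, ∃ r > 0, ∀ x ∈ D, ∀ y ∈ D, ‖x - p‖ < r → ‖y - p‖ < r →
        ‖f x - f y - A (x - y)‖ ≤ e * ‖x - y‖ := by
  obtain ⟨n, hn1, hn⟩ := exists_apply_eq_one hG0
  have hf' : ContDiffWithinAt ℝ (0 + 1) f D p := by simpa using hf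
  obtain ⟨u, hu, -, f', hfu, hf'u⟩ :=
    (contDiffWithinAt_succ_iff_hasFDerivWithinAt (by simp)).1 hf'
  rw [insert_eq_of_mem hp] at hu
  have hpu : p ∈ u := mem_of_mem_nhdsWithin hp hu
  refine ⟨f' p, (hfu p hpu).mono_of_mem_nhdsWithin hu, fun e he => ?_⟩
  obtain ⟨R₁, hR₁, hu'⟩ := Metric.mem_nhdsWithin_iff.1 hu
  obtain ⟨R₂, hR₂, hcont⟩ := Metric.continuousWithinAt_iff.1 hf'u.continuousWithinAt (e / 3)
    (by positivity)
  obtain ⟨R₃, hR₃, hD⟩ := Metric.eventually_nhds_iff_ball.1 hD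
  set c : NNReal := ⟨1 / (2 * ‖n‖), by positivity⟩ with hc
  have hcn : (c : ℝ) * ‖n‖ = 1 / 2 := by
    change 1 / (2 * ‖n‖) * ‖n‖ = 1 / 2
    field_simp
  obtain ⟨s, hs, happ⟩ := hG.approximates_deriv_on_nhds (c := c) (Or.inr (by
    rw [← NNReal.coe_pos]; exact (by positivity : 0 < 1 / (2 * ‖n‖))))
  obtain ⟨R₄, hR₄, hs⟩ := Metric.mem_nhds_iff.1 hs
  set R := min (min R₁ R₂) (min R₃ R₄) with hR
  have hRp : 0 < R := lt_min (lt_min hR₁ hR₂) (lt_min hR₃ hR₄)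
  -- The mean value inequality needs the segment to lie in `D`. This may fail for `x` and `y` near
  -- the boundary, so they are joined by three segments, displaced inwards by a vector `m` of length
  -- `‖x - y‖`.
  have hseg : ∀ a b : E, (∀ θ ∈ Icc (0 : ℝ) 1, a + θ • (b - a) ∈ D ∧ ‖a + θ • (b - a) - p‖ < R) →
      ‖f b - f a - f' p (b - a)‖ ≤ e / 3 * ‖b - a‖ := by
    intro a b hab
    have hsub : ∀ z ∈ segment ℝ a b, z ∈ u ∧ ‖f' z - f' p‖ ≤ e / 3 := by
      rw [segment_eq_image']
      rintro _ ⟨θ, hθ, rfl⟩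
      obtain ⟨h1, h2⟩ := hab θ hθ
      have hzu : a + θ • (b - a) ∈ u := hu' ⟨by
        rw [Metric.mem_ball, dist_eq_norm]
        exact h2.trans_le ((min_le_left _ _).trans (min_le_left _ _)), h1⟩
      refine ⟨hzu, ?_⟩
      have h3 := hcont hzu (by
        rw [dist_eq_norm]; exact h2.trans_le ((min_le_left _ _).trans (min_le_right _ _)))
      rw [dist_eq_norm] at h3
      exact h3.le
    exact Convex.norm_image_sub_le_of_norm_hasFDerivWithin_le'
      (fun z hz => (hfu z (hsub z hz).1).mono fun w hw => (hsub w hw).1)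
      (fun z hz => (hsub z hz).2) (convex_segment a b) (left_mem_segment ℝ a b)
      (right_mem_segment ℝ a b)
  refine ⟨R / 3, by positivity, fun x hx y hy hxr hyr => ?_⟩
  set ℓ := ‖x - y‖ with hℓ
  have hℓ0 : 0 ≤ ℓ := norm_nonneg _
  have hℓR : ℓ < 2 * (R / 3) := by
    have : ‖x - y‖ ≤ ‖x - p‖ + ‖y - p‖ := by
      rw [show x - y = (x - p) - (y - p) by abel]; exact norm_sub_le _ _
    linarith
  have hmem : ∀ z : E, ‖z - p‖ < R → 0 ≤ G z → z ∈ D := fun z hz hGz => hD z (by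
    rw [Metric.mem_ball, dist_eq_norm]
    exact hz.trans_le ((min_le_right _ _).trans (min_le_left _ _))) hGz
  have hGest : ∀ z w : E, ‖z - p‖ < R → ‖w - p‖ < R →
      G w + G' (z - w) - c * ‖z - w‖ ≤ G z := by
    intro z w hz hw
    have h1 := happ z (hs (by
      rw [Metric.mem_ball, dist_eq_norm]
      exact hz.trans_le ((min_le_right _ _).trans (min_le_right _ _)))) w (hs (by
      rw [Metric.mem_ball, dist_eq_norm]
      exact hw.trans_le ((min_le_right _ _).trans (min_le_right _ _))))
    linarith [(abs_le.1 h1).1]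
  set m := (ℓ / ‖n‖) • n with hm
  have hmn : ‖m‖ = ℓ := by
    rw [hm, norm_smul, Real.norm_eq_abs, abs_of_nonneg (by positivity), div_mul_cancel₀ _ hn.ne']
  have hGm : G' m = ℓ / ‖n‖ := by rw [hm, map_smul, hn1, smul_eq_mul, mul_one]
  have hcℓ : c * ℓ = ℓ / ‖n‖ / 2 := by
    change 1 / (2 * ‖n‖) * ℓ = _
    field_simp
  clear_value m c
  have hup : ∀ a ∈ D, ‖a - p‖ < R / 3 → ∀ θ ∈ Icc (0 : ℝ) 1, a + θ • m ∈ D ∧ ‖a + θ • m - p‖ < R := by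
    intro a ha har θ hθ
    have h1 : ‖θ • m‖ = θ * ℓ := by rw [norm_smul, Real.norm_eq_abs, abs_of_nonneg hθ.1, hmn]
    have h2 : θ * ℓ ≤ ℓ := mul_le_of_le_one_left hℓ0 hθ.2
    have h3 : ‖a + θ • m - p‖ < R := by
      rw [show a + θ • m - p = (a - p) + θ • m by abel]
      exact (norm_add_le _ _).trans_lt (by linarith)
    refine ⟨hmem _ h3 ?_, h3⟩
    have h4 := hGest _ a h3 (by linarith)
    rw [add_sub_cancel_left, map_smul, hGm, h1, smul_eq_mul] at h4
    have h5 : (c : ℝ) * (θ * ℓ) = θ * (ℓ / ‖n‖ / 2) := by rw [← hcℓ]; ring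
    have h6 : 0 ≤ θ * (ℓ / ‖n‖) := mul_nonneg hθ.1 (by positivity)
    linarith [hD' a ha]
  have hyx := hup x hx hxr
  have hyy := hup y hy hyr
  have e1 := hseg x (x + m) (by simpa using hyx)
  have e2 := hseg y (y + m) (by simpa using hyy)
  -- At a point `z` of the shifted segment `G` is bounded below from `x` and from `y`. In the
  -- combination of the two bounds with weights `θ` and `1 - θ` the terms `G' (x - y)` cancel, and
  -- the inward displacement dominates the error.
  have e3 := hseg (y + m) (x + m) (by
    intro θ hθ
    set z := y + m + θ • (x + m - (y + m)) with hz
    have hzx : z - x = (θ - 1) • (x - y) + m := by rw [hz]; module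
    have hzy : z - y = θ • (x - y) + m := by rw [hz]; module
    have h2 : ‖z - x‖ ≤ (1 - θ) * ℓ + ℓ := by
      rw [hzx]
      refine (norm_add_le _ _).trans (le_of_eq ?_)
      rw [norm_smul, Real.norm_eq_abs, abs_of_nonpos (by linarith [hθ.2]), hmn, neg_sub]
    have h3 : ‖z - y‖ ≤ θ * ℓ + ℓ := by
      rw [hzy]
      refine (norm_add_le _ _).trans (le_of_eq ?_)
      rw [norm_smul, Real.norm_eq_abs, abs_of_nonneg hθ.1, hmn]
    have h1 : ‖z - p‖ < R := by
      rw [show z - p = (1 - θ) • (y - p) + θ • (x - p) + m by rw [hz]; module]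
      refine (norm_add_le _ _).trans_lt ?_
      have h4 := norm_add_le ((1 - θ) • (y - p)) (θ • (x - p))
      rw [norm_smul, norm_smul, Real.norm_eq_abs, Real.norm_eq_abs,
        abs_of_nonneg (sub_nonneg.2 hθ.2), abs_of_nonneg hθ.1] at h4
      have h5 : (1 - θ) * ‖y - p‖ ≤ (1 - θ) * (R / 3) :=
        mul_le_mul_of_nonneg_left hyr.le (sub_nonneg.2 hθ.2)
      have h6 : θ * ‖x - p‖ ≤ θ * (R / 3) := mul_le_mul_of_nonneg_left hxr.le hθ.1
      rw [hmn]
      linarith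
    refine ⟨hmem _ h1 ?_, h1⟩
    have h4 := hGest z x h1 (by linarith)
    have h5 := hGest z y h1 (by linarith)
    rw [hzx, map_add, map_smul, hGm, smul_eq_mul, ← hzx] at h4
    rw [hzy, map_add, map_smul, hGm, smul_eq_mul, ← hzy] at h5
    have h6 : (c : ℝ) * ‖z - x‖ ≤ c * ((1 - θ) * ℓ + ℓ) := mul_le_mul_of_nonneg_left h2 c.2
    have h7 : (c : ℝ) * ‖z - y‖ ≤ c * (θ * ℓ + ℓ) := mul_le_mul_of_nonneg_left h3 c.2
    have h8 : (c : ℝ) * ((1 - θ) * ℓ + ℓ) = (2 - θ) * (ℓ / ‖n‖ / 2) := by rw [← hcℓ]; ring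
    have h9 : (c : ℝ) * (θ * ℓ + ℓ) = (1 + θ) * (ℓ / ‖n‖ / 2) := by rw [← hcℓ]; ring
    have i1 : θ * ((θ - 1) * G' (x - y) + ℓ / ‖n‖ - (2 - θ) * (ℓ / ‖n‖ / 2)) ≤ θ * G z :=
      mul_le_mul_of_nonneg_left (by linarith [hD' x hx]) hθ.1
    have i2 : (1 - θ) * (θ * G' (x - y) + ℓ / ‖n‖ - (1 + θ) * (ℓ / ‖n‖ / 2)) ≤ (1 - θ) * G z :=
      mul_le_mul_of_nonneg_left (by linarith [hD' y hy]) (sub_nonneg.2 hθ.2)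
    have i3 : 0 ≤ ℓ / ‖n‖ * ((1 - θ) ^ 2 + θ ^ 2) := by positivity
    linarith)
  rw [add_sub_cancel_left, hmn] at e1 e2
  rw [add_sub_add_right_eq_sub, ← hℓ] at e3
  have : f x - f y - f' p (x - y) = (f (x + m) - f (y + m) - f' p (x - y)) +
      (f (y + m) - f y - f' p m) - (f (x + m) - f x - f' p m) := by abel
  rw [this]
  refine (norm_sub_le _ _).trans ?_
  have := norm_add_le (f (x + m) - f (y + m) - f' p (x - y)) (f (y + m) - f y - f' p m)
  linarith

/-- Near `p` the set `D` contains a truncated convex cone around the inward normal. Thus the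
derivative within `D` at a boundary point, in terms of which the eigenvalues are given, is well
determined. -/
theorem uniqueDiffWithinAt_half (hG : HasStrictFDerivAt G G' p) (hG0 : G' ≠ 0) (hGp : 0 ≤ G p)
    (hD : ∀ᶠ x in 𝓝 p, 0 ≤ G x → x ∈ D) : UniqueDiffWithinAt ℝ D p := by
  obtain ⟨n, hn1, hn⟩ := exists_apply_eq_one hG0
  have hev := (hG.hasFDerivAt.isLittleO.def (c := 1 / (2 * ‖n‖)) (by positivity)).and hD
  obtain ⟨r, hr, hball⟩ := Metric.eventually_nhds_iff_ball.1 hev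
  set c := 1 / (2 * ‖n‖) with hc
  have hcn : c * ‖n‖ = 1 / 2 := by rw [hc]; field_simp
  have hcp : 0 < c := by positivity
  clear_value c
  set s : Set E := Metric.ball p r ∩ {x | c * ‖x - p‖ ≤ G' (x - p)} with hs
  have hconv : Convex ℝ s := by
    refine (convex_ball p r).inter fun x hx y hy a b ha hb hab => ?_
    have h1 : a • x + b • y - p = a • (x - p) + b • (y - p) := by
      have : p = (a + b) • p := by rw [hab, one_smul]
      nth_rewrite 1 [this]; module
    rw [mem_ofPred_eq] at hx hy ⊢
    rw [h1, map_add, map_smul, map_smul, smul_eq_mul, smul_eq_mul]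
    have h2 := norm_add_le (a • (x - p)) (b • (y - p))
    rw [norm_smul, norm_smul, Real.norm_eq_abs, Real.norm_eq_abs, abs_of_nonneg ha,
      abs_of_nonneg hb] at h2
    have h3 := mul_le_mul_of_nonneg_left h2 hcp.le
    have h4 := mul_le_mul_of_nonneg_left hx ha
    have h5 := mul_le_mul_of_nonneg_left hy hb
    linarith
  have hsD : s ⊆ D := by
    rintro x ⟨hx, hx'⟩
    obtain ⟨h1, h2⟩ := hball x hx
    rw [Real.norm_eq_abs] at h1
    rw [mem_ofPred_eq] at hx'
    exact h2 (by linarith [(abs_le.1 h1).1])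
  have hint : (interior s).Nonempty := by
    have hopen : IsOpen (Metric.ball p r ∩ {x | c * ‖x - p‖ < G' (x - p)}) := by
      refine Metric.isOpen_ball.inter (isOpen_lt ?_ ?_)
      · fun_prop
      · exact G'.continuous.comp (by fun_prop)
    have hsub' : Metric.ball p r ∩ {x | c * ‖x - p‖ < G' (x - p)} ⊆ s :=
      inter_subset_inter_right _ fun x (hx : c * ‖x - p‖ < G' (x - p)) => hx.le
    have hsub := interior_maximal hsub' hopen
    refine ⟨p + (r / (2 * ‖n‖)) • n, hsub (mem_inter ?_ ?_)⟩
    · rw [Metric.mem_ball, dist_eq_norm, add_sub_cancel_left, norm_smul, Real.norm_eq_abs,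
        abs_of_pos (by positivity)]
      have : r / (2 * ‖n‖) * ‖n‖ = r / 2 := by field_simp
      linarith
    · rw [mem_ofPred_eq, add_sub_cancel_left, norm_smul, Real.norm_eq_abs,
        abs_of_pos (by positivity), map_smul, hn1, smul_eq_mul, mul_one]
      have h1 : 0 < r / (2 * ‖n‖) := by positivity
      have : c * (r / (2 * ‖n‖) * ‖n‖) = r / (2 * ‖n‖) * (1 / 2) := by rw [← hcn]; ring
      linarith
  refine (uniqueDiffWithinAt_convex hconv hint (subset_closure ⟨Metric.mem_ball_self hr, ?_⟩)).mono hsD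
  rw [mem_ofPred_eq]
  simp

end HalfDomain

/-! ### Global Lipschitz extension of the perturbed field -/

theorem exists_bounded_extension {X : Type*} [PseudoMetricSpace X] {s : Set X} {f : X → Plane}
    {K : NNReal} {C : ℝ} (hf : LipschitzOnWith K f s) (hC0 : 0 ≤ C) (hC : ∀ x ∈ s, ‖f x‖ ≤ C) :
    ∃ g, LipschitzWith (lipschitzExtensionConstant Plane * K) g ∧ EqOn f g s ∧
      ∀ x, ‖g x‖ ≤ 2 * C := by
  obtain ⟨g, hg, heq⟩ := hf.extend_finite_dimension
  -- Truncating each coordinate to `[-C, C]` keeps the Lipschitz constant and does not change `f` on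
  -- `s`; with two coordinates the norm is at most `√2 C`.
  set κ : ℝ → ℝ := fun a => max (-C) (min C a) with hκ
  have hκlip : ∀ a b, |κ a - κ b| ≤ |a - b| := fun a b => by
    rw [hκ]
    simp only [max_comm (-C), min_comm C]
    exact (abs_max_sub_max_le_abs _ _ _).trans ((abs_min_sub_min_le_max a C b C).trans (by simp))
  have hκb : ∀ a, |κ a| ≤ C := fun a =>
    abs_le.2 ⟨le_max_left _ _, max_le (by linarith) (min_le_left _ _)⟩
  have hκid : ∀ a, |a| ≤ C → κ a = a := fun a ha => by
    rw [hκ]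
    simp only
    rw [min_eq_right (abs_le.1 ha).2, max_eq_right (abs_le.1 ha).1]
  set φ : Plane → Plane := fun v => WithLp.toLp 2 fun i => κ (v i) with hφ
  have hφlip : LipschitzWith 1 φ := by
    refine LipschitzWith.of_dist_le_mul fun v w => ?_
    rw [NNReal.coe_one, one_mul, EuclideanSpace.dist_eq, EuclideanSpace.dist_eq]
    refine Real.sqrt_le_sqrt (Finset.sum_le_sum fun i _ => ?_)
    exact pow_le_pow_left₀ dist_nonneg (by rw [Real.dist_eq, Real.dist_eq]; exact hκlip _ _) 2
  refine ⟨fun x => φ (g x), by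
    have := hφlip.comp hg
    rwa [one_mul] at this, fun x hx => ?_, fun x => ?_⟩
  · rw [heq hx]
    refine PiLp.ext fun i => ?_
    have h1 := (PiLp.norm_apply_le (f x) i).trans (hC x hx)
    rw [Real.norm_eq_abs, heq hx] at h1
    exact (hκid _ h1).symm
  · rw [EuclideanSpace.norm_eq]
    refine Real.sqrt_le_iff.2 ⟨by linarith, ?_⟩
    rw [Fin.sum_univ_two]
    have h1 : ∀ i, ‖φ (g x) i‖ ^ 2 ≤ C ^ 2 := fun i =>
      pow_le_pow_left₀ (norm_nonneg _) (hκb _) 2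
    linarith [h1 0, h1 1, sq_nonneg C]

namespace PSSystem

/-- The regularity of the half system which is used below. -/
structure HalfRegular (S : PSSystem) : Prop where
  isOpen : IsOpen S.Ω
  G_reg : ContDiffOn ℝ 1 S.G S.Ω
  fp_reg : ContDiffOn ℝ 1 S.fp S.Dp
  regular : ∀ x ∈ S.O0, fderiv ℝ S.G x ≠ 0
  g_bdd : ∃ C : ℝ, ∀ t ε, ∀ x ∈ S.Ω, ‖S.g t x ε‖ ≤ C
  g_lip : ∃ L : ℝ, 0 ≤ L ∧ ∀ t t' ε x x', segment ℝ x x' ⊆ S.Ω →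
    ‖S.g t x ε - S.g t' x' ε‖ ≤ L * (|t - t'| + ‖x - x'‖)

variable {S : PSSystem}

theorem HalfRegular.contDiffAt (h : S.HalfRegular) {x : Plane} (hx : x ∈ S.Ω) :
    ContDiffAt ℝ 1 S.G x := h.G_reg.contDiffAt (h.isOpen.mem_nhds hx)

theorem HalfRegular.strict (h : S.HalfRegular) {x : Plane} (hx : x ∈ S.Ω) :
    HasStrictFDerivAt S.G (fderiv ℝ S.G x) x :=
  (h.contDiffAt hx).hasStrictFDerivAt one_ne_zero

theorem HalfRegular.mem_Dp (h : S.HalfRegular) {p : Plane} (hp : p ∈ S.Ω) :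
    ∀ᶠ x in 𝓝 p, 0 ≤ S.G x → x ∈ S.Dp := by
  filter_upwards [h.isOpen.mem_nhds hp] with x hx h0
  rcases h0.eq_or_lt with h1 | h1
  · exact Or.inr ⟨hx, h1.symm⟩
  · exact Or.inl ⟨hx, h1⟩

theorem G_nonneg_of_Dp {x : Plane} (hx : x ∈ S.Dp) : 0 ≤ S.G x := by
  rcases hx with h | h
  · exact h.2.le
  · exact h.2.ge

theorem Dp_sub {x : Plane} (hx : x ∈ S.Dp) : x ∈ S.Ω := by
  rcases hx with h | h <;> exact h.1

theorem HalfRegular.isOpen_Op (h : S.HalfRegular) : IsOpen S.Op :=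
  h.G_reg.continuousOn.isOpen_inter_preimage h.isOpen isOpen_Ioi

theorem HalfRegular.exists_strict (h : S.HalfRegular) {p : Plane} (hp : p ∈ S.O0) :
    ∀ e > 0, ∃ r > 0, ∀ x ∈ S.Dp, ∀ y ∈ S.Dp, ‖x - p‖ < r → ‖y - p‖ < r →
      ‖S.fp x - S.fp y - fderivWithin ℝ S.fp S.Dp p (x - y)‖ ≤ e * ‖x - y‖ := by
  have hG := h.strict hp.1
  have hG0 := h.regular p hp
  obtain ⟨A, hA, hs⟩ := exists_strict_derivative hG hG0 (h.mem_Dp hp.1)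
    (fun x hx => G_nonneg_of_Dp hx) (Or.inr hp : p ∈ S.Dp) (h.fp_reg p (Or.inr hp))
  rwa [(hA.fderivWithin (uniqueDiffWithinAt_half hG hG0 hp.2.ge (h.mem_Dp hp.1)))]

/-- At interior points this is the usual consequence of `C¹`; at points of `Ω⁰` it follows from
strict differentiability within the half domain. -/
theorem HalfRegular.locallyLipschitzOn (h : S.HalfRegular) : LocallyLipschitzOn S.Dp S.fp := by
  intro p hp
  rcases hp with hp | hp
  · have h1 : ContDiffAt ℝ 1 S.fp p := (h.fp_reg p (Or.inl hp)).contDiffAt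
      (mem_of_superset (h.isOpen_Op.mem_nhds hp) subset_union_left)
    obtain ⟨K, t, ht, hK⟩ := h1.exists_lipschitzOnWith
    exact ⟨K, t, mem_nhdsWithin_of_mem_nhds ht, hK⟩
  · obtain ⟨r, hr, hs⟩ := h.exists_strict hp 1 one_pos
    set A := fderivWithin ℝ S.fp S.Dp p
    refine ⟨‖A‖₊ + 1, Metric.ball p r ∩ S.Dp,
      inter_mem (mem_nhdsWithin_of_mem_nhds (Metric.ball_mem_nhds p hr)) self_mem_nhdsWithin,
      LipschitzOnWith.of_dist_le_mul fun x hx y hy => ?_⟩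
    have h1 := hs x hx.2 y hy.2 (by rw [← dist_eq_norm]; exact hx.1) (by
      rw [← dist_eq_norm]; exact hy.1)
    have h2 := A.le_opNorm (x - y)
    rw [dist_eq_norm, dist_eq_norm, NNReal.coe_add, coe_nnnorm, NNReal.coe_one]
    have h3 := norm_add_le (S.fp x - S.fp y - A (x - y)) (A (x - y))
    rw [sub_add_cancel] at h3
    linarith

theorem HalfRegular.isCompact_inter (h : S.HalfRegular) {Q : Set Plane} (hQ : IsCompact Q)
    (hQΩ : Q ⊆ S.Ω) : IsCompact (Q ∩ S.Dp) := by
  have h1 : Q ∩ S.Dp = Q ∩ S.G ⁻¹' Ici 0 := by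
    ext x
    refine and_congr_right fun hx => ⟨fun h => G_nonneg_of_Dp h, fun h1 => ?_⟩
    exact (h.mem_Dp (hQΩ hx)).self_of_nhds h1
  rw [h1]
  exact hQ.of_isClosed_subset
    ((h.G_reg.continuousOn.mono hQΩ).preimage_isClosed_of_isClosed hQ.isClosed isClosed_Ici)
    inter_subset_left

/-- Bounded derivatives give a Lipschitz bound only along segments contained in `Ω`. Points of the
compact set closer than `δ` are joined by such segments; for points farther apart the boundedness of
`g` suffices. -/
theorem HalfRegular.exists_g_lip (h : S.HalfRegular) {Q : Set Plane} (hQ : IsCompact Q)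
    (hQΩ : Q ⊆ S.Ω) : ∃ L : ℝ, 0 ≤ L ∧ ∀ t t' ε, ∀ x ∈ Q, ∀ x' ∈ Q,
      ‖S.g t x ε - S.g t' x' ε‖ ≤ L * (|t - t'| + ‖x - x'‖) := by
  obtain ⟨C, hC⟩ := h.g_bdd
  obtain ⟨L, hL0, hL⟩ := h.g_lip
  obtain ⟨δ, hδ, hth⟩ := hQ.exists_thickening_subset_open h.isOpen hQΩ
  refine ⟨L + 2 * |C| / δ, by positivity, fun t t' ε x hx x' hx' => ?_⟩
  rcases lt_or_ge ‖x - x'‖ δ with hlt | hge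
  · have hseg : segment ℝ x x' ⊆ S.Ω := by
      refine ((convex_ball x δ).segment_subset (Metric.mem_ball_self hδ) ?_).trans
        ((Metric.ball_subset_thickening hx δ).trans hth)
      rwa [Metric.mem_ball, dist_comm, dist_eq_norm]
    refine (hL t t' ε x x' hseg).trans (mul_le_mul_of_nonneg_right ?_ (by positivity))
    have : 0 ≤ 2 * |C| / δ := by positivity
    linarith
  · have h1 := hL t t' ε x x (by rw [segment_same]; exact singleton_subset_iff.2 (hQΩ hx))
    rw [sub_self, norm_zero, add_zero] at h1
    have h2 := norm_sub_le (S.g t' x ε) (S.g t' x' ε)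
    have h3 := (hC t' ε x (hQΩ hx)).trans (le_abs_self C)
    have h4 := (hC t' ε x' (hQΩ hx')).trans (le_abs_self C)
    have h5 : 2 * |C| ≤ 2 * |C| / δ * ‖x - x'‖ := by
      rw [div_mul_eq_mul_div, le_div_iff₀ hδ]
      exact mul_le_mul_of_nonneg_left hge (by positivity)
    have h6 : 0 ≤ L * ‖x - x'‖ := by positivity
    have h7 : 0 ≤ 2 * |C| / δ * |t - t'| := by positivity
    have h8 : S.g t x ε - S.g t' x' ε =
      (S.g t x ε - S.g t' x ε) + (S.g t' x ε - S.g t' x' ε) := by abel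
    rw [h8]
    refine (norm_add_le _ _).trans ?_
    linarith

/-- Extension of the perturbed field from a compact part of the half domain to a bounded Lipschitz
field. -/
theorem HalfRegular.exists_field (h : S.HalfRegular) {Q : Set Plane} (hQ : IsCompact Q)
    (hQΩ : Q ⊆ S.Ω) : ∃ (L : NNReal) (C : ℝ) (F : ℝ → ℝ → Plane → Plane), 0 ≤ C ∧
      (∀ ε ∈ Icc (0 : ℝ) 1, ∀ t, LipschitzWith L (F ε t)) ∧
      (∀ ε ∈ Icc (0 : ℝ) 1, ∀ x, Continuous fun t => F ε t x) ∧
      (∀ ε ∈ Icc (0 : ℝ) 1, ∀ t x, ‖F ε t x‖ ≤ C) ∧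
      (∀ ε ∈ Icc (0 : ℝ) 1, ∀ t, ∀ x ∈ Q ∩ S.Dp, F ε t x = S.Fp ε t x) ∧
      (∀ ε t t', ∀ x ∈ Q, ∀ x' ∈ Q, ‖S.g t x ε - S.g t' x' ε‖ ≤ C * (|t - t'| + ‖x - x'‖)) ∧
      ∀ t ε, ∀ x ∈ S.Ω, ‖S.g t x ε‖ ≤ C := by
  have hQD := h.isCompact_inter hQ hQΩ
  obtain ⟨Kf, hKf⟩ := LocallyLipschitzOn.exists_lipschitzOnWith_of_compact hQD
    (h.locallyLipschitzOn.mono inter_subset_right)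
  obtain ⟨Lg, hLg0, hLg⟩ := h.exists_g_lip hQ hQΩ
  obtain ⟨Cg, hCg⟩ := h.g_bdd
  obtain ⟨Cf, hCf⟩ := hQD.exists_bound_of_continuousOn hKf.continuousOn
  set C := |Cf| + |Cg| with hC
  have hC0 : 0 ≤ C := by positivity
  set Lg' : NNReal := ⟨Lg, hLg0⟩ with hLg'
  -- Time and space are treated jointly, so that the extended field is continuous in time as well.
  have hlip : ∀ ε ∈ Icc (0 : ℝ) 1, LipschitzOnWith (Kf + 2 * Lg')
      (fun p : ℝ × Plane => S.Fp ε p.1 p.2) (univ ×ˢ (Q ∩ S.Dp)) := by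
    intro ε hε
    refine LipschitzOnWith.of_dist_le_mul fun p hp q hq => ?_
    have h1 := hKf.dist_le_mul p.2 hp.2 q.2 hq.2
    have h2 := hLg p.1 q.1 ε p.2 hp.2.1 q.2 hq.2.1
    have h3 : dist p.2 q.2 ≤ dist p q := le_max_right _ _
    have h4 : |p.1 - q.1| ≤ dist p q := le_max_left _ _
    have h5 : ‖ε • (S.g p.1 p.2 ε - S.g q.1 q.2 ε)‖ ≤ ‖S.g p.1 p.2 ε - S.g q.1 q.2 ε‖ := by
      rw [norm_smul, Real.norm_eq_abs, abs_of_nonneg hε.1]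
      exact mul_le_of_le_one_left (norm_nonneg _) hε.2
    have h6 : S.Fp ε p.1 p.2 - S.Fp ε q.1 q.2 =
        (S.fp p.2 - S.fp q.2) + ε • (S.g p.1 p.2 ε - S.g q.1 q.2 ε) := by
      simp only [Fp]; module
    rw [dist_eq_norm, h6]
    refine (norm_add_le _ _).trans ?_
    rw [dist_eq_norm] at h1
    have h7 : (Kf : ℝ) * dist p.2 q.2 ≤ Kf * dist p q := mul_le_mul_of_nonneg_left h3 Kf.2
    have h8 : Lg * (|p.1 - q.1| + ‖p.2 - q.2‖) ≤ Lg * (2 * dist p q) := by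
      refine mul_le_mul_of_nonneg_left ?_ hLg0
      rw [dist_eq_norm] at h3
      linarith
    have h9 : ((Kf + 2 * Lg' : NNReal) : ℝ) = Kf + 2 * Lg := rfl
    rw [h9]
    linarith
  have hbd : ∀ ε ∈ Icc (0 : ℝ) 1, ∀ p ∈ univ ×ˢ (Q ∩ S.Dp), ‖S.Fp ε p.1 p.2‖ ≤ C := by
    intro ε hε p hp
    refine (norm_add_le _ _).trans (add_le_add ((hCf _ hp.2).trans (le_abs_self _)) ?_)
    rw [norm_smul, Real.norm_eq_abs, abs_of_nonneg hε.1]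
    exact (mul_le_of_le_one_left (norm_nonneg _) hε.2).trans
      ((hCg _ _ _ (hQΩ hp.2.1)).trans (le_abs_self _))
  have hext : ∀ ε : ℝ, ∃ g : ℝ × Plane → Plane, ε ∈ Icc (0 : ℝ) 1 →
      LipschitzWith (lipschitzExtensionConstant Plane * (Kf + 2 * Lg')) g ∧
      EqOn (fun p : ℝ × Plane => S.Fp ε p.1 p.2) g (univ ×ˢ (Q ∩ S.Dp)) ∧ ∀ x, ‖g x‖ ≤ 2 * C := by
    intro ε
    by_cases hε : ε ∈ Icc (0 : ℝ) 1
    · obtain ⟨g, hg⟩ := exists_bounded_extension (hlip ε hε) hC0 (hbd ε hε)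
      exact ⟨g, fun _ => hg⟩
    · exact ⟨fun _ => 0, fun h => absurd h hε⟩
  choose g hg using hext
  refine ⟨lipschitzExtensionConstant Plane * (Kf + 2 * Lg'), 2 * C + Lg, fun ε t x => g ε (t, x),
    by positivity, fun ε hε t => ?_, fun ε hε x => ?_, fun ε hε t x => ?_, fun ε hε t x hx => ?_,
    fun ε t t' x hx x' hx' => ?_, fun t ε x hx => ?_⟩
  · refine LipschitzWith.of_dist_le_mul fun x y => ?_
    have := (hg ε hε).1.dist_le_mul (t, x) (t, y)
    rwa [Prod.dist_eq, dist_self, max_eq_right dist_nonneg] at this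
  · exact (hg ε hε).1.continuous.comp (by fun_prop)
  · linarith [(hg ε hε).2.2 (t, x)]
  · exact ((hg ε hε).2.1 (⟨mem_univ _, hx⟩ : (t, x) ∈ univ ×ˢ (Q ∩ S.Dp))).symm
  · refine (hLg t t' ε x hx x' hx').trans (mul_le_mul_of_nonneg_right (by linarith) (by positivity))
  · linarith [(hCg t ε x hx).trans (le_abs_self _), abs_nonneg Cf]

end PSSystem

/-! ### Construction of the saddle model -/

namespace PSSystem
variable {S : PSSystem} {γ : ℝ → Plane}

/-- Coordinates with respect to a basis of eigenvectors. -/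
theorem exists_eigen_coordinates {A : Plane →L[ℝ] Plane} {ls lu : ℝ} {vs vu : Plane}
    (hs : IsUnitEigenvector A ls vs) (hu : IsUnitEigenvector A lu vu) (h : ls < lu) :
    ∃ α β : Plane →L[ℝ] ℝ, (∀ w, w = α w • vu + β w • vs) ∧ (α vu = 1 ∧ β vu = 0) ∧
      ∀ w, α (A w) = lu * α w ∧ β (A w) = ls * β w := by
  have hvs : vs ≠ 0 := by rintro rfl; simpa using hs.1
  have hvu : vu ≠ 0 := by rintro rfl; simpa using hu.1
  have hli : LinearIndependent ℝ ![vu, vs] := by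
    refine LinearIndependent.pair_iff.2 fun s t hst => ?_
    have h1 : A (s • vu + t • vs) = 0 := by rw [hst, map_zero]
    rw [map_add, map_smul, map_smul, hs.2, hu.2] at h1
    have h2 : (s * (lu - ls)) • vu = 0 := by
      have : (s * (lu - ls)) • vu = (s • lu • vu + t • ls • vs) - ls • (s • vu + t • vs) := by
        module
      rw [this, h1, hst, smul_zero, sub_zero]
    have h3 : s = 0 := by
      rcases smul_eq_zero.1 h2 with h4 | h4
      · rcases mul_eq_zero.1 h4 with h5 | h5
        · exact h5
        · linarith
      · exact absurd h4 hvu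
    rw [h3, zero_smul, zero_add] at hst
    exact ⟨h3, (smul_eq_zero.1 hst).resolve_right hvs⟩
  set b := basisOfLinearIndependentOfCardEqFinrank hli (by simp) with hb
  have hb0 : b 0 = vu := by simp [hb]
  have hb1 : b 1 = vs := by simp [hb]
  set α : Plane →L[ℝ] ℝ := LinearMap.toContinuousLinearMap (b.coord 0) with hα
  set β : Plane →L[ℝ] ℝ := LinearMap.toContinuousLinearMap (b.coord 1) with hβ
  have hw : ∀ w, w = α w • vu + β w • vs := fun w => by
    have := b.sum_repr w
    rw [Fin.sum_univ_two, hb0, hb1] at this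
    exact this.symm
  have h00 : α vu = 1 := by rw [← hb0]; simp [hα]
  have h10 : β vu = 0 := by rw [← hb0]; simp [hβ]
  have h01 : α vs = 0 := by rw [← hb1]; simp [hα]
  have h11 : β vs = 1 := by rw [← hb1]; simp [hβ]
  refine ⟨α, β, hw, ⟨h00, h10⟩, fun w => ?_⟩
  have hAw : A w = (α w * lu) • vu + (β w * ls) • vs := by
    conv_lhs => rw [hw w]
    rw [map_add, map_smul, map_smul, hs.2, hu.2, smul_smul, smul_smul]
  rw [hAw]
  simp only [map_add, map_smul, smul_eq_mul, h00, h10, h01, h11]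
  constructor <;> ring

/-- The hypotheses on the half system in `Ω⁺ ∪ Ω⁰` and on the half loop. -/
structure HalfHyp (S : PSSystem) (γ : ℝ → Plane) (ls lu : ℝ) (vs vu : Plane) : Prop where
  regular : S.HalfRegular
  zero_mem : (0 : Plane) ∈ S.O0
  fp_zero : S.fp 0 = 0
  eig_s : IsUnitEigenvector (fderivWithin ℝ S.fp S.Dp 0) ls vs
  eig_u : IsUnitEigenvector (fderivWithin ℝ S.fp S.Dp 0) lu vu
  ls_neg : ls < 0
  lu_pos : 0 < lu
  G_u : 0 < fderiv ℝ S.G 0 vu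
  G_s : 0 < fderiv ℝ S.G 0 vs
  g_zero : S.HypG
  γ_cont : Continuous γ
  γ_zero : γ 0 ∈ S.O0
  γ_pos : ∀ t > 0, γ t ∈ S.Op
  γ_tendsto : Tendsto γ atTop (𝓝 0)
  γ_deriv : ∀ t > 0, HasDerivAt γ (S.fp (γ t)) t
  cross : 0 < fderiv ℝ S.G (γ 0) (S.fp (γ 0))

/-- The closed half loop is covered by a compact arc and a ball around the saddle; a thickening
gives an open `K` in a compact `Q ⊆ Ω`, from which the field can be extended. -/
theorem HalfHyp.exists_compact {ls lu : ℝ} {vs vu : Plane} (h : S.HalfHyp γ ls lu vs vu) :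
    ∃ K Q : Set Plane, IsOpen K ∧ IsCompact Q ∧ K ⊆ Q ∧ Q ⊆ S.Ω ∧ (0 : Plane) ∈ K ∧
      ∀ t, 0 ≤ t → γ t ∈ K := by
  obtain ⟨R, hR, hRΩ⟩ := Metric.nhds_basis_closedBall.mem_iff.1
    (h.regular.isOpen.mem_nhds h.zero_mem.1)
  obtain ⟨T, hT⟩ := eventually_atTop.1 (h.γ_tendsto.eventually (Metric.closedBall_mem_nhds 0 hR))
  have hc : IsCompact (γ '' Icc 0 T ∪ Metric.closedBall 0 R) :=
    (isCompact_Icc.image h.γ_cont).union (isCompact_closedBall 0 R)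
  have hsub : γ '' Icc 0 T ∪ Metric.closedBall 0 R ⊆ S.Ω := by
    refine union_subset ?_ hRΩ
    rintro _ ⟨t, ht, rfl⟩
    rcases ht.1.eq_or_lt with h0 | h0
    · rw [← h0]; exact h.γ_zero.1
    · exact (h.γ_pos t h0).1
  obtain ⟨δ, hδ, hδΩ⟩ := hc.exists_cthickening_subset_open h.regular.isOpen hsub
  have hself := Metric.self_subset_thickening hδ (γ '' Icc 0 T ∪ Metric.closedBall 0 R)
  refine ⟨_, _, Metric.isOpen_thickening, hc.cthickening, Metric.thickening_subset_cthickening δ _,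
    hδΩ, hself (Or.inr (Metric.mem_closedBall_self hR.le)), fun t ht => hself ?_⟩
  rcases le_total t T with h1 | h1
  · exact Or.inl ⟨t, ⟨ht, h1⟩, rfl⟩
  · exact Or.inr (hT t h1)

set_option maxHeartbeats 800000 in
/-- The half system is described by a saddle model, with arbitrarily small nonlinearity. -/
theorem HalfHyp.exists_model {ls lu : ℝ} {vs vu : Plane} (h : S.HalfHyp γ ls lu vs vu) {η₀ : ℝ}
    (hη₀ : 0 < η₀) : ∃ M : SaddleModel S γ, M.a = -ls ∧ M.b = lu ∧ M.η ≤ η₀ ∧ 0 < M.U vu ∧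
      M.V vu = 0 := by
  have hreg := h.regular
  obtain ⟨K, Q, hK, hQ, hKQ, hQΩ, h0K, hγK⟩ := h.exists_compact
  obtain ⟨L, C₂, F, hC₂, hFlip, hFcont, hFbdd, hFeq, hglip, hgbdd⟩ := hreg.exists_field hQ hQΩ
  obtain ⟨α, β, hαβ, ⟨hα, hβ⟩, hAαβ⟩ := exists_eigen_coordinates h.eig_s h.eig_u
    (h.ls_neg.trans h.lu_pos)
  set A := fderivWithin ℝ S.fp S.Dp 0 with hA
  set D := fderiv ℝ S.G 0 with hD
  have hpu := h.G_u
  have hps := h.G_s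
  rw [← hD] at hpu hps
  -- Eigen-coordinates weighted by the positive numbers `D vu` and `D vs`, so that `U + V` is
  -- exactly the derivative of `G` at the origin.
  set U : Plane →L[ℝ] ℝ := D vu • α with hU
  set V : Plane →L[ℝ] ℝ := D vs • β with hV
  have hUV : U + V = D := by
    ext w
    conv_rhs => rw [hαβ w]
    rw [map_add, map_smul, map_smul]
    simp only [hU, hV, _root_.add_apply, _root_.smul_apply, smul_eq_mul]
    ring
  have hUA : ∀ w, U (A w) = lu * U w := fun w => by
    simp only [hU, _root_.smul_apply, smul_eq_mul, (hAαβ w).1]; ring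
  have hVA : ∀ w, V (A w) = ls * V w := fun w => by
    simp only [hV, _root_.smul_apply, smul_eq_mul, (hAαβ w).2]; ring
  set C₁ := (D vu)⁻¹ + (D vs)⁻¹ with hC₁
  have hC₁p : 0 < C₁ := by positivity
  have hnorm : ∀ w, ‖w‖ ≤ C₁ * (|U w| + |V w|) := by
    intro w
    have h1 : |α w| = (D vu)⁻¹ * |U w| := by
      simp only [hU, _root_.smul_apply, smul_eq_mul, abs_mul, abs_of_pos hpu]
      rw [inv_mul_cancel_left₀ hpu.ne']
    have h2 : |β w| = (D vs)⁻¹ * |V w| := by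
      simp only [hV, _root_.smul_apply, smul_eq_mul, abs_mul, abs_of_pos hps]
      rw [inv_mul_cancel_left₀ hps.ne']
    have h3 : ‖w‖ ≤ |α w| + |β w| := by
      conv_lhs => rw [hαβ w]
      refine (norm_add_le _ _).trans (le_of_eq ?_)
      rw [norm_smul, norm_smul, h.eig_s.1, h.eig_u.1, mul_one, mul_one, Real.norm_eq_abs,
        Real.norm_eq_abs]
    have h4 : 0 ≤ (D vu)⁻¹ * |V w| := by positivity
    have h5 : 0 ≤ (D vs)⁻¹ * |U w| := by positivity
    rw [hC₁]
    linarith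
  have hUvu : 0 < U vu := by simp [hU, hα, hpu]
  have hVvu : V vu = 0 := by simp [hV, hβ]
  clear_value U V C₁
  have ha : 0 < -ls := neg_pos.2 h.ls_neg
  have hb := h.lu_pos
  set η := min η₀ (min (-ls / 100) (min (lu / 100) (1 / 100))) with hη
  have hηp : 0 < η := by positivity
  obtain ⟨hη1, hη2, hη3, hη4⟩ : η ≤ η₀ ∧ η ≤ -ls / 100 ∧ η ≤ lu / 100 ∧ η ≤ 1 / 100 := by
    have : η ≤ η := le_rfl
    conv at this => rhs; rw [hη]
    simpa only [le_min_iff] using this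
  clear_value η
  -- `H` dominates every factor that multiplies `e` in the estimates at the saddle, so `e C₁ H ≤ η`
  -- is the only condition on `e`.
  set H := 2 * ‖U‖ + 2 * ‖V‖ + ‖A‖ + 2 * ‖D‖ + 3 with hH
  have hHp : 0 < H := by positivity
  set e := min 1 (η / (C₁ * H)) with he
  have hep : 0 < e := by positivity
  have he1 : e ≤ 1 := min_le_left _ _
  have heH : e * C₁ * H ≤ η := by
    have := (le_div_iff₀ (by positivity)).1 (min_le_right 1 (η / (C₁ * H)))
    rw [← he] at this
    linarith
  clear_value e
  -- the radius at the saddle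
  obtain ⟨r₁, hr₁, hstrict⟩ := hreg.exists_strict h.zero_mem e hep
  obtain ⟨r₂, hr₂, hGn⟩ := Metric.eventually_nhds_iff_ball.1
    ((hreg.strict h.zero_mem.1).hasFDerivAt.isLittleO.def hep)
  have hDG : ∀ p ∈ S.Ω, ContinuousAt (fderiv ℝ S.G) p := fun p hp =>
    (hreg.G_reg.continuousOn_fderiv_of_isOpen hreg.isOpen le_rfl).continuousAt
      (hreg.isOpen.mem_nhds hp)
  obtain ⟨r₃, hr₃, hDG0⟩ := Metric.continuousAt_iff.1 (hDG 0 h.zero_mem.1) e hep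
  obtain ⟨r₄, hr₄, hrK⟩ := Metric.isOpen_iff.1 hK 0 h0K
  set r := min (min r₁ r₂) (min r₃ r₄) with hr
  have hrp : 0 < r := lt_min (lt_min hr₁ hr₂) (lt_min hr₃ hr₄)
  have hr1 : r ≤ r₁ := (min_le_left _ _).trans (min_le_left _ _)
  have hr2 : r ≤ r₂ := (min_le_left _ _).trans (min_le_right _ _)
  have hr3 : r ≤ r₃ := (min_le_right _ _).trans (min_le_left _ _)
  have hr4 : r ≤ r₄ := (min_le_right _ _).trans (min_le_right _ _)
  clear_value r
  -- the radius at the crossing point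
  set c := fderiv ℝ S.G (γ 0) (S.fp (γ 0)) with hc
  have hcp : 0 < c := h.cross
  set N := ‖fderiv ℝ S.G (γ 0)‖ + 1 with hN
  have hNp : 0 < N := by positivity
  set w := ‖S.fp (γ 0)‖ + 1 with hw
  have hwp : 0 < w := by positivity
  obtain ⟨r₅, hr₅, hDGγ⟩ := Metric.continuousAt_iff.1 (hDG (γ 0) h.γ_zero.1)
    (min 1 (c / (6 * w))) (by positivity)
  obtain ⟨r₆, hr₆, hr₆K⟩ := Metric.isOpen_iff.1 hK (γ 0) (hγK 0 le_rfl)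
  obtain ⟨KG, tG, htG, hKG⟩ := (hreg.contDiffAt h.γ_zero.1).exists_lipschitzOnWith
  obtain ⟨r₇, hr₇, hr₇t⟩ := Metric.mem_nhds_iff.1 htG
  set r₀ := min (min r₅ r₆) (min r₇ (c / (6 * N * (L + 1)))) with hr₀
  have hr₀p : 0 < r₀ := lt_min (lt_min hr₅ hr₆) (lt_min hr₇ (by positivity))
  have hr05 : r₀ ≤ r₅ := (min_le_left _ _).trans (min_le_left _ _)
  have hr06 : r₀ ≤ r₆ := (min_le_left _ _).trans (min_le_right _ _)
  have hr07 : r₀ ≤ r₇ := (min_le_right _ _).trans (min_le_left _ _)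
  have hr08 : r₀ ≤ c / (6 * N * (L + 1)) := (min_le_right _ _).trans (min_le_right _ _)
  clear_value r₀
  -- The first quotient makes `ε` times the Lipschitz constant of `g` at most `e`; the second keeps
  -- the crossing at `γ 0` transversal under the perturbation.
  set ε₁ := min 1 (min (e / (C₂ + 1)) (c / (6 * N * (C₂ + 1)))) with hε₁
  have hε₁p : 0 < ε₁ := by positivity
  have hε1 : ε₁ ≤ 1 := min_le_left _ _
  have hε2 : ε₁ ≤ e / (C₂ + 1) := (min_le_right _ _).trans (min_le_left _ _)
  have hε3 : ε₁ ≤ c / (6 * N * (C₂ + 1)) := (min_le_right _ _).trans (min_le_right _ _)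
  clear_value ε₁
  have hε : ∀ ε ∈ Icc 0 ε₁, ε ∈ Icc (0 : ℝ) 1 := fun ε hε => ⟨hε.1, hε.2.trans hε1⟩
  have hF : ∀ ε ∈ Icc 0 ε₁, ∀ t, ∀ x ∈ K, x ∈ S.Dp → F ε t x = S.fp x + ε • S.g t x ε :=
    fun ε hε' t x hx hxD => hFeq ε (hε ε hε') t x ⟨hKQ hx, hxD⟩
  have hball : ∀ x ∈ Metric.ball (0 : Plane) r, ‖x - 0‖ < r ∧ x ∈ K := fun x hx =>
    ⟨by rwa [← dist_eq_norm], hrK (Metric.ball_subset_ball hr4 hx)⟩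
  have hεe : ∀ ε ∈ Icc 0 ε₁, ε * C₂ ≤ e := by
    intro ε hε'
    have h1 := (le_div_iff₀ (by positivity)).1 (hε'.2.trans hε2)
    linarith [hε'.1]
  have hlin : ∀ ε ∈ Icc 0 ε₁, ∀ t, ∀ x ∈ Metric.ball (0 : Plane) r,
      ∀ y ∈ Metric.ball (0 : Plane) r, x ∈ S.Dp → y ∈ S.Dp →
      ‖F ε t x - F ε t y - A (x - y)‖ ≤ 2 * e * ‖x - y‖ := by
    intro ε hε' t x hx y hy hxD hyD
    obtain ⟨hx1, hx2⟩ := hball x hx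
    obtain ⟨hy1, hy2⟩ := hball y hy
    have h1 := hstrict x hxD y hyD (hx1.trans_le hr1) (hy1.trans_le hr1)
    have h2 := hglip ε t t x (hKQ hx2) y (hKQ hy2)
    rw [sub_self, abs_zero, zero_add] at h2
    have h3 : ‖ε • (S.g t x ε - S.g t y ε)‖ ≤ e * ‖x - y‖ := by
      rw [norm_smul, Real.norm_eq_abs, abs_of_nonneg hε'.1]
      have h4 := mul_le_mul_of_nonneg_left h2 hε'.1
      have h5 := mul_le_mul_of_nonneg_right (hεe ε hε') (norm_nonneg (x - y))
      linarith
    rw [hF ε hε' t x hx2 hxD, hF ε hε' t y hy2 hyD]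
    have h6 : S.fp x + ε • S.g t x ε - (S.fp y + ε • S.g t y ε) - A (x - y) =
        (S.fp x - S.fp y - A (x - y)) + ε • (S.g t x ε - S.g t y ε) := by module
    rw [h6]
    exact (norm_add_le _ _).trans (by linarith)
  have hF0 : ∀ ε ∈ Icc 0 ε₁, ∀ t, F ε t 0 = 0 := fun ε hε' t => by
    rw [hF ε hε' t 0 h0K (Or.inr h.zero_mem), h.fp_zero, h.g_zero t ε, smul_zero, add_zero]
  have h0r : (0 : Plane) ∈ Metric.ball (0 : Plane) r := Metric.mem_ball_self hrp
  have hHs : ∀ q : ℝ, 0 ≤ q → q ≤ H → ∀ w : Plane, e * q * ‖w‖ ≤ η * (|U w| + |V w|) := by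
    intro q hq0 hq w
    have h1 : e * q * ‖w‖ ≤ e * H * ‖w‖ := by gcongr
    have h2 : e * H * ‖w‖ ≤ e * H * (C₁ * (|U w| + |V w|)) := by gcongr; exact hnorm w
    have h3 : e * C₁ * H * (|U w| + |V w|) ≤ η * (|U w| + |V w|) := by gcongr
    linarith
  have hUn := norm_nonneg U
  have hVn := norm_nonneg V
  have hAn := norm_nonneg A
  have hDn := norm_nonneg D
  set C := 1 + C₁ + ‖U‖ + ‖V‖ + C₂ + KG with hC
  have hKG0 : (0 : ℝ) ≤ KG := KG.2
  have hGzero : S.G 0 = 0 := h.zero_mem.2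
  refine ⟨⟨F, K, U, V, -ls, lu, η, r, r₀, c / 3, C, ε₁, L, ha, hb, hηp, hrp, hr₀p, by positivity,
    by linarith, hε₁p, by linarith, by linarith, by linarith, ?norm, ?U, ?V, hK, hKQ.trans hQΩ,
    hreg.isOpen, ?Gd, fun ε hε' => hFlip ε (hε ε hε'), fun ε hε' => hFcont ε (hε ε hε'), ?bdd, hF,
    ?shift, ?var, hF0, h.zero_mem, fun x hx => (hball x hx).2, ?sU, ?sV, ?Gz, ?Gnear, ?Gflow,
    fun x hx => hr₆K (Metric.ball_subset_ball hr06 hx), ?cross, ?Glip, h.γ_zero, h.γ_pos,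
    h.γ_tendsto, hγK, h.γ_cont, ?γd⟩, rfl, rfl, hη1, hUvu, hVvu⟩
  case norm =>
    intro x
    exact (hnorm x).trans (mul_le_mul_of_nonneg_right (by linarith) (by positivity))
  case U =>
    intro x
    exact (U.le_opNorm x).trans (mul_le_mul_of_nonneg_right (by linarith) (norm_nonneg x))
  case V =>
    intro x
    exact (V.le_opNorm x).trans (mul_le_mul_of_nonneg_right (by linarith) (norm_nonneg x))
  case Gd => exact fun x hx => (hreg.strict hx).hasFDerivAt.differentiableAt
  case bdd => exact fun ε hε' t x => (hFbdd ε (hε ε hε') t x).trans (by linarith)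
  case shift =>
    intro ε hε' t t' x hx hxD
    rw [hF ε hε' t x hx hxD, hF ε hε' t' x hx hxD, add_sub_add_left_eq_sub, ← smul_sub, norm_smul,
      Real.norm_eq_abs, abs_of_nonneg hε'.1]
    have h1 := hglip ε t t' x (hKQ hx) x (hKQ hx)
    rw [sub_self, norm_zero, add_zero] at h1
    have h2 : C₂ * |t - t'| ≤ C * |t - t'| :=
      mul_le_mul_of_nonneg_right (by linarith) (abs_nonneg _)
    linarith [mul_le_mul_of_nonneg_left (h1.trans h2) hε'.1]
  case var =>
    intro ε hε' t x hx hxD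
    rw [hF ε hε' t x hx hxD, hF 0 ⟨le_rfl, hε₁p.le⟩ t x hx hxD, zero_smul, add_zero,
      add_sub_cancel_left, norm_smul, Real.norm_eq_abs, abs_of_nonneg hε'.1, mul_comm]
    exact mul_le_mul_of_nonneg_right ((hgbdd t ε x (hQΩ (hKQ hx))).trans (by linarith)) hε'.1
  case sU =>
    intro ε hε' t x hx y hy hxD hyD
    have h1 := hlin ε hε' t x hx y hy hxD hyD
    have h2 := U.le_opNorm (F ε t x - F ε t y - A (x - y))
    rw [map_sub, hUA, Real.norm_eq_abs] at h2
    refine (h2.trans (mul_le_mul_of_nonneg_left h1 hUn)).trans ?_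
    refine le_trans (le_of_eq ?_) (hHs (2 * ‖U‖) (by positivity) (by linarith) (x - y))
    ring
  case sV =>
    intro ε hε' t x hx y hy hxD hyD
    have h1 := hlin ε hε' t x hx y hy hxD hyD
    have h2 := V.le_opNorm (F ε t x - F ε t y - A (x - y))
    rw [map_sub, hVA, Real.norm_eq_abs, ← neg_neg ls, neg_mul, sub_neg_eq_add] at h2
    refine (h2.trans (mul_le_mul_of_nonneg_left h1 hVn)).trans ?_
    refine le_trans (le_of_eq ?_) (hHs (2 * ‖V‖) (by positivity) (by linarith) (x - y))
    ring
  case Gz =>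
    rw [hUV]
    exact (hreg.strict h.zero_mem.1).hasFDerivAt
  case Gnear =>
    intro x hx
    have h1 := hGn x (Metric.ball_subset_ball hr2 hx)
    rw [hGzero, sub_zero, sub_zero, ← hD, ← hUV, _root_.add_apply, Real.norm_eq_abs] at h1
    refine h1.trans (le_trans (le_of_eq ?_) (hHs 1 zero_le_one (by linarith) x))
    ring
  case Gflow =>
    intro ε hε' t x hx hxD
    obtain ⟨hx1, hx2⟩ := hball x hx
    have h1 := hlin ε hε' t x hx 0 h0r hxD (Or.inr h.zero_mem)
    rw [hF0 ε hε', sub_zero, sub_zero] at h1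
    have h2 := (hDG0 (Metric.ball_subset_ball hr3 hx)).le
    rw [dist_eq_norm, ← hD] at h2
    have h3 : ‖F ε t x‖ ≤ (‖A‖ + 2) * ‖x‖ := by
      have h4 := norm_add_le (F ε t x - A x) (A x)
      rw [sub_add_cancel] at h4
      have h5 := A.le_opNorm x
      have h6 : 2 * e * ‖x‖ ≤ 2 * ‖x‖ := mul_le_mul_of_nonneg_right (by linarith) (norm_nonneg x)
      linarith
    have h4 : fderiv ℝ S.G x (F ε t x) - (lu * U x - -ls * V x) =
        (fderiv ℝ S.G x - D) (F ε t x) + D (F ε t x - A x) := by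
      rw [_root_.sub_apply, map_sub, ← hUV, _root_.add_apply, _root_.add_apply, hUA, hVA]
      ring
    have h5 := (ContinuousLinearMap.le_opNorm (fderiv ℝ S.G x - D) (F ε t x)).trans
      (mul_le_mul h2 h3 (norm_nonneg _) hep.le)
    have h6 := (D.le_opNorm (F ε t x - A x)).trans (mul_le_mul_of_nonneg_left h1 hDn)
    rw [h4]
    have h7 := hHs (‖A‖ + 2 + 2 * ‖D‖) (by positivity) (by linarith) x
    rw [Real.norm_eq_abs] at h5 h6
    refine (abs_add_le _ _).trans ?_
    linarith
  case cross =>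
    intro ε hε' t x hx
    have h1 := (hDGγ (Metric.ball_subset_ball hr05 hx)).le
    rw [dist_eq_norm] at h1
    have h2 : ‖F ε t x - S.fp (γ 0)‖ ≤ c / (3 * N) := by
      have h3 := (hFlip ε (hε ε hε') t).dist_le_mul x (γ 0)
      rw [dist_eq_norm] at h3
      have h4 : F ε t (γ 0) - S.fp (γ 0) = ε • S.g t (γ 0) ε := by
        rw [hF ε hε' t _ (hγK 0 le_rfl) (Or.inr h.γ_zero), add_sub_cancel_left]
      have h5 : ‖ε • S.g t (γ 0) ε‖ ≤ c / (6 * N) := by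
        rw [norm_smul, Real.norm_eq_abs, abs_of_nonneg hε'.1]
        have h6 := mul_le_mul_of_nonneg_left (hgbdd t ε _ h.γ_zero.1) hε'.1
        have h7 := (le_div_iff₀ (by positivity)).1 (hε'.2.trans hε3)
        rw [le_div_iff₀ (by positivity)]
        have h8 := mul_le_mul_of_nonneg_right h6 (by positivity : 0 ≤ 6 * N)
        have h9 : 0 ≤ ε * (6 * N) := mul_nonneg hε'.1 (by positivity)
        linarith
      have h6 : (L : ℝ) * dist x (γ 0) ≤ c / (6 * N) := by
        have h7 := (Metric.mem_ball.1 hx).le.trans hr08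
        rw [le_div_iff₀ (by positivity)] at h7
        rw [le_div_iff₀ (by positivity)]
        have h8 : 0 ≤ dist x (γ 0) * (6 * N) := by positivity
        linarith
      have h7 := norm_add_le (F ε t x - F ε t (γ 0)) (F ε t (γ 0) - S.fp (γ 0))
      rw [sub_add_sub_cancel, h4] at h7
      have h8 : c / (3 * N) = c / (6 * N) + c / (6 * N) := by field_simp; norm_num
      linarith
    have h3 : ‖fderiv ℝ S.G x‖ ≤ N := by
      have := norm_add_le (fderiv ℝ S.G x - fderiv ℝ S.G (γ 0)) (fderiv ℝ S.G (γ 0))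
      rw [sub_add_cancel] at this
      linarith [h1.trans (min_le_left _ _)]
    have h4 := (ContinuousLinearMap.le_opNorm (fderiv ℝ S.G x) (F ε t x - S.fp (γ 0))).trans
      (mul_le_mul h3 h2 (norm_nonneg _) hNp.le)
    have h5 := (ContinuousLinearMap.le_opNorm (fderiv ℝ S.G x - fderiv ℝ S.G (γ 0))
      (S.fp (γ 0))).trans (mul_le_mul (h1.trans (min_le_right _ _))
        (by linarith : ‖S.fp (γ 0)‖ ≤ w) (norm_nonneg _) (by positivity))
    have h6 : N * (c / (3 * N)) = c / 3 := by field_simp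
    have h7 : c / (6 * w) * w = c / 6 := by field_simp
    rw [h6, Real.norm_eq_abs] at h4
    rw [h7, Real.norm_eq_abs, _root_.sub_apply, ← hc] at h5
    rw [map_sub] at h4
    linarith [(abs_le.1 h4).1, (abs_le.1 h5).1]
  case Glip =>
    intro x hx y hy
    have h1 := hKG.dist_le_mul x (hr₇t (Metric.ball_subset_ball hr07 hx)) y
      (hr₇t (Metric.ball_subset_ball hr07 hy))
    rw [Real.dist_eq, dist_eq_norm] at h1
    exact h1.trans (mul_le_mul_of_nonneg_right (by linarith) (norm_nonneg _))
  case γd =>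
    intro t ht
    rw [hF 0 ⟨le_rfl, hε₁p.le⟩ t _ (hγK t ht.le) (Or.inl (h.γ_pos t ht)), zero_smul, add_zero]
    exact h.γ_deriv t ht

end PSSystem

/-! ### Arc length charts of `Ω⁰` -/

namespace PSSystem
variable {S : PSSystem}

/-- `Ω⁰` is a curve of class `C¹` near each of its points. -/
theorem HalfRegular.exists_graph (h : S.HalfRegular) {p : Plane} (hp : p ∈ S.O0) :
    ∃ (l : Plane →L[ℝ] ℝ) (φ φ' : ℝ → Plane) (s₀ ρ : ℝ), 0 < s₀ ∧ 0 < ρ ∧ φ 0 = p ∧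
      (∀ s ∈ Ioo (-s₀) s₀, φ s ∈ S.O0 ∧ l (φ s - p) = s ∧ HasDerivAt φ (φ' s) s ∧
        ContinuousAt φ' s) ∧
      ∀ x ∈ S.O0, ‖x - p‖ < ρ → φ (l (x - p)) = x := by
  set D := fderiv ℝ S.G p with hD
  have hD0 : D ≠ 0 := h.regular p hp
  set e0 : Plane := EuclideanSpace.single 0 1
  set e1 : Plane := EuclideanSpace.single 1 1
  have hdec : ∀ w : Plane, w = w 0 • e0 + w 1 • e1 := by
    intro w
    ext i
    fin_cases i <;> simp [e0, e1]
  have hDw : ∀ w : Plane, D w = w 0 * D e0 + w 1 * D e1 := by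
    intro w
    conv_lhs => rw [hdec w]
    rw [map_add, map_smul, map_smul, smul_eq_mul, smul_eq_mul]
  -- The pairing with the gradient rotated by a right angle: together with `D` it is a linear
  -- isomorphism onto `ℝ × ℝ`, so `x ↦ (l (x - p), G x)` straightens `Ω⁰` near `p`.
  set l : Plane →L[ℝ] ℝ := (-(D e1)) • EuclideanSpace.proj 0 + (D e0) • EuclideanSpace.proj 1
    with hl
  have hlw : ∀ w : Plane, l w = -(D e1) * w 0 + D e0 * w 1 := fun w => rfl
  have hinj : Function.Injective (l.prod D : Plane →L[ℝ] ℝ × ℝ).toLinearMap := by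
    rw [← LinearMap.ker_eq_bot, LinearMap.ker_eq_bot']
    intro w hw
    have h1 : l w = 0 := congrArg Prod.fst hw
    have h2 : D w = 0 := congrArg Prod.snd hw
    rw [hlw] at h1
    rw [hDw] at h2
    have hsq : 0 < D e0 ^ 2 + D e1 ^ 2 := by
      rcases (add_nonneg (sq_nonneg (D e0)) (sq_nonneg (D e1))).eq_or_lt with h0 | h0
      · have ha : D e0 = 0 := by nlinarith [sq_nonneg (D e0), sq_nonneg (D e1)]
        have hb : D e1 = 0 := by nlinarith [sq_nonneg (D e0), sq_nonneg (D e1)]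
        exact absurd (ContinuousLinearMap.ext fun w => by rw [hDw, ha, hb]; simp) hD0
      · exact h0
    have h3 : (D e0 ^ 2 + D e1 ^ 2) * w 0 = 0 := by linear_combination (-(D e1)) * h1 + D e0 * h2
    have h4 : (D e0 ^ 2 + D e1 ^ 2) * w 1 = 0 := by linear_combination D e0 * h1 + D e1 * h2
    rw [hdec w, (mul_eq_zero.1 h3).resolve_left hsq.ne', (mul_eq_zero.1 h4).resolve_left hsq.ne']
    simp
  have hfr : Module.finrank ℝ Plane = Module.finrank ℝ (ℝ × ℝ) := by simp
  set Φ : Plane ≃L[ℝ] ℝ × ℝ :=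
    (LinearMap.linearEquivOfInjective _ hinj hfr).toContinuousLinearEquiv
  have hΦ : (Φ : Plane →L[ℝ] ℝ × ℝ) = l.prod D := by
    ext w <;> rfl
  set Ψ : Plane → ℝ × ℝ := fun x => (l (x - p), S.G x) with hΨ
  have hΨp : Ψ p = (0, 0) := by simp [hΨ, hp.2]
  have hC : ContDiffAt ℝ 1 Ψ p := by
    refine ContDiffAt.prodMk ?_ (h.contDiffAt hp.1)
    exact (l.contDiff.comp (contDiff_id.sub contDiff_const)).contDiffAt
  have hder : HasFDerivAt Ψ (Φ : Plane →L[ℝ] ℝ × ℝ) p := by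
    rw [hΦ]
    refine HasFDerivAt.prodMk ?_ ((h.contDiffAt hp.1).differentiableAt one_ne_zero).hasFDerivAt
    have h1 := l.hasFDerivAt.comp p ((hasFDerivAt_id p).sub_const p)
    rwa [ContinuousLinearMap.comp_id] at h1
  have hstr := hC.hasStrictFDerivAt' hder one_ne_zero
  set ψ := hC.localInverse hder one_ne_zero with hψ
  have hψC : ContDiffAt ℝ 1 ψ (Ψ p) := hC.to_localInverse hder one_ne_zero
  have hψp : ψ (Ψ p) = p := hC.localInverse_apply_image hder one_ne_zero
  have hleft : ∀ᶠ x in 𝓝 p, ψ (Ψ x) = x := hstr.eventually_left_inverse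
  have hright : ∀ᶠ y in 𝓝 (Ψ p), Ψ (ψ y) = y := hstr.eventually_right_inverse
  rw [hΨp] at hψC hright hψp
  set φ : ℝ → Plane := fun s => ψ (s, 0) with hφ
  have hin : ContDiff ℝ 1 (fun s : ℝ => ((s, 0) : ℝ × ℝ)) := contDiff_id.prodMk contDiff_const
  have hφC : ContDiffAt ℝ 1 φ 0 := ContDiffAt.comp (0 : ℝ) hψC hin.contDiffAt
  have hin0 : Tendsto (fun s : ℝ => ((s, 0) : ℝ × ℝ)) (𝓝 0) (𝓝 (0, 0)) :=
    hin.continuous.tendsto 0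
  have hΩ : ∀ᶠ s in 𝓝 (0 : ℝ), φ s ∈ S.Ω := by
    refine hφC.continuousAt.eventually (h.isOpen.mem_nhds ?_)
    change ψ (0, 0) ∈ S.Ω
    rw [hψp]
    exact hp.1
  have hev := (((hφC.eventually (by simp)).and (hin0.eventually hright)).and hΩ)
  obtain ⟨s₀, hs₀, hs⟩ := Metric.eventually_nhds_iff.1 hev
  obtain ⟨ρ, hρ, hx⟩ := Metric.eventually_nhds_iff.1 hleft
  refine ⟨l, φ, fun s => deriv φ s, s₀, ρ, hs₀, hρ, hψp, fun s hs1 => ?_, fun x hxO hxp => ?_⟩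
  · obtain ⟨⟨h1, h2⟩, h3⟩ := hs (y := s) (by rw [dist_zero_right, Real.norm_eq_abs]; exact abs_lt.2 hs1)
    refine ⟨⟨h3, congrArg Prod.snd h2⟩, congrArg Prod.fst h2,
      (h1.differentiableAt one_ne_zero).hasDerivAt, ?_⟩
    have h4 : ContinuousAt (fderiv ℝ φ) s :=
      (h1.fderiv_right (m := 0) (by simp)).continuousAt
    have h5 : (fun s => deriv φ s) = fun s => fderiv ℝ φ s 1 := by
      ext1 s
      simp
    rw [h5]
    exact h4.clm_apply continuousAt_const
  · have h1 := hx (y := x) (by rw [dist_eq_norm]; exact hxp)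
    have h2 : Ψ x = (l (x - p), 0) := by rw [hΨ]; simp only [hxO.2]
    rwa [h2] at h1

/-- An arc length parametrization of `Ω⁰` near `p`. -/
structure ArcChart (S : PSSystem) (p : Plane) where
  P : ℝ → Plane
  κ : Plane → ℝ
  k : ℝ
  ρ : ℝ
  k_pos : 0 < k
  ρ_pos : 0 < ρ
  P_zero : P 0 = p
  mem : ∀ h ∈ Ioo (-k) k, P h ∈ S.O0
  unit : ∀ h ∈ Ioo (-k) k, ∃ v : Plane, ‖v‖ = 1 ∧ HasDerivAt P v h
  κ_P : ∀ h ∈ Ioo (-k) k, κ (P h) = h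
  P_κ : ∀ x ∈ S.O0, ‖x - p‖ < ρ → κ x ∈ Ioo (-k) k ∧ P (κ x) = x
  diff : Differentiable ℝ κ

/-- The graph parametrization is reparametrized by the integral of its speed. As `l (φ') = 1`, the
speed is bounded below, so the integral can be inverted; the chart function `κ` is defined, and
differentiable, on the whole plane. -/
theorem HalfRegular.exists_arcChart (h : S.HalfRegular) {p : Plane} (hp : p ∈ S.O0) :
    Nonempty (ArcChart S p) := by
  obtain ⟨l, φ, φ', s₀, ρ, hs₀, hρ, hφ0, hφ, hgr⟩ := h.exists_graph hp
  have hl : ∀ s ∈ Ioo (-s₀) s₀, l (φ' s) = 1 := by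
    intro s hs
    obtain ⟨_, _, h3, _⟩ := hφ s hs
    have h4 : HasDerivAt (fun u => l (φ u - p)) (l (φ' s)) s :=
      l.hasFDerivAt.comp_hasDerivAt s (h3.sub_const p)
    have h5 : (fun u => l (φ u - p)) =ᶠ[𝓝 s] fun u => u := by
      filter_upwards [Ioo_mem_nhds hs.1 hs.2] with u hu using (hφ u hu).2.1
    exact h4.unique ((hasDerivAt_id s).congr_of_eventuallyEq h5)
  set s₁ := s₀ / 2 with hs₁
  -- The parameter is clamped to `[-s₁, s₁]`: the speed becomes continuous and bounded below on all
  -- of `ℝ`, and its integral a bijection of `ℝ`.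
  have hc : ∀ s : ℝ, max (-s₁) (min s₁ s) ∈ Ioo (-s₀) s₀ := fun s =>
    ⟨(by linarith : -s₀ < -s₁).trans_le (le_max_left _ _),
      max_lt (by linarith) ((min_le_left _ _).trans_lt (by linarith))⟩
  have hceq : ∀ s ∈ Ioo (-s₁) s₁, max (-s₁) (min s₁ s) = s := fun s hs => by
    rw [min_eq_right hs.2.le, max_eq_right hs.1.le]
  set w : ℝ → ℝ := fun s => ‖φ' (max (-s₁) (min s₁ s))‖ with hw
  have hwc : Continuous w := by
    refine Continuous.norm (continuous_iff_continuousAt.2 fun s => ?_)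
    exact ContinuousAt.comp (f := fun s => max (-s₁) (min s₁ s)) (hφ _ (hc s)).2.2.2 (by fun_prop)
  have hwm : ∀ s, (‖l‖ + 1)⁻¹ ≤ w s := by
    intro s
    have h1 := l.le_opNorm (φ' (max (-s₁) (min s₁ s)))
    rw [hl _ (hc s), norm_one] at h1
    rw [inv_le_iff_one_le_mul₀ (by positivity)]
    have : 0 ≤ w s := norm_nonneg _
    change 1 ≤ ‖l‖ * w s at h1
    linarith
  have hm : 0 < (‖l‖ + 1)⁻¹ := by positivity
  have hw0 : ∀ s, 0 < w s := fun s => hm.trans_le (hwm s)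
  set A : ℝ → ℝ := fun s => ∫ u in (0 : ℝ)..s, w u with hA
  have hAd : ∀ s, HasDerivAt A (w s) s := fun s => (hwc.integral_hasStrictDerivAt 0 s).hasDerivAt
  have hA0 : A 0 = 0 := intervalIntegral.integral_same
  have hAmono : StrictMono A := strictMono_of_hasDerivAt_pos hAd hw0
  have hAcont : Continuous A := continuous_iff_continuousAt.2 fun s => (hAd s).continuousAt
  have hAm : Monotone fun s => A s - (‖l‖ + 1)⁻¹ * s := by
    refine monotone_of_hasDerivAt_nonneg (f' := fun s => w s - (‖l‖ + 1)⁻¹ * 1)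
      (fun s => (hAd s).sub ((hasDerivAt_id s).const_mul _)) fun s => ?_
    have := hwm s
    change 0 ≤ w s - _
    linarith
  have hsurj : Function.Surjective A := by
    refine hAcont.surjective ?_ ?_
    · refine tendsto_atTop_mono' atTop ?_ (tendsto_id.const_mul_atTop hm)
      filter_upwards [eventually_ge_atTop 0] with s hs
      have : A 0 - (‖l‖ + 1)⁻¹ * 0 ≤ A s - (‖l‖ + 1)⁻¹ * s := hAm hs
      rw [hA0] at this
      simp only [id]
      linarith
    · refine tendsto_atBot_mono' atBot ?_ (tendsto_id.const_mul_atBot hm)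
      filter_upwards [eventually_le_atBot 0] with s hs
      have : A s - (‖l‖ + 1)⁻¹ * s ≤ A 0 - (‖l‖ + 1)⁻¹ * 0 := hAm hs
      rw [hA0] at this
      simp only [id]
      linarith
  set E : ℝ ≃o ℝ := hAmono.orderIsoOfSurjective A hsurj with hE
  set B : ℝ → ℝ := fun y => E.symm y with hB
  have hAB : ∀ y, A (B y) = y := fun y => E.apply_symm_apply y
  have hBA : ∀ s, B (A s) = s := fun s => E.symm_apply_apply s
  have hBc : Continuous B := E.symm.continuous
  have hB0 : B 0 = 0 := by
    have := hBA 0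
    rwa [hA0] at this
  have hBd : ∀ y, HasDerivAt B (w (B y))⁻¹ y := fun y =>
    HasDerivAt.of_local_left_inverse hBc.continuousAt (hAd _) (hw0 _).ne'
      (Eventually.of_forall hAB)
  have hs₁0 : 0 < s₁ := by positivity
  obtain ⟨k, hk, hkB⟩ := Metric.eventually_nhds_iff.1 (hBc.tendsto 0 |>.eventually
    (Ioo_mem_nhds (show -s₁ < B 0 by rw [hB0]; linarith) (show B 0 < s₁ by rwa [hB0])))
  have hk' : ∀ y ∈ Ioo (-k) k, B y ∈ Ioo (-s₁) s₁ := fun y hy =>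
    hkB (by rw [dist_zero_right, Real.norm_eq_abs]; exact abs_lt.2 hy)
  have hs : ∀ s ∈ Ioo (-s₁) s₁, s ∈ Ioo (-s₀) s₀ := fun s hs =>
    ⟨by linarith [hs.1], by linarith [hs.2]⟩
  set κ : Plane → ℝ := fun x => A (l (x - p)) with hκ
  have hκp : κ p = 0 := by rw [hκ]; simp only [sub_self, map_zero, hA0]
  have hκd : Differentiable ℝ κ := by
    refine Differentiable.comp (g := A) (f := fun x => l (x - p))
      (fun s => (hAd s).differentiableAt) ?_
    exact l.differentiable.comp (differentiable_id.sub_const p)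
  obtain ⟨ρ', hρ', hκ'⟩ := Metric.eventually_nhds_iff.1 (hκd.continuous.tendsto p |>.eventually
    (Ioo_mem_nhds (show -k < κ p by rw [hκp]; linarith) (show κ p < k by rwa [hκp])))
  refine ⟨⟨fun y => φ (B y), κ, k, min ρ ρ', hk, lt_min hρ hρ', by rw [hB0, hφ0],
    fun y hy => (hφ _ (hs _ (hk' y hy))).1, fun y hy => ?_, fun y hy => ?_,
    fun x hx hxp => ⟨hκ' (y := x) ?_, ?_⟩, hκd⟩⟩
  · refine ⟨(w (B y))⁻¹ • φ' (B y), ?_, ?_⟩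
    · rw [norm_smul, norm_inv, Real.norm_of_nonneg (hw0 _).le]
      have : ‖φ' (B y)‖ = w (B y) := by rw [hw]; simp only [hceq _ (hk' y hy)]
      rw [this]
      exact inv_mul_cancel₀ (hw0 _).ne'
    · exact (hφ _ (hs _ (hk' y hy))).2.2.1.scomp y (hBd y)
  · change A (l (φ (B y) - p)) = y
    rw [(hφ _ (hs _ (hk' y hy))).2.1, hAB]
  · rw [dist_eq_norm]; exact hxp.trans_le (min_le_right _ _)
  · change φ (B (A (l (x - p)))) = x
    rw [hBA, hgr x hx (hxp.trans_le (min_le_left _ _))]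

namespace ArcChart
variable {p : Plane}

/-- The chart with the reverse orientation. -/
def reverse (A : ArcChart S p) : ArcChart S p where
  P h := A.P (-h)
  κ x := -A.κ x
  k := A.k
  ρ := A.ρ
  k_pos := A.k_pos
  ρ_pos := A.ρ_pos
  P_zero := by rw [neg_zero, A.P_zero]
  mem h hh := A.mem _ ⟨by linarith [hh.2], by linarith [hh.1]⟩
  unit h hh := by
    obtain ⟨v, hv, hd⟩ := A.unit (-h) ⟨by linarith [hh.2], by linarith [hh.1]⟩
    refine ⟨-v, by rwa [norm_neg], ?_⟩
    have := hd.scomp h (hasDerivAt_neg h)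
    rwa [neg_one_smul] at this
  κ_P h hh := by rw [A.κ_P _ ⟨by linarith [hh.2], by linarith [hh.1]⟩, neg_neg]
  P_κ x hx hxp := by
    obtain ⟨h1, h2⟩ := A.P_κ x hx hxp
    exact ⟨⟨by linarith [h1.2], by linarith [h1.1]⟩, by rw [neg_neg, h2]⟩
  diff := A.diff.neg

theorem injOn (A : ArcChart S p) : InjOn A.P (Ioo (-A.k) A.k) := fun h hh h' hh' he => by
  rw [← A.κ_P h hh, ← A.κ_P h' hh', he]

theorem κ_self (A : ArcChart S p) : A.κ p = 0 := by
  have := A.κ_P 0 ⟨by linarith [A.k_pos], A.k_pos⟩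
  rwa [A.P_zero] at this

theorem norm_sub_le (A : ArcChart S p) {h h' : ℝ} (hh : h ∈ Ioo (-A.k) A.k)
    (hh' : h' ∈ Ioo (-A.k) A.k) : ‖A.P h - A.P h'‖ ≤ |h - h'| := by
  choose! v hv hd using A.unit
  have := (convex_Ioo (-A.k) A.k).norm_image_sub_le_of_norm_hasDerivWithin_le (C := 1)
    (fun x hx => (hd x hx).hasDerivWithinAt) (fun x hx => (hv x hx).le) hh' hh
  rwa [one_mul] at this

/-- In the chart, the curves of unit speed are affine. -/
theorem affine (A : ArcChart S p) {c : ℝ → Plane} {a b : ℝ} (hab : a < b)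
    (hO : ∀ u ∈ Icc a b, c u ∈ S.O0) (hρ : ∀ u ∈ Icc a b, ‖c u - p‖ < A.ρ)
    (hc : ∀ u ∈ Icc a b, ∃ v : Plane, ‖v‖ = 1 ∧ HasDerivWithinAt c v (Icc a b) u) :
    ∃ σ : ℝ, (σ = 1 ∨ σ = -1) ∧ ∀ u ∈ Icc a b, ∀ u' ∈ Icc a b,
      A.κ (c u) - A.κ (c u') = σ * (u - u') := by
  choose! v hv hd using hc
  set f : ℝ → ℝ := fun u => A.κ (c u) with hf
  set f' : ℝ → ℝ := fun u => fderiv ℝ A.κ (c u) (v u) with hf'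
  have hfd : ∀ u ∈ Icc a b, HasDerivWithinAt f (f' u) (Icc a b) u := fun u hu =>
    (A.diff (c u)).hasFDerivAt.comp_hasDerivWithinAt u (hd u hu)
  have habs : ∀ u ∈ Icc a b, |f' u| = 1 := by
    intro u hu
    obtain ⟨h1, h2⟩ := A.P_κ _ (hO u hu) (hρ u hu)
    obtain ⟨w, hw, hPd⟩ := A.unit _ h1
    have h3 : HasDerivWithinAt (fun u => A.P (f u)) (f' u • w) (Icc a b) u :=
      HasDerivAt.scomp_hasDerivWithinAt u hPd (hfd u hu)
    have h4 : HasDerivWithinAt c (f' u • w) (Icc a b) u :=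
      h3.congr (fun y hy => ((A.P_κ _ (hO y hy) (hρ y hy)).2).symm) h2.symm
    have h5 := (uniqueDiffOn_Icc hab u hu).eq_deriv _ h4 (hd u hu)
    have h6 := congrArg norm h5
    rwa [norm_smul, hw, mul_one, hv u hu, Real.norm_eq_abs] at h6
  have key : ∀ σ : ℝ, (∀ u ∈ Icc a b, f' u = σ) → ∀ u ∈ Icc a b, ∀ u' ∈ Icc a b,
      A.κ (c u) - A.κ (c u') = σ * (u - u') := by
    intro σ hσ u hu u' hu'
    have := (convex_Icc a b).norm_image_sub_le_of_norm_hasDerivWithin_le (C := 0)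
      (f := fun u => f u - σ * u) (f' := fun u => f' u - σ * 1)
      (fun x hx => (hfd x hx).sub ((hasDerivWithinAt_id x _).const_mul σ))
      (fun x hx => by rw [hσ x hx]; simp) hu' hu
    rw [zero_mul, norm_le_zero_iff] at this
    linarith
  -- The derivative of `κ ∘ c` is `±1` everywhere but not assumed continuous; by Darboux it has
  -- constant sign.
  rcases hasDerivWithinAt_forall_lt_or_forall_gt_of_forall_ne (convex_Icc a b) hfd (m := 0)
    (fun u hu h0 => by have := habs u hu; rw [h0] at this; simp at this) with h0 | h0
  · refine ⟨-1, Or.inr rfl, key _ fun u hu => ?_⟩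
    have := habs u hu
    rw [abs_of_neg (h0 u hu)] at this
    linarith
  · refine ⟨1, Or.inl rfl, key _ fun u hu => ?_⟩
    have := habs u hu
    rwa [abs_of_pos (h0 u hu)] at this

end ArcChart

end PSSystem

/-! ### Arcs of `Ω⁰` from the origin are determined by their length -/

namespace PSSystem
variable {S : PSSystem} {γ : ℝ → Plane}

/-- A path of `Ω⁰` of length `s`, parametrized by arc length, that leaves the origin towards the
inside of the loop. -/
structure ArcPath (S : PSSystem) (γ : ℝ → Plane) (c : ℝ → Plane) (s : ℝ) : Prop where
  pos : 0 < s
  zero : c 0 = 0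
  inj : InjOn c (Icc 0 s)
  mem : ∀ u ∈ Icc 0 s, c u ∈ S.O0
  unit : ∀ u ∈ Icc 0 s, ∃ v : Plane, ‖v‖ = 1 ∧ HasDerivWithinAt c v (Icc 0 s) u
  enclosed : ∀ᶠ u in 𝓝[>] (0 : ℝ), c u ∈ enclosed (loopSet γ)

theorem hasLength_iff {Q : Plane} {s : ℝ} :
    S.HasLength γ Q s ↔ ∃ c, S.ArcPath γ c s ∧ c s = Q :=
  ⟨fun ⟨h, c, h1, h2, h3, h4, h5, h6⟩ => ⟨c, ⟨h, h1, h3, h4, h5, h6⟩, h2⟩,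
    fun ⟨c, h, h2⟩ => ⟨h.pos, c, h.zero, h2, h.inj, h.mem, h.unit, h.enclosed⟩⟩

namespace ArcPath
variable {c c' : ℝ → Plane} {s s' : ℝ}

theorem restrict (hc : S.ArcPath γ c s') (hs : 0 < s) (hss : s ≤ s') : S.ArcPath γ c s := by
  have hsub : Icc 0 s ⊆ Icc 0 s' := Icc_subset_Icc_right hss
  refine ⟨hs, hc.zero, hc.inj.mono hsub, fun u hu => hc.mem u (hsub hu), fun u hu => ?_,
    hc.enclosed⟩
  obtain ⟨v, hv, hd⟩ := hc.unit u (hsub hu)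
  exact ⟨v, hv, hd.mono hsub⟩

theorem continuousOn (hc : S.ArcPath γ c s) : ContinuousOn c (Icc 0 s) := fun u hu => by
  obtain ⟨v, _, hd⟩ := hc.unit u hu
  exact hd.continuousWithinAt

theorem eq_of_eqOn_Ico {t : ℝ} (hc : S.ArcPath γ c s) (hc' : S.ArcPath γ c' s) (ht : t ∈ Icc 0 s)
    (h : ∀ u ∈ Ico 0 t, c u = c' u) : c t = c' t := by
  rcases ht.1.eq_or_lt with h0 | h0
  · rw [← h0, hc.zero, hc'.zero]
  · have hne : (𝓝[Ico 0 t] t).NeBot :=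
      mem_closure_iff_nhdsWithin_neBot.1 (by rw [closure_Ico h0.ne]; exact ⟨h0.le, le_rfl⟩)
    have hsub : Ico 0 t ⊆ Icc 0 s := fun u hu => ⟨hu.1, hu.2.le.trans ht.2⟩
    exact tendsto_nhds_unique_of_eventuallyEq ((hc.continuousOn t ht).mono hsub)
      ((hc'.continuousOn t ht).mono hsub) (eventually_of_mem self_mem_nhdsWithin h)

theorem exists_close (hc : S.ArcPath γ c s) {t ρ : ℝ} (ht : t ∈ Icc 0 s) (hρ : 0 < ρ) :
    ∃ η > 0, ∀ u ∈ Icc 0 s, |u - t| ≤ η → ‖c u - c t‖ < ρ := by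
  obtain ⟨η, hη, h⟩ := Metric.continuousOn_iff.1 hc.continuousOn t ht ρ hρ
  refine ⟨η / 2, by positivity, fun u hu hut => ?_⟩
  rw [← dist_eq_norm]
  exact h u hu (by rw [Real.dist_eq]; linarith)

/-- A path of unit speed is affine in a chart. -/
theorem affine (hc : S.ArcPath γ c s) {p : Plane} (A : ArcChart S p) {a b t : ℝ} (ha : 0 ≤ a)
    (hab : a < b) (hb : b ≤ s) (ht : t ∈ Icc a b) (hp : c t = p)
    (hρ : ∀ u ∈ Icc a b, ‖c u - p‖ < A.ρ) : ∃ σ : ℝ, (σ = 1 ∨ σ = -1) ∧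
      ∀ u ∈ Icc a b, A.κ (c u) = σ * (u - t) ∧ σ * (u - t) ∈ Ioo (-A.k) A.k ∧
        c u = A.P (σ * (u - t)) := by
  have hsub : Icc a b ⊆ Icc 0 s := Icc_subset_Icc ha hb
  obtain ⟨σ, hσ, h⟩ := A.affine hab (fun u hu => hc.mem u (hsub hu)) hρ (fun u hu => by
    obtain ⟨v, hv, hd⟩ := hc.unit u (hsub hu)
    exact ⟨v, hv, hd.mono hsub⟩)
  refine ⟨σ, hσ, fun u hu => ?_⟩
  have h1 := h u hu t ht
  rw [hp, A.κ_self, sub_zero] at h1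
  obtain ⟨h2, h3⟩ := A.P_κ _ (hc.mem u (hsub hu)) (hρ u hu)
  exact ⟨h1, h1 ▸ h2, by rw [← h1, h3]⟩

end ArcPath

/-- The curve `Ω⁰` is inside the loop only on one side of the saddle. -/
theorem ArcChart.not_both_enclosed {M : SaddleModel S γ} (f : M.LoopFrame) {p : Plane}
    (A : ArcChart S p) (hp : p = 0)
    (h1 : ∀ᶠ u in 𝓝[>] (0 : ℝ), A.P u ∈ enclosed (loopSet γ))
    (h2 : ∀ᶠ u in 𝓝[>] (0 : ℝ), A.P (-u) ∈ enclosed (loopSet γ)) : False := by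
  subst hp
  have hk := A.k_pos
  have h0 : (0 : ℝ) ∈ Ioo (-A.k) A.k := ⟨by linarith, hk⟩
  obtain ⟨v, hv, hd⟩ := A.unit 0 h0
  obtain ⟨δ, hδ, hiff⟩ := f.mem_enclosed_iff
  have hmem : ∀ᶠ u in 𝓝 (0 : ℝ), A.P u ∈ S.O0 := by
    filter_upwards [Ioo_mem_nhds h0.1 h0.2] with u hu using A.mem u hu
  have hsmall : ∀ᶠ u in 𝓝 (0 : ℝ), ‖A.P u‖ < δ := by
    have := (continuous_norm.continuousAt (x := A.P 0)).comp hd.continuousAt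
    exact this.eventually (gt_mem_nhds (by simpa [A.P_zero] using hδ))
  have hV : ∀ᶠ u in 𝓝 (0 : ℝ), A.P u ∈ enclosed (loopSet γ) → 0 < M.V (A.P u) := by
    filter_upwards [hmem, hsmall] with u ha hb using (hiff _ ha hb).1
  -- If both branches were enclosed, `V` would have a minimum at the origin along `Ω⁰`. The unit
  -- tangent would then satisfy `V v = 0`, and `U v + V v = 0` because `G` vanishes on `Ω⁰`; so it
  -- would be zero.
  have hmin : IsLocalMin (fun u => M.V (A.P u)) 0 := by
    rw [eventually_nhdsWithin_iff] at h1 h2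
    have h3 := (continuous_neg.tendsto' (0 : ℝ) 0 neg_zero).eventually h2
    filter_upwards [hV, h1, h3] with u ha hb hc
    rw [A.P_zero, map_zero]
    rcases lt_trichotomy u 0 with h | h | h
    · exact (ha (by simpa using hc (by simpa using h))).le
    · rw [h, A.P_zero, map_zero]
    · exact (ha (hb h)).le
  have hVv : M.V v = 0 :=
    hmin.hasDerivAt_eq_zero (M.V.hasFDerivAt.comp_hasDerivAt (0 : ℝ) hd)
  have hG : HasDerivAt (fun u => S.G (A.P u)) ((M.U + M.V) v) 0 := by
    refine HasFDerivAt.comp_hasDerivAt (0 : ℝ) ?_ hd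
    rw [A.P_zero]
    exact M.G_deriv_zero
  have hG0 : (fun u => S.G (A.P u)) =ᶠ[𝓝 0] fun _ => (0 : ℝ) := by
    filter_upwards [hmem] with u hu using hu.2
  have hUV : (M.U + M.V) v = 0 :=
    hG.unique ((hasDerivAt_const (0 : ℝ) (0 : ℝ)).congr_of_eventuallyEq hG0)
  rw [_root_.add_apply, hVv, add_zero] at hUV
  have := M.norm_le v
  rw [hUV, hVv, hv] at this
  simp at this
  linarith

namespace ArcPath
variable {c c' : ℝ → Plane} {s s' : ℝ} {M : SaddleModel S γ}

/-- Continuous induction on the length of the common initial piece. In a chart both paths are affine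
with slope `±1`, so only their directions have to be compared. -/
theorem eqOn_of_same (f : M.LoopFrame) (h : S.HalfRegular) (hc : S.ArcPath γ c s)
    (hc' : S.ArcPath γ c' s) : EqOn c c' (Icc 0 s) := by
  set E : Set ℝ := {t | ∀ u ∈ Icc 0 s, c u ≠ c' u → t ≤ u} with hE
  have heq : ∀ t ∈ E, t ≤ s → ∀ u ∈ Icc 0 t, c u = c' u := by
    intro t ht hts
    have h1 : ∀ u ∈ Ico 0 t, c u = c' u := fun u hu => by
      by_contra hne
      exact (ht u ⟨hu.1, hu.2.le.trans hts⟩ hne).not_gt hu.2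
    intro u hu
    exact eq_of_eqOn_Ico hc hc' ⟨hu.1, hu.2.trans hts⟩ fun v hv => h1 v ⟨hv.1, hv.2.trans_le hu.2⟩
  have hcl : IsClosed E := by
    have : E = ⋂ u ∈ Icc 0 s, ⋂ _ : c u ≠ c' u, Iic u := by
      ext t
      simp [hE]
    rw [this]
    exact isClosed_biInter fun u _ => isClosed_iInter fun _ => isClosed_Iic
  have hsub : Icc 0 s ⊆ E := by
    refine (hcl.inter isClosed_Icc).Icc_subset_of_forall_exists_gt (fun u hu _ => hu.1) ?_
    rintro t ⟨htE, ht⟩ y hy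
    have ht' : t ∈ Icc 0 s := ⟨ht.1, ht.2.le⟩
    have hagree := heq t htE ht.2.le
    have hp := hagree t ⟨ht.1, le_rfl⟩
    obtain ⟨A⟩ := h.exists_arcChart (hc.mem t ht')
    obtain ⟨η, hη, h1⟩ := hc.exists_close ht' A.ρ_pos
    obtain ⟨η', hη', h2⟩ := hc'.exists_close ht' A.ρ_pos
    set a := max 0 (t - min η η') with ha
    set b := min s (t + min η η') with hb
    have hm : 0 < min η η' := lt_min hη hη'
    have hat : a ≤ t := max_le ht.1 (by linarith)
    have htb : t < b := lt_min ht.2 (by linarith)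
    have ha0 : 0 ≤ a := le_max_left _ _
    have hbs : b ≤ s := min_le_left _ _
    have hclose : ∀ u ∈ Icc a b, u ∈ Icc 0 s ∧ |u - t| ≤ min η η' := fun u hu =>
      ⟨⟨ha0.trans hu.1, hu.2.trans hbs⟩, abs_le.2 ⟨by
        have := (le_max_right 0 (t - min η η')).trans hu.1
        linarith, by
        have := hu.2.trans (min_le_right s (t + min η η'))
        linarith⟩⟩
    obtain ⟨σ, hσ, h3⟩ := hc.affine A ha0 (hat.trans_lt htb) hbs ⟨hat, htb.le⟩ rfl fun u hu =>
      h1 u (hclose u hu).1 ((hclose u hu).2.trans (min_le_left _ _))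
    obtain ⟨σ', hσ', h4⟩ := hc'.affine A ha0 (hat.trans_lt htb) hbs ⟨hat, htb.le⟩ hp.symm
      fun u hu => by
        have := h2 u (hclose u hu).1 ((hclose u hu).2.trans (min_le_right _ _))
        rwa [← hp] at this
    -- At a positive parameter the common past fixes the direction. At the origin there is no past;
    -- there the direction is fixed because both paths start inside the loop and `Ω⁰` is enclosed on
    -- one side only.
    have hσσ : σ = σ' := by
      rcases ht.1.eq_or_lt with h0 | h0
      · by_contra hne
        have hev : ∀ᶠ u in 𝓝[>] (0 : ℝ), u ∈ Icc a b ∧ u - t = u := by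
          have hb0 : 0 < b := h0 ▸ htb
          filter_upwards [Ioo_mem_nhdsGT hb0] with u hu
          exact ⟨⟨hat.trans (h0 ▸ hu.1.le), hu.2.le⟩, by rw [← h0, sub_zero]⟩
        have hcE : ∀ᶠ u in 𝓝[>] (0 : ℝ), A.P (σ * u) ∈ _root_.enclosed (loopSet γ) := by
          filter_upwards [hev, hc.enclosed] with u hu hue
          have := (h3 u hu.1).2.2
          rw [hu.2] at this
          rwa [← this]
        have hcE' : ∀ᶠ u in 𝓝[>] (0 : ℝ), A.P (σ' * u) ∈ _root_.enclosed (loopSet γ) := by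
          filter_upwards [hev, hc'.enclosed] with u hu hue
          have := (h4 u hu.1).2.2
          rw [hu.2] at this
          rwa [← this]
        have hct : c t = 0 := by rw [← h0, hc.zero]
        rcases hσ with rfl | rfl <;> rcases hσ' with rfl | rfl
        · exact hne rfl
        · simp only [one_mul, neg_one_mul] at hcE hcE'
          exact A.not_both_enclosed f hct hcE hcE'
        · simp only [one_mul, neg_one_mul] at hcE hcE'
          exact A.not_both_enclosed f hct hcE' hcE
        · exact hne rfl
      · have hat' : a < t := max_lt h0 (by linarith)
        have h5 := (h3 a ⟨le_rfl, hat.trans htb.le⟩).1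
        rw [hagree a ⟨ha0, hat⟩, (h4 a ⟨le_rfl, hat.trans htb.le⟩).1] at h5
        exact (mul_right_cancel₀ (sub_ne_zero.2 hat'.ne) h5).symm
    refine ⟨min b y, fun u hu hne => ?_, lt_min htb hy, min_le_right _ _⟩
    by_contra hlt
    push Not at hlt
    refine hne ?_
    rcases le_or_gt u t with hut | hut
    · exact hagree u ⟨hu.1, hut⟩
    · have hu' : u ∈ Icc a b := ⟨hat.trans hut.le, hlt.le.trans (min_le_left _ _)⟩
      rw [(h3 u hu').2.2, (h4 u hu').2.2, hσσ]
  exact heq s (hsub ⟨hc.pos.le, le_rfl⟩) le_rfl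

theorem eqOn (f : M.LoopFrame) (h : S.HalfRegular) (hc : S.ArcPath γ c s)
    (hc' : S.ArcPath γ c' s') (hs : s ≤ s') : EqOn c c' (Icc 0 s) :=
  hc.eqOn_of_same f h (hc'.restrict hc.pos hs)

end ArcPath

theorem HasLength.length_unique {M : SaddleModel S γ} (f : M.LoopFrame) (h : S.HalfRegular)
    {Q : Plane} {s s' : ℝ} (h1 : S.HasLength γ Q s) (h2 : S.HasLength γ Q s') : s = s' := by
  have key : ∀ s s' : ℝ, S.HasLength γ Q s → S.HasLength γ Q s' → s ≤ s' → s = s' := by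
    intro s s' h1 h2 hs
    obtain ⟨c, hc, hQ⟩ := hasLength_iff.1 h1
    obtain ⟨c', hc', hQ'⟩ := hasLength_iff.1 h2
    have h3 := hc.eqOn f h hc' hs ⟨hc.pos.le, le_rfl⟩
    rw [hQ, ← hQ'] at h3
    exact (hc'.inj ⟨hc'.pos.le, le_rfl⟩ ⟨hc.pos.le, hs⟩ h3).symm
  rcases le_total s s' with hs | hs
  · exact key s s' h1 h2 hs
  · exact (key s' s h2 h1 hs).symm

theorem HasLength.point_unique {M : SaddleModel S γ} (f : M.LoopFrame) (h : S.HalfRegular)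
    {Q Q' : Plane} {s : ℝ} (h1 : S.HasLength γ Q s) (h2 : S.HasLength γ Q' s) : Q = Q' := by
  obtain ⟨c, hc, hQ⟩ := hasLength_iff.1 h1
  obtain ⟨c', hc', hQ'⟩ := hasLength_iff.1 h2
  rw [← hQ, ← hQ']
  exact hc.eqOn f h hc' le_rfl ⟨hc.pos.le, le_rfl⟩

/-- The arc of `Ω⁰` which joins the saddle to `γ 0`, prolonged beyond `γ 0`. -/
theorem exists_crossArc {M : SaddleModel S γ} (f : M.LoopFrame) (h : S.HalfRegular)
    (hArc : ∃ s, S.HasLength γ (γ 0) s) : ∃ (A : CrossArc S γ) (l : ℝ),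
      ∀ x ∈ Ioo (-A.k) A.k, S.HasLength γ (A.P x) (l + x) := by
  obtain ⟨l, hl⟩ := hArc
  obtain ⟨c, hc, hcl⟩ := hasLength_iff.1 hl
  have hl0 := hc.pos
  have hll : l ∈ Icc 0 l := ⟨hl0.le, le_rfl⟩
  -- A chart at `γ 0`, reversed if necessary, in which the given arc arrives with increasing
  -- parameter.
  obtain ⟨A, η, hη, hηl, hA⟩ : ∃ (A : ArcChart S (γ 0)) (η : ℝ), 0 < η ∧ η ≤ l ∧
      ∀ u ∈ Icc (l - η) l, u - l ∈ Ioo (-A.k) A.k ∧ c u = A.P (u - l) := by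
    obtain ⟨A⟩ := h.exists_arcChart M.γ_zero
    obtain ⟨η, hη, h1⟩ := hc.exists_close hll A.ρ_pos
    have hη' : 0 < min η l := lt_min hη hl0
    obtain ⟨σ, hσ, h2⟩ := hc.affine A (a := l - min η l) (b := l)
      (by linarith [min_le_right η l]) (by linarith) le_rfl ⟨by linarith, le_rfl⟩ hcl fun u hu => by
        have h2 := h1 u ⟨by linarith [hu.1, min_le_right η l], hu.2⟩
        rw [hcl] at h2
        refine h2 (abs_le.2 ⟨?_, ?_⟩)
        · linarith [hu.1, min_le_left η l]
        · linarith [hu.2]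
    rcases hσ with rfl | rfl
    · refine ⟨A, _, hη', min_le_right _ _, fun u hu => ?_⟩
      obtain ⟨_, h4, h5⟩ := h2 u hu
      rw [one_mul] at h4 h5
      exact ⟨h4, h5⟩
    · refine ⟨A.reverse, _, hη', min_le_right _ _, fun u hu => ?_⟩
      obtain ⟨_, h4, h5⟩ := h2 u hu
      rw [neg_one_mul] at h4 h5
      exact ⟨⟨by change -A.k < _; linarith [h4.2], by change _ < A.k; linarith [h4.1]⟩, h5⟩
  -- The earlier part of the arc stays at distance at least `m` from `γ 0`, so the prolongation
  -- beyond `γ 0` by less than `m` cannot run into it.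
  obtain ⟨m, hm, hdist⟩ : ∃ m > 0, ∀ u ∈ Icc 0 (l - η), m ≤ ‖c u - γ 0‖ := by
    have hsub : Icc 0 (l - η) ⊆ Icc 0 l := Icc_subset_Icc_right (by linarith)
    obtain ⟨u, hu, hmin⟩ := (isCompact_Icc (a := (0 : ℝ)) (b := l - η)).exists_isMinOn
      ⟨0, le_rfl, by linarith⟩ ((hc.continuousOn.mono hsub).sub continuousOn_const).norm
    refine ⟨‖c u - γ 0‖, norm_pos_iff.2 fun h0 => ?_, fun v hv => hmin hv⟩
    rw [sub_eq_zero, ← hcl] at h0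
    have := hc.inj (hsub hu) hll h0
    linarith [hu.2]
  have hγ0 : 0 < ‖γ 0‖ := norm_pos_iff.2 M.γ_zero_ne_zero
  set k := min (min A.k η) (min m ‖γ 0‖) with hk
  have hk0 : 0 < k := lt_min (lt_min A.k_pos hη) (lt_min hm hγ0)
  have hkA : k ≤ A.k := (min_le_left _ _).trans (min_le_left _ _)
  have hkη : k ≤ η := (min_le_left _ _).trans (min_le_right _ _)
  have hkm : k ≤ m := (min_le_right _ _).trans (min_le_left _ _)
  have hkγ : k ≤ ‖γ 0‖ := (min_le_right _ _).trans (min_le_right _ _)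
  clear_value k
  have hsub : Ioo (-k) k ⊆ Ioo (-A.k) A.k := Ioo_subset_Ioo (by linarith) hkA
  have hz : (0 : ℝ) ∈ Ioo (-A.k) A.k := ⟨by linarith [A.k_pos], A.k_pos⟩
  have hdP : ∀ x ∈ Ioo (-k) k, ‖A.P x - γ 0‖ ≤ |x| := fun x hx => by
    have := A.norm_sub_le (hsub hx) hz
    rwa [A.P_zero, sub_zero] at this
  have hcP : ∀ x ∈ Ioo (-k) k, x ≤ 0 → c (l + x) = A.P x := fun x hx hx0 => by
    have := (hA (l + x) ⟨by linarith [hx.1], by linarith⟩).2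
    rwa [add_sub_cancel_left] at this
  refine ⟨⟨A.P, k, hk0, A.P_zero, fun x hx y hy => A.norm_sub_le (hsub hx) (hsub hy),
    fun x hx => A.mem x (hsub hx), A.injOn.mono hsub, fun x hx h0 => ?_, fun k' hk' => ?_,
    fun x hx hx0 => ?_⟩, l, fun x hx => ?_⟩
  · have h1 := hdP x hx
    rw [h0, zero_sub, norm_neg] at h1
    exact (h1.trans_lt (abs_lt.2 hx)).not_ge hkγ
  · have hmin : 0 < min k k' := lt_min hk0 hk'
    obtain ⟨ρ, hρ, hx⟩ := Metric.eventually_nhds_iff.1 ((A.diff.continuous.tendsto (γ 0)).eventually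
      (Metric.ball_mem_nhds _ hmin))
    refine ⟨min ρ A.ρ, lt_min hρ A.ρ_pos, fun x hxO hxd => ⟨A.κ x, ?_⟩⟩
    have h1 := hx (y := x) (by rw [dist_eq_norm]; exact hxd.trans_le (min_le_left _ _))
    rw [A.κ_self, dist_zero_right, Real.norm_eq_abs] at h1
    exact ⟨abs_lt.1 (h1.trans_le (min_le_left _ _)), h1.trans_le (min_le_right _ _),
      (A.P_κ x hxO (hxd.trans_le (min_le_right _ _))).2⟩
  -- The loop meets `Ω⁰` only at `0` and `γ 0`, the end points of the injective arc. Its interior is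
  -- connected and starts inside, hence is enclosed.
  · rw [← hcP x hx hx0.le]
    have hsubI : Ioo 0 l ⊆ Icc 0 l := Ioo_subset_Icc_self
    obtain ⟨u, hu, hul⟩ := (hc.enclosed.and (Ioo_mem_nhdsGT hl0)).exists
    refine subset_enclosed (A := c '' Ioo 0 l)
      (isPreconnected_Ioo.image c (hc.continuousOn.mono hsubI)) ?_
      (mem_image_of_mem c hul) hu (mem_image_of_mem c ⟨by linarith [hx.1], by linarith⟩)
    rintro _ ⟨v, hv, rfl⟩ hvΓ
    rcases f.O0_inter_loopSet (hc.mem v (hsubI hv)) hvΓ with h0 | h0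
    · rw [← hc.zero] at h0
      exact hv.1.ne' (hc.inj (hsubI hv) ⟨le_rfl, hl0.le⟩ h0)
    · rw [← hcl] at h0
      exact hv.2.ne (hc.inj (hsubI hv) hll h0)
  · rw [hasLength_iff]
    rcases le_or_gt x 0 with hx0 | hx0
    · exact ⟨c, hc.restrict (by linarith [hx.1]) (by linarith), hcP x hx hx0⟩
    · set c' : ℝ → Plane := fun u => if u ≤ l then c u else A.P (u - l) with hc'
      have hc1 : ∀ u ≤ l, c' u = c u := fun u hu => if_pos hu
      have hc2 : ∀ u, l < u → c' u = A.P (u - l) := fun u hu => if_neg hu.not_ge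
      have hc3 : ∀ u, l - η < u → c' u = A.P (u - l) := fun u hu => by
        rcases le_or_gt u l with h1 | h1
        · rw [hc1 u h1, (hA u ⟨hu.le, h1⟩).2]
        · exact hc2 u h1
      have hc4 : ∀ u ∈ Ioc l (l + x), u - l ∈ Ioo (-k) k := fun u hu =>
        ⟨by linarith [hu.1], by linarith [hu.2, hx.2]⟩
      have hne : ∀ u ∈ Icc 0 l, ∀ v ∈ Ioc l (l + x), c' u ≠ c' v := by
        intro u hu v hv heq
        rw [hc2 v hv.1] at heq
        rcases lt_or_ge (l - η) u with h1 | h1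
        · rw [hc3 u h1] at heq
          have := A.injOn (hA u ⟨h1.le, hu.2⟩).1 (hsub (hc4 v hv)) heq
          linarith [hu.2, hv.1]
        · have h2 := hdist u ⟨hu.1, h1⟩
          rw [← hc1 u hu.2, heq] at h2
          have h3 := hdP _ (hc4 v hv)
          have h4 := abs_lt.2 (hc4 v hv)
          linarith
      refine ⟨c', ⟨by linarith, by rw [hc1 0 hl0.le, hc.zero], ?_, ?_, ?_, ?_⟩, ?_⟩
      · intro u hu v hv heq
        rcases le_or_gt u l with h1 | h1 <;> rcases le_or_gt v l with h2 | h2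
        · rw [hc1 u h1, hc1 v h2] at heq
          exact hc.inj ⟨hu.1, h1⟩ ⟨hv.1, h2⟩ heq
        · exact (hne u ⟨hu.1, h1⟩ v ⟨h2, hv.2⟩ heq).elim
        · exact (hne v ⟨hv.1, h2⟩ u ⟨h1, hu.2⟩ heq.symm).elim
        · rw [hc2 u h1, hc2 v h2] at heq
          have := A.injOn (hsub (hc4 u ⟨h1, hu.2⟩)) (hsub (hc4 v ⟨h2, hv.2⟩)) heq
          linarith
      · intro u hu
        rcases le_or_gt u l with h1 | h1
        · rw [hc1 u h1]; exact hc.mem u ⟨hu.1, h1⟩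
        · rw [hc2 u h1]; exact A.mem _ (hsub (hc4 u ⟨h1, hu.2⟩))
      · intro u hu
        rcases lt_or_ge u l with h1 | h1
        · obtain ⟨v, hv, hd⟩ := hc.unit u ⟨hu.1, h1.le⟩
          refine ⟨v, hv, ?_⟩
          have h2 : Icc 0 l ∈ 𝓝[Icc 0 (l + x)] u :=
            mem_nhdsWithin.2 ⟨Iio l, isOpen_Iio, h1, fun y hy => ⟨hy.2.1, hy.1.le⟩⟩
          refine (hd.mono_of_mem_nhdsWithin h2).congr_of_eventuallyEq ?_ (hc1 u h1.le)
          filter_upwards [h2] with y hy using hc1 y hy.2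
        · have h2 : u - l ∈ Ioo (-k) k := ⟨by linarith, by linarith [hu.2, hx.2]⟩
          obtain ⟨v, hv, hd⟩ := A.unit _ (hsub h2)
          refine ⟨v, hv, HasDerivAt.hasDerivWithinAt ?_⟩
          refine (hd.comp_sub_const u l).congr_of_eventuallyEq ?_
          filter_upwards [lt_mem_nhds (show l - η < u by linarith)] with y hy using hc3 y hy
      · filter_upwards [hc.enclosed, Ioo_mem_nhdsGT hl0] with u hu hul
        rwa [hc1 u hul.2.le]
      · rw [hc2 _ (by linarith), add_sub_cancel_left]

end PSSystem

/-! ### Time reversal -/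

namespace PSSystem

/-- The system obtained by reversing the time and exchanging `Ω⁺` and `Ω⁻`. -/
def rev (S : PSSystem) : PSSystem where
  Ω := S.Ω
  G x := -S.G x
  fp x := -S.fm x
  fm x := -S.fp x
  g t x ε := -S.g (-t) x ε

variable {S : PSSystem} {γ : ℝ → Plane}

theorem rev_rev (S : PSSystem) : S.rev.rev = S := by
  cases S
  simp [rev]

theorem rev_Op (S : PSSystem) : S.rev.Op = S.Om := by
  ext x
  simp [rev, Op, Om]

theorem rev_Om (S : PSSystem) : S.rev.Om = S.Op := by
  ext x
  simp [rev, Op, Om]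

theorem rev_O0 (S : PSSystem) : S.rev.O0 = S.O0 := by
  ext x
  simp [rev, O0]

theorem rev_Fp (S : PSSystem) (ε t : ℝ) (x : Plane) : S.rev.Fp ε t x = -S.Fm ε (-t) x := by
  simp [rev, Fp, Fm, add_comm]

theorem rev_Fm (S : PSSystem) (ε t : ℝ) (x : Plane) : S.rev.Fm ε t x = -S.Fp ε (-t) x := by
  simp [rev, Fp, Fm, add_comm]

theorem _root_.loopSet_rev (γ : ℝ → Plane) : loopSet (fun t => γ (-t)) = loopSet γ := by
  rw [loopSet, loopSet]
  congr 1
  exact neg_surjective.range_comp γ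

theorem rev_hasLength (S : PSSystem) (γ : ℝ → Plane) (Q : Plane) (s : ℝ) :
    S.rev.HasLength (fun t => γ (-t)) Q s ↔ S.HasLength γ Q s := by
  rw [HasLength, HasLength, rev_O0, loopSet_rev]

theorem rev_hasDirectedDist (S : PSSystem) (γ : ℝ → Plane) (Q P : Plane) (d : ℝ) :
    S.rev.HasDirectedDist (fun t => γ (-t)) Q P d ↔ S.HasDirectedDist γ Q P d := by
  simp only [HasDirectedDist, rev_hasLength]

theorem hasDerivWithinAt_comp_neg {x : ℝ → Plane} {v : Plane} {I : Set ℝ} {t : ℝ}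
    (h : HasDerivWithinAt x v I (-t)) :
    HasDerivWithinAt (fun u => x (-u)) (-v) ((fun u => -u) ⁻¹' I) t := by
  have := h.scomp t (hasDerivAt_neg t).hasDerivWithinAt (fun u (hu : u ∈ (fun u => -u) ⁻¹' I) => hu)
  rwa [neg_one_smul] at this

theorem IsSolution.rev {ε : ℝ} {I : Set ℝ} {x : ℝ → Plane} (h : S.IsSolution ε I x) :
    S.rev.IsSolution ε ((fun t => -t) ⁻¹' I) (fun t => x (-t)) := by
  have hlt : ∀ t : ℝ, Tendsto (fun s : ℝ => -s) (𝓝[<] t) (𝓝[>] (-t)) := fun t =>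
    tendsto_neg_nhdsLT
  have hgt : ∀ t : ℝ, Tendsto (fun s : ℝ => -s) (𝓝[>] t) (𝓝[<] (-t)) := fun t =>
    tendsto_neg_nhdsGT
  have hl : ∀ t : ℝ, ∀ v : Plane, HasDerivWithinAt x v (Ici (-t)) (-t) →
      HasDerivWithinAt (fun u => x (-u)) (-v) (Iic t) t := fun t v hd => by
    have := hasDerivWithinAt_comp_neg hd
    simpa using this
  have hr : ∀ t : ℝ, ∀ v : Plane, HasDerivWithinAt x v (Iic (-t)) (-t) →
      HasDerivWithinAt (fun u => x (-u)) (-v) (Ici t) t := fun t v hd => by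
    have := hasDerivWithinAt_comp_neg hd
    simpa using this
  refine ⟨h.continuousOn.comp continuous_neg.continuousOn fun t ht => ht, fun t ht => h.mem _ ht,
    fun t ht hx => ?_, fun t ht hx => ?_, fun t ht hx hs => ?_, fun t ht hx hs => ?_⟩
  · rw [rev_Op] at hx
    rw [rev_Fp]
    exact hasDerivWithinAt_comp_neg (h.minus _ ht hx)
  · rw [rev_Om] at hx
    rw [rev_Fm]
    exact hasDerivWithinAt_comp_neg (h.plus _ ht hx)
  · rw [rev_O0] at hx
    obtain ⟨s, hs, hst⟩ := hs
    rw [rev_Op, rev_Om, rev_Fp, rev_Fm]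
    rcases h.right _ ht hx ⟨-s, hs, by linarith⟩ with ⟨h1, h2⟩ | ⟨h1, h2⟩
    · exact Or.inr ⟨(hlt t).eventually h1, hl t _ h2⟩
    · exact Or.inl ⟨(hlt t).eventually h1, hl t _ h2⟩
  · rw [rev_O0] at hx
    obtain ⟨s, hs, hst⟩ := hs
    rw [rev_Op, rev_Om, rev_Fp, rev_Fm]
    rcases h.left _ ht hx ⟨-s, hs, by linarith⟩ with ⟨h1, h2⟩ | ⟨h1, h2⟩
    · exact Or.inr ⟨(hgt t).eventually h1, hr t _ h2⟩
    · exact Or.inl ⟨(hgt t).eventually h1, hr t _ h2⟩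

theorem rev_L0 (S : PSSystem) (γ : ℝ → Plane) (ρ : ℝ) :
    S.rev.L0 (fun t => γ (-t)) ρ = S.L0 γ ρ := by
  rw [L0, L0, rev_O0, neg_zero]

theorem IsStableLeafTrajectory.rev {ε τ : ℝ} {y : ℝ → Plane}
    (h : S.IsStableLeafTrajectory γ ε τ y) :
    S.rev.IsUnstableLeafTrajectory (fun t => γ (-t)) ε (-τ) (fun t => y (-t)) := by
  refine ⟨?_, ?_, fun t ht => ?_, h.tendsto.comp tendsto_neg_atBot_atTop⟩
  · have := h.sol.rev
    simpa using this
  · rw [rev_L0, neg_neg]; exact h.start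
  · rw [rev_Om]; exact h.pos _ (by linarith)

theorem IsUnstableLeafTrajectory.rev {ε τ : ℝ} {y : ℝ → Plane}
    (h : S.IsUnstableLeafTrajectory γ ε τ y) :
    S.rev.IsStableLeafTrajectory (fun t => γ (-t)) ε (-τ) (fun t => y (-t)) := by
  refine ⟨?_, ?_, fun t ht => ?_, h.tendsto.comp tendsto_neg_atTop_atBot⟩
  · have := h.sol.rev
    simpa using this
  · rw [rev_L0, neg_neg]; exact h.start
  · rw [rev_Op]; exact h.neg _ (by linarith)

theorem IsForwardLoop.rev {ε τ Th T1 : ℝ} {Q : Plane} {x : ℝ → Plane}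
    (h : S.IsForwardLoop γ ε τ Q Th T1 x) :
    S.rev.IsBackwardLoop (fun t => γ (-t)) ε (-τ) Q (-Th) (-T1) (fun t => x (-t)) := by
  refine ⟨by linarith [h.lt_half], by linarith [h.lt_one], ?_, ?_, fun t ht => ?_, ?_,
    fun t ht => ?_, ?_⟩
  · have := h.sol.rev
    simpa using this
  · rw [neg_neg]; exact h.start
  · rw [rev_Om]; exact h.first _ ⟨by linarith [ht.2], by linarith [ht.1]⟩
  · rw [rev_O0, loopSet_rev, neg_neg]; exact h.half
  · rw [rev_Op]; exact h.second _ ⟨by linarith [ht.2], by linarith [ht.1]⟩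
  · rw [rev_O0, neg_neg]; exact h.final

theorem IsBackwardLoop.rev {ε τ Th T1 : ℝ} {Q : Plane} {x : ℝ → Plane}
    (h : S.IsBackwardLoop γ ε τ Q Th T1 x) :
    S.rev.IsForwardLoop (fun t => γ (-t)) ε (-τ) Q (-Th) (-T1) (fun t => x (-t)) := by
  refine ⟨by linarith [h.half_lt], by linarith [h.one_lt], ?_, ?_, fun t ht => ?_, ?_,
    fun t ht => ?_, ?_⟩
  · have := h.sol.rev
    simpa using this
  · rw [neg_neg]; exact h.start
  · rw [rev_Op]; exact h.first _ ⟨by linarith [ht.2], by linarith [ht.1]⟩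
  · rw [rev_O0, loopSet_rev, neg_neg]; exact h.half
  · rw [rev_Om]; exact h.second _ ⟨by linarith [ht.2], by linarith [ht.1]⟩
  · rw [rev_O0, neg_neg]; exact h.final

theorem rev_isStableLeafTrajectory {ε τ : ℝ} {y : ℝ → Plane} :
    S.rev.IsStableLeafTrajectory (fun t => γ (-t)) ε (-τ) (fun t => y (-t)) ↔
      S.IsUnstableLeafTrajectory γ ε τ y := by
  refine ⟨fun h => ?_, fun h => h.rev⟩
  have := h.rev
  simpa only [rev_rev, neg_neg] using this

theorem rev_isForwardLoop {ε τ Th T1 : ℝ} {Q : Plane} {x : ℝ → Plane} :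
    S.rev.IsForwardLoop (fun t => γ (-t)) ε (-τ) Q (-Th) (-T1) (fun t => x (-t)) ↔
      S.IsBackwardLoop γ ε τ Q Th T1 x := by
  refine ⟨fun h => ?_, fun h => h.rev⟩
  have := h.rev
  simpa only [rev_rev, neg_neg] using this

theorem rev_isPs {ε τ : ℝ} {P : Plane} :
    S.rev.IsPs (fun t => γ (-t)) ε (-τ) P ↔ S.IsPu γ ε τ P := by
  refine ⟨fun ⟨y, hy, hP⟩ => ⟨fun t => y (-t), ?_, hP⟩,
    fun ⟨y, hy, hP⟩ => ⟨fun t => y (-t), hy.rev, by simpa using hP⟩⟩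
  rw [← rev_isStableLeafTrajectory]
  simpa only [neg_neg] using hy

theorem rev_isQs {ε d τ : ℝ} {Q : Plane} :
    S.rev.IsQs (fun t => γ (-t)) ε d (-τ) Q ↔ S.IsQu γ ε d τ Q := by
  simp only [IsQs, IsQu, rev_isPs, rev_hasDirectedDist]

theorem rev_Dp (S : PSSystem) : S.rev.Dp = S.Om ∪ S.O0 := by
  rw [Dp, rev_Op, rev_O0]

/-- As `r > 1`, first derivatives exist and are bounded; the mean value inequality on `ℝ × Ω × ℝ`
gives the Lipschitz bound for `g` along segments of `Ω`. -/
theorem IsRegular.halfRegular {r : ℝ} (h : S.IsRegular r) (hr : 1 < r) : S.HalfRegular := by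
  have h1 : 1 ≤ ⌊r⌋₊ := (Nat.one_le_floor_iff r).2 hr.le
  have h1' : ((1 : ℕ) : WithTop ℕ∞) ≤ ((⌊r⌋₊ : ℕ) : WithTop ℕ∞) := by exact_mod_cast h1
  set W : Set (ℝ × Plane × ℝ) := univ ×ˢ S.Ω ×ˢ univ with hW
  have hWo : IsOpen W := isOpen_univ.prod (h.isOpen.prod isOpen_univ)
  set f : ℝ × Plane × ℝ → Plane := fun p => S.g p.1 p.2.1 p.2.2 with hf
  obtain ⟨hg1, hg2, _⟩ := h.g_reg
  obtain ⟨⟨C0, hC0⟩, _⟩ := hg2 0 (Nat.zero_le _)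
  obtain ⟨⟨C1, hC1⟩, _⟩ := hg2 1 h1
  refine ⟨h.isOpen, h.G_reg.1.of_le h1', h.fp_reg.1.of_le h1', h.regularValue,
    ⟨C0, fun t ε x hx => ?_⟩, ⟨max C1 0, le_max_right _ _, fun t t' ε x x' hseg => ?_⟩⟩
  · have := hC0 (t, x, ε) ⟨mem_univ _, hx, mem_univ _⟩
    rwa [norm_iteratedFDerivWithin_zero] at this
  · have hsegW : segment ℝ (t', x', ε) (t, x, ε) ⊆ W := by
      rintro _ ⟨a, b, ha, hb, hab, rfl⟩
      exact ⟨mem_univ _, hseg ⟨b, a, hb, ha, by rw [add_comm]; exact hab, add_comm _ _⟩, mem_univ _⟩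
    have hd : ∀ q ∈ W, DifferentiableAt ℝ f q := fun q hq =>
      ((hg1.contDiffAt (hWo.mem_nhds hq)).of_le h1').differentiableAt (by simp)
    have hb : ∀ q ∈ W, ‖fderiv ℝ f q‖ ≤ max C1 0 := fun q hq => by
      have := hC1 q hq
      rw [norm_iteratedFDerivWithin_one _ (hWo.uniqueDiffWithinAt hq),
        fderivWithin_of_isOpen hWo hq] at this
      exact this.trans (le_max_left _ _)
    have key := (convex_segment (𝕜 := ℝ) (t', x', ε) (t, x, ε)).norm_image_sub_le_of_norm_fderiv_le
      (fun q hq => hd q (hsegW hq)) (fun q hq => hb q (hsegW hq)) (left_mem_segment ℝ _ _)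
      (right_mem_segment ℝ _ _)
    refine key.trans (mul_le_mul_of_nonneg_left ?_ (le_max_right _ _))
    have : (t, x, ε) - (t', x', ε) = (t - t', x - x', 0) := by simp
    rw [this, Prod.norm_def, Prod.norm_def]
    simp only [norm_zero, Real.norm_eq_abs]
    refine max_le (by linarith [norm_nonneg (x - x')]) (max_le ?_ (by positivity))
    linarith [abs_nonneg (t - t')]

theorem HalfRegular.rev (h : S.HalfRegular) (hm : ContDiffOn ℝ 1 S.fm (S.Om ∪ S.O0)) :
    S.rev.HalfRegular := by
  obtain ⟨C, hC⟩ := h.g_bdd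
  obtain ⟨L, hL0, hL⟩ := h.g_lip
  refine ⟨h.isOpen, h.G_reg.neg, ?_, fun x hx => ?_, ⟨C, fun t ε x hx => ?_⟩,
    ⟨L, hL0, fun t t' ε x x' hs => ?_⟩⟩
  · rw [rev_Dp]; exact hm.neg
  · rw [rev_O0] at hx
    have : fderiv ℝ S.rev.G x = -fderiv ℝ S.G x := fderiv_fun_neg
    rw [this]
    exact neg_ne_zero.2 (h.regular x hx)
  · change ‖-S.g (-t) x ε‖ ≤ C
    rw [norm_neg]
    exact hC _ _ x hx
  · change ‖-S.g (-t) x ε - -S.g (-t') x' ε‖ ≤ _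
    rw [← norm_neg, neg_sub, sub_neg_eq_add, neg_add_eq_sub]
    have := hL (-t) (-t') ε x x' hs
    rwa [show -t - -t' = -(t - t') by ring, abs_neg] at this

theorem HypK.halfHyp {r : ℝ} {e : EigenData} (hr : 1 < r) (hS : S.IsRegular r) (hF0 : S.HypF0 e)
    (hF1 : S.HypF1 e) (hK : S.HypK γ) (hG : S.HypG) :
    S.HalfHyp γ e.lsp e.lup e.vsp e.vup := by
  have hsol := hK.homoclinic.sol
  refine ⟨hS.halfRegular hr, hF0.zero_mem, hF0.fp_zero, hF0.eig_sp, hF0.eig_up, hF0.lsp_neg,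
    hF0.lup_pos, hF1.up, hF1.sp, hG, continuousOn_univ.1 hsol.continuousOn, hK.homoclinic.zero,
    hK.homoclinic.pos, hK.homoclinic.tendsto_atTop, fun t ht => ?_, hK.cross_plus⟩
  have := hsol.plus t (mem_univ t) (hK.homoclinic.pos t ht)
  rw [hasDerivWithinAt_univ, Fp, zero_smul, add_zero] at this
  exact this

/-- Reversal turns `-λ_u^-` into the stable and `-λ_s^-` into the unstable eigenvalue, with the same
eigenvectors; since `G` changes sign as well, **F1** gives the required positivity. -/
theorem HypK.halfHyp_rev {r : ℝ} {e : EigenData} (hr : 1 < r) (hS : S.IsRegular r)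
    (hF0 : S.HypF0 e) (hF1 : S.HypF1 e) (hK : S.HypK γ) (hG : S.HypG) :
    S.rev.HalfHyp (fun t => γ (-t)) (-e.lum) (-e.lsm) e.vum e.vsm := by
  have hsol := hK.homoclinic.sol
  have h1 : 1 ≤ ⌊r⌋₊ := (Nat.one_le_floor_iff r).2 hr.le
  have h1' : ((1 : ℕ) : WithTop ℕ∞) ≤ ((⌊r⌋₊ : ℕ) : WithTop ℕ∞) := by exact_mod_cast h1
  have hreg := (hS.halfRegular hr).rev (hS.fm_reg.1.of_le h1')
  have hGd : ∀ x, fderiv ℝ S.rev.G x = -fderiv ℝ S.G x := fun x => fderiv_fun_neg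
  have huniq : UniqueDiffWithinAt ℝ (S.Om ∪ S.O0) 0 := by
    have h0 : (0 : Plane) ∈ S.rev.O0 := by rw [rev_O0]; exact hF0.zero_mem
    rw [← rev_Dp]
    exact uniqueDiffWithinAt_half (hreg.strict h0.1) (hreg.regular 0 h0) h0.2.ge (hreg.mem_Dp h0.1)
  have hfd : fderivWithin ℝ S.rev.fp S.rev.Dp 0 = -fderivWithin ℝ S.fm (S.Om ∪ S.O0) 0 := by
    rw [rev_Dp]
    exact fderivWithin_fun_neg huniq
  refine ⟨hreg, by rw [rev_O0]; exact hF0.zero_mem, ?_, ?_, ?_, by linarith [hF0.lum_pos],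
    by linarith [hF0.lsm_neg], ?_, ?_, fun t ε => ?_,
    (continuousOn_univ.1 hsol.continuousOn).comp continuous_neg, ?_, fun t ht => ?_,
    hK.homoclinic.tendsto_atBot.comp tendsto_neg_atTop_atBot, fun t ht => ?_, ?_⟩
  · change -S.fm 0 = 0
    rw [hF0.fm_zero, neg_zero]
  · rw [hfd]
    exact ⟨hF0.eig_um.1, by rw [_root_.neg_apply, hF0.eig_um.2, neg_smul]⟩
  · rw [hfd]
    exact ⟨hF0.eig_sm.1, by rw [_root_.neg_apply, hF0.eig_sm.2, neg_smul]⟩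
  · rw [hGd, _root_.neg_apply]; linarith [hF1.sm]
  · rw [hGd, _root_.neg_apply]; linarith [hF1.um]
  · change -S.g (-t) 0 ε = 0
    rw [hG, neg_zero]
  · rw [rev_O0, neg_zero]; exact hK.homoclinic.zero
  · rw [rev_Op]; exact hK.homoclinic.neg _ (by linarith)
  · have := hsol.minus (-t) (mem_univ _) (hK.homoclinic.neg _ (by linarith))
    rw [Fm, zero_smul, add_zero] at this
    have h2 := hasDerivWithinAt_comp_neg this
    rwa [preimage_univ, hasDerivWithinAt_univ] at h2
  · rw [hGd, neg_zero]
    change 0 < (-fderiv ℝ S.G (γ 0)) (-S.fm (γ 0))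
    rw [_root_.neg_apply, map_neg, neg_neg]
    exact hK.cross_minus

end PSSystem

/-! ### From the two half systems to the whole loop -/

/-- The position of the loop near the saddle, from the models of the two half systems. -/
theorem SaddleModel.exists_loopFrame {S S' : PSSystem} {γ γ' : ℝ → Plane} (M : SaddleModel S γ)
    (M' : SaddleModel S' γ') (hG : ∀ x, S'.G x = -S.G x) (hγ : ∀ t, γ' t = γ (-t))
    (hneg : ∀ t < 0, γ t ∈ S.Om) {v : Plane} (hU : 0 < M.U v) (hV : M.V v = 0)
    (hext : ∃ ρ > 0, ∀ d : ℝ, 0 < d → d < ρ → d • v ∉ enclosed (loopSet γ))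
    (hArc : ∃ s, S.HasLength γ (γ 0) s) : Nonempty M.LoopFrame := by
  obtain ⟨ρ₁, hρ₁, hext⟩ := hext
  obtain ⟨T, hT, _⟩ := M.exists_goodTime one_pos
  obtain ⟨T', hT', _⟩ := M'.exists_goodTime one_pos
  have hC := C_pos (M := M')
  have hne : ∀ t, γ t ≠ 0 := by
    intro t h0
    rcases lt_trichotomy t 0 with h | h | h
    · have h1 := (hneg t h).2
      have h2 := M.zero_mem.2
      rw [h0] at h1
      linarith
    · rw [h] at h0
      exact M.γ_zero_ne_zero h0
    · exact PSSystem.Op_disjoint_O0 (M.γ_pos t h) (h0 ▸ M.zero_mem)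
  -- Outside the two tails the loop stays at a positive distance from the saddle, so only the tails
  -- matter near it.
  obtain ⟨ρ₂, hρ₂, hmid⟩ : ∃ ρ > 0, ∀ t ∈ Icc (-T') T, ρ ≤ ‖γ t‖ := by
    obtain ⟨u, hu, hmin⟩ := (isCompact_Icc (a := -T') (b := T)).exists_isMinOn
      ⟨0, by linarith [hT'.pos], hT.pos.le⟩ M.γ_cont.norm.continuousOn
    exact ⟨‖γ u‖, norm_pos_iff.2 (hne u), fun t ht => hmin ht⟩
  -- Both sums are the derivative at `0` of the respective `G`, and these differ in sign. Thus the
  -- cone around the tail in `Ω⁻`, known in the coordinates of `M'`, bounds `U + V` of `M` away from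
  -- zero.
  have hsum : M'.U + M'.V = -(M.U + M.V) := by
    have h1 := M.G_deriv_zero.neg
    have h2 : S'.G = -S.G := funext hG
    exact (h2 ▸ M'.G_deriv_zero).unique h1
  refine ⟨⟨v, 3 / (5 * M'.C), min ρ₁ ρ₂, T, hU, hV, by positivity, lt_min hρ₁ hρ₂, hT,
    fun d hd hdρ => hext d hd (hdρ.trans_le (min_le_left _ _)), fun x hx hxρ => ?_, hneg,
    fun δ hδ => ?_⟩⟩
  · rcases hx with ⟨t, rfl⟩ | h
    · refine Or.inr ?_
      rcases le_or_gt T t with h1 | h1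
      · exact Or.inl ⟨t, h1, rfl⟩
      · refine Or.inr ?_
        have h2 : T' ≤ -t := by
          by_contra h2
          exact (hxρ.trans_le (min_le_right _ _)).not_ge (hmid t ⟨by linarith, h1.le⟩)
        have h3 := hT'.cone (-t) h2
        rw [hγ, neg_neg] at h3
        obtain ⟨_, h4, h5⟩ := h3
        have h6 := M'.norm_le (γ t)
        rw [abs_of_pos h4] at h6
        have h7 : M'.U (γ t) + M'.V (γ t) = -(M.U (γ t) + M.V (γ t)) :=
          congrArg (fun l : Plane →L[ℝ] ℝ => l (γ t)) hsum
        have h8 := neg_abs_le (M'.U (γ t))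
        have h9 : ‖γ t‖ ≤ M'.C * (5 / 4 * M'.V (γ t)) :=
          h6.trans (mul_le_mul_of_nonneg_left (by linarith) hC.le)
        have h10 : 3 / (5 * M'.C) * ‖γ t‖ ≤ 3 / 4 * M'.V (γ t) := by
          have := mul_le_mul_of_nonneg_left h9 (show 0 ≤ 3 / (5 * M'.C) by positivity)
          refine this.trans (le_of_eq ?_)
          field_simp
        linarith
    · exact Or.inl h
  · obtain ⟨s, hs⟩ := hArc
    obtain ⟨c, hc, _⟩ := PSSystem.hasLength_iff.1 hs
    have h0 : (0 : ℝ) ∈ Icc 0 s := ⟨le_rfl, hc.pos.le⟩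
    obtain ⟨η, hη, h1⟩ := hc.exists_close h0 hδ
    obtain ⟨u, hu, hus⟩ := (hc.enclosed.and (Ioo_mem_nhdsGT (lt_min hc.pos hη))).exists
    have hu' : u ∈ Icc 0 s := ⟨hus.1.le, hus.2.le.trans (min_le_left _ _)⟩
    refine ⟨c u, hc.mem u hu', hu, ?_⟩
    have := h1 u hu' (by
      rw [sub_zero, abs_of_pos hus.1]; exact hus.2.le.trans (min_le_right _ _))
    rwa [hc.zero, sub_zero] at this

namespace PSSystem
variable {S S' : PSSystem} {γ γ' : ℝ → Plane}

theorem HalfRegular.tendsto_Fp (h : S.HalfRegular) {ε τ : ℝ} {y : ℝ → Plane} {l : Filter ℝ}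
    (hl : Tendsto id l (𝓝 τ)) (hy : Tendsto y l (𝓝 (y τ))) (hD : ∀ᶠ t in l, y t ∈ S.Dp)
    (h0 : y τ ∈ S.Dp) : Tendsto (fun t => S.Fp ε t (y t)) l (𝓝 (S.Fp ε τ (y τ))) := by
  refine Tendsto.add ?_ (Tendsto.const_smul ?_ ε)
  · exact (h.fp_reg.continuousOn (y τ) h0).tendsto.comp
      (tendsto_nhdsWithin_iff.2 ⟨hy, hD⟩)
  · obtain ⟨L, _, hL⟩ := h.g_lip
    obtain ⟨ρ, hρ, hρΩ⟩ := Metric.isOpen_iff.1 h.isOpen (y τ) (Dp_sub h0)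
    rw [tendsto_iff_norm_sub_tendsto_zero]
    have hlim : Tendsto (fun t => L * (|t - τ| + ‖y t - y τ‖)) l (𝓝 0) := by
      have h1 : Tendsto (fun t : ℝ => |t - τ|) l (𝓝 0) := by
        simpa using ((hl.sub_const τ).abs)
      have h2 : Tendsto (fun t => ‖y t - y τ‖) l (𝓝 0) := tendsto_iff_norm_sub_tendsto_zero.1 hy
      simpa using (h1.add h2).const_mul L
    refine squeeze_zero' (Eventually.of_forall fun t => norm_nonneg _) ?_ hlim
    filter_upwards [hy.eventually (Metric.ball_mem_nhds (y τ) hρ)] with t ht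
    exact hL t τ ε _ _ (((convex_ball (y τ) ρ).segment_subset ht
      (Metric.mem_ball_self hρ)).trans hρΩ)

theorem IsSolution.plusOn {ε p q : ℝ} {I : Set ℝ} {x : ℝ → Plane} (h : S.IsSolution ε I x)
    (hI : Icc p q ⊆ I) (hO : ∀ t ∈ Ioo p q, x t ∈ S.Op) : S.PlusOn ε p q x :=
  ⟨h.continuousOn.mono hI, hO, fun t ht => (h.plus t (hI (Ioo_subset_Icc_self ht)) (hO t ht)).hasDerivAt
    (mem_of_superset (Icc_mem_nhds ht.1 ht.2) hI)⟩

theorem IsStableLeafTrajectory.isLeaf {ε τ : ℝ} {y : ℝ → Plane}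
    (h : S.IsStableLeafTrajectory γ ε τ y) : S.IsLeaf ε τ y :=
  ⟨h.sol.continuousOn, h.start.1, h.pos, fun t ht =>
    (h.sol.plus t ht.le (h.pos t ht)).hasDerivAt (Ici_mem_nhds ht), h.tendsto⟩

/-- Only the right derivative at the start on `Ω⁰` is missing from `IsLeaf`; it is the limit of the
derivatives, by continuity of the field up to `Ω⁰`. -/
theorem IsLeaf.isStableLeafTrajectory {ε τ : ℝ} {y : ℝ → Plane} (hS : S.HalfRegular)
    (h : S.IsLeaf ε τ y) (hε : ‖y τ - γ 0‖ < Real.sqrt ε) :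
    S.IsStableLeafTrajectory γ ε τ y := by
  have hgt : ∀ t ∈ Ici τ, y t ∈ S.O0 → t = τ := fun t ht hO => by
    by_contra hne
    exact Op_disjoint_O0 (h.mem t (lt_of_le_of_ne ht (Ne.symm hne))) hO
  refine ⟨⟨h.cont, fun t ht => ?_, fun t ht hO => ?_, fun t ht hO => ?_, fun t ht hO hs => ?_,
    fun t ht hO hs => ?_⟩, ⟨h.start, hε⟩, h.mem, h.tendsto⟩
  · rcases (mem_Ici.1 ht).eq_or_lt with h0 | h0
    · rw [← h0]; exact h.start.1
    · exact (h.mem t h0).1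
  · rcases (mem_Ici.1 ht).eq_or_lt with h0 | h0
    · rw [← h0] at hO
      exact (Op_disjoint_O0 hO h.start).elim
    · exact (h.deriv t h0).hasDerivWithinAt
  · have h1 := hO.2
    rcases (mem_Ici.1 ht).eq_or_lt with h0 | h0
    · rw [← h0, h.start.2] at h1
      exact (lt_irrefl _ h1).elim
    · exact (h1.not_gt (h.mem t h0).2).elim
  · obtain ⟨s, hs, hst⟩ := hs
    rw [hgt t ht hO] at hst
    exact (hst.not_ge hs).elim
  · have h0 := hgt t ht hO
    subst h0
    have hev : ∀ᶠ s in 𝓝[>] t, y s ∈ S.Op := by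
      filter_upwards [self_mem_nhdsWithin] with s hs using h.mem s hs
    refine Or.inl ⟨hev, hasDerivWithinAt_Ici_of_tendsto_deriv (s := Ioi t)
      (fun s hs => (h.deriv s hs).differentiableAt.differentiableWithinAt)
      ((h.cont t self_mem_Ici).mono Ioi_subset_Ici_self) self_mem_nhdsWithin ?_⟩
    refine (hS.tendsto_Fp (ε := ε) (l := 𝓝[>] t) (tendsto_id.mono_left nhdsWithin_le_nhds)
      ((h.cont t self_mem_Ici).mono Ioi_subset_Ici_self) (hev.mono fun s hs => Or.inl hs)
      (Or.inr hO)).congr' ?_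
    filter_upwards [self_mem_nhdsWithin] with s hs using (h.deriv s hs).deriv.symm

/-- A loop consists of an arc in `Ω⁺` and of an arc in `Ω⁻`. -/
theorem FullArc.isForwardLoop {ε τ Th T1 : ℝ} {x x' : ℝ → Plane} (hx : S.FullArc ε τ Th x)
    (hx' : S.rev.FullArc ε (-T1) (-Th) x') (heq : x' (-Th) = x Th)
    (hE : x Th ∈ enclosed (loopSet γ)) :
    ∃ z, S.IsForwardLoop γ ε τ (x τ) Th T1 z := by
  have hlt : Th < T1 := by linarith [hx'.lt]
  have hlt' := hx.lt
  set w : ℝ → Plane := fun t => x' (-t) with hw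
  have hwd : ∀ t ∈ Icc Th T1, HasDerivAt w (S.Fm ε t (w t)) t := fun t ht => by
    have h1 := hx'.deriv (-t) ⟨by linarith [ht.2], by linarith [ht.1]⟩
    rw [rev_Fp, neg_neg] at h1
    have h2 := h1.scomp t (hasDerivAt_neg t)
    rwa [neg_one_smul, neg_neg] at h2
  have hwm : ∀ t ∈ Ioo Th T1, w t ∈ S.Om := fun t ht => by
    rw [← rev_Op]
    exact hx'.mem (-t) ⟨by linarith [ht.2], by linarith [ht.1]⟩
  have hwT : w T1 ∈ S.O0 := by rw [← rev_O0]; exact hx'.left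
  -- Each arc is differentiable up to and across its end points, so the glued curve has the
  -- one-sided derivatives required at the crossing.
  set z : ℝ → Plane := fun t => if t ≤ Th then x t else w t with hz
  have hz1 : ∀ t ≤ Th, z t = x t := fun t ht => if_pos ht
  have hz2 : ∀ t, Th ≤ t → z t = w t := fun t ht => by
    rcases ht.eq_or_lt with h | h
    · rw [← h, hz1 Th le_rfl, hw, ← heq]
    · exact if_neg h.not_ge
  have hzp : ∀ t ∈ Ioo τ Th, z t ∈ S.Op := fun t ht => by
    rw [hz1 t ht.2.le]; exact hx.mem t ht
  have hzm : ∀ t ∈ Ioo Th T1, z t ∈ S.Om := fun t ht => by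
    rw [hz2 t ht.1.le]; exact hwm t ht
  have hzτ : z τ ∈ S.O0 := by rw [hz1 τ hlt'.le]; exact hx.left
  have hzTh : z Th ∈ S.O0 := by rw [hz1 Th le_rfl]; exact hx.right
  have hzT : z T1 ∈ S.O0 := by rw [hz2 T1 hlt.le]; exact hwT
  have hcases : ∀ t ∈ Icc τ T1, t = τ ∨ t ∈ Ioo τ Th ∨ t = Th ∨ t ∈ Ioo Th T1 ∨ t = T1 := by
    intro t ht
    rcases ht.1.eq_or_lt with h1 | h1
    · exact Or.inl h1.symm
    · rcases lt_trichotomy t Th with h2 | h2 | h2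
      · exact Or.inr (Or.inl ⟨h1, h2⟩)
      · exact Or.inr (Or.inr (Or.inl h2))
      · rcases ht.2.eq_or_lt with h3 | h3
        · exact Or.inr (Or.inr (Or.inr (Or.inr h3)))
        · exact Or.inr (Or.inr (Or.inr (Or.inl ⟨h2, h3⟩)))
  have hdisj : ∀ p, p ∈ S.Om → p ∈ S.O0 → False := fun p h1 h2 => by
    have h3 := h1.2
    rw [h2.2] at h3
    exact lt_irrefl _ h3
  have hdisj' : ∀ p, p ∈ S.Op → p ∈ S.Om → False := fun p h1 h2 => h1.2.not_gt h2.2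
  have hzx : ∀ t ∈ Icc τ Th, HasDerivWithinAt z (S.Fp ε t (z t)) (Iic Th) t := fun t ht => by
    rw [hz1 t ht.2]
    exact (hx.deriv t ht).hasDerivWithinAt.congr (fun u hu => hz1 u hu) (hz1 t ht.2)
  have hzw : ∀ t ∈ Icc Th T1, HasDerivWithinAt z (S.Fm ε t (z t)) (Ici Th) t := fun t ht => by
    rw [hz2 t ht.1]
    exact (hwd t ht).hasDerivWithinAt.congr (fun u hu => hz2 u hu) (hz2 t ht.1)
  have hcont : ContinuousOn z (Icc τ T1) := by
    rw [← Icc_union_Icc_eq_Icc hlt'.le hlt.le]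
    refine ContinuousOn.union_of_isClosed (fun t ht => ?_) (fun t ht => ?_) isClosed_Icc
      isClosed_Icc
    · exact (hzx t ht).continuousWithinAt.mono fun u hu => hu.2
    · exact (hzw t ht).continuousWithinAt.mono fun u hu => hu.1
  refine ⟨z, hlt', hlt, ⟨hcont, fun t ht => ?_, fun t ht hO => ?_, fun t ht hO => ?_,
    fun t ht hO hs => ?_, fun t ht hO hs => ?_⟩, hz1 τ hlt'.le, hzp, ⟨hzTh, ?_⟩, hzm, hzT⟩
  · rcases hcases t ht with rfl | h | rfl | h | rfl
    · exact hzτ.1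
    · exact (hzp t h).1
    · exact hzTh.1
    · exact (hzm t h).1
    · exact hzT.1
  · rcases hcases t ht with rfl | h | rfl | h | rfl
    · exact (Op_disjoint_O0 hO hzτ).elim
    · exact ((hzx t (Ioo_subset_Icc_self h)).hasDerivAt (Iic_mem_nhds h.2)).hasDerivWithinAt
    · exact (Op_disjoint_O0 hO hzTh).elim
    · exact (hdisj' _ hO (hzm t h)).elim
    · exact (Op_disjoint_O0 hO hzT).elim
  · rcases hcases t ht with rfl | h | rfl | h | rfl
    · exact (hdisj _ hO hzτ).elim
    · exact (hdisj' _ (hzp t h) hO).elim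
    · exact (hdisj _ hO hzTh).elim
    · exact ((hzw t (Ioo_subset_Icc_self h)).hasDerivAt (Ici_mem_nhds h.1)).hasDerivWithinAt
    · exact (hdisj _ hO hzT).elim
  · rcases hcases t ht with rfl | h | rfl | h | rfl
    · obtain ⟨s, hs, hst⟩ := hs
      exact (hst.not_ge hs.1).elim
    · exact (Op_disjoint_O0 (hzp t h) hO).elim
    · refine Or.inl ⟨?_, hzx t ⟨hlt'.le, le_rfl⟩⟩
      filter_upwards [Ioo_mem_nhdsLT hlt'] with s hs using hzp s hs
    · exact (hdisj _ (hzm t h) hO).elim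
    · refine Or.inr ⟨?_, ?_⟩
      · filter_upwards [Ioo_mem_nhdsLT hlt] with s hs using hzm s hs
      · exact ((hzw t ⟨hlt.le, le_rfl⟩).hasDerivAt (Ici_mem_nhds hlt)).hasDerivWithinAt
  · rcases hcases t ht with rfl | h | rfl | h | rfl
    · refine Or.inl ⟨?_, ?_⟩
      · filter_upwards [Ioo_mem_nhdsGT hlt'] with s hs using hzp s hs
      · exact ((hzx t ⟨le_rfl, hlt'.le⟩).hasDerivAt (Iic_mem_nhds hlt')).hasDerivWithinAt
    · exact (Op_disjoint_O0 (hzp t h) hO).elim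
    · refine Or.inr ⟨?_, hzw t ⟨le_rfl, hlt.le⟩⟩
      filter_upwards [Ioo_mem_nhdsGT hlt] with s hs using hzm s hs
    · exact (hdisj _ (hzm t h) hO).elim
    · obtain ⟨s, hs, hst⟩ := hs
      exact (hst.not_ge hs.2).elim
  · rw [hz1 Th le_rfl]; exact hE

theorem IsForwardLoop.plusArc {ε τ Th T1 : ℝ} {Q : Plane} {x : ℝ → Plane}
    (h : S.IsForwardLoop γ ε τ Q Th T1 x) (hQ : Q ∈ S.O0) : S.PlusArc ε τ Th x :=
  ⟨h.lt_half, h.sol.plusOn (Icc_subset_Icc_right h.lt_one.le) h.first, by rw [h.start]; exact hQ,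
    h.half.1⟩

theorem IsForwardLoop.plusArc_rev {ε τ Th T1 : ℝ} {Q : Plane} {x : ℝ → Plane}
    (h : S.IsForwardLoop γ ε τ Q Th T1 x) :
    S.rev.PlusArc ε (-T1) (-Th) (fun t => x (-t)) := by
  refine ⟨by linarith [h.lt_one], h.sol.rev.plusOn (fun t ht => ?_) fun t ht => ?_, ?_, ?_⟩
  · exact ⟨by linarith [ht.2, h.lt_half], by linarith [ht.1]⟩
  · rw [rev_Op]
    exact h.second _ ⟨by linarith [ht.2], by linarith [ht.1]⟩
  · rw [rev_O0, neg_neg]; exact h.final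
  · rw [rev_O0, neg_neg]; exact h.half.1

end PSSystem

/-- Any loss in the exponent absorbs a constant, since `B d^{p-s} → 0` as `d → 0`. -/
theorem exists_mul_rpow_le (B : ℝ) {p s : ℝ} (hs : s < p) :
    ∃ δ > 0, ∀ d, 0 < d → d ≤ δ → B * d ^ p ≤ d ^ s := by
  have h1 : Tendsto (fun d : ℝ => B * d ^ (p - s)) (𝓝 0) (𝓝 (B * 0 ^ (p - s))) :=
    ((Real.continuousAt_rpow_const 0 (p - s) (Or.inr (by linarith))).tendsto).const_mul B
  rw [Real.zero_rpow (by linarith), mul_zero] at h1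
  obtain ⟨δ, hδ, h2⟩ := Metric.eventually_nhds_iff.1 (h1.eventually (gt_mem_nhds one_pos))
  refine ⟨δ / 2, by positivity, fun d hd hdδ => ?_⟩
  have h3 := h2 (y := d) (by rw [dist_zero_right, Real.norm_of_nonneg hd.le]; linarith)
  have h4 : d ^ p = d ^ (p - s) * d ^ s := by rw [← Real.rpow_add hd]; ring_nf
  rw [h4, ← mul_assoc]
  have h5 : 0 < d ^ s := Real.rpow_pos_of_pos hd s
  nlinarith

namespace PSSystem
variable {S : PSSystem} {γ : ℝ → Plane}

/-- The statement on the forward loops. -/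
theorem forward_loops {M : SaddleModel S γ} {M' : SaddleModel S.rev (fun t => γ (-t))}
    (f : M.LoopFrame) (f' : M'.LoopFrame) (hS : S.HalfRegular)
    (A : CrossArc S γ) (A' : CrossArc S.rev (fun t => γ (-t))) {l : ℝ}
    (hA : ∀ x ∈ Ioo (-A.k) A.k, S.HasLength γ (A.P x) (l + x)) {s : ℝ}
    (hs : s < M.expFwd * M'.expBwd) :
    ∃ ε₀ > 0, ∃ δ > 0, ∀ ε, 0 < ε → ε ≤ ε₀ → (∀ τ : ℝ, ∃! P, S.IsPs γ ε τ P) ∧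
      ∀ d, 0 < d → d ≤ δ → ∀ τ : ℝ, (∃! Q, S.IsQs γ ε d τ Q) ∧ ∀ Q, S.IsQs γ ε d τ Q →
        (∃ Th T1 x, S.IsForwardLoop γ ε τ Q Th T1 x) ∧
        ∀ Th T1 x, S.IsForwardLoop γ ε τ Q Th T1 x →
          (∀ y, S.IsStableLeafTrajectory γ ε τ y → ∀ t ∈ Icc τ Th, ‖x t - y t‖ ≤ d ^ s) ∧
          (∀ y, S.IsUnstableLeafTrajectory γ ε T1 y → ∀ t ∈ Icc Th T1, ‖x t - y t‖ ≤ d ^ s) := by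
  obtain ⟨ε₂, hε₂, δ₁, hδ₁, B, hB, k₁, hk₁, hkA, hδk, H⟩ := f.half A
  obtain ⟨ε₃, hε₃, δ₂, hδ₂, B', hB', _, _, _, _, H'⟩ := f'.half A'
  obtain ⟨hp0, hp1⟩ := M.expFwd_mem
  obtain ⟨hq0, hq1⟩ := M'.expBwd_mem
  set p := M.expFwd with hp
  set q := M'.expBwd with hq
  clear_value p q
  have hsp : s < p := hs.trans_le (mul_le_of_le_one_right hp0.le hq1)
  obtain ⟨δ₃, hδ₃, hb1⟩ := exists_mul_rpow_le B hsp
  obtain ⟨δ₄, hδ₄, hb2⟩ := exists_mul_rpow_le (B' * B ^ q) hs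
  obtain ⟨δ₅, hδ₅, hb3⟩ := exists_mul_rpow_le (B / δ₂) hp0
  -- The last bound on `ε` gives `B ε < √ε`, so every leaf point, being within `B ε` of `γ 0`, lies
  -- on the transversal. The bound `δ₅` brings the midpoint of the loop within the range `δ₂` of the
  -- reversed system.
  refine ⟨min (min ε₂ ε₃) (1 / (2 * B ^ 2)), by positivity,
    min (min δ₁ δ₃) (min δ₄ δ₅), by positivity, fun ε hε hεle => ?_⟩
  have hε2 : ε ≤ ε₂ := hεle.trans ((min_le_left _ _).trans (min_le_left _ _))
  have hε3 : ε ≤ ε₃ := hεle.trans ((min_le_left _ _).trans (min_le_right _ _))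
  have hεB : B * ε < Real.sqrt ε := by
    have h1 : ε ≤ 1 / (2 * B ^ 2) := hεle.trans (min_le_right _ _)
    rw [le_div_iff₀ (by positivity)] at h1
    refine Real.lt_sqrt_of_sq_lt ?_
    have h2 : ε * (ε * (2 * B ^ 2)) ≤ ε * 1 := mul_le_mul_of_nonneg_left h1 hε.le
    have h3 : (B * ε) ^ 2 = ε * (ε * (2 * B ^ 2)) / 2 := by ring
    linarith
  have hstab : ∀ τ y, S.IsStableLeafTrajectory γ ε τ y ↔ S.IsLeaf ε τ y := fun τ y =>
    ⟨fun h => h.isLeaf, fun h => h.isStableLeafTrajectory hS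
      (((H ε hε hε2 τ).2.1 y h).trans_lt hεB)⟩
  have hPs : ∀ τ, ∃ h y, |h| < k₁ ∧ S.IsLeaf ε τ y ∧ y τ = A.P h ∧
      ∀ P, S.IsPs γ ε τ P ↔ P = A.P h := fun τ => by
    obtain ⟨⟨h, y, hh, hy, hyP⟩, _, huniq, _⟩ := H ε hε hε2 τ
    refine ⟨h, y, hh, hy, hyP, fun P => ⟨fun ⟨y', hy', hP⟩ => ?_, fun hP => ?_⟩⟩
    · rw [← hP, ← hyP]
      exact huniq y' y hy'.isLeaf hy
    · exact ⟨y, (hstab τ y).2 hy, by rw [hyP, hP]⟩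
  refine ⟨fun τ => ?_, fun d hd hdδ τ => ?_⟩
  · obtain ⟨h, _, _, _, _, hP⟩ := hPs τ
    exact ⟨A.P h, (hP _).2 rfl, fun P' hP' => (hP P').1 hP'⟩
  have hd1 : d ≤ δ₁ := hdδ.trans ((min_le_left _ _).trans (min_le_left _ _))
  have hd3 : d ≤ δ₃ := hdδ.trans ((min_le_left _ _).trans (min_le_right _ _))
  have hd4 : d ≤ δ₄ := hdδ.trans ((min_le_right _ _).trans (min_le_left _ _))
  have hd5 : d ≤ δ₅ := hdδ.trans ((min_le_right _ _).trans (min_le_right _ _))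
  have hsmall : B * d ^ p ≤ δ₂ := by
    have := hb3 d hd hd5
    rw [Real.rpow_zero, div_mul_eq_mul_div, div_le_one hδ₂] at this
    exact this
  have hsecond : B' * (B * d ^ p) ^ q ≤ d ^ s := by
    have h1 : (B * d ^ p) ^ q = B ^ q * d ^ (p * q) := by
      rw [Real.mul_rpow hB.le (Real.rpow_nonneg hd.le p), Real.rpow_mul hd.le]
    rw [h1, ← mul_assoc]
    exact hb2 d hd hd4
  obtain ⟨h, y₀, hh, hy₀, hyP, hP⟩ := hPs τ
  have hh' := abs_lt.1 hh
  have hmem : h ∈ Ioo (-A.k) A.k := ⟨by linarith, by linarith⟩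
  have hmem' : h - d ∈ Ioo (-A.k) A.k := ⟨by linarith, by linarith⟩
  -- The directed distance is defined through arbitrary arcs; uniqueness of lengths and of end
  -- points identifies it with a difference of parameters in `A`.
  have hQs : ∀ Q, S.IsQs γ ε d τ Q ↔ Q = A.P (h - d) := by
    intro Q
    constructor
    · rintro ⟨P, hP', a, b, ha, hb, hab⟩
      rw [(hP P).1 hP'] at hb
      have h1 := hb.length_unique f hS (hA h hmem)
      have h2 : a = l + (h - d) := by linarith
      rw [h2] at ha
      exact ha.point_unique f hS (hA _ hmem')
    · rintro rfl
      exact ⟨A.P h, (hP _).2 rfl, _, _, hA _ hmem', hA h hmem, by ring⟩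
  refine ⟨⟨A.P (h - d), (hQs _).2 rfl, fun Q hQ => (hQs Q).1 hQ⟩, fun Q hQ => ?_⟩
  rw [(hQs Q).1 hQ]
  obtain ⟨⟨t, x, hx, hxQ⟩, hall⟩ := (H ε hε hε2 τ).2.2.2.1 y₀ h d hy₀ hyP hh hd hd1
  refine ⟨?_, fun Th T1 x hx => ?_⟩
  · obtain ⟨hE, hn, _⟩ := hall t x hx.plusArc hxQ
    obtain ⟨⟨τ', x', hx', hxx⟩, _⟩ := (H' ε hε hε3 (-t)).2.2.2.2 (x t)
      (by rw [rev_O0]; exact hx.right) (by rw [loopSet_rev]; exact hE) (hn.trans hsmall)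
    rw [← hxQ]
    obtain ⟨z, hz⟩ := hx.isForwardLoop (T1 := -τ') (by rw [neg_neg]; exact hx') hxx hE
    exact ⟨t, -τ', z, hz⟩
  · have hQO : A.P (h - d) ∈ S.O0 := A.mem _ hmem'
    obtain ⟨hE, hn, hest⟩ := hall Th x (hx.plusArc hQO) hx.start
    refine ⟨fun y hy u hu => ?_, fun y hy u hu => ?_⟩
    · have hyτ : y τ = A.P h := by
        rw [← hyP]
        exact (H ε hε hε2 τ).2.2.1 y y₀ hy.isLeaf hy₀
      obtain ⟨_, hall'⟩ := (H ε hε hε2 τ).2.2.2.1 y h d hy.isLeaf hyτ hh hd hd1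
      exact ((hall' Th x (hx.plusArc hQO) hx.start).2.2 u hu).trans (hb1 d hd hd3)
    -- In reversed time the second half of the loop ends at `x Th`, of size at most `B d^p`; the
    -- backward estimate turns this into `B' (B d^p)^q`.
    · have h1 := ((H' ε hε hε3 (-Th)).2.2.2.2 (x Th) (by rw [rev_O0]; exact hx.half.1)
        (by rw [loopSet_rev]; exact hE) (hn.trans hsmall)).2 (-T1) (fun t => x (-t))
        (fun t => y (-t)) hx.plusArc_rev (by rw [neg_neg]) hy.rev.isLeaf (-u)
        ⟨by linarith [hu.2], by linarith [hu.1]⟩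
      simp only [neg_neg] at h1
      refine h1.trans (le_trans ?_ hsecond)
      exact mul_le_mul_of_nonneg_left (Real.rpow_le_rpow (norm_nonneg _) hn hq0.le) hB'.le

end PSSystem

/-- At `η = η' = 0` the product is `a / (a + b)`: the backward factor is then `1`. Continuity leaves
room for small nonlinearities. -/
theorem exists_exponents {a b a' s : ℝ} (ha : 0 < a) (hb : 0 < b) (ha' : 0 < a')
    (hs : s < a / (a + b)) : ∃ η₀ > 0, ∀ η η' : ℝ, 0 < η → η ≤ η₀ → 0 < η' → η' ≤ η₀ →
      s < (a - 3 * η) / (a + b + 5 * η) * ((a' - 3 * η') / (a' + 3 * η')) := by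
  have hc : ContinuousAt (fun z : ℝ × ℝ =>
      (a - 3 * z.1) / (a + b + 5 * z.1) * ((a' - 3 * z.2) / (a' + 3 * z.2))) (0, 0) := by
    refine ContinuousAt.mul (ContinuousAt.div (by fun_prop) (by fun_prop) ?_)
      (ContinuousAt.div (by fun_prop) (by fun_prop) ?_)
    · simp only [mul_zero, add_zero]; positivity
    · simp only [mul_zero, add_zero]; positivity
  have h0 : s < (a - 3 * (0 : ℝ)) / (a + b + 5 * 0) * ((a' - 3 * 0) / (a' + 3 * 0)) := by
    simp only [mul_zero, add_zero, sub_zero]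
    rwa [div_self ha'.ne', mul_one]
  obtain ⟨e, he, h⟩ := Metric.eventually_nhds_iff.1 (hc.eventually (lt_mem_nhds h0))
  refine ⟨e / 2, by positivity, fun η η' h1 h2 h3 h4 => h (y := (η, η')) ?_⟩
  rw [Prod.dist_eq, max_lt_iff, dist_zero_right, dist_zero_right, Real.norm_of_nonneg h1.le,
    Real.norm_of_nonneg h3.le]
  constructor <;> linarith

namespace PSSystem
variable {S : PSSystem} {γ : ℝ → Plane}

/-- The admissible nonlinearity is fixed first, from the target exponent and the eigenvalues; both
models are then built below it. Each model locates the tail of the loop in the other half domain for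
its partner. -/
theorem HalfHyp.forward_loops {ls lu ls' lu' s : ℝ} {vs vu vs' vu' : Plane}
    (h : S.HalfHyp γ ls lu vs vu) (h' : S.rev.HalfHyp (fun t => γ (-t)) ls' lu' vs' vu')
    (hneg : ∀ t < 0, γ t ∈ S.Om)
    (hext : ∃ ρ > 0, ∀ d : ℝ, 0 < d → d < ρ → d • vu ∉ enclosed (loopSet γ))
    (hext' : ∃ ρ > 0, ∀ d : ℝ, 0 < d → d < ρ → d • vu' ∉ enclosed (loopSet γ))
    (hArc : ∃ s, S.HasLength γ (γ 0) s) (hs : s < -ls / (-ls + lu)) :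
    ∃ ε₀ > 0, ∃ δ > 0, ∀ ε, 0 < ε → ε ≤ ε₀ → (∀ τ : ℝ, ∃! P, S.IsPs γ ε τ P) ∧
      ∀ d, 0 < d → d ≤ δ → ∀ τ : ℝ, (∃! Q, S.IsQs γ ε d τ Q) ∧ ∀ Q, S.IsQs γ ε d τ Q →
        (∃ Th T1 x, S.IsForwardLoop γ ε τ Q Th T1 x) ∧
        ∀ Th T1 x, S.IsForwardLoop γ ε τ Q Th T1 x →
          (∀ y, S.IsStableLeafTrajectory γ ε τ y → ∀ t ∈ Icc τ Th, ‖x t - y t‖ ≤ d ^ s) ∧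
          (∀ y, S.IsUnstableLeafTrajectory γ ε T1 y →
            ∀ t ∈ Icc Th T1, ‖x t - y t‖ ≤ d ^ s) := by
  obtain ⟨η₀, hη₀, hη⟩ := exists_exponents (a' := -ls') (by linarith [h.ls_neg]) h.lu_pos
    (by linarith [h'.ls_neg]) hs
  obtain ⟨M, hMa, hMb, hMη, hMU, hMV⟩ := h.exists_model hη₀
  obtain ⟨M', hMa', _, hMη', hMU', hMV'⟩ := h'.exists_model hη₀
  have hArc' : ∃ s, S.rev.HasLength (fun t => γ (-t)) (γ (-0)) s := by
    simp only [rev_hasLength, neg_zero]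
    exact hArc
  obtain ⟨f⟩ := M.exists_loopFrame M' (fun x => rfl) (fun t => rfl) hneg hMU hMV hext hArc
  obtain ⟨f'⟩ := M'.exists_loopFrame M (fun x => (neg_neg (S.G x)).symm)
    (fun t => by rw [neg_neg]) (fun t ht => by rw [rev_Om]; exact h.γ_pos _ (by linarith)) hMU' hMV'
    (by rw [loopSet_rev]; exact hext') hArc'
  obtain ⟨A, l, hA⟩ := exists_crossArc f h.regular hArc
  obtain ⟨A', _, _⟩ := exists_crossArc f' h'.regular hArc'
  refine PSSystem.forward_loops f f' h.regular A A' hA ?_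
  rw [SaddleModel.expFwd, SaddleModel.expBwd, hMa, hMb, hMa']
  exact hη _ _ M.η_pos hMη M'.η_pos hMη'

end PSSystem

theorem theorem4p2 (S : PSSystem) (e : EigenData) (γ : ℝ → Plane) (r : ℝ) (hr : 1 < r)
    (hS : S.IsRegular r) (hF0 : S.HypF0 e) (hF1 : S.HypF1 e) (hF2 : e.HypF2)
    (hK : S.HypK γ) (hG : S.HypG) (hScenario : e.Scenario1 γ)
    (hArc : ∃ s, S.HasLength γ (γ 0) s)
    (μ : ℝ) (hμ : 0 < μ) (hμ₀ : μ < e.mu0) :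
    ∃ ε₀ > 0, ∃ δ > 0, ∀ ε, 0 < ε → ε ≤ ε₀ →
      (∀ τ : ℝ, (∃! P, S.IsPs γ ε τ P) ∧ (∃! P, S.IsPu γ ε τ P)) ∧
      ∀ d, 0 < d → d ≤ δ → ∀ τ : ℝ,
        ((∃! Q, S.IsQs γ ε d τ Q) ∧ ∀ Q, S.IsQs γ ε d τ Q →
          (∃ Th T1 x, S.IsForwardLoop γ ε τ Q Th T1 x) ∧
          ∀ Th T1 x, S.IsForwardLoop γ ε τ Q Th T1 x →
            (∀ y, S.IsStableLeafTrajectory γ ε τ y →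
              ∀ t ∈ Set.Icc τ Th, ‖x t - y t‖ ≤ d ^ (e.sigmaFwdPlus - μ)) ∧
            (∀ y, S.IsUnstableLeafTrajectory γ ε T1 y →
              ∀ t ∈ Set.Icc Th T1, ‖x t - y t‖ ≤ d ^ (e.sigmaFwdPlus - μ))) ∧
        ((∃! Q, S.IsQu γ ε d τ Q) ∧ ∀ Q, S.IsQu γ ε d τ Q →
          (∃ Th T1 x, S.IsBackwardLoop γ ε τ Q Th T1 x) ∧
          ∀ Th T1 x, S.IsBackwardLoop γ ε τ Q Th T1 x →
            (∀ y, S.IsUnstableLeafTrajectory γ ε τ y →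
              ∀ t ∈ Set.Icc Th τ, ‖x t - y t‖ ≤ d ^ (e.sigmaBwdMinus - μ)) ∧
            (∀ y, S.IsStableLeafTrajectory γ ε T1 y →
              ∀ t ∈ Set.Icc T1 Th, ‖x t - y t‖ ≤ d ^ (e.sigmaBwdMinus - μ))) := by
  have h := hK.halfHyp hr hS hF0 hF1 hG
  have h' := hK.halfHyp_rev hr hS hF0 hF1 hG
  -- The backward loops are the forward loops of the reversed system, whose own reversal is the
  -- original one; the same statement is applied a second time with the two half systems exchanged.
  have h'' : S.rev.rev.HalfHyp (fun t => γ (- -t)) e.lsp e.lup e.vsp e.vup := by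
    simpa only [PSSystem.rev_rev, neg_neg] using h
  obtain ⟨ρ, hρ, hext⟩ := hScenario
  have hup : ∃ ρ > 0, ∀ d : ℝ, 0 < d → d < ρ → d • e.vup ∉ enclosed (loopSet γ) :=
    ⟨ρ, hρ, fun d hd hdρ hE => (hext d hd hdρ).1 (Or.inl hE)⟩
  have hsm : ∃ ρ > 0, ∀ d : ℝ, 0 < d → d < ρ → d • e.vsm ∉ enclosed (loopSet γ) :=
    ⟨ρ, hρ, fun d hd hdρ hE => (hext d hd hdρ).2 (Or.inl hE)⟩
  have hσ : e.sigmaFwdPlus = -e.lsp / (-e.lsp + e.lup) := by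
    rw [EigenData.sigmaFwdPlus, abs_of_neg hF0.lsp_neg, add_comm]
  have hσ' : e.sigmaBwdMinus = - -e.lum / (- -e.lum + -e.lsm) := by
    rw [EigenData.sigmaBwdMinus, abs_of_neg hF0.lsm_neg, neg_neg]
  obtain ⟨ε₁, hε₁, δ₁, hδ₁, H⟩ := h.forward_loops (s := e.sigmaFwdPlus - μ) h'
    hK.homoclinic.neg hup hsm hArc (by rw [← hσ]; linarith)
  obtain ⟨ε₂, hε₂, δ₂, hδ₂, H'⟩ := h'.forward_loops (s := e.sigmaBwdMinus - μ) h''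
    (fun t ht => by rw [PSSystem.rev_Om]; exact hK.homoclinic.pos _ (by linarith))
    (by rw [loopSet_rev]; exact hsm) (by rw [loopSet_rev]; exact hup)
    (by simp only [PSSystem.rev_hasLength, neg_zero]; exact hArc) (by rw [← hσ']; linarith)
  refine ⟨min ε₁ ε₂, lt_min hε₁ hε₂, min δ₁ δ₂, lt_min hδ₁ hδ₂, fun ε hε hεle => ?_⟩
  obtain ⟨HP, HQ⟩ := H ε hε (hεle.trans (min_le_left _ _))
  obtain ⟨HP', HQ'⟩ := H' ε hε (hεle.trans (min_le_right _ _))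
  refine ⟨fun τ => ⟨HP τ, ?_⟩, fun d hd hdδ τ => ⟨HQ d hd (hdδ.trans (min_le_left _ _)) τ, ?_⟩⟩
  · simpa only [PSSystem.rev_isPs] using HP' (-τ)
  obtain ⟨h1, h2⟩ := HQ' d hd (hdδ.trans (min_le_right _ _)) (-τ)
  simp only [PSSystem.rev_isQs] at h1 h2
  refine ⟨h1, fun Q hQ => ?_⟩
  obtain ⟨⟨Th, T1, x, hx⟩, h3⟩ := h2 Q hQ
  refine ⟨⟨-Th, -T1, fun t => x (-t), ?_⟩, fun Th T1 x hx => ?_⟩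
  · rw [← PSSystem.rev_isForwardLoop]
    simpa only [neg_neg] using hx
  · obtain ⟨h4, h5⟩ := h3 _ _ _ hx.rev
    refine ⟨fun y hy t ht => ?_, fun y hy t ht => ?_⟩
    · simpa only [neg_neg] using h4 _ hy.rev (-t) ⟨by linarith [ht.2], by linarith [ht.1]⟩
    · simpa only [neg_neg] using h5 _ hy.rev (-t) ⟨by linarith [ht.2], by linarith [ht.1]⟩
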